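/- Setup. Let $G$ be a compact connected Lie group that is isomorphic to the product of a simply connected group and a torus, $T\subset G$ a maximal torus, $\mathfrak g,\mathfrak t$ the Lie algebras, and fix an invariant inner product on $\mathfrak g$ (used to identify $\mathfrak g\cong\mathfrak g^*$), orthonormal bases $e_a$ of $\mathfrak g$ and $e_k$ of $\mathfrak t$, and a Weyl chamber $\mathfrak t_+$. Let $\Lambda^*$ be the weight lattice ($(\exp\xi)^\lambda=e^{2\pi i\langle\lambda,\xi\rangle}$), $\Lambda^*_+=\Lambda^*\cap\mathfrak t_+$, $\rho$ the half-sum of the positive roots, and for each positive root $\alpha$ let $e_\alpha\in\mathfrak g_{\mathbb C}$ satisfy $[\xi,e_\alpha]=2\pi i\langle\alpha,\xi\rangle e_\alpha$ for $\xi\in\mathfrak t$ and $e_\alpha\cdot e_{-\alpha}=1$, where $e_{-\alpha}=\overline{e_\alpha}$. Write $f_{abc}=[e_a,e_b]\cdot e_c$, and sum over repeated indices. For a Lie group $K$ with Lie algebra $\mathfrak k$, a $K$-differential space is a complex super vector space with an odd operator $d$, odd contractions $\iota_\xi$ and even Lie derivatives $L_\xi$, linear in $\xi\in\mathfrak k$,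 such that $d^2=0$, $[\iota_\xi,\iota_\eta]=0$, $[\iota_\xi,d]=L_\xi$, $[L_\xi,d]=0$, $[L_\xi,\iota_\eta]=\iota_{[\xi,\eta]}$, $[L_\xi,L_\eta]=L_{[\xi,\eta]}$ (super commutators); homomorphisms are parity preserving linear maps that intertwine all these operators. The basic subspace is the joint kernel of all $\iota_\xi$ and $L_\xi$. Let $\mathcal E'(G)$ be the space of distributions on $G$ with the convolution product, $u_\xi=\frac{d}{dt}|_{t=0}\delta_{\exp t\xi}$, $u_a=u_{e_a}$, and let $\mathrm{Cl}(\mathfrak g)$ be the complexified Clifford algebra with generators $x_\xi$, $x_a=x_{e_a}$, and relations $2x_\xi^2=\xi\cdot\xi$. The non-commutative Weil algebra is $\widehat{\mathcal W}_G=\mathcal E'(G)\otimes\mathrm{Cl}(\mathfrak g)$ with $$\iota_a=\mathrm{ad}(x_a),\quad L_a=\mathrm{ad}(u_a-\tfrac12 f_{abc}x_bx_c),\quad d=\mathrm{ad}(u_ax_a-\tfrac16 f_{abc}x_ax_bx_c)$$ ($\mathrm{ad}$ denotes the super commutator). Let $\mathcal E'(T)^-$ be the negative Hardy space of all $u\in\mathcal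 E'(T)$ with $\langle u,t^\nu\rangle=0$ unless $\nu\in\rho+\Lambda^*_+$. The Hardy–Weil algebra is $\widehat{\mathcal W}_T^-=\mathcal E'(T)^-\otimes\mathrm{Cl}(\mathfrak t)$ with contractions $\iota_k=\mathrm{ad}(x_k)$, zero Lie derivatives, and differential $\sum_k u_k\iota_k$, where $u_k$ acts by convolution. For $\lambda\in\Lambda^*_+$ let $V_\lambda$ be the irreducible unitary representation of $G$ with highest weight $\lambda$, $v_\lambda$ a highest weight vector of unit length, and $\Delta_\lambda(g)=(v_\lambda,g\cdot v_\lambda)$. Let $r_{ab}e_a\otimes e_b=\frac12\sum_{\alpha>0}(e_\alpha\otimes e_{-\alpha}-e_{-\alpha}\otimes e_\alpha)$ be the classical $r$-matrix, and let $p_G^T:\mathrm{Cl}(\mathfrak g)=\mathrm{Cl}(\mathfrak t)\otimes\mathrm{Cl}(\mathfrak t^\perp)\to\mathrm{Cl}(\mathfrak t)$ be the orthogonal projection. Theorem. (a) $\widehat{\mathcal W}_G$ (with the operators $\iota_\xi,L_\xi$ for $\xi\in\mathfrak t$ only) and $\widehat{\mathcal W}_T^-$ are $T$-differential spaces. There is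 exactly one linear map $r_G^T:\mathcal E'(G)\to\mathcal E'(T)^-$ with $\langle r_G^T(u),t^{\lambda+\rho}\rangle=\langle u,\Delta_\lambda\rangle$ for all $\lambda\in\Lambda^*_+$, and $$\mathcal R_G^T=r_G^T\otimes\bigl(p_G^T\circ\exp(\tfrac12 r_{ab}\iota_a\iota_b)\bigr):\ \widehat{\mathcal W}_G\to\widehat{\mathcal W}_T^-$$ is a homomorphism of $T$-differential spaces: it is parity preserving and a chain map, and it intertwines the contractions and Lie derivatives for $\xi\in\mathfrak t$. (b) Let $M$ be a $G$-manifold (Hausdorff, second countable, without boundary, of pure dimension), and let $\Omega(M)$ be its complex differential forms with the $C^\infty$ topology, with $d$, $\iota_\xi=\iota(\xi_M)$, $L_\xi=L(\xi_M)$, where $\xi_M$ is the vector field $\frac{d}{dt}|_{t=0}\exp(-t\xi)^*$. Let $\mathcal E'(G)\,\hat\otimes\,\Omega(M)$ be the space of continuous linear maps $C^\infty(G)\to\Omega(M)$, and let $\mathcal E'(T)^-\hat\otimes\,\Omega(M)$ be the space of continuous linear maps $C^\infty(T)\to\Omega(M)$ that vanish on $t^\nu$ unless $\nu\in\rho+\Lambda^*_+$.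 There is exactly one linear map $r_M:\mathcal E'(G)\,\hat\otimes\,\Omega(M)\to\mathcal E'(T)^-\hat\otimes\,\Omega(M)$ with $\langle r_M(u),t^{\lambda+\rho}\rangle=\langle u,\Delta_\lambda\rangle$ for all $\lambda\in\Lambda_+^*$. It extends $r_G^T\otimes 1$, and $$\mathcal R_G^T\otimes1:=r_M\otimes\bigl(p_G^T\circ\exp(\tfrac12 r_{ab}\iota_a\iota_b)\bigr):\ \widehat{\mathcal W}_G\otimes\Omega(M)\to\widehat{\mathcal W}_T^-\otimes\Omega(M)$$ intertwines parities, differentials, and the contractions and Lie derivatives for $\xi\in\mathfrak t$ (total operators on the graded tensor products). It maps cocycles of the $G$-basic subcomplex to cocycles of the $T$-basic subcomplex and induces a linear map $$\widehat{\mathcal H}_G(M)\to\widehat{\mathcal H}_T^-(M),\qquad [z]\mapsto[(\mathcal R_G^T\otimes1)z],$$ between the cohomologies of the basic subcomplexes $(\widehat{\mathcal W}_G\otimes\Omega(M))_{basic}$ and $(\widehat{\mathcal W}_T^-\otimes\Omega(M))_{basic}$. -/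

import Mathlib

open scoped Manifold ContDiff TensorProduct
noncomputable section
namespace EqLoc

section SmoothFunctions

variable {E : Type*} [NormedAddCommGroup E] [NormedSpace ℝ E]
  {H : Type*} [TopologicalSpace H] (I : ModelWithCorners ℝ E H)
  (M : Type*) [TopologicalSpace M] [ChartedSpace H M]

/-- The smooth complex valued functions, as a subalgebra of all functions. -/
def smoothSubalgebra : Subalgebra ℂ (M → ℂ) where
  carrier := {f | ContMDiff I 𝓘(ℝ, ℂ) ∞ f}
  mul_mem' hf hg := contDiff_mul.comp_contMDiff (ContMDiff.prodMk_space hf hg)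
  add_mem' hf hg := ContMDiff.add hf hg
  algebraMap_mem' _ := contMDiff_const

/-- `C^∞(M)`, the algebra of smooth complex valued functions on `M`. -/
def SmoothFn : Type _ := smoothSubalgebra I M

instance : CommRing (SmoothFn I M) := inferInstanceAs (CommRing (smoothSubalgebra I M))
instance : Algebra ℂ (SmoothFn I M) := inferInstanceAs (Algebra ℂ (smoothSubalgebra I M))
instance : FunLike (SmoothFn I M) M ℂ where
  coe f := f.1
  coe_injective := Subtype.val_injective

variable {I M}

lemma SmoothFn.contMDiff (f : SmoothFn I M) : ContMDiff I 𝓘(ℝ, ℂ) ∞ f := f.2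

@[ext] lemma SmoothFn.ext {f g : SmoothFn I M} (h : ∀ x, f x = g x) : f = g := DFunLike.ext _ _ h

/-- Bundle a smooth function. -/
def SmoothFn.mk (f : M → ℂ) (hf : ContMDiff I 𝓘(ℝ, ℂ) ∞ f) : SmoothFn I M := ⟨f, hf⟩

@[simp] lemma SmoothFn.mk_apply (f : M → ℂ) (hf : ContMDiff I 𝓘(ℝ, ℂ) ∞ f) (x : M) :
    SmoothFn.mk f hf x = f x := rfl
@[simp] lemma SmoothFn.add_apply (f g : SmoothFn I M) (x : M) : (f + g) x = f x + g x := rfl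
@[simp] lemma SmoothFn.mul_apply (f g : SmoothFn I M) (x : M) : (f * g) x = f x * g x := rfl
@[simp] lemma SmoothFn.smul_apply (c : ℂ) (f : SmoothFn I M) (x : M) : (c • f) x = c * f x := rfl

variable (I M) in
/-- Complex vector fields on `M`, i.e. derivations of `C^∞(M)`. -/
abbrev VField : Type _ := Derivation ℂ (SmoothFn I M) (SmoothFn I M)

/-- `V₁ V₂ ⋯ V_k f`. -/
def iterDer (w : List (VField I M)) : SmoothFn I M →ₗ[ℂ] SmoothFn I M :=
  (w.map fun V => (V : SmoothFn I M →ₗ[ℂ] SmoothFn I M)).prod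

variable (I M) in
/-- A smooth function as a continuous function. -/
def toCont : SmoothFn I M →ₗ[ℂ] C(M, ℂ) where
  toFun f := ⟨f, f.contMDiff.continuous⟩
  map_add' _ _ := rfl
  map_smul' _ _ := rfl

/-- The `C^∞`-topology: uniform convergence on compact sets of all iterated derivatives
`V₁ ⋯ V_k f` along vector fields. -/
instance : TopologicalSpace (SmoothFn I M) :=
  ⨅ w : List (VField I M),
    TopologicalSpace.induced (fun f => toCont I M (iterDer w f)) inferInstance

instance : IsTopologicalAddGroup (SmoothFn I M) :=
  topologicalAddGroup_iInf fun w =>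
    topologicalAddGroup_induced ((toCont I M).comp (iterDer w))

instance : ContinuousSMul ℂ (SmoothFn I M) :=
  continuousSMul_iInf fun w => continuousSMul_induced ((toCont I M).comp (iterDer w))

lemma continuous_der (V : VField I M) : Continuous (fun f : SmoothFn I M => V f) := by
  refine continuous_iInf_rng.2 fun w => continuous_induced_rng.2 ?_
  have h : Continuous (fun f : SmoothFn I M => toCont I M (iterDer (w ++ [V]) f)) :=
    continuous_iInf_dom (i := w ++ [V]) continuous_induced_dom
  convert h using 2
  simp [iterDer]

/-- A vector field as a continuous operator on `C^∞(M)`. -/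
def VField.toCLM (V : VField I M) : SmoothFn I M →L[ℂ] SmoothFn I M :=
  ⟨(V : SmoothFn I M →ₗ[ℂ] SmoothFn I M), continuous_der V⟩

end SmoothFunctions

section Infinitesimal

variable {E : Type*} [NormedAddCommGroup E] [NormedSpace ℝ E]
  {H : Type*} [TopologicalSpace H] {I : ModelWithCorners ℝ E H}
  {G : Type*} [TopologicalSpace G] [ChartedSpace H G] [Group G] 
  {E' : Type*} [NormedAddCommGroup E'] [NormedSpace ℝ E']
  {H' : Type*} [TopologicalSpace H'] {I' : ModelWithCorners ℝ E' H'}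
  {M : Type*} [TopologicalSpace M] [ChartedSpace H' M]


/-- The partial derivative of a smooth function of two variables is smooth. -/
lemma contMDiff_partial [IsManifold I 1 G] [IsManifold I' 1 M] (F : G → M → ℂ)
    (hF : ContMDiff (I.prod I') 𝓘(ℝ, ℂ) ∞ (fun p : G × M => F p.1 p.2)) (ξ : GroupLieAlgebra I G) :
    ContMDiff I' 𝓘(ℝ, ℂ) ∞ (fun x => (mfderiv I 𝓘(ℝ, ℂ) (fun h => F h x) 1 ξ : ℂ)) := by
  intro x₀
  have hsw : ContMDiff (I'.prod I) 𝓘(ℝ, ℂ) ∞ (Function.uncurry fun (x : M) (h : G) => F h x) :=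
    hF.comp (contMDiff_snd.prodMk contMDiff_fst)
  have := ContMDiffAt.mfderiv_apply (n := ∞) (m := ∞) (I := I) (I' := 𝓘(ℝ, ℂ)) (J := I') (J' := I')
    (x₀ := x₀) (fun (x : M) (h : G) => F h x) (fun _ => (1 : G)) id (fun _ => ξ)
    (hsw _) contMDiffAt_const contMDiffAt_id contMDiffAt_const le_rfl
  refine this.congr_of_eventuallyEq (Filter.Eventually.of_forall fun x => ?_)
  have h1 := (tangentBundleCore I G).coordChange_self (achart H (1 : G)) 1
    (mem_chart_source _ _) ξ
  have h2 := congrArg (fun L : E →L[ℝ] ℂ => L ξ) (inTangentCoordinates_eq (I := I)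
    (I' := 𝓘(ℝ, ℂ)) (fun _ : M => (1 : G)) (fun x => F 1 x)
    (fun x => mfderiv I 𝓘(ℝ, ℂ) (fun h => F h x) 1) (x₀ := x₀) (x := x)
    (mem_chart_source _ _) (by rw [chartAt_self_eq]; trivial))
  refine Eq.trans ?_ h2.symm
  rw [tangentBundleCore_coordChange_model_space]
  exact (congrArg (fun v : E => (mfderiv I 𝓘(ℝ, ℂ) (fun h => F h x) 1 : E →L[ℝ] ℂ) v) h1).symm

/-- For a smooth family of maps `φ h : M → M`, `h ∈ G`, with `φ 1 = id`, and `ξ ∈ 𝔤`, the vector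
field `(V f)(x) = d/dt|_{t=0} f (φ (γ t) x)` where `γ` is a curve in `G` through `1` with
velocity `ξ`. -/
def infinitesimal [IsManifold I 1 G] [IsManifold I' 1 M] (φ : G → M → M)
    (hφ : ContMDiff (I.prod I') I' ∞ (fun p : G × M => φ p.1 p.2)) (h1 : ∀ x, φ 1 x = x)
    (ξ : GroupLieAlgebra I G) : VField I' M :=
  have hs (f : SmoothFn I' M) :
      ContMDiff (I.prod I') 𝓘(ℝ, ℂ) ∞ (fun p : G × M => f (φ p.1 p.2)) := f.contMDiff.comp hφ
  have hd (f : SmoothFn I' M) (x : M) :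
      HasMFDerivAt I 𝓘(ℝ, ℂ) (fun h => f (φ h x)) (1 : G)
        (mfderiv I 𝓘(ℝ, ℂ) (fun h => f (φ h x)) 1) :=
    (((hs f).comp (contMDiff_id.prodMk contMDiff_const)).mdifferentiable
      (by simp) (1 : G)).hasMFDerivAt
  Derivation.mk'
  { toFun f := SmoothFn.mk (fun x => (mfderiv I 𝓘(ℝ, ℂ) (fun h => f (φ h x)) 1 ξ : ℂ))
      (contMDiff_partial (fun h x => f (φ h x)) (hs f) ξ)
    map_add' f g := by
      ext x
      exact congrArg (fun L : TangentSpace I (1 : G) →L[ℝ] ℂ => L ξ) ((hd f x).add (hd g x)).mfderiv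
    map_smul' c f := by
      ext x
      have := ((hasMFDerivAt_const c (1 : G)).mul (hd f x)).mfderiv
      refine (congrArg (fun L : E →L[ℝ] ℂ => L ξ) this).trans ?_
      let A : E →L[ℝ] ℂ := mfderiv I 𝓘(ℝ, ℂ) (fun h => f (φ h x)) (1 : G)
      change (c • A + f (φ 1 x) • (0 : E →L[ℝ] ℂ)) ξ = c * A ξ
      have e : c • A + f (φ 1 x) • (0 : E →L[ℝ] ℂ) = c • A :=
        (congrArg (c • A + ·) (smul_zero (f (φ 1 x)))).trans (add_zero _)
      exact congrArg (fun L : E →L[ℝ] ℂ => L ξ) e }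
  (fun f g => by
    ext x
    refine (congrArg (fun L : TangentSpace I (1 : G) →L[ℝ] ℂ => L ξ)
      ((hd f x).mul (hd g x)).mfderiv).trans ?_
    simp only [h1]
    rfl)

@[simp] lemma infinitesimal_apply [IsManifold I 1 G] [IsManifold I' 1 M] (φ : G → M → M)
    (hφ : ContMDiff (I.prod I') I' ∞ (fun p : G × M => φ p.1 p.2)) (h1 : ∀ x, φ 1 x = x)
    (ξ : GroupLieAlgebra I G) (f : SmoothFn I' M) (x : M) :
    infinitesimal φ hφ h1 ξ f x = mfderiv I 𝓘(ℝ, ℂ) (fun h => f (φ h x)) 1 ξ := rfl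

end Infinitesimal
section Forms

variable (A : Type*) [CommRing A] [Algebra ℂ A]

/-- Differential forms of degree `k`: alternating `A`-multilinear maps `Der(A)^k → A`. -/
abbrev Form (k : ℕ) : Type _ := Derivation ℂ A A [⋀^Fin k]→ₗ[A] A

variable {A}

lemma der_lie_smul (X Y : Derivation ℂ A A) (a : A) : ⁅X, a • Y⁆ = a • ⁅X, Y⁆ + X a • Y := by
  ext b
  simp [Derivation.commutator_apply]

/-- The Lie derivative as a `ℂ`-multilinear map. -/
def lieAux {k : ℕ} (X : Derivation ℂ A A) (θ : Form A k) :
    MultilinearMap ℂ (fun _ : Fin k => Derivation ℂ A A) A :=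
  (X : A →ₗ[ℂ] A).compMultilinearMap (θ.toMultilinearMap.restrictScalars ℂ) -
  ∑ i, (θ.toMultilinearMap.restrictScalars ℂ).compLinearMap
     (Function.update (fun _ => LinearMap.id) i (LieAlgebra.ad ℂ (Derivation ℂ A A) X))

lemma lieAux_apply {k : ℕ} (X : Derivation ℂ A A) (θ : Form A k)
    (Y : Fin k → Derivation ℂ A A) :
    lieAux X θ Y = X (θ Y) - ∑ i, θ (Function.update Y i ⁅X, Y i⁆) := by
  simp only [lieAux, sub_apply, sum_apply,
    MultilinearMap.compLinearMap_apply]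
  congr 1
  refine Finset.sum_congr rfl fun i _ => ?_
  change θ _ = θ _
  congr 1
  ext1 j
  rcases eq_or_ne j i with rfl | h
  · simp
  · simp [h]

/-- The Lie derivative of a form:
`(L_X θ)(Y₁, …, Y_k) = X (θ (Y₁, …, Y_k)) - ∑ i, θ (Y₁, …, [X, Y_i], …, Y_k)`. -/
def Form.lie {k : ℕ} (X : Derivation ℂ A A) (θ : Form A k) : Form A k where
  toFun Y := X (θ Y) - ∑ i, θ (Function.update Y i ⁅X, Y i⁆)
  map_update_add' {inst} m i x y := by
    obtain rfl := Subsingleton.elim inst (instDecidableEqFin k)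
    simp only [← lieAux_apply, MultilinearMap.map_update_add]
  map_update_smul' {inst} m i a x := by
    obtain rfl := Subsingleton.elim inst (instDecidableEqFin k)
    rw [← Finset.add_sum_erase _ _ (Finset.mem_univ i), ← Finset.add_sum_erase _ _ (Finset.mem_univ i)]
    have : ∀ b : A, ∀ j ∈ Finset.univ.erase i,
        θ (Function.update (Function.update m i (b • x)) j ⁅X, Function.update m i (b • x) j⁆) =
          b * θ (Function.update (Function.update m i x) j ⁅X, Function.update m i x j⁆) := by
      intro b j hj
      have hj : j ≠ i := Finset.ne_of_mem_erase hj
      rw [Function.update_comm hj.symm, Function.update_comm hj.symm, Function.update_of_ne hj,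
        Function.update_of_ne hj, θ.map_update_smul, smul_eq_mul]
    rw [Finset.sum_congr rfl (this a), ← Finset.mul_sum]
    simp
    ring
  map_eq_zero_of_eq' Y p q h hpq := by
    rw [θ.map_eq_zero_of_eq Y h hpq, map_zero, zero_sub, neg_eq_zero]
    rw [Fintype.sum_eq_add p q hpq]
    · have := θ.map_swap (Function.update Y p ⁅X, Y p⁆) hpq
      rw [← h, add_comm, ← eq_neg_iff_add_eq_zero, ← this]
      congr 1
      ext1 j
      rcases eq_or_ne j q with rfl | hq
      · simp
      rcases eq_or_ne j p with rfl | hp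
      · simp [hpq, h, hpq.symm]
      · simp [hp, hq, Equiv.swap_apply_of_ne_of_ne hp hq]
    · rintro j ⟨hp, hq⟩
      exact θ.map_eq_zero_of_eq _ (by simp [hp.symm, hq.symm, h]) hpq

@[simp] lemma Form.lie_apply {k : ℕ} (X : Derivation ℂ A A) (θ : Form A k)
    (Y : Fin k → Derivation ℂ A A) :
    θ.lie X Y = X (θ Y) - ∑ i, θ (Function.update Y i ⁅X, Y i⁆) := rfl

/-- `X ↦ X ∘ θ + L_X θ`, with values in the `ℂ`-multilinear alternating maps. -/
def dAux {k : ℕ} (θ : Form A k) : Derivation ℂ A A →ₗ[ℂ] Derivation ℂ A A [⋀^Fin k]→ₗ[ℂ] A where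
  toFun X :=
    { (X : A →ₗ[ℂ] A).compMultilinearMap (θ.toMultilinearMap.restrictScalars ℂ) +
        (θ.lie X).toMultilinearMap.restrictScalars ℂ with
      map_eq_zero_of_eq' := fun v i j h hij => by
        change X (θ v) + θ.lie X v = 0
        rw [θ.map_eq_zero_of_eq v h hij, (θ.lie X).map_eq_zero_of_eq v h hij, map_zero, add_zero] }
  map_add' X Y := by
    ext v
    change (X + Y) (θ v) + θ.lie (X + Y) v = X (θ v) + θ.lie X v + (Y (θ v) + θ.lie Y v)
    simp only [Form.lie_apply, add_lie, AlternatingMap.map_update_add, Finset.sum_add_distrib,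
      Derivation.add_apply]
    ring
  map_smul' c X := by
    ext v
    change (c • X) (θ v) + θ.lie (c • X) v = c • (X (θ v) + θ.lie X v)
    have h : ∀ i, θ (Function.update v i (c • ⁅X, v i⁆)) = c • θ (Function.update v i ⁅X, v i⁆) :=
      fun i => (θ.toMultilinearMap.restrictScalars ℂ).map_update_smul v i c _
    simp only [Form.lie_apply, smul_lie, h, Derivation.smul_apply, smul_add, smul_sub,
      Finset.smul_sum]

lemma dAux_apply {k : ℕ} (θ : Form A k) (X : Derivation ℂ A A) (v : Fin k → Derivation ℂ A A) :
    dAux θ X v = X (θ v) + θ.lie X v := rfl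

lemma dAux_smul {k : ℕ} (θ : Form A k) (X : Derivation ℂ A A) (a : A)
    (v : Fin k → Derivation ℂ A A) :
    dAux θ (a • X) v = a * dAux θ X v + ∑ i, v i a * θ (Function.update v i X) := by
  have h (i) : ⁅a • X, v i⁆ = a • ⁅X, v i⁆ - v i a • X := by
    rw [← lie_skew, der_lie_smul, ← lie_skew X, smul_neg]; abel
  simp only [dAux_apply, Form.lie_apply, h, AlternatingMap.map_update_sub,
    AlternatingMap.map_update_smul, Finset.sum_sub_distrib, Derivation.smul_apply, smul_eq_mul,
    ← Finset.mul_sum]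
  ring

lemma cons_smul_eq {k : ℕ} (θ : Form A (k + 1)) (X : Derivation ℂ A A) (a : A)
    (w : Fin k → Derivation ℂ A A) :
    θ (Fin.cons (a • X) w) = a * θ (Fin.cons X w) :=
  θ.toMultilinearMap.cons_smul w a X

lemma removeNth_succ_cons {k : ℕ} {α : Type*} (x : α) (v : Fin (k + 1) → α) (i : Fin (k + 1)) :
    (i.succ.removeNth (Fin.cons x v : Fin (k + 2) → α)) = Fin.cons x (i.removeNth v) := by
  ext1 j
  refine Fin.cases ?_ (fun j => ?_) j <;> simp [Fin.removeNth]

lemma alternatize_dAux_smul {k : ℕ} (θ : Form A k) (X : Derivation ℂ A A) (a : A)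
    (v : Fin k → Derivation ℂ A A) :
    AlternatingMap.alternatizeUncurryFin (dAux θ) (Fin.cons (a • X) v) =
      a * AlternatingMap.alternatizeUncurryFin (dAux θ) (Fin.cons X v) := by
  simp only [AlternatingMap.alternatizeUncurryFin_apply, Fin.sum_univ_succ, Fin.cons_zero,
    Fin.cons_succ, Fin.removeNth_zero, Fin.tail_cons, dAux_smul]
  cases k with
  | zero => simp
  | succ n =>
    have h (i : Fin (n + 1)) : θ (Function.update v i X) =
        (-1) ^ (i : ℕ) * θ (Fin.cons X (i.removeNth v)) := by
      rw [← Fin.insertNth_removeNth, AlternatingMap.map_insertNth]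
      simp [Matrix.vecCons]
    simp only [removeNth_succ_cons, dAux_apply, cons_smul_eq, h, Fin.val_succ, Derivation.leibniz,
      smul_eq_mul, mul_add, Finset.mul_sum, Fin.val_zero, pow_zero, one_smul, zsmul_eq_mul,
      Int.cast_pow, Int.cast_neg, Int.cast_one]
    rw [add_assoc, ← Finset.sum_add_distrib]
    congr 1
    refine Finset.sum_congr rfl fun i _ => ?_
    ring

/-- The exterior derivative, given by the Koszul formula
`dθ(X₀, …, X_k) = ∑ i, (-1)^i X_i (θ(X̂_i)) - ½ ∑ i, ∑ j ≠ i, (-1)^i θ(X̂_i with X_j ↦ [X_i, X_j])`,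
where `X̂_i` is `(X₀, …, X_k)` with `X_i` omitted (each bracket term of the usual formula occurs
twice in the double sum). By the definition of `L`, this is
`½ ∑ i, (-1)^i (X_i (θ(X̂_i)) + (L_{X_i} θ)(X̂_i))`. -/
def Form.d {k : ℕ} (θ : Form A k) : Form A (k + 1) where
  toFun v := (1 / 2 : ℂ) • ∑ i : Fin (k + 1), (-1) ^ (i : ℕ) •
    (v i (θ (i.removeNth v)) + θ.lie (v i) (i.removeNth v))
  map_update_add' {inst} m i x y := by
    obtain rfl := Subsingleton.elim inst (instDecidableEqFin (k + 1))
    have := (AlternatingMap.alternatizeUncurryFin (dAux θ)).map_update_add m i x y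
    simp only [AlternatingMap.alternatizeUncurryFin_apply, dAux_apply] at this
    rw [this, smul_add]
  map_update_smul' {inst} m i a x := by
    obtain rfl := Subsingleton.elim inst (instDecidableEqFin (k + 1))
    have key (y : Derivation ℂ A A) : ∑ j : Fin (k + 1), (-1) ^ (j : ℕ) • (Function.update m i y j
          (θ (j.removeNth (Function.update m i y))) +
          θ.lie (Function.update m i y j) (j.removeNth (Function.update m i y))) =
        (-1) ^ (i : ℕ) • AlternatingMap.alternatizeUncurryFin (dAux θ)
          (Fin.cons y (i.removeNth m)) := by
      have h := AlternatingMap.map_insertNth (AlternatingMap.alternatizeUncurryFin (dAux θ)) i y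
        (i.removeNth m)
      rw [Fin.insertNth_removeNth] at h
      refine Eq.trans ?_ h
      simp only [AlternatingMap.alternatizeUncurryFin_apply, dAux_apply]
    rw [key, key, alternatize_dAux_smul]
    simp only [smul_eq_mul, mul_smul_comm]
  map_eq_zero_of_eq' Y p q h hpq := by
    have := (AlternatingMap.alternatizeUncurryFin (dAux θ)).map_eq_zero_of_eq Y h hpq
    simp only [AlternatingMap.alternatizeUncurryFin_apply, dAux_apply] at this
    rw [this, smul_zero]


variable (A) in
/-- All differential forms (forms of degree greater than `dim M` are zero, so that the product over
all degrees is the direct sum). -/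
abbrev Forms : Type _ := ∀ k : ℕ, Form A k


lemma Form.lie_add {k : ℕ} (X : Derivation ℂ A A) (θ η : Form A k) :
    (θ + η).lie X = θ.lie X + η.lie X := by
  ext Y
  simp only [Form.lie_apply, AlternatingMap.add_apply, map_add, Finset.sum_add_distrib]
  ring

lemma Form.lie_smul {k : ℕ} (X : Derivation ℂ A A) (c : ℂ) (θ : Form A k) :
    (c • θ).lie X = c • θ.lie X := by
  ext Y
  simp only [Form.lie_apply, AlternatingMap.smul_apply, Derivation.map_smul, smul_sub,
    Finset.smul_sum]

lemma Form.d_apply {k : ℕ} (θ : Form A k) (v : Fin (k + 1) → Derivation ℂ A A) :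
    θ.d v = (1 / 2 : ℂ) • ∑ i : Fin (k + 1), (-1) ^ (i : ℕ) •
      (v i (θ (i.removeNth v)) + θ.lie (v i) (i.removeNth v)) := rfl

lemma Form.d_add {k : ℕ} (θ η : Form A k) : (θ + η).d = θ.d + η.d := by
  ext v
  simp only [Form.d_apply, AlternatingMap.add_apply, Form.lie_add, map_add, ← smul_add,
    ← Finset.sum_add_distrib]
  simp only [add_add_add_comm]

lemma Form.d_smul {k : ℕ} (c : ℂ) (θ : Form A k) : (c • θ).d = c • θ.d := by
  ext v
  simp only [Form.d_apply, AlternatingMap.smul_apply, Form.lie_smul, Derivation.map_smul,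
    ← smul_add, smul_comm _ c, ← Finset.smul_sum]

/-- The exterior derivative on all forms. -/
def Forms.d : Forms A →ₗ[ℂ] Forms A where
  toFun θ k := match k with
    | 0 => 0
    | k + 1 => (θ k).d
  map_add' θ η := by
    ext1 k
    cases k with
    | zero => exact (add_zero _).symm
    | succ k => exact Form.d_add _ _
  map_smul' c θ := by
    ext1 k
    cases k with
    | zero => exact (smul_zero (M := ℂ) (A := Form A 0) c).symm
    | succ k => exact Form.d_smul _ _

/-- The contraction with a vector field, on all forms. -/
def Forms.contr (X : Derivation ℂ A A) : Forms A →ₗ[ℂ] Forms A where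
  toFun θ k := (θ (k + 1)).curryLeft X
  map_add' _ _ := rfl
  map_smul' _ _ := rfl

/-- The Lie derivative along a vector field, on all forms. -/
def Forms.lie (X : Derivation ℂ A A) : Forms A →ₗ[ℂ] Forms A where
  toFun θ k := (θ k).lie X
  map_add' _ _ := funext fun _ => Form.lie_add _ _ _
  map_smul' _ _ := funext fun _ => Form.lie_smul _ _ _

/-- The parity operator `(-1)^k` on forms of degree `k`. -/
def Forms.parity : Forms A →ₗ[ℂ] Forms A where
  toFun θ k := (-1 : ℂ) ^ k • θ k
  map_add' _ _ := funext fun _ => smul_add _ _ _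
  map_smul' c θ := funext fun k => smul_comm ((-1 : ℂ) ^ k) c (θ k)

section Topology

variable [TopologicalSpace A]

/-- The topology on forms: convergence of the values on all tuples of vector fields. -/
instance (k : ℕ) : TopologicalSpace (Form A k) :=
  TopologicalSpace.induced (fun θ => (θ : (Fin k → Derivation ℂ A A) → A)) inferInstance

lemma Form.continuous_eval {k : ℕ} (v : Fin k → Derivation ℂ A A) :
    Continuous (fun θ : Form A k => θ v) :=
  (continuous_apply v).comp continuous_induced_dom

lemma Form.continuous_iff {T : Type*} [TopologicalSpace T] {k : ℕ} {f : T → Form A k} :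
    Continuous f ↔ ∀ v, Continuous fun t => f t v :=
  continuous_induced_rng.trans continuous_pi_iff

instance [IsTopologicalAddGroup A] (k : ℕ) : IsTopologicalAddGroup (Form A k) where
  continuous_add := Form.continuous_iff.2 fun v =>
    ((Form.continuous_eval v).comp continuous_fst).add ((Form.continuous_eval v).comp continuous_snd)
  continuous_neg := Form.continuous_iff.2 fun v => (Form.continuous_eval v).neg

instance [ContinuousConstSMul ℂ A] (k : ℕ) : ContinuousConstSMul ℂ (Form A k) where
  continuous_const_smul c := Form.continuous_iff.2 fun v => (Form.continuous_eval v).const_smul c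

instance [ContinuousSMul ℂ A] (k : ℕ) : ContinuousSMul ℂ (Form A k) where
  continuous_smul := Form.continuous_iff.2 fun v =>
    continuous_fst.smul ((Form.continuous_eval v).comp continuous_snd)

lemma Forms.continuous_eval {k : ℕ} (v : Fin k → Derivation ℂ A A) :
    Continuous (fun θ : Forms A => θ k v) := (Form.continuous_eval v).comp (continuous_apply k)

lemma Forms.continuous_contr (X : Derivation ℂ A A) : Continuous (Forms.contr X) :=
  continuous_pi fun _ => Form.continuous_iff.2 fun _ => Forms.continuous_eval _

lemma Forms.continuous_parity [ContinuousConstSMul ℂ A] : Continuous (Forms.parity (A := A)) :=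
  continuous_pi fun k => (continuous_const_smul ((-1 : ℂ) ^ k)).comp (continuous_apply k)


lemma Forms.continuous_lie [IsTopologicalAddGroup A]
    (hc : ∀ X : Derivation ℂ A A, Continuous X) (X : Derivation ℂ A A) : Continuous (Forms.lie X) :=
  continuous_pi fun _ => Form.continuous_iff.2 fun _ =>
    ((hc X).comp (Forms.continuous_eval _)).sub
      (continuous_finsetSum _ fun _ _ => Forms.continuous_eval _)

lemma Forms.continuous_d [IsTopologicalAddGroup A] [ContinuousConstSMul ℂ A]
    (hc : ∀ X : Derivation ℂ A A, Continuous X) : Continuous (Forms.d (A := A)) := by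
  refine continuous_pi fun k => Form.continuous_iff.2 fun v => ?_
  cases k with
  | zero => exact continuous_const
  | succ k =>
    refine (continuous_finsetSum _ fun i _ => ?_).const_smul (1 / 2 : ℂ)
    exact (((hc _).comp (Forms.continuous_eval _)).add ((Form.continuous_eval _).comp
      ((continuous_apply k).comp (Forms.continuous_lie hc _)))).const_smul ((-1 : ℤ) ^ (i : ℕ))

end Topology

end Forms

section DifferentialSpaces

/-- The operators of a differential space for a Lie algebra `𝔨`: the parity operator (`+1` on even
and `-1` on odd vectors), the differential, the contractions and the Lie derivatives. -/
structure DiffOps (𝔨 V : Type*) [AddCommGroup V] [Module ℂ V] where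
  parity : V →ₗ[ℂ] V
  d : V →ₗ[ℂ] V
  contr : 𝔨 → V →ₗ[ℂ] V
  lie : 𝔨 → V →ₗ[ℂ] V

/-- The same with continuous operators. -/
structure ContDiffOps (𝔨 B : Type*) [AddCommGroup B] [Module ℂ B] [TopologicalSpace B] where
  parity : B →L[ℂ] B
  d : B →L[ℂ] B
  contr : 𝔨 → B →L[ℂ] B
  lie : 𝔨 → B →L[ℂ] B

namespace DiffOps

variable {𝔨 𝔥 V W : Type*} [AddCommGroup V] [Module ℂ V] [AddCommGroup W] [Module ℂ W]

/-- Restriction of the operators along a map of Lie algebras. -/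
def restrict (X : DiffOps 𝔨 V) (φ : 𝔥 → 𝔨) : DiffOps 𝔥 V :=
  { X with contr := fun ξ => X.contr (φ ξ), lie := fun ξ => X.lie (φ ξ) }

/-- The axioms of a differential space: `V` is a super vector space with a representation of the
graded Lie algebra `𝔨[1] ⊕ 𝔨 ⊕ ℝ d`. -/
structure IsDifferentialSpace [LieRing 𝔨] [LieAlgebra ℝ 𝔨] (X : DiffOps 𝔨 V) : Prop where
  parity_parity : X.parity ∘ₗ X.parity = LinearMap.id
  d_parity : X.d ∘ₗ X.parity = -(X.parity ∘ₗ X.d)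
  contr_parity : ∀ ξ, X.contr ξ ∘ₗ X.parity = -(X.parity ∘ₗ X.contr ξ)
  lie_parity : ∀ ξ, X.lie ξ ∘ₗ X.parity = X.parity ∘ₗ X.lie ξ
  contr_add : ∀ ξ η, X.contr (ξ + η) = X.contr ξ + X.contr η
  contr_smul : ∀ (c : ℝ) ξ, X.contr (c • ξ) = (c : ℂ) • X.contr ξ
  lie_add : ∀ ξ η, X.lie (ξ + η) = X.lie ξ + X.lie η
  lie_smul : ∀ (c : ℝ) ξ, X.lie (c • ξ) = (c : ℂ) • X.lie ξ
  d_d : X.d ∘ₗ X.d = 0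
  contr_contr : ∀ ξ η, X.contr ξ ∘ₗ X.contr η + X.contr η ∘ₗ X.contr ξ = 0
  contr_d : ∀ ξ, X.contr ξ ∘ₗ X.d + X.d ∘ₗ X.contr ξ = X.lie ξ
  lie_d : ∀ ξ, X.lie ξ ∘ₗ X.d = X.d ∘ₗ X.lie ξ
  lie_contr : ∀ ξ η, X.lie ξ ∘ₗ X.contr η - X.contr η ∘ₗ X.lie ξ = X.contr ⁅ξ, η⁆
  lie_lie : ∀ ξ η, X.lie ξ ∘ₗ X.lie η - X.lie η ∘ₗ X.lie ξ = X.lie ⁅ξ, η⁆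

/-- Homomorphisms of differential spaces: homomorphisms of super vector spaces which intertwine
the differentials, the contractions and the Lie derivatives. -/
structure IsHom (X : DiffOps 𝔨 V) (Y : DiffOps 𝔨 W) (R : V →ₗ[ℂ] W) : Prop where
  parity : R ∘ₗ X.parity = Y.parity ∘ₗ R
  d : R ∘ₗ X.d = Y.d ∘ₗ R
  contr : ∀ ξ, R ∘ₗ X.contr ξ = Y.contr ξ ∘ₗ R
  lie : ∀ ξ, R ∘ₗ X.lie ξ = Y.lie ξ ∘ₗ R

/-- The basic subspace: vectors annihilated by all contractions and all Lie derivatives. -/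
def basic (X : DiffOps 𝔨 V) : Submodule ℂ V :=
  (⨅ ξ, LinearMap.ker (X.contr ξ)) ⊓ ⨅ ξ, LinearMap.ker (X.lie ξ)

/-- Cocycles of the basic subcomplex. -/
def cocycles (X : DiffOps 𝔨 V) : Submodule ℂ V := X.basic ⊓ LinearMap.ker X.d

/-- Coboundaries of the basic subcomplex. -/
def coboundaries (X : DiffOps 𝔨 V) : Submodule ℂ V := X.basic.map X.d

/-- The cohomology of the basic subcomplex. -/
abbrev cohomology (X : DiffOps 𝔨 V) : Type _ :=
  X.cocycles ⧸ X.coboundaries.comap X.cocycles.subtype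

open TensorProduct in
/-- The graded tensor product of a differential space of the form `S ⊗ C`, where `C` carries the
grading with parity operator `inv`, with a differential space `B`. Here `S` is already a completed
tensor product with `B`, and `post` is the action of the operators on `B` on it. -/
def tensor {S C B : Type*} [AddCommGroup S] [Module ℂ S] [AddCommGroup C] [Module ℂ C]
    [AddCommGroup B] [Module ℂ B] [TopologicalSpace B]
    (X : DiffOps 𝔨 (S ⊗[ℂ] C)) (inv : C →ₗ[ℂ] C) (post : (B →L[ℂ] B) → S →ₗ[ℂ] S)
    (Y : ContDiffOps 𝔨 B) : DiffOps 𝔨 (S ⊗[ℂ] C) where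
  parity := TensorProduct.map (post Y.parity) inv
  d := X.d + TensorProduct.map (post Y.d) inv
  contr ξ := X.contr ξ + TensorProduct.map (post (Y.contr ξ)) inv
  lie ξ := X.lie ξ + TensorProduct.map (post (Y.lie ξ)) LinearMap.id

end DiffOps

end DifferentialSpaces

section Clifford

open TensorProduct

variable {V W : Type*} [AddCommGroup V] [Module ℝ V] [AddCommGroup W] [Module ℝ W]
  (β : LinearMap.BilinForm ℝ V) (β' : LinearMap.BilinForm ℝ W)

/-- The quadratic form `v ↦ ½ v · v` on the complexification of `V`. -/
def halfForm : QuadraticForm ℂ (ℂ ⊗[ℝ] V) :=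
  (1 / 2 : ℂ) • (LinearMap.BilinForm.baseChange ℂ β).toQuadraticMap

/-- The complexified Clifford algebra of `(V, β)`, with relations `2 v * v = v · v`. -/
abbrev Cliff : Type _ := CliffordAlgebra (halfForm β)

/-- The generator `x_v` of the Clifford algebra. -/
def clx (v : V) : Cliff β := CliffordAlgebra.ι (halfForm β) (1 ⊗ₜ v)

/-- The parity operator of the Clifford algebra. -/
def clParity : Cliff β →ₗ[ℂ] Cliff β := (CliffordAlgebra.involute (Q := halfForm β)).toLinearMap

/-- Left multiplication by `y`. -/
def clLeft : Cliff β →ₗ[ℂ] Cliff β →ₗ[ℂ] Cliff β := LinearMap.mul ℂ (Cliff β)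

/-- `c ↦ (-1)^{|c|} c y`. -/
def clRight : Cliff β →ₗ[ℂ] Cliff β →ₗ[ℂ] Cliff β := (LinearMap.mul ℂ (Cliff β) ∘ₗ clParity β).flip

/-- The super commutator `[y, c] = y c - (-1)^{|c|} c y` with an odd element `y`. -/
def oddAd : Cliff β →ₗ[ℂ] Cliff β →ₗ[ℂ] Cliff β := clLeft β - clRight β

/-- The commutator `[y, c] = y c - c y` with an even element `y`. -/
def evenAd : Cliff β →ₗ[ℂ] Cliff β →ₗ[ℂ] Cliff β :=
  LinearMap.mul ℂ (Cliff β) - (LinearMap.mul ℂ (Cliff β)).flip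

/-- The contraction `ι_v = ad(x_v)` for a complex vector `v`. -/
def clContr : ℂ ⊗[ℝ] V →ₗ[ℂ] Cliff β →ₗ[ℂ] Cliff β := oddAd β ∘ₗ CliffordAlgebra.ι (halfForm β)

/-- The operator `r_{ab} ι_a ι_b` on the Clifford algebra, for a tensor `r`. -/
def clContr₂ : (ℂ ⊗[ℝ] V) ⊗[ℂ] (ℂ ⊗[ℝ] V) →ₗ[ℂ] Cliff β →ₗ[ℂ] Cliff β :=
  TensorProduct.lift ((LinearMap.mul ℂ (Module.End ℂ (Cliff β))).compl₁₂ (clContr β) (clContr β))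

/-- The map of Clifford algebras which corresponds to `⋀ P` under the symbol maps
`Cl(V) ≅ ⋀ V`, `Cl(W) ≅ ⋀ W`. If `P` is the orthogonal projection onto a subspace `W`, then
`x_{w₁} ⋯ x_{w_j} x_{v₁} ⋯ x_{v_k}` with orthonormal `w_i` in `W` and `v_i` in `Wᗮ` is mapped to
`x_{w₁} ⋯ x_{w_j}` if `k = 0` and to `0` if `k > 0`, so that this is the orthogonal
projection `Cl(W) ⊗ Cl(Wᗮ) → Cl(W)`. -/
def clProj (P : V →ₗ[ℝ] W) : Cliff β →ₗ[ℂ] Cliff β' :=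
  letI : Invertible (2 : ℂ) := invertibleOfNonzero two_ne_zero
  (CliffordAlgebra.equivExterior (halfForm β')).symm.toLinearMap ∘ₗ
    (ExteriorAlgebra.map (P.baseChange ℂ)).toLinearMap ∘ₗ
      (CliffordAlgebra.equivExterior (halfForm β)).toLinearMap

end Clifford

section CliffordLie

variable {L : Type*} [LieRing L] [LieAlgebra ℝ L] (β : LinearMap.BilinForm ℝ L)
  {ι : Type*} [Fintype ι] (e : Module.Basis ι ℝ L)

/-- The element `γ = -1/6 f_{abc} x_a x_b x_c`, where `f_{abc} = [e_a, e_b] · e_c`, for an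
orthonormal basis `e`. -/
def clGamma : Cliff β :=
  (-(1 / 6) : ℂ) • ∑ a, ∑ b, ∑ c, (β ⁅e a, e b⁆ (e c) : ℂ) •
    (clx β (e a) * clx β (e b) * clx β (e c))

/-- The element `-1/2 f_{ξbc} x_b x_c`, where `f_{ξbc} = [ξ, e_b] · e_c`. -/
def clSpin (ξ : L) : Cliff β :=
  (-(1 / 2) : ℂ) • ∑ b, ∑ c, (β ⁅ξ, e b⁆ (e c) : ℂ) • (clx β (e b) * clx β (e c))

end CliffordLie

section LieGroups

open TensorProduct

variable {n r m : ℕ}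
  {G : Type*} [TopologicalSpace G] [ChartedSpace (EuclideanSpace ℝ (Fin n)) G] [Group G]
  [LieGroup (𝓡 n) ∞ G]
  {T : Type*} [TopologicalSpace T] [ChartedSpace (EuclideanSpace ℝ (Fin r)) T] [Group T]
  [LieGroup (𝓡 r) ∞ T]
  {M : Type*} [TopologicalSpace M] [ChartedSpace (EuclideanSpace ℝ (Fin m)) M]
  [IsManifold (𝓡 m) ∞ M] [MulAction G M]
  {B : Type*} [AddCommGroup B] [Module ℂ B] [TopologicalSpace B] [IsTopologicalAddGroup B]
  [ContinuousConstSMul ℂ B]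

instance instLieGroupMinSmoothness : LieGroup (𝓡 n) (minSmoothness ℝ 3) G :=
  LieGroup.of_le (n := ∞) (by
    rw [minSmoothness_of_isRCLikeNormedField]
    exact ENat.LEInfty.out)

variable (n G) in
/-- The Lie algebra of `G`. -/
abbrev LieAlg : Type := GroupLieAlgebra (𝓡 n) G

/-- The right invariant vector field `(V f)(g) = d/dt f(exp(tξ) g)`. -/
def rightInvField (ξ : LieAlg n G) : VField (𝓡 n) G :=
  infinitesimal (fun h g => h * g) (contMDiff_mul (𝓡 n) ∞) one_mul ξ

/-- The left invariant vector field `(V f)(g) = d/dt f(g exp(tξ))`. -/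
def leftInvField (ξ : LieAlg n G) : VField (𝓡 n) G :=
  infinitesimal (fun h g => g * h)
    ((contMDiff_mul (𝓡 n) ∞).comp (contMDiff_snd.prodMk contMDiff_fst)) mul_one ξ

variable (m M) in
/-- The fundamental vector field `ξ_M = d/dt exp(-tξ)^*` of a smooth action of `G` on `M`. -/
def fundField [ContMDiffSMul (𝓡 n) (𝓡 m) ∞ G M] (ξ : LieAlg n G) : VField (𝓡 m) M :=
  -infinitesimal (fun h x => h • x) contMDiff_smul (one_smul G) ξ

variable (n G B) in
/-- Distributions on the compact group `G` with values in `B`. For `B = ℂ` this is `E'(G)`;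
for general `B` it is the completed tensor product `E'(G) ⊗ B`. -/
def Dist : Type _ := SmoothFn (𝓡 n) G →L[ℂ] B

instance : AddCommGroup (Dist n G B) := inferInstanceAs (AddCommGroup (SmoothFn (𝓡 n) G →L[ℂ] B))

instance : Module ℂ (Dist n G B) := inferInstanceAs (Module ℂ (SmoothFn (𝓡 n) G →L[ℂ] B))

instance : FunLike (Dist n G B) (SmoothFn (𝓡 n) G) B :=
  inferInstanceAs (FunLike (SmoothFn (𝓡 n) G →L[ℂ] B) (SmoothFn (𝓡 n) G) B)

instance : ContinuousLinearMapClass (Dist n G B) ℂ (SmoothFn (𝓡 n) G) B :=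
  inferInstanceAs (ContinuousLinearMapClass (SmoothFn (𝓡 n) G →L[ℂ] B) ℂ (SmoothFn (𝓡 n) G) B)

/-- The transpose of a vector field on distributions. -/
def Dist.transpose (D : VField (𝓡 n) G) : Dist n G B →ₗ[ℂ] Dist n G B where
  toFun u := ContinuousLinearMap.comp u D.toCLM
  map_add' _ _ := rfl
  map_smul' _ _ := rfl

/-- Convolution `u ↦ u_ξ * u` from the left with `u_ξ = d/dt δ_{exp(tξ)}`:
`⟨u_ξ * u, f⟩ = ⟨u, g ↦ ⟨u_ξ, h ↦ f (h g)⟩⟩`. -/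
def convLeft (ξ : LieAlg n G) : Dist n G B →ₗ[ℂ] Dist n G B := Dist.transpose (rightInvField ξ)

/-- Convolution `u ↦ u * u_ξ` from the right with `u_ξ = d/dt δ_{exp(tξ)}`:
`⟨u * u_ξ, f⟩ = ⟨u, g ↦ ⟨u_ξ, h ↦ f (g h)⟩⟩`. -/
def convRight (ξ : LieAlg n G) : Dist n G B →ₗ[ℂ] Dist n G B := Dist.transpose (leftInvField ξ)

/-- The action of an operator on `B` on `B`-valued distributions. -/
def Dist.post (S : B →L[ℂ] B) : Dist n G B →ₗ[ℂ] Dist n G B where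
  toFun u := S.comp (u : SmoothFn (𝓡 n) G →L[ℂ] B)
  map_add' _ _ := S.comp_add _ _
  map_smul' _ _ := S.comp_smul _ _

/-- The distribution `u ⊗ b`. -/
def Dist.tmul [ContinuousSMul ℂ B] (u : Dist n G ℂ) (b : B) : Dist n G B :=
  ContinuousLinearMap.smulRight (M₁ := SmoothFn (𝓡 n) G) u b

/-! ### The non-commutative Weil algebra -/

variable (n G) in
/-- An invariant inner product on the Lie algebra of a (connected) Lie group. -/
structure InvariantInner where
  form : LinearMap.BilinForm ℝ (LieAlg n G)
  symm : ∀ ξ η, form ξ η = form η ξ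
  pos : ∀ ξ, ξ ≠ 0 → 0 < form ξ ξ
  invariant : ∀ ξ η ζ, form ⁅ξ, η⁆ ζ = form ξ ⁅η, ζ⁆

variable (B) in
/-- The operators of the non-commutative Weil algebra `Ŵ_G = E'(G) ⊗ Cl(𝔤)` (for `B = ℂ`), acting
on `Ŵ_G ⊗ B = E'(G; B) ⊗ Cl(𝔤)`: with `e` an orthonormal basis,
`ι_ξ = ad(x_ξ)`, `L_ξ = ad(u_ξ - 1/2 f_{ξbc} x_b x_c)`, `d = ad(u_a x_a - 1/6 f_{abc} x_a x_b x_c)`,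
where `ad` is the super commutator. -/
def weilOps (β : LinearMap.BilinForm ℝ (LieAlg n G)) (e : Module.Basis (Fin n) ℝ (LieAlg n G)) :
    DiffOps (LieAlg n G) (Dist n G B ⊗[ℂ] Cliff β) where
  parity := TensorProduct.map LinearMap.id (clParity β)
  d := ∑ a, (TensorProduct.map (convLeft (B := B) (e a)) (clLeft β (clx β (e a))) -
      TensorProduct.map (convRight (B := B) (e a)) (clRight β (clx β (e a)))) +
    TensorProduct.map LinearMap.id (oddAd β (clGamma β e))
  contr ξ := TensorProduct.map LinearMap.id (oddAd β (clx β ξ))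
  lie ξ := TensorProduct.map (convLeft (B := B) ξ - convRight ξ) LinearMap.id +
    TensorProduct.map LinearMap.id (evenAd β (clSpin β e ξ))

section Forms

variable [ContMDiffSMul (𝓡 n) (𝓡 m) ∞ G M]

variable (m M) in
/-- The complex of differential forms on `M`. -/
def Ω : Type _ := Forms (SmoothFn (𝓡 m) M)

instance : AddCommGroup (Ω m M) := inferInstanceAs (AddCommGroup (Forms (SmoothFn (𝓡 m) M)))

instance : Module ℂ (Ω m M) := inferInstanceAs (Module ℂ (Forms (SmoothFn (𝓡 m) M)))

instance : TopologicalSpace (Ω m M) := inferInstanceAs (TopologicalSpace (Forms (SmoothFn (𝓡 m) M)))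

instance : IsTopologicalAddGroup (Ω m M) :=
  inferInstanceAs (IsTopologicalAddGroup (Forms (SmoothFn (𝓡 m) M)))

instance : ContinuousSMul ℂ (Ω m M) :=
  inferInstanceAs (ContinuousSMul ℂ (Forms (SmoothFn (𝓡 m) M)))

variable (n m G M) in
/-- The `G`-differential space `Ω(M)` of a `G`-manifold `M`. -/
def formOps : ContDiffOps (LieAlg n G) (Ω m M) where
  parity := ⟨Forms.parity, Forms.continuous_parity (A := SmoothFn (𝓡 m) M)⟩
  d := ⟨Forms.d, Forms.continuous_d (A := SmoothFn (𝓡 m) M) continuous_der⟩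
  contr ξ := ⟨Forms.contr (fundField m M ξ), Forms.continuous_contr (fundField m M ξ)⟩
  lie ξ := ⟨Forms.lie (fundField m M ξ), Forms.continuous_lie (A := SmoothFn (𝓡 m) M)
    continuous_der _⟩

variable (m M) in
/-- The `G`-differential space `Ŵ_G ⊗ Ω(M)`. The cohomology of its basic subcomplex is the
`G`-valued equivariant cohomology of `M`. -/
def weilFormOps (β : LinearMap.BilinForm ℝ (LieAlg n G))
    (e : Module.Basis (Fin n) ℝ (LieAlg n G)) :
    DiffOps (LieAlg n G) (Dist n G (Ω m M) ⊗[ℂ] Cliff β) :=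
  (weilOps (Ω m M) β e).tensor (clParity β) Dist.post (formOps n m G M)

end Forms

/-! ### Maximal tori, weights and roots -/

variable (n r G T) in
/-- A maximal torus of `G`: a Lie subgroup `T → G` (an injective immersion and homomorphism) whose
image is maximal among the closed connected abelian subgroups. -/
structure MaxTorus where
  incl : T →* G
  smooth : ContMDiff (𝓡 r) (𝓡 n) ∞ incl
  injective : Function.Injective incl
  immersion : ∀ t, Function.Injective (mfderiv (𝓡 r) (𝓡 n) incl t)
  maximal : Maximal (fun S : Subgroup G =>
    IsClosed (S : Set G) ∧ IsConnected (S : Set G) ∧ ∀ s ∈ S, ∀ t ∈ S, s * t = t * s) incl.range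

/-- The inclusion `𝔱 → 𝔤`. -/
def MaxTorus.lieIncl (τ : MaxTorus n r G T) : LieAlg r T →ₗ[ℝ] LieAlg n G :=
  (mfderiv (𝓡 r) (𝓡 n) τ.incl 1 :
    EuclideanSpace ℝ (Fin r) →L[ℝ] EuclideanSpace ℝ (Fin n)).toLinearMap

/-- The restriction of a bilinear form on `𝔤` to `𝔱`. -/
def MaxTorus.res (τ : MaxTorus n r G T) (β : LinearMap.BilinForm ℝ (LieAlg n G)) :
    LinearMap.BilinForm ℝ (LieAlg r T) := β.compl₁₂ τ.lieIncl τ.lieIncl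

variable (r T) in
/-- Elements of the weight lattice `Λ^*`, as characters `t ↦ t^χ` of `T`. -/
structure Weight where
  char : T →* Circle
  smooth : ContMDiff (𝓡 r) 𝓘(ℝ, ℂ) ∞ (fun t => (char t : ℂ))

/-- The function `t ↦ t^χ`. -/
def Weight.fn (χ : Weight r T) : SmoothFn (𝓡 r) T := SmoothFn.mk (fun t => (χ.char t : ℂ)) χ.smooth

/-- The weight as a linear form on `𝔱`, so that `(exp ξ)^χ = exp(2πi χ(ξ))`. -/
def Weight.lin (χ : Weight r T) : Module.Dual ℝ (LieAlg r T) :=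
  ((2 * Real.pi)⁻¹ • Complex.imCLM.comp
    (mfderiv (𝓡 r) 𝓘(ℝ, ℂ) (fun t => (χ.char t : ℂ)) 1 :
      EuclideanSpace ℝ (Fin r) →L[ℝ] ℂ)).toLinearMap

namespace MaxTorus

variable (τ : MaxTorus n r G T)

/-- The vectors `e ∈ 𝔤_ℂ` with `[ξ, e] = 2πi α(ξ) e` for all `ξ ∈ 𝔱`. -/
def rootSpace (α : Module.Dual ℝ (LieAlg r T)) : Set (ℂ ⊗[ℝ] LieAlg n G) :=
  {e | ∀ ξ, ⁅(1 : ℂ) ⊗ₜ[ℝ] τ.lieIncl ξ, e⁆ = (2 * Real.pi * Complex.I * α ξ : ℂ) • e}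

/-- The set of roots. -/
def roots : Set (Module.Dual ℝ (LieAlg r T)) :=
  {α | α ≠ 0 ∧ ∃ e ∈ τ.rootSpace α, e ≠ 0}

/-- Complex conjugation on `𝔤_ℂ`. -/
def conj : ℂ ⊗[ℝ] LieAlg n G →ₗ[ℝ] ℂ ⊗[ℝ] LieAlg n G :=
  Complex.conjAe.toLinearMap.rTensor _

end MaxTorus

/-- The choices made for a maximal torus `T` and an invariant inner product `β`: a Weyl chamber
(given by a regular element in its interior), root vectors `e_α` for the positive roots `α`, with
`e_{-α}` the complex conjugate of `e_α`, normalized by `e_α · e_{-α} = 1`, and orthonormal bases of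
`𝔤` and `𝔱`. -/
structure CartanWeyl (τ : MaxTorus n r G T) (β : InvariantInner n G) where
  regular : LieAlg r T
  regular_ne : ∀ α ∈ τ.roots, α regular ≠ 0
  rootVec : Module.Dual ℝ (LieAlg r T) → ℂ ⊗[ℝ] LieAlg n G
  rootVec_mem : ∀ α ∈ τ.roots, 0 < α regular → rootVec α ∈ τ.rootSpace α
  rootVec_norm : ∀ α ∈ τ.roots, 0 < α regular →
    β.form.baseChange ℂ (rootVec α) (MaxTorus.conj (rootVec α)) = 1
  basis : Module.Basis (Fin n) ℝ (LieAlg n G)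
  basis_orthonormal : ∀ a b, β.form (basis a) (basis b) = if a = b then 1 else 0
  basisT : Module.Basis (Fin r) ℝ (LieAlg r T)
  basisT_orthonormal : ∀ k l, τ.res β.form (basisT k) (basisT l) = if k = l then 1 else 0

namespace CartanWeyl

variable {τ : MaxTorus n r G T} {β : InvariantInner n G} (c : CartanWeyl τ β)

/-- The set of positive roots. -/
def posRoots : Set (Module.Dual ℝ (LieAlg r T)) := {α | α ∈ τ.roots ∧ 0 < α c.regular}

/-- The half sum of the positive roots. -/
def rho : Module.Dual ℝ (LieAlg r T) := (1 / 2 : ℝ) • ∑ᶠ α ∈ c.posRoots, α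

/-- The closed positive Weyl chamber `𝔱_+`. -/
def chamber : Set (LieAlg r T) := {η | ∀ α ∈ c.posRoots, 0 ≤ α η}

/-- A weight is dominant if it lies in `𝔱_+` under the identification of `𝔱^*` with `𝔱`. -/
def Dominant (χ : Weight r T) : Prop := ∃ η ∈ c.chamber, τ.res β.form η = χ.lin

/-- The classical r-matrix `∑_α e_α ∧ e_{-α} = ½ ∑_α (e_α ⊗ e_{-α} - e_{-α} ⊗ e_α)`,
where the (finite) sum is over the positive roots. -/
def rMatrix : (ℂ ⊗[ℝ] LieAlg n G) ⊗[ℂ] (ℂ ⊗[ℝ] LieAlg n G) :=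
  (1 / 2 : ℂ) • ∑ᶠ α ∈ c.posRoots,
    (c.rootVec α ⊗ₜ MaxTorus.conj (c.rootVec α) - MaxTorus.conj (c.rootVec α) ⊗ₜ c.rootVec α)

/-- The twist `exp(½ r_{ab} ι_a ι_b)`. The exponential series stops since a product of more
than `n = dim 𝔤` contractions is zero. -/
def twist : Cliff β.form →ₗ[ℂ] Cliff β.form :=
  ∑ k ∈ Finset.range (n + 1),
    ((k.factorial : ℂ)⁻¹) • ((1 / 2 : ℂ) • clContr₂ β.form c.rMatrix : Module.End ℂ _) ^ k

/-- The orthogonal projection `𝔤 → 𝔱`. -/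
def lieProj : LieAlg n G →ₗ[ℝ] LieAlg r T :=
  ∑ k, (β.form.flip (τ.lieIncl (c.basisT k))).smulRight (c.basisT k)

/-- The orthogonal projection `Cl(𝔤) → Cl(𝔱)`. -/
def clRes : Cliff β.form →ₗ[ℂ] Cliff (τ.res β.form) := clProj β.form (τ.res β.form) c.lieProj

/-! ### Irreducible representations -/

/-- The derivative `𝔤 → W` at the identity of a `W`-valued function on `G`. -/
def orbitDeriv {W : Type*} [NormedAddCommGroup W] [NormedSpace ℝ W] (f : G → W) :
    LieAlg n G →ₗ[ℝ] W :=
  (mfderiv (𝓡 n) 𝓘(ℝ, W) f 1 : EuclideanSpace ℝ (Fin n) →L[ℝ] W).toLinearMap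

/-- An irreducible unitary representation of `G` with a highest weight vector `v` of unit
length and of weight `χ`. -/
structure HighestWeightRep (χ : Weight r T) where
  dim : ℕ
  π : G →* (EuclideanSpace ℂ (Fin dim) →L[ℂ] EuclideanSpace ℂ (Fin dim))
  smooth : ContMDiff (𝓡 n) 𝓘(ℝ, EuclideanSpace ℂ (Fin dim) →L[ℂ] EuclideanSpace ℂ (Fin dim)) ∞ π
  unitary : ∀ g w, ‖π g w‖ = ‖w‖
  irreducible : ∀ W : Submodule ℂ (EuclideanSpace ℂ (Fin dim)),
    (∀ g, ∀ w ∈ W, π g w ∈ W) → W = ⊥ ∨ W = ⊤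
  v : EuclideanSpace ℂ (Fin dim)
  norm_v : ‖v‖ = 1
  weight : ∀ t, π (τ.incl t) v = (χ.char t : ℂ) • v
  highest : ∀ α ∈ c.posRoots, ∀ e ∈ τ.rootSpace α,
    LinearMap.liftBaseChange ℂ (orbitDeriv (fun g => π g v)) e = 0

/-- The matrix coefficient `g ↦ (v, g · v)`. -/
def HighestWeightRep.coeff {c : CartanWeyl τ β} {χ : Weight r T} (V : c.HighestWeightRep χ) :
    SmoothFn (𝓡 n) G :=
  SmoothFn.mk (fun g => inner ℂ V.v (V.π g V.v))
    (((((innerSL ℂ V.v).comp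
      (ContinuousLinearMap.apply ℂ _ V.v)).restrictScalars ℝ).contDiff).comp_contMDiff V.smooth)

open Classical in
/-- The function `Δ_χ(g) = (v, g · v)` for the irreducible representation with highest weight `χ`
and a highest weight vector `v` of unit length (the value for a non-dominant `χ` is irrelevant). -/
def Delta (χ : Weight r T) : SmoothFn (𝓡 n) G :=
  if h : Nonempty (c.HighestWeightRep χ) then h.some.coeff else 0

/-! ### The Hardy-Weil algebra -/

variable (B) in
/-- The negative Hardy space as a subspace of the space of distributions:
distributions with `⟨u, t^ν⟩ = 0` unless `ν ∈ ρ + Λ^*_+`. -/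
def hardySpace : Submodule ℂ (Dist r T B) where
  carrier := {u | ∀ ν : Weight r T, (¬ ∃ χ : Weight r T, c.Dominant χ ∧ ν.lin = χ.lin + c.rho) →
    u ν.fn = 0}
  add_mem' {u v} hu hv ν hν := by
    change u ν.fn + v ν.fn = 0
    rw [hu ν hν, hv ν hν, add_zero]
  zero_mem' _ _ := rfl
  smul_mem' a u hu ν hν := by
    change a • u ν.fn = 0
    rw [hu ν hν, smul_zero]

variable (B) in
/-- The negative Hardy space `E'(T)^-` (for `B = ℂ`), and its completed tensor product with `B` in
general. -/
def Hardy : Type _ := c.hardySpace B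

instance : AddCommGroup (c.Hardy B) := inferInstanceAs (AddCommGroup (c.hardySpace B))

instance : Module ℂ (c.Hardy B) := inferInstanceAs (Module ℂ (c.hardySpace B))

/-- The inclusion of the Hardy space into the space of distributions. -/
def Hardy.incl : c.Hardy B →ₗ[ℂ] Dist r T B := (c.hardySpace B).subtype

end CartanWeyl

/-- Characters are eigenfunctions of invariant vector fields. -/
lemma rightInvField_weight (ξ : LieAlg r T) (ν : Weight r T) :
    ∃ a : ℂ, rightInvField ξ ν.fn = a • ν.fn := by
  let A : EuclideanSpace ℝ (Fin r) →L[ℝ] ℂ :=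
    mfderiv (𝓡 r) 𝓘(ℝ, ℂ) (fun t => (ν.char t : ℂ)) 1
  have hA : HasMFDerivAt (𝓡 r) 𝓘(ℝ, ℂ) (fun t => (ν.char t : ℂ)) 1 A :=
    (ν.smooth.mdifferentiable (by simp) 1).hasMFDerivAt
  refine ⟨A ξ, ?_⟩
  ext t
  have h := (hA.mul (hasMFDerivAt_const (ν.char t : ℂ) (1 : T))).mfderiv
  have e : ((fun t => (ν.char t : ℂ)) * fun _ => (ν.char t : ℂ)) =
      fun h => ν.fn (h * t) := by
    ext1 h
    change (ν.char h : ℂ) * ν.char t = (ν.char (h * t) : ℂ)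
    simp
  rw [e] at h
  refine (congrArg (fun L : EuclideanSpace ℝ (Fin r) →L[ℝ] ℂ => L ξ) h).trans ?_
  change (((ν.char 1 : ℂ) • (0 : EuclideanSpace ℝ (Fin r) →L[ℝ] ℂ) + (ν.char t : ℂ) • A)
    : EuclideanSpace ℝ (Fin r) →L[ℝ] ℂ) ξ = A ξ * (ν.char t : ℂ)
  have e' : (ν.char 1 : ℂ) • (0 : EuclideanSpace ℝ (Fin r) →L[ℝ] ℂ) + (ν.char t : ℂ) • A =
    (ν.char t : ℂ) • A := by simp
  refine (congrArg (fun L : EuclideanSpace ℝ (Fin r) →L[ℝ] ℂ => L ξ) e').trans ?_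
  exact mul_comm _ _

namespace CartanWeyl

variable {τ : MaxTorus n r G T} {β : InvariantInner n G} (c : CartanWeyl τ β)

/-- Convolution with `u_ξ`, `ξ ∈ 𝔱`, on the Hardy space. This is multiplication by
`u_ξ^- = π^-(u_ξ)`, since the projection `π^-` onto the Hardy space is a homomorphism of
convolution algebras. -/
def hardyConv (ξ : LieAlg r T) : c.Hardy B →ₗ[ℂ] c.Hardy B :=
  (convLeft ξ).restrict fun u hu ν hν => by
    obtain ⟨a, ha⟩ := rightInvField_weight ξ ν
    change u (rightInvField ξ ν.fn) = 0
    rw [ha, map_smul, hu ν hν, smul_zero]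

/-- The action of an operator on `B` on the `B`-valued Hardy space. -/
def hardyPost (S : B →L[ℂ] B) : c.Hardy B →ₗ[ℂ] c.Hardy B :=
  (Dist.post S).restrict fun u hu ν hν => by
    change S (u ν.fn) = 0
    rw [hu ν hν, map_zero]

variable (B) in
/-- The operators of the Hardy-Weil algebra `Ŵ_T^- = E'(T)^- ⊗ Cl(𝔱)` (for `B = ℂ`), acting on
`Ŵ_T^- ⊗ B`: the contractions are `ad(x_ξ)`, the differential is `∑ u_k^- ι_k`, and
the Lie derivatives are zero since `T` is abelian. -/
def hardyWeilOps : DiffOps (LieAlg r T) (c.Hardy B ⊗[ℂ] Cliff (τ.res β.form)) where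
  parity := TensorProduct.map LinearMap.id (clParity _)
  d := ∑ k, TensorProduct.map (c.hardyConv (c.basisT k)) (oddAd _ (clx _ (c.basisT k)))
  contr ξ := TensorProduct.map LinearMap.id (oddAd _ (clx _ ξ))
  lie _ := 0

section Forms

variable [ContMDiffSMul (𝓡 n) (𝓡 m) ∞ G M]

variable (m M) in
/-- The `T`-differential space `Ŵ_T^- ⊗ Ω(M)`. The cohomology of its basic subcomplex is the
`T`-valued (Hardy) equivariant cohomology of `M`. -/
def hardyWeilFormOps :
    DiffOps (LieAlg r T) (c.Hardy (Ω m M) ⊗[ℂ] Cliff (τ.res β.form)) :=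
  (c.hardyWeilOps (Ω m M)).tensor (clParity _) c.hardyPost
    { formOps n m G M with
      contr := fun ξ => (formOps n m G M).contr (τ.lieIncl ξ)
      lie := fun ξ => (formOps n m G M).lie (τ.lieIncl ξ) }

end Forms

/-- The defining property of the map `r_G^T` (for `B = ℂ`) and of `r_G^T ⊗ 1` on `B`-valued
distributions: `⟨r(u), t^{χ+ρ}⟩ = ⟨u, Δ_χ⟩` for all dominant weights `χ`. -/
def IsDistRestriction (R : Dist n G B →ₗ[ℂ] c.Hardy B) : Prop :=
  ∀ (u : Dist n G B) (χ ν : Weight r T), c.Dominant χ → ν.lin = χ.lin + c.rho →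
    Hardy.incl c (R u) ν.fn = u (c.Delta χ)

/-- The map `R_G^T = r_G^T ⊗ (p_G^T ∘ exp(½ r_{ab} ι_a ι_b))` built from `R = r_G^T`. -/
def weilRestriction (R : Dist n G B →ₗ[ℂ] c.Hardy B) :
    Dist n G B ⊗[ℂ] Cliff β.form →ₗ[ℂ] c.Hardy B ⊗[ℂ] Cliff (τ.res β.form) :=
  TensorProduct.map R (c.clRes ∘ₗ c.twist)

end CartanWeyl

end LieGroups
end EqLoc

end

open scoped Manifold ContDiff TensorProduct
noncomputable section
namespace EqLoc

open Set Filter Topology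
set_option linter.unusedSectionVars false

/-! ### Hadamard's lemma -/

section Hadamard

/-! The restriction map is the transpose of one continuous operator `C^∞(T) → C^∞(G)`, which sends
`t^{λ+ρ}` to `Δ_λ` for dominant `λ` and every other character to zero (`exists_deltaOp`). Uniqueness
holds because Fourier series converge in `C^∞(T)` (`hasSum_fourier`), so a continuous map into a
Hausdorff space is determined by its values on characters. Existence is a balance of growth. Fourier
coefficients of a smooth function decay faster than any power. The Casimir operator acts on `V_λ` by
the scalar `-4π²(|λ+ρ|² - |ρ|²)`, so each unit basis vector of `𝔤` acts with norm at most `2π|λ+ρ|`,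
and the derivatives of `Δ_λ` grow only polynomially (`norm_iterDer_Delta_le`). Hence the series that
defines the operator converges in `C^∞(G)`. The transpose works for distributions with values in any
`B`, and `Ω(M)` is Hausdorff, so the same construction gives `r_M`.

The Weil differential is left minus graded right multiplication by the cubic Dirac element `D = u_a
x_a + γ`. One has `D² = ½ u_a u_a + γ²`. Left and right Casimir operators agree on a connected group
(`casimir_comm`) and `γ²` is central in the Clifford algebra, so the two halves have opposite
squares. They also anticommute, and therefore `d² = 0`. Cartan's formula reduces to the fact that
`x_ξ` anticommutes with `γ` to the spin element of `ξ`.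

For the chain map, write the sum over an orthonormal basis as a torus part plus pairs of root
vectors `e_α`, `ē_α`. Since `Δ_λ` is built from a highest weight vector, `r` kills `u_{ē_α} * u` and
`u * u_{e_α}`. The twisted Clifford projection `θ = p ∘ exp(½ r_{ab} ι_a ι_b)` kills `x_{ē_α} x` and
`x x_{e_α}`. Indeed, under the symbol map left and right Clifford multiplication by a vector are
exterior multiplication plus or minus half a contraction. Conjugation by the exponential removes
exactly this half contraction for the root vectors in question, and what remains is exterior
multiplication by a vector orthogonal to `𝔱`, which `p` annihilates. So all root terms disappear on
either side. In the torus part `r` turns `u_k` into `u_k - 2πi ρ_k` because of the shift by `ρ`,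
whereas `θ` turns `γ` into `Σ 2πi ρ_k x_k` (`theta_clGamma_mul`, `theta_mul_clGamma`). The two
shifts cancel, and left minus right is `Σ u_k ι_k`, the differential of the Hardy–Weil algebra.

The root decomposition rests on `𝔱` being its own centralizer in `𝔤` (`mem_range_lieIncl`), which
follows from maximality of `T` by way of one-parameter subgroups. Vector fields are derivations of
the function algebra throughout, so some calculus is developed first: locality of derivations,
invariant frames, and series in the `C^∞` topology. Operators on `Ω(M)` act by composition after a
distribution and hence commute with `r_M`; the statement on cohomology is then formal. -/

lemma contDiff_integral_segment {E : Type} [NormedAddCommGroup E] [NormedSpace ℝ E]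
    [FiniteDimensional ℝ E] (x₀ : E) (n : ℕ) :
    ∀ {F : Type} [NormedAddCommGroup F] [NormedSpace ℝ F] [CompleteSpace F] (k : ℕ) (G : E → F),
      ContDiff ℝ ∞ G → ContDiff ℝ n (fun x => ∫ t in (0 : ℝ)..1, t ^ k • G (x₀ + t • (x - x₀))) := by
  -- Differentiation under the integral raises the weight from `t ^ k` to `t ^ (k + 1)` and replaces
  -- `G` by its derivative. The family with arbitrary weight and arbitrary target is closed under
  -- differentiation, so the order of smoothness can be raised by induction.
  have hder : ∀ {F : Type} [NormedAddCommGroup F] [NormedSpace ℝ F] [CompleteSpace F] (k : ℕ)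
      (G : E → F), ContDiff ℝ ∞ G → ∀ x,
      HasFDerivAt (fun x => ∫ t in (0 : ℝ)..1, t ^ k • G (x₀ + t • (x - x₀)))
        (∫ t in (0 : ℝ)..1, t ^ (k + 1) • fderiv ℝ G (x₀ + t • (x - x₀))) x := by
    intro F _ _ _ k G hG x
    have hG' : Continuous (fderiv ℝ G) := hG.continuous_fderiv (by simp)
    have hc : Continuous fun p : ℝ × E => p.1 ^ (k + 1) • fderiv ℝ G (x₀ + p.1 • (p.2 - x₀)) := by
      fun_prop
    obtain ⟨C, hC⟩ := (((isCompact_Icc (a := (0 : ℝ)) (b := 1)).prod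
      (isCompact_closedBall x 1)).exists_bound_of_continuousOn hc.continuousOn)
    have hGc := hG.continuous
    refine (intervalIntegral.hasFDerivAt_integral_of_dominated_of_fderiv_le
      (μ := MeasureTheory.volume) (bound := fun _ => C)
      (F' := fun x t => t ^ (k + 1) • fderiv ℝ G (x₀ + t • (x - x₀)))
      (Metric.ball_mem_nhds x one_pos) ?_ ?_ ?_ ?_ ?_ ?_)
    · refine Eventually.of_forall fun y => Continuous.aestronglyMeasurable ?_
      fun_prop
    · refine Continuous.intervalIntegrable ?_ _ _
      fun_prop
    · have : SecondCountableTopologyEither ℝ (E →L[ℝ] F) := ⟨Or.inl inferInstance⟩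
      refine Continuous.aestronglyMeasurable (hc.comp (.prodMk_left x))
    · refine Eventually.of_forall fun t ht y hy => ?_
      rw [uIoc_of_le zero_le_one] at ht
      exact hC (t, y) ⟨⟨ht.1.le, ht.2⟩, Metric.ball_subset_closedBall hy⟩
    · exact intervalIntegrable_const
    · refine Eventually.of_forall fun t _ y _ => ?_
      have h1 : HasFDerivAt (fun y => x₀ + t • (y - x₀)) (t • ContinuousLinearMap.id ℝ E) y :=
        (((hasFDerivAt_id y).sub_const x₀).const_smul t).const_add x₀
      have h2 := (hG.differentiable (by simp) (x₀ + t • (y - x₀))).hasFDerivAt.comp y h1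
      have h3 := h2.const_smul (t ^ k)
      rw [ContinuousLinearMap.comp_smul, ContinuousLinearMap.comp_id, smul_smul, ← pow_succ] at h3
      exact h3
  induction n with
  | zero =>
    intro F _ _ _ k G hG
    rw [Nat.cast_zero, contDiff_zero]
    exact continuous_iff_continuousAt.2 fun x => (hder k G hG x).continuousAt
  | succ n ih =>
    intro F _ _ _ k G hG
    rw [Nat.cast_succ, contDiff_succ_iff_hasFDerivAt]
    exact ⟨_, ih (k + 1) (fderiv ℝ G) (hG.fderiv_right (by simp)), hder k G hG⟩

/-- Hadamard's lemma. -/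
lemma exists_hadamard {m : ℕ} (F : EuclideanSpace ℝ (Fin m) → ℂ) (hF : ContDiff ℝ ∞ F)
    (x₀ : EuclideanSpace ℝ (Fin m)) :
    ∃ H : Fin m → EuclideanSpace ℝ (Fin m) → ℂ, (∀ i, ContDiff ℝ ∞ (H i)) ∧
      (∀ i, H i x₀ = fderiv ℝ F x₀ (EuclideanSpace.single i 1)) ∧
      ∀ x, F x = F x₀ + ∑ i, ((x i - x₀ i : ℝ) : ℂ) * H i x := by
  -- `H i` averages the `i`-th partial derivative over the segment from `x₀` to `x`; the expansion
  -- is the fundamental theorem of calculus along this segment.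
  refine ⟨fun i x => ∫ t in (0 : ℝ)..1,
    t ^ 0 • fderiv ℝ F (x₀ + t • (x - x₀)) (EuclideanSpace.single i 1), fun i => ?_, fun i => ?_,
    fun x => ?_⟩
  · rw [contDiff_infty]
    intro n
    exact contDiff_integral_segment x₀ n 0 (fun y => fderiv ℝ F y (EuclideanSpace.single i 1))
      ((hF.fderiv_right (by simp)).clm_apply contDiff_const)
  · simp
  · have hF' : Continuous (fderiv ℝ F) := hF.continuous_fderiv (by simp)
    have h1 : ∫ t in (0 : ℝ)..1, fderiv ℝ F (x₀ + t • (x - x₀)) (x - x₀) = F x - F x₀ := by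
      have := intervalIntegral.integral_eq_sub_of_hasDerivAt (a := (0 : ℝ)) (b := 1)
        (f := fun t => F (x₀ + t • (x - x₀)))
        (f' := fun t => fderiv ℝ F (x₀ + t • (x - x₀)) (x - x₀)) (fun t _ => ?_) ?_
      · simpa using this
      · have h : HasDerivAt (fun t : ℝ => x₀ + t • (x - x₀)) (x - x₀) t := by
          simpa using ((hasDerivAt_id t).smul_const (x - x₀)).const_add x₀
        exact (hF.differentiable (by simp) _).hasFDerivAt.comp_hasDerivAt t h
      · exact Continuous.intervalIntegrable (by fun_prop) _ _
    have h2 : x - x₀ = ∑ i, (x i - x₀ i) • EuclideanSpace.single i (1 : ℝ) := by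
      ext j
      simp [Pi.single_apply]
    rw [← sub_eq_iff_eq_add', ← h1]
    have h3 : ∀ t : ℝ, fderiv ℝ F (x₀ + t • (x - x₀)) (x - x₀) = ∑ i, (x i - x₀ i) •
        fderiv ℝ F (x₀ + t • (x - x₀)) (EuclideanSpace.single i 1) := fun t => by
      conv_lhs => rw [h2, map_sum]
      refine Finset.sum_congr rfl fun i _ => ?_
      rw [map_smul, ← h2]
    simp only [h3, pow_zero, one_smul]
    rw [intervalIntegral.integral_finsetSum fun i _ =>
      Continuous.intervalIntegrable (by fun_prop) _ _]
    refine Finset.sum_congr rfl fun i _ => ?_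
    rw [intervalIntegral.integral_smul]
    simp

end Hadamard

/-! ### Derivations in local coordinates -/

section LocalCoordinates

variable {m : ℕ} {M : Type*} [TopologicalSpace M] [ChartedSpace (EuclideanSpace ℝ (Fin m)) M]

@[simp] lemma SmoothFn.one_apply (x : M) : (1 : SmoothFn (𝓡 m) M) x = 1 := rfl
@[simp] lemma SmoothFn.zero_apply (x : M) : (0 : SmoothFn (𝓡 m) M) x = 0 := rfl
@[simp] lemma SmoothFn.sub_apply (f g : SmoothFn (𝓡 m) M) (x : M) : (f - g) x = f x - g x := rfl

/-- Evaluation at a point. -/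
def SmoothFn.eval (x : M) : SmoothFn (𝓡 m) M →ₗ[ℂ] ℂ where
  toFun f := f x
  map_add' _ _ := rfl
  map_smul' _ _ := rfl

@[simp] lemma SmoothFn.sum_apply {ι : Type*} (s : Finset ι) (f : ι → SmoothFn (𝓡 m) M) (x : M) :
    (∑ i ∈ s, f i) x = ∑ i ∈ s, f i x := map_sum (SmoothFn.eval x) f s

variable [IsManifold (𝓡 m) ∞ M] [T2Space M]

variable (m) in
/-- A bump function at `x₀`. -/
def bumpAt (x₀ : M) : SmoothBumpFunction (𝓡 m) x₀ := Classical.arbitrary _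

/-- The product of a bump function at `x₀` with a function in the chart at `x₀`. -/
def chartExt (x₀ : M) (h : EuclideanSpace ℝ (Fin m) → ℂ) (hh : ContDiff ℝ ∞ h) :
    SmoothFn (𝓡 m) M :=
  SmoothFn.mk (fun x => (bumpAt m x₀) x • h (extChartAt (𝓡 m) x₀ x))
    (SmoothBumpFunction.contMDiff_smul _ (hh.contMDiff.comp_contMDiffOn contMDiffOn_extChartAt))

lemma chartExt_eventuallyEq (x₀ : M) (h : EuclideanSpace ℝ (Fin m) → ℂ) (hh : ContDiff ℝ ∞ h) :
    ∀ᶠ x in 𝓝 x₀, chartExt x₀ h hh x = h (extChartAt (𝓡 m) x₀ x) := by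
  filter_upwards [(bumpAt m x₀).eventuallyEq_one] with x hx
  simp [chartExt, hx]

/-- Locality of derivations: a bump function `ψ` supported where `f` vanishes gives `ψ f = 0`, and
the Leibniz rule at `x₀`, where `ψ = 1` and `f = 0`, leaves only `V f x₀`. -/
lemma der_eq_zero_of_eventuallyEq_zero (V : VField (𝓡 m) M) {f : SmoothFn (𝓡 m) M} {x₀ : M}
    (h : ∀ᶠ x in 𝓝 x₀, f x = 0) : V f x₀ = 0 := by
  obtain ⟨b, -, hb⟩ := (SmoothBumpFunction.nhds_basis_support (I := 𝓡 m) (c := x₀)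
    (Filter.univ_mem)).mem_iff.1 h
  let ψ : SmoothFn (𝓡 m) M := SmoothFn.mk (fun x => ((b x : ℝ) : ℂ))
    (Complex.ofRealCLM.contDiff.contMDiff.comp b.contMDiff)
  have h0 : ψ * f = 0 := by
    ext x
    by_cases hx : b x = 0
    · have hψ : ψ x = 0 := by
        change ((b x : ℝ) : ℂ) = 0
        rw [hx, Complex.ofReal_zero]
      rw [SmoothFn.mul_apply, hψ, zero_mul]; rfl
    · have : f x = 0 := hb hx
      simp [this]
  have h1 : V (ψ * f) x₀ = 0 := by rw [h0, map_zero]; rfl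
  have h2 : f x₀ = 0 := h.self_of_nhds
  have h3 : ψ x₀ = 1 := by
    change ((b x₀ : ℝ) : ℂ) = 1
    rw [b.eq_one, Complex.ofReal_one]
  rw [V.leibniz] at h1
  simpa [h2, h3] using h1

lemma der_congr (V : VField (𝓡 m) M) {f g : SmoothFn (𝓡 m) M} {x₀ : M}
    (h : ∀ᶠ x in 𝓝 x₀, f x = g x) : V f x₀ = V g x₀ := by
  have := der_eq_zero_of_eventuallyEq_zero V (f := f - g) (x₀ := x₀)
    (by filter_upwards [h] with x hx; simp [hx])
  rwa [map_sub, SmoothFn.sub_apply, sub_eq_zero] at this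

omit [T2Space M] in
lemma SmoothFn.contDiffOn_chart (f : SmoothFn (𝓡 m) M) (x₀ : M) :
    ContDiffOn ℝ ∞ (f ∘ (extChartAt (𝓡 m) x₀).symm) (extChartAt (𝓡 m) x₀).target :=
  (f.contMDiff.comp_contMDiffOn (contMDiffOn_extChartAt_symm x₀)).contDiffOn

/-- The `i`-th coordinate function at `x₀`, cut off by a bump function. -/
def coordFn (x₀ : M) (i : Fin m) : SmoothFn (𝓡 m) M :=
  chartExt x₀ (fun x => ((x i - extChartAt (𝓡 m) x₀ x₀ i : ℝ) : ℂ))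
    (Complex.ofRealCLM.contDiff.comp
      ((EuclideanSpace.proj (𝕜 := ℝ) i).contDiff.sub contDiff_const))

omit [T2Space M] in
/-- Near any point of the chart domain a smooth function agrees with the pull-back of a smooth
function on the model space. -/
lemma exists_chart_extension (f : SmoothFn (𝓡 m) M) (x₀ : M) :
    ∃ F : EuclideanSpace ℝ (Fin m) → ℂ, ContDiff ℝ ∞ F ∧
      (F =ᶠ[𝓝 (extChartAt (𝓡 m) x₀ x₀)] f ∘ (extChartAt (𝓡 m) x₀).symm) ∧
      ∀ᶠ x in 𝓝 x₀, f x = F (extChartAt (𝓡 m) x₀ x) := by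
  set φ := extChartAt (𝓡 m) x₀ with hφ
  have ht : φ.target ∈ 𝓝 (φ x₀) := extChartAt_target_mem_nhds x₀
  obtain ⟨R, hR, hRt⟩ := Metric.nhds_basis_closedBall.mem_iff.1 ht
  let b : ContDiffBump (φ x₀) := ⟨R / 2, R, by positivity, by linarith⟩
  have hF : ContDiff ℝ ∞ fun x => b x • (f ∘ φ.symm) x := by
    rw [contDiff_iff_contDiffAt]
    intro x
    by_cases hx : x ∈ φ.target
    · exact b.contDiff.contDiffAt.smul
        ((f.contDiffOn_chart x₀).contDiffAt ((isOpen_extChartAt_target x₀).mem_nhds hx))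
    · have hx' : x ∉ tsupport b := fun h => hx (hRt (by rwa [b.tsupport_eq] at h))
      refine (contDiffAt_const (c := (0 : ℂ))).congr_of_eventuallyEq ?_
      filter_upwards [(isClosed_tsupport b).isOpen_compl.mem_nhds hx'] with y hy
      simp [image_eq_zero_of_notMem_tsupport hy]
  refine ⟨_, hF, ?_, ?_⟩
  · filter_upwards [b.eventuallyEq_one] with x hx
    simp [hx]
  · filter_upwards [(continuousAt_extChartAt x₀).eventually b.eventuallyEq_one,
      extChartAt_source_mem_nhds (I := 𝓡 m) x₀] with x hx hx'
    rw [hx]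
    simp [φ.left_inv hx']

/-- A derivation is a combination of the coordinate derivations. -/
lemma der_eq_sum (V : VField (𝓡 m) M) (f : SmoothFn (𝓡 m) M) (x₀ : M) :
    V f x₀ = ∑ i, fderiv ℝ (f ∘ (extChartAt (𝓡 m) x₀).symm) (extChartAt (𝓡 m) x₀ x₀)
      (EuclideanSpace.single i 1) * V (coordFn x₀ i) x₀ := by
  obtain ⟨F, hF, hF1, hF2⟩ := exists_chart_extension f x₀
  -- Apply `V` to Hadamard's expansion: the constant is killed and the coordinate functions vanish
  -- at `x₀`, so only the values of `H i` at `x₀`, which are the partial derivatives, survive.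
  obtain ⟨H, hH, hH1, hH2⟩ := exists_hadamard F hF (extChartAt (𝓡 m) x₀ x₀)
  have h1 : V f x₀ = V (F (extChartAt (𝓡 m) x₀ x₀) • (1 : SmoothFn (𝓡 m) M) +
      ∑ i, coordFn x₀ i * chartExt x₀ (H i) (hH i)) x₀ := by
    refine der_congr V ?_
    have h3 : ∀ i, ∀ᶠ x in 𝓝 x₀, coordFn x₀ i x =
      ((extChartAt (𝓡 m) x₀ x i - extChartAt (𝓡 m) x₀ x₀ i : ℝ) : ℂ) := fun i =>
        chartExt_eventuallyEq _ _ _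
    have h4 := fun i => chartExt_eventuallyEq x₀ (H i) (hH i)
    filter_upwards [hF2, eventually_all.2 h3, eventually_all.2 h4] with x hx hx3 hx4
    rw [hx, hH2, SmoothFn.add_apply, SmoothFn.smul_apply, SmoothFn.one_apply, mul_one,
      SmoothFn.sum_apply]
    simp only [SmoothFn.mul_apply, hx3, hx4]
  have h5 : ∀ i, coordFn x₀ i x₀ = 0 := fun i => by
    refine (chartExt_eventuallyEq x₀ (fun x => ((x i - extChartAt (𝓡 m) x₀ x₀ i : ℝ) : ℂ))
      _).self_of_nhds.trans ?_
    rw [sub_self, Complex.ofReal_zero]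
  rw [h1, map_add, V.map_smul, V.map_one_eq_zero, smul_zero, zero_add, map_sum, SmoothFn.sum_apply]
  refine Finset.sum_congr rfl fun i _ => ?_
  rw [V.leibniz, SmoothFn.add_apply, smul_eq_mul, smul_eq_mul, SmoothFn.mul_apply,
    SmoothFn.mul_apply, h5, zero_mul, zero_add, (chartExt_eventuallyEq x₀ (H i) _).self_of_nhds,
    hH1, hF1.fderiv_eq]

variable (m) in
/-- The differential of a function at a point. -/
def dAt (f : M → ℂ) (x : M) : EuclideanSpace ℝ (Fin m) →L[ℝ] ℂ := mfderiv (𝓡 m) 𝓘(ℝ, ℂ) f x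

omit [IsManifold (𝓡 m) ∞ M] [T2Space M] in
lemma hasFDerivAt_chart {f : M → ℂ} {x : M} {L : EuclideanSpace ℝ (Fin m) →L[ℝ] ℂ}
    (hf : HasMFDerivAt (𝓡 m) 𝓘(ℝ, ℂ) f x L) :
    HasFDerivAt (f ∘ (extChartAt (𝓡 m) x).symm) L (extChartAt (𝓡 m) x x) :=
  hf.2.hasFDerivAt (by rw [ModelWithCorners.range_eq_univ]; exact univ_mem)

omit [IsManifold (𝓡 m) ∞ M] [T2Space M] in
lemma dAt_eq_fderiv {f : M → ℂ} {x : M} (hf : MDifferentiableAt (𝓡 m) 𝓘(ℝ, ℂ) f x) :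
    dAt m f x = fderiv ℝ (f ∘ (extChartAt (𝓡 m) x).symm) (extChartAt (𝓡 m) x x) :=
  (hasFDerivAt_chart (L := dAt m f x) hf.hasMFDerivAt).fderiv.symm

lemma der_eq_sum_dAt (V : VField (𝓡 m) M) (f : SmoothFn (𝓡 m) M) (x₀ : M) :
    V f x₀ = ∑ i, dAt m f x₀ (EuclideanSpace.single i 1) * V (coordFn x₀ i) x₀ := by
  rw [der_eq_sum, dAt_eq_fderiv (f.contMDiff.mdifferentiable (by simp) x₀)]

lemma der_eq_zero_of_dAt_eq_zero (V : VField (𝓡 m) M) (f : SmoothFn (𝓡 m) M) (x₀ : M)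
    (h : dAt m f x₀ = 0) : V f x₀ = 0 := by
  rw [der_eq_sum_dAt, h]
  simp only [zero_apply, zero_mul, Finset.sum_const_zero]

/-- Any linear form on the tangent space is the differential of a smooth function. -/
lemma exists_dAt_eq (x₀ : M) (L : EuclideanSpace ℝ (Fin m) →L[ℝ] ℂ) :
    ∃ f : SmoothFn (𝓡 m) M, dAt m f x₀ = L := by
  refine ⟨chartExt x₀ L L.contDiff, ?_⟩
  rw [dAt_eq_fderiv ((chartExt x₀ L L.contDiff).contMDiff.mdifferentiable (by simp) x₀)]
  refine (Filter.EventuallyEq.fderiv_eq (f := L) ?_).trans L.fderiv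
  have h1 := (continuousAt_extChartAt_symm (I := 𝓡 m) x₀).eventually
    (p := fun x => chartExt x₀ L L.contDiff x = L (extChartAt (𝓡 m) x₀ x)) (by
      rw [extChartAt_to_inv]; exact chartExt_eventuallyEq x₀ L L.contDiff)
  filter_upwards [h1, extChartAt_target_mem_nhds (I := 𝓡 m) x₀] with y hy hy'
  rw [Function.comp_apply, hy, (extChartAt (𝓡 m) x₀).right_inv hy']

/-- The coordinate vector field `∂_i` at `x₀`, cut off by a bump function. -/
def coordField (x₀ : M) (i : Fin m) : VField (𝓡 m) M :=
  have hd (f : SmoothFn (𝓡 m) M) {x : M} (hx : x ∈ (extChartAt (𝓡 m) x₀).source) :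
      DifferentiableAt ℝ (f ∘ (extChartAt (𝓡 m) x₀).symm) (extChartAt (𝓡 m) x₀ x) :=
    ((f.contDiffOn_chart x₀).contDiffAt ((isOpen_extChartAt_target x₀).mem_nhds
      ((extChartAt (𝓡 m) x₀).map_source hx))).differentiableAt (by simp)
  have h0 {x : M} (hx : x ∉ (extChartAt (𝓡 m) x₀).source) :
      (bumpAt m x₀) x = 0 := by
    by_contra h
    exact hx (by rw [extChartAt_source]; exact SmoothBumpFunction.support_subset_source _ h)
  Derivation.mk'
  { toFun f := SmoothFn.mk (fun x => (bumpAt m x₀) x •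
        fderiv ℝ (f ∘ (extChartAt (𝓡 m) x₀).symm) (extChartAt (𝓡 m) x₀ x)
          (EuclideanSpace.single i 1)) (by
      refine SmoothBumpFunction.contMDiff_smul _ ?_
      have h1 := ((f.contDiffOn_chart x₀).fderiv_of_isOpen (m := ∞)
        (isOpen_extChartAt_target x₀) (by simp)).clm_apply
          (contDiffOn_const (c := EuclideanSpace.single i (1 : ℝ)))
      refine h1.contMDiffOn.comp (contMDiffOn_extChartAt (x := x₀)) fun x hx => ?_
      exact (extChartAt (𝓡 m) x₀).map_source (by rwa [extChartAt_source]))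
    map_add' f g := by
      ext x
      by_cases hx : x ∈ (extChartAt (𝓡 m) x₀).source
      · have := fderiv_add (hd f hx) (hd g hx)
        change fderiv ℝ ((f + g : SmoothFn (𝓡 m) M) ∘ (extChartAt (𝓡 m) x₀).symm) _ = _ at this
        change bumpAt m x₀ x • fderiv ℝ ((f + g : SmoothFn (𝓡 m) M) ∘ _) _ _ =
          bumpAt m x₀ x • fderiv ℝ _ _ _ + bumpAt m x₀ x • fderiv ℝ _ _ _
        rw [this, add_apply, smul_add]
      · simp [h0 hx, SmoothFn.mk_apply]
    map_smul' c f := by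
      ext x
      by_cases hx : x ∈ (extChartAt (𝓡 m) x₀).source
      · have := fderiv_const_smul (hd f hx) c
        change fderiv ℝ ((c • f : SmoothFn (𝓡 m) M) ∘ (extChartAt (𝓡 m) x₀).symm) _ = _ at this
        change bumpAt m x₀ x • fderiv ℝ ((c • f : SmoothFn (𝓡 m) M) ∘ _) _ _ =
          c • bumpAt m x₀ x • fderiv ℝ _ _ _
        rw [this, smul_apply, smul_comm]
      · simp [h0 hx, SmoothFn.mk_apply] }
  (fun f g => by
    ext x
    by_cases hx : x ∈ (extChartAt (𝓡 m) x₀).source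
    · have := fderiv_mul (hd f hx) (hd g hx)
      change fderiv ℝ ((f * g : SmoothFn (𝓡 m) M) ∘ (extChartAt (𝓡 m) x₀).symm) _ = _ at this
      change bumpAt m x₀ x • fderiv ℝ ((f * g : SmoothFn (𝓡 m) M) ∘ _) _ _ =
        f x * bumpAt m x₀ x • fderiv ℝ _ _ _ + g x * bumpAt m x₀ x • fderiv ℝ _ _ _
      rw [this, add_apply, smul_apply, smul_apply]
      simp only [Function.comp_apply, (extChartAt (𝓡 m) x₀).left_inv hx, smul_add, smul_eq_mul,
        mul_smul_comm]
    · simp [h0 hx, SmoothFn.mk_apply])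

lemma coordField_eventuallyEq (x₀ : M) (i : Fin m) :
    ∀ᶠ x in 𝓝 x₀, ∀ f : SmoothFn (𝓡 m) M, coordField x₀ i f x =
      fderiv ℝ (f ∘ (extChartAt (𝓡 m) x₀).symm) (extChartAt (𝓡 m) x₀ x)
        (EuclideanSpace.single i 1) := by
  filter_upwards [(bumpAt m x₀).eventuallyEq_one] with x hx f
  change (bumpAt m x₀ x : ℝ) • (fderiv ℝ (f ∘ (extChartAt (𝓡 m) x₀).symm) (extChartAt (𝓡 m) x₀ x)
    (EuclideanSpace.single i 1) : ℂ) = _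
  rw [hx, Pi.one_apply, one_smul]

end LocalCoordinates

/-! ### Absolutely convergent series in the `C^∞` topology -/

section Completeness

variable {m : ℕ} {M : Type*} [TopologicalSpace M] [ChartedSpace (EuclideanSpace ℝ (Fin m)) M]

lemma tendsto_smoothFn_iff {α : Type*} {l : Filter α} {u : α → SmoothFn (𝓡 m) M}
    {F : SmoothFn (𝓡 m) M} :
    Tendsto u l (𝓝 F) ↔ ∀ w : List (VField (𝓡 m) M),
      Tendsto (fun a => toCont (𝓡 m) M (iterDer w (u a))) l
        (𝓝 (toCont (𝓡 m) M (iterDer w F))) := by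
  simp only [nhds_iInf, nhds_induced, tendsto_iInf, tendsto_comap_iff]
  rfl

lemma continuous_toCont_iterDer (w : List (VField (𝓡 m) M)) :
    Continuous fun f : SmoothFn (𝓡 m) M => toCont (𝓡 m) M (iterDer w f) :=
  continuous_iInf_dom (i := w) continuous_induced_dom

lemma continuous_smoothFn_eval (x : M) : Continuous fun f : SmoothFn (𝓡 m) M => f x :=
  (continuous_eval_const (F := C(M, ℂ)) x).comp (continuous_toCont_iterDer (m := m) (M := M) [])

instance : T2Space (SmoothFn (𝓡 m) M) where
  t2 f g h := by
    obtain ⟨x, hx⟩ : ∃ x, f x ≠ g x := by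
      by_contra! h'
      exact h (SmoothFn.ext h')
    exact separated_by_continuous (continuous_smoothFn_eval x) hx

@[simp] lemma iterDer_cons (V : VField (𝓡 m) M) (w : List (VField (𝓡 m) M))
    (f : SmoothFn (𝓡 m) M) : iterDer (V :: w) f = V (iterDer w f) := by
  simp [iterDer]

/-- The coordinate form `dx_i`. -/
def dzForm (i : Fin m) : EuclideanSpace ℝ (Fin m) →L[ℝ] ℂ :=
  Complex.ofRealCLM.comp (EuclideanSpace.proj (𝕜 := ℝ) i)

@[simp] lemma dzForm_apply (i : Fin m) (v : EuclideanSpace ℝ (Fin m)) : dzForm i v = (v i : ℂ) := rfl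

lemma sum_dzForm_single (c : Fin m → ℂ) (j : Fin m) :
    (∑ i, c i • dzForm i) (EuclideanSpace.single j 1) = c j := by
  simp only [sum_apply, smul_apply, dzForm_apply, PiLp.single_apply, smul_eq_mul]
  rw [Finset.sum_eq_single j (fun i _ h => by simp [h]) (by simp)]
  simp

lemma eq_sum_dzForm (L : EuclideanSpace ℝ (Fin m) →L[ℝ] ℂ) :
    L = ∑ i, L (EuclideanSpace.single i 1) • dzForm i := by
  ext v
  conv_lhs => rw [show v = ∑ i, v i • EuclideanSpace.single i (1 : ℝ) by
    ext j; simp [Pi.single_apply]]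
  rw [map_sum, sum_apply]
  refine Finset.sum_congr rfl fun i _ => ?_
  simp [mul_comm]

variable [IsManifold (𝓡 m) ∞ M] [T2Space M]

/-- A coordinate ball on which the cut-off coordinate fields are the coordinate fields. -/
lemma exists_coord_ball (x₀ : M) : ∃ R > 0,
    Metric.ball (extChartAt (𝓡 m) x₀ x₀) R ⊆ (extChartAt (𝓡 m) x₀).target ∧
    ∀ y ∈ Metric.ball (extChartAt (𝓡 m) x₀ x₀) R, ∀ f : SmoothFn (𝓡 m) M,
      HasFDerivAt (f ∘ (extChartAt (𝓡 m) x₀).symm)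
        (∑ i, coordField x₀ i f ((extChartAt (𝓡 m) x₀).symm y) •
          dzForm i) y := by
  have h1 : ∀ᶠ y in 𝓝 (extChartAt (𝓡 m) x₀ x₀), ∀ i, ∀ f : SmoothFn (𝓡 m) M,
      coordField x₀ i f ((extChartAt (𝓡 m) x₀).symm y) =
      fderiv ℝ (f ∘ (extChartAt (𝓡 m) x₀).symm)
        (extChartAt (𝓡 m) x₀ ((extChartAt (𝓡 m) x₀).symm y)) (EuclideanSpace.single i 1) := by
    refine (continuousAt_extChartAt_symm (I := 𝓡 m) x₀).eventually
      (p := fun x => ∀ i, ∀ f : SmoothFn (𝓡 m) M, coordField x₀ i f x =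
      fderiv ℝ (f ∘ (extChartAt (𝓡 m) x₀).symm)
        (extChartAt (𝓡 m) x₀ x) (EuclideanSpace.single i 1)) ?_
    rw [extChartAt_to_inv]
    exact eventually_all.2 fun i => coordField_eventuallyEq x₀ i
  obtain ⟨R, hR, hRt⟩ := Metric.nhds_basis_ball.mem_iff.1
    (h1.and (extChartAt_target_mem_nhds (I := 𝓡 m) x₀))
  refine ⟨R, hR, fun y hy => (hRt hy).2, fun y hy f => ?_⟩
  have hd : DifferentiableAt ℝ (f ∘ (extChartAt (𝓡 m) x₀).symm) y :=
    ((f.contDiffOn_chart x₀).contDiffAt ((isOpen_extChartAt_target x₀).mem_nhds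
      (hRt hy).2)).differentiableAt (by simp)
  refine hd.hasFDerivAt.congr_fderiv ?_
  have h2 := (hRt hy).1
  rw [(extChartAt (𝓡 m) x₀).right_inv (hRt hy).2] at h2
  simp only [h2]
  exact eq_sum_dzForm _

variable [CompactSpace M]

omit [IsManifold (𝓡 m) ∞ M] [T2Space M] in
lemma norm_apply_le_toCont (f : SmoothFn (𝓡 m) M) (x : M) : ‖f x‖ ≤ ‖toCont (𝓡 m) M f‖ :=
  ContinuousMap.norm_coe_le_norm (toCont (𝓡 m) M f) x

/-- Termwise differentiation on a coordinate ball. The partial derivatives of each term are the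
values of globally defined fields, so their sup norms on the compact manifold serve as the
dominating series. -/
lemma hasFDerivAt_tsum_chart {ι : Type*} (g : ι → SmoothFn (𝓡 m) M) (x₀ : M)
    (h0 : Summable fun n => ‖toCont (𝓡 m) M (g n)‖)
    (h1 : ∀ i, Summable fun n => ‖toCont (𝓡 m) M (coordField x₀ i (g n))‖) {R : ℝ}
    (hR : ∀ y ∈ Metric.ball (extChartAt (𝓡 m) x₀ x₀) R, ∀ f : SmoothFn (𝓡 m) M,
      HasFDerivAt (f ∘ (extChartAt (𝓡 m) x₀).symm)
        (∑ i, coordField x₀ i f ((extChartAt (𝓡 m) x₀).symm y) •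
          dzForm i) y)
    {y : EuclideanSpace ℝ (Fin m)} (hy : y ∈ Metric.ball (extChartAt (𝓡 m) x₀ x₀) R) :
    HasFDerivAt (fun y => ∑' n, g n ((extChartAt (𝓡 m) x₀).symm y))
      (∑ i, (∑' n, coordField x₀ i (g n) ((extChartAt (𝓡 m) x₀).symm y)) •
          dzForm i) y := by
  have hs : ∀ i, Summable fun n => coordField x₀ i (g n) ((extChartAt (𝓡 m) x₀).symm y) :=
    fun i => Summable.of_norm_bounded (h1 i) fun n => norm_apply_le_toCont _ _
  have h2 := hasFDerivAt_tsum_of_isPreconnected (𝕜 := ℝ)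
    (f := fun n => g n ∘ (extChartAt (𝓡 m) x₀).symm)
    (f' := fun n y => ∑ i, coordField x₀ i (g n) ((extChartAt (𝓡 m) x₀).symm y) •
          dzForm i)
    (u := fun n => ∑ i, ‖toCont (𝓡 m) M (coordField x₀ i (g n))‖ *
      ‖dzForm i‖)
    (x₀ := y) (x := y) (s := Metric.ball (extChartAt (𝓡 m) x₀ x₀) R)
    (summable_sum fun i _ => (h1 i).mul_right _) Metric.isOpen_ball
    (convex_ball _ _).isPreconnected (fun n y hy => hR y hy (g n)) (fun n y _ => ?_) hy
    (Summable.of_norm_bounded h0 fun n => norm_apply_le_toCont _ _) hy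
  · refine h2.congr_fderiv ?_
    rw [Summable.tsum_finsetSum fun i _ => (hs i).smul_const _]
    exact Finset.sum_congr rfl fun i _ => (hs i).tsum_smul_const _
  · refine (norm_sum_le _ _).trans (Finset.sum_le_sum fun i _ => ?_)
    rw [norm_smul]
    gcongr
    exact norm_apply_le_toCont _ _

/-- Absolutely convergent series converge in the `C^∞`-topology. -/
theorem exists_hasSum_smoothFn {ι : Type*} (f : ι → SmoothFn (𝓡 m) M)
    (hf : ∀ w : List (VField (𝓡 m) M), Summable fun n => ‖toCont (𝓡 m) M (iterDer w (f n))‖) :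
    ∃ F : SmoothFn (𝓡 m) M, HasSum f F := by
  have hsm : ContMDiff (𝓡 m) 𝓘(ℝ, ℂ) ∞ fun x => ∑' n, f n x := by
    intro x₀
    obtain ⟨R, hR, hRt, hRd⟩ := exists_coord_ball (m := m) x₀
    set φ := extChartAt (𝓡 m) x₀ with hφ
    -- All words `w` are treated at once, because the derivative of the series for `w` consists of
    -- the series for the words `coordField x₀ i :: w`.
    have key : ∀ k : ℕ, ∀ w : List (VField (𝓡 m) M), ContDiffOn ℝ k
        (fun y => ∑' n, iterDer w (f n) (φ.symm y)) (Metric.ball (φ x₀) R) := by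
      intro k
      induction k with
      | zero =>
        intro w
        rw [Nat.cast_zero, contDiffOn_zero]
        intro y hy
        exact (hasFDerivAt_tsum_chart (fun n => iterDer w (f n)) x₀ (hf w)
          (fun i => by simpa using hf (coordField x₀ i :: w)) hRd hy).continuousAt.continuousWithinAt
      | succ k ih =>
        intro w
        rw [Nat.cast_succ, contDiffOn_succ_iff_hasFDerivWithinAt_of_uniqueDiffOn
          Metric.isOpen_ball.uniqueDiffOn]
        refine ⟨by simp, _, ?_, fun y hy => (hasFDerivAt_tsum_chart (fun n => iterDer w (f n)) x₀
          (hf w) (fun i => by simpa using hf (coordField x₀ i :: w)) hRd hy).hasFDerivWithinAt⟩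
        refine ContDiffOn.sum fun i _ => ContDiffOn.smul
          (f := fun y => ∑' n, coordField x₀ i (iterDer w (f n)) (φ.symm y)) ?_ contDiffOn_const
        simpa using ih (coordField x₀ i :: w)
    have h1 : ContDiffAt ℝ ∞ (fun y => ∑' n, f n (φ.symm y)) (φ x₀) := by
      rw [contDiffAt_infty]
      intro k
      exact (key k []).contDiffAt (Metric.ball_mem_nhds _ hR)
    refine (h1.contMDiffAt.comp x₀ contMDiffAt_extChartAt).congr_of_eventuallyEq ?_
    filter_upwards [extChartAt_source_mem_nhds (I := 𝓡 m) x₀] with x hx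
    simp only [Function.comp_apply]
    rw [φ.left_inv hx]
  let F : SmoothFn (𝓡 m) M := SmoothFn.mk _ hsm
  have hF : ∀ w : List (VField (𝓡 m) M), ∀ x, iterDer w F x = ∑' n, iterDer w (f n) x := by
    intro w
    induction w with
    | nil => intro x; rfl
    | cons V w ih =>
      intro x₀
      obtain ⟨R, hR, hRt, hRd⟩ := exists_coord_ball (m := m) x₀
      have hmem := Metric.mem_ball_self (x := extChartAt (𝓡 m) x₀ x₀) hR
      have h1 : ∀ i, Summable fun n => ‖toCont (𝓡 m) M (coordField x₀ i (iterDer w (f n)))‖ :=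
        fun i => by simpa using hf (coordField x₀ i :: w)
      have h2 := hasFDerivAt_tsum_chart (fun n => iterDer w (f n)) x₀ (hf w) h1 hRd hmem
      have h3 : (fun y => ∑' n, iterDer w (f n) ((extChartAt (𝓡 m) x₀).symm y)) =
          iterDer w F ∘ (extChartAt (𝓡 m) x₀).symm := funext fun y => (ih _).symm
      rw [h3] at h2
      have hs : ∀ i, Summable fun n => coordField x₀ i (iterDer w (f n)) x₀ :=
        fun i => Summable.of_norm_bounded (h1 i) fun n => norm_apply_le_toCont _ _
      simp only [iterDer_cons]
      -- `V` is arbitrary, but at `x₀` it is a combination of the coordinate fields, with the same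
      -- coefficients for the sum and for each term. So it commutes with the sum as they do.
      rw [der_eq_sum, h2.fderiv]
      simp only [sum_dzForm_single, extChartAt_to_inv]
      have h5 : ∀ n, V (iterDer w (f n)) x₀ =
          ∑ i, coordField x₀ i (iterDer w (f n)) x₀ * V (coordFn x₀ i) x₀ := by
        intro n
        rw [der_eq_sum, (hRd _ hmem (iterDer w (f n))).fderiv]
        simp only [sum_dzForm_single, extChartAt_to_inv]
      simp only [h5]
      rw [Summable.tsum_finsetSum fun i _ => (hs i).mul_right _]
      simp only [tsum_mul_right]
  refine ⟨F, tendsto_smoothFn_iff.2 fun w => ?_⟩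
  have h1 : HasSum (fun n => toCont (𝓡 m) M (iterDer w (f n))) (toCont (𝓡 m) M (iterDer w F)) := by
    have h2 := (Summable.of_norm (hf w)).hasSum
    have h4 : toCont (𝓡 m) M (iterDer w F) = ∑' n, toCont (𝓡 m) M (iterDer w (f n)) :=
      ContinuousMap.ext fun x => (hF w x).trans
        (h2.mapL (ContinuousMap.evalCLM ℂ x : C(M, ℂ) →L[ℂ] ℂ)).tsum_eq
    rw [h4]
    exact h2
  simp only [map_sum]
  exact h1

end Completeness

/-! ### Mixed partial derivatives and the Lie bracket -/

section Partial

variable {n r m : ℕ}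
  {G : Type*} [TopologicalSpace G] [ChartedSpace (EuclideanSpace ℝ (Fin n)) G]
  {T : Type*} [TopologicalSpace T] [ChartedSpace (EuclideanSpace ℝ (Fin r)) T]

lemma hasMFDerivAt_dAt {f : G → ℂ} {g : G} (hf : MDifferentiableAt (𝓡 n) 𝓘(ℝ, ℂ) f g) :
    HasMFDerivAt (𝓡 n) 𝓘(ℝ, ℂ) f g (dAt n f g) := hf.hasMFDerivAt

lemma dAt_eq {f : G → ℂ} {g : G} {L : EuclideanSpace ℝ (Fin n) →L[ℝ] ℂ}
    (h : HasMFDerivAt (𝓡 n) 𝓘(ℝ, ℂ) f g L) : dAt n f g = L := h.mfderiv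

/-- The differential of a map between manifolds, as a map between the model spaces. -/
def dMap (φ : T → G) (t : T) : EuclideanSpace ℝ (Fin r) →L[ℝ] EuclideanSpace ℝ (Fin n) :=
  mfderiv (𝓡 r) (𝓡 n) φ t

lemma dAt_comp {f : G → ℂ} {φ : T → G} {t : T} (hf : MDifferentiableAt (𝓡 n) 𝓘(ℝ, ℂ) f (φ t))
    (hφ : MDifferentiableAt (𝓡 r) (𝓡 n) φ t) :
    dAt r (fun t => f (φ t)) t = (dAt n f (φ t)).comp (dMap φ t) :=
  dAt_eq (hf.hasMFDerivAt.comp t hφ.hasMFDerivAt)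

lemma mdifferentiableAt_left {F : G → T → ℂ}
    (hF : ContMDiff ((𝓡 n).prod (𝓡 r)) 𝓘(ℝ, ℂ) ∞ (fun p : G × T => F p.1 p.2)) (g : G) (t : T) :
    MDifferentiableAt (𝓡 n) 𝓘(ℝ, ℂ) (fun g => F g t) g :=
  (hF.comp (contMDiff_id.prodMk contMDiff_const)).mdifferentiable (by simp) g

lemma mdifferentiableAt_right {F : G → T → ℂ}
    (hF : ContMDiff ((𝓡 n).prod (𝓡 r)) 𝓘(ℝ, ℂ) ∞ (fun p : G × T => F p.1 p.2)) (g : G) (t : T) :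
    MDifferentiableAt (𝓡 r) 𝓘(ℝ, ℂ) (fun t => F g t) t :=
  (hF.comp (contMDiff_const.prodMk contMDiff_id)).mdifferentiable (by simp) t

variable [IsManifold (𝓡 n) ∞ G] [IsManifold (𝓡 r) ∞ T]

/-- Mixed partial derivatives commute. -/
lemma dAt_dAt_comm (F : G → T → ℂ)
    (hF : ContMDiff ((𝓡 n).prod (𝓡 r)) 𝓘(ℝ, ℂ) ∞ (fun p : G × T => F p.1 p.2)) (g₀ : G) (t₀ : T)
    (hg : ∀ η, ContMDiff (𝓡 n) 𝓘(ℝ, ℂ) ∞ fun g => dAt r (F g) t₀ η)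
    (ht : ∀ ξ, ContMDiff (𝓡 r) 𝓘(ℝ, ℂ) ∞ fun t => dAt n (fun g => F g t) g₀ ξ)
    (ξ : EuclideanSpace ℝ (Fin n)) (η : EuclideanSpace ℝ (Fin r)) :
    dAt n (fun g => dAt r (F g) t₀ η) g₀ ξ = dAt r (fun t => dAt n (fun g => F g t) g₀ ξ) t₀ η := by
  set φ := extChartAt (𝓡 n) g₀
  set ψ := extChartAt (𝓡 r) t₀
  -- In the product chart both iterated derivatives become the second derivative of `Fh`, evaluated
  -- on `(ξ, 0)` and `(0, η)` in the two orders; its symmetry finishes the proof.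
  let Fh : EuclideanSpace ℝ (Fin n) × EuclideanSpace ℝ (Fin r) → ℂ :=
    fun p => F (φ.symm p.1) (ψ.symm p.2)
  have hFh : ContDiffOn ℝ ∞ Fh (φ.target ×ˢ ψ.target) := by
    have h1 : ContMDiffOn 𝓘(ℝ, EuclideanSpace ℝ (Fin n) × EuclideanSpace ℝ (Fin r))
        ((𝓡 n).prod (𝓡 r)) ∞ (fun p : EuclideanSpace ℝ (Fin n) × EuclideanSpace ℝ (Fin r) =>
          (φ.symm p.1, ψ.symm p.2)) (φ.target ×ˢ ψ.target) :=
      ((contMDiffOn_extChartAt_symm g₀).comp contDiff_fst.contMDiff.contMDiffOn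
        (fun p hp => hp.1)).prodMk ((contMDiffOn_extChartAt_symm t₀).comp
          contDiff_snd.contMDiff.contMDiffOn (fun p hp => hp.2))
    exact (hF.comp_contMDiffOn h1).contDiffOn
  have hU : φ.target ×ˢ ψ.target ∈ 𝓝 (φ g₀, ψ t₀) :=
    prod_mem_nhds (extChartAt_target_mem_nhds g₀) (extChartAt_target_mem_nhds t₀)
  have hc : ContDiffAt ℝ ∞ Fh (φ g₀, ψ t₀) := hFh.contDiffAt hU
  have hd : ∀ᶠ p in 𝓝 (φ g₀, ψ t₀), DifferentiableAt ℝ Fh p := by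
    filter_upwards [((isOpen_extChartAt_target g₀).prod (isOpen_extChartAt_target t₀)).mem_nhds
      ⟨mem_extChartAt_target (I := 𝓡 n) g₀, mem_extChartAt_target (I := 𝓡 r) t₀⟩] with p hp
    exact (hFh.contDiffAt (((isOpen_extChartAt_target g₀).prod
      (isOpen_extChartAt_target t₀)).mem_nhds hp)).differentiableAt (by simp)
  have hdd : HasFDerivAt (fderiv ℝ Fh) (fderiv ℝ (fderiv ℝ Fh) (φ g₀, ψ t₀)) (φ g₀, ψ t₀) :=
    ((hc.fderiv_right (m := 1) (by norm_cast)).differentiableAt (by simp)).hasFDerivAt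
  have hsymm : IsSymmSndFDerivAt ℝ Fh (φ g₀, ψ t₀) :=
    hc.isSymmSndFDerivAt (by simp; exact ENat.LEInfty.out)
  have h1 : dAt n (fun g => dAt r (F g) t₀ η) g₀ ξ =
      fderiv ℝ (fderiv ℝ Fh) (φ g₀, ψ t₀) (ξ, 0) (0, η) := by
    rw [dAt_eq_fderiv ((hg η).mdifferentiable (by simp) g₀)]
    have e : (fun g => dAt r (F g) t₀ η) ∘ φ.symm =ᶠ[𝓝 (φ g₀)]
        fun x => fderiv ℝ Fh (x, ψ t₀) (0, η) := by
      filter_upwards [(Continuous.prodMk_left (ψ t₀)).continuousAt.eventually hd] with x hx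
      simp only [Function.comp_apply]
      rw [dAt_eq_fderiv (mdifferentiableAt_right hF (φ.symm x) t₀)]
      have h2 : HasFDerivAt (fun y : EuclideanSpace ℝ (Fin r) => (x, y))
        (ContinuousLinearMap.inr ℝ (EuclideanSpace ℝ (Fin n)) (EuclideanSpace ℝ (Fin r))) (ψ t₀) :=
        hasFDerivAt_prodMk_right x (ψ t₀)
      have h3 := (HasFDerivAt.comp (ψ t₀) hx.hasFDerivAt h2).fderiv
      exact congrArg (fun L : EuclideanSpace ℝ (Fin r) →L[ℝ] ℂ => L η) h3
    rw [e.fderiv_eq]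
    have h4 := (hdd.comp (φ g₀) (hasFDerivAt_prodMk_left (𝕜 := ℝ) (φ g₀) (ψ t₀))).clm_apply
      (hasFDerivAt_const ((0 : EuclideanSpace ℝ (Fin n)), η) (φ g₀))
    refine (congrArg (fun L : EuclideanSpace ℝ (Fin n) →L[ℝ] ℂ => L ξ) h4.fderiv).trans ?_
    simp
  have h1' : dAt r (fun t => dAt n (fun g => F g t) g₀ ξ) t₀ η =
      fderiv ℝ (fderiv ℝ Fh) (φ g₀, ψ t₀) (0, η) (ξ, 0) := by
    rw [dAt_eq_fderiv ((ht ξ).mdifferentiable (by simp) t₀)]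
    have e : (fun t => dAt n (fun g => F g t) g₀ ξ) ∘ ψ.symm =ᶠ[𝓝 (ψ t₀)]
        fun y => fderiv ℝ Fh (φ g₀, y) (ξ, 0) := by
      filter_upwards [(Continuous.prodMk_right (φ g₀)).continuousAt.eventually hd] with y hy
      simp only [Function.comp_apply]
      rw [dAt_eq_fderiv (mdifferentiableAt_left hF g₀ (ψ.symm y))]
      have h2 : HasFDerivAt (fun x : EuclideanSpace ℝ (Fin n) => (x, y))
        (ContinuousLinearMap.inl ℝ (EuclideanSpace ℝ (Fin n)) (EuclideanSpace ℝ (Fin r))) (φ g₀) :=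
        hasFDerivAt_prodMk_left (φ g₀) y
      have h3 := (HasFDerivAt.comp (φ g₀) hy.hasFDerivAt h2).fderiv
      exact congrArg (fun L : EuclideanSpace ℝ (Fin n) →L[ℝ] ℂ => L ξ) h3
    rw [e.fderiv_eq]
    have h4 := (hdd.comp (ψ t₀) (hasFDerivAt_prodMk_right (𝕜 := ℝ) (φ g₀) (ψ t₀))).clm_apply
      (hasFDerivAt_const (ξ, (0 : EuclideanSpace ℝ (Fin r))) (ψ t₀))
    refine (congrArg (fun L : EuclideanSpace ℝ (Fin r) →L[ℝ] ℂ => L η) h4.fderiv).trans ?_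
    simp
  rw [h1, h1']
  exact hsymm (ξ, 0) (0, η)

end Partial

section Bracket

open VectorField

variable {m : ℕ} {M : Type*} [TopologicalSpace M] [ChartedSpace (EuclideanSpace ℝ (Fin m)) M]
  [IsManifold (𝓡 m) ∞ M]

/-- The Lie bracket of vector fields acts on functions as the commutator. -/
lemma dAt_mlieBracket (V W : Π x : M, TangentSpace (𝓡 m) x) (x₀ : M)
    (hV : MDifferentiableAt (𝓡 m) ((𝓡 m).prod 𝓘(ℝ, EuclideanSpace ℝ (Fin m)))
      (fun x => (V x : TangentBundle (𝓡 m) M)) x₀)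
    (hW : MDifferentiableAt (𝓡 m) ((𝓡 m).prod 𝓘(ℝ, EuclideanSpace ℝ (Fin m)))
      (fun x => (W x : TangentBundle (𝓡 m) M)) x₀)
    (f fV fW : SmoothFn (𝓡 m) M) (hfV : ∀ x, fV x = dAt m f x (V x))
    (hfW : ∀ x, fW x = dAt m f x (W x)) :
    dAt m f x₀ (mlieBracket (𝓡 m) V W x₀) = dAt m fW x₀ (V x₀) - dAt m fV x₀ (W x₀) := by
  have : IsManifold (𝓡 m) 2 M := IsManifold.of_le (n := ∞) (by norm_cast)
  set φ := extChartAt (𝓡 m) x₀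
  let Vh : EuclideanSpace ℝ (Fin m) → EuclideanSpace ℝ (Fin m) :=
    mpullbackWithin 𝓘(ℝ, EuclideanSpace ℝ (Fin m)) (𝓡 m) φ.symm V (range (𝓡 m))
  let Wh : EuclideanSpace ℝ (Fin m) → EuclideanSpace ℝ (Fin m) :=
    mpullbackWithin 𝓘(ℝ, EuclideanSpace ℝ (Fin m)) (𝓡 m) φ.symm W (range (𝓡 m))
  let A : EuclideanSpace ℝ (Fin m) → EuclideanSpace ℝ (Fin m) →L[ℝ] EuclideanSpace ℝ (Fin m) :=
    fun y => mfderivWithin 𝓘(ℝ, EuclideanSpace ℝ (Fin m)) (𝓡 m) φ.symm (range (𝓡 m)) y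
  have hAinv : ∀ y ∈ φ.target, (A y).IsInvertible := fun y hy =>
    isInvertible_mfderivWithin_extChartAt_symm hy
  have hF : ∀ (u : SmoothFn (𝓡 m) M), ∀ y ∈ φ.target,
      HasFDerivAt (u ∘ φ.symm) ((dAt m u (φ.symm y)).comp (A y)) y := by
    intro u y hy
    have h1 : HasMFDerivAt 𝓘(ℝ, EuclideanSpace ℝ (Fin m)) (𝓡 m) φ.symm y (A y) := by
      have h2 := (mdifferentiableWithinAt_extChartAt_symm (I := 𝓡 m) (x := x₀) hy).hasMFDerivWithinAt
      exact h2.hasMFDerivAt (by rw [ModelWithCorners.range_eq_univ]; exact univ_mem)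
    have h3 := hasMFDerivAt_dAt (u.contMDiff.mdifferentiable (by simp) (φ.symm y))
    exact (h3.comp y h1).hasFDerivAt
  have happ : ∀ (u uV : SmoothFn (𝓡 m) M) (V : Π x : M, TangentSpace (𝓡 m) x),
      (∀ x, uV x = dAt m u x (V x)) → ∀ y ∈ φ.target,
      fderiv ℝ (u ∘ φ.symm) y ((A y).inverse (V (φ.symm y))) = uV (φ.symm y) := by
    intro u uV V huV y hy
    rw [(hF u y hy).fderiv, huV, ContinuousLinearMap.comp_apply]
    congr 1
    obtain ⟨e, he⟩ := hAinv y hy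
    rw [← he, ContinuousLinearMap.inverse_equiv]
    exact e.apply_symm_apply _
  have hy₀ : φ x₀ ∈ φ.target := mem_extChartAt_target x₀
  have hdiff : ∀ (V : Π x : M, TangentSpace (𝓡 m) x),
      MDifferentiableAt (𝓡 m) ((𝓡 m).prod 𝓘(ℝ, EuclideanSpace ℝ (Fin m)))
      (fun x => (V x : TangentBundle (𝓡 m) M)) x₀ →
      DifferentiableAt ℝ (fun y => (A y).inverse (V (φ.symm y)) :
        EuclideanSpace ℝ (Fin m) → EuclideanSpace ℝ (Fin m)) (φ x₀) := by
    intro V hV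
    have h1 := MDifferentiableWithinAt.differentiableWithinAt_mpullbackWithin_vectorField
      (s := univ) hV.mdifferentiableWithinAt
    rw [preimage_univ, univ_inter] at h1
    exact h1.differentiableAt (by rw [ModelWithCorners.range_eq_univ]; exact univ_mem)
  have hVd : DifferentiableAt ℝ Vh (φ x₀) := hdiff V hV
  have hWd : DifferentiableAt ℝ Wh (φ x₀) := hdiff W hW
  have hcd : ContDiffAt ℝ ∞ (f ∘ φ.symm) (φ x₀) :=
    (f.contDiffOn_chart x₀).contDiffAt (extChartAt_target_mem_nhds x₀)
  have hdd : HasFDerivAt (fderiv ℝ (f ∘ φ.symm)) (fderiv ℝ (fderiv ℝ (f ∘ φ.symm)) (φ x₀)) (φ x₀) :=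
    ((hcd.fderiv_right (m := 1) (by norm_cast)).differentiableAt (by simp)).hasFDerivAt
  have hsymm : IsSymmSndFDerivAt ℝ (f ∘ φ.symm) (φ x₀) := hcd.isSymmSndFDerivAt (by simp; exact ENat.LEInfty.out)
  -- The product rule for `y ↦ f'(y) (V y)`. The terms with the second derivative of `f` are
  -- symmetric and cancel in the commutator, and the remaining terms form the bracket of the fields
  -- in the chart.
  have hder : ∀ (Vh : EuclideanSpace ℝ (Fin m) → EuclideanSpace ℝ (Fin m)) (fV : SmoothFn (𝓡 m) M),
      DifferentiableAt ℝ Vh (φ x₀) → (∀ y ∈ φ.target, fderiv ℝ (f ∘ φ.symm) y (Vh y) =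
        fV (φ.symm y)) → ∀ v, fderiv ℝ (fV ∘ φ.symm) (φ x₀) v =
        fderiv ℝ (f ∘ φ.symm) (φ x₀) (fderiv ℝ Vh (φ x₀) v) +
          fderiv ℝ (fderiv ℝ (f ∘ φ.symm)) (φ x₀) v (Vh (φ x₀)) := by
    intro Vh fV hVd h v
    have e : (fV ∘ φ.symm) =ᶠ[𝓝 (φ x₀)] fun y => fderiv ℝ (f ∘ φ.symm) y (Vh y) := by
      filter_upwards [extChartAt_target_mem_nhds (I := 𝓡 m) x₀] with y hy
      exact (h y hy).symm
    rw [e.fderiv_eq, (hdd.clm_apply hVd.hasFDerivAt).fderiv]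
    simp
  have hbr : dAt m f x₀ (mlieBracket (𝓡 m) V W x₀) = fderiv ℝ (f ∘ φ.symm) (φ x₀)
      (fderiv ℝ Wh (φ x₀) (Vh (φ x₀)) - fderiv ℝ Vh (φ x₀) (Wh (φ x₀))) := by
    rw [(hF f _ hy₀).fderiv, ContinuousLinearMap.comp_apply, extChartAt_to_inv]
    congr 1
    let D : EuclideanSpace ℝ (Fin m) →L[ℝ] EuclideanSpace ℝ (Fin m) :=
      mfderiv (𝓡 m) 𝓘(ℝ, EuclideanSpace ℝ (Fin m)) φ x₀
    have h1 : D.inverse = A (φ x₀) :=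
      ContinuousLinearMap.inverse_eq
        (mfderiv_extChartAt_comp_mfderivWithin_extChartAt_symm' (mem_extChartAt_source x₀))
        (mfderivWithin_extChartAt_symm_comp_mfderiv_extChartAt' (mem_extChartAt_source x₀))
    rw [← h1]
    change D.inverse (lieBracketWithin ℝ Vh Wh (φ.symm ⁻¹' univ ∩ range (𝓡 m)) (φ x₀)) = _
    rw [preimage_univ, univ_inter, ModelWithCorners.range_eq_univ, lieBracketWithin_univ]
    rfl
  have hx₀ : ∀ u : SmoothFn (𝓡 m) M, dAt m u x₀ = fderiv ℝ (u ∘ φ.symm) (φ x₀) := fun u =>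
    dAt_eq_fderiv (u.contMDiff.mdifferentiable (by simp) x₀)
  have hval : ∀ (V : Π x : M, TangentSpace (𝓡 m) x) (u : SmoothFn (𝓡 m) M),
      dAt m u x₀ (V x₀) = fderiv ℝ (u ∘ φ.symm) (φ x₀) ((A (φ x₀)).inverse (V (φ.symm (φ x₀)))) := by
    intro V u
    rw [(hF u _ hy₀).fderiv, ContinuousLinearMap.comp_apply, extChartAt_to_inv]
    congr 1
    obtain ⟨e, he⟩ := hAinv _ hy₀
    rw [← he, ContinuousLinearMap.inverse_equiv]
    exact (e.apply_symm_apply _).symm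
  rw [hbr, map_sub, hval V fW, hval W fV]
  have e1 := hder Wh fW hWd (happ f fW W hfW) (Vh (φ x₀))
  have e2 := hder Vh fV hVd (happ f fV V hfV) (Wh (φ x₀))
  change _ = fderiv ℝ (fW ∘ φ.symm) (φ x₀) (Vh (φ x₀)) - fderiv ℝ (fV ∘ φ.symm) (φ x₀) (Wh (φ x₀))
  rw [e1, e2, hsymm.eq]
  ring

end Bracket

lemma der_sum_apply {A ι : Type*} [CommRing A] [Algebra ℂ A] (s : Finset ι)
    (V : ι → Derivation ℂ A A) (f : A) : (∑ b ∈ s, V b) f = ∑ b ∈ s, V b f := by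
  classical
  induction s using Finset.induction_on with
  | empty => simp
  | insert a s ha ih => rw [Finset.sum_insert ha, Finset.sum_insert ha, Derivation.add_apply, ih]

/-! ### Invariant vector fields on a Lie group -/

section LieGroupFields

variable {n : ℕ} {G : Type*} [TopologicalSpace G] [ChartedSpace (EuclideanSpace ℝ (Fin n)) G]
  [Group G] [LieGroup (𝓡 n) ∞ G]

lemma leftInvField_apply (ξ : LieAlg n G) (f : SmoothFn (𝓡 n) G) (g : G) :
    leftInvField ξ f g = dAt n (fun h => f (g * h)) 1 ξ := rfl

lemma rightInvField_apply (ξ : LieAlg n G) (f : SmoothFn (𝓡 n) G) (g : G) :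
    rightInvField ξ f g = dAt n (fun h => f (h * g)) 1 ξ := rfl

lemma contMDiff_mulLeft (g : G) : ContMDiff (𝓡 n) (𝓡 n) ∞ fun h : G => g * h :=
  contMDiff_mul_left

lemma contMDiff_mulRight (g : G) : ContMDiff (𝓡 n) (𝓡 n) ∞ fun h : G => h * g :=
  contMDiff_mul_right

/-- Left translation of functions. -/
def leftTrans (g : G) (f : SmoothFn (𝓡 n) G) : SmoothFn (𝓡 n) G :=
  SmoothFn.mk (fun h => f (g * h)) (f.contMDiff.comp (contMDiff_mulLeft g))

/-- Right translation of functions. -/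
def rightTrans (g : G) (f : SmoothFn (𝓡 n) G) : SmoothFn (𝓡 n) G :=
  SmoothFn.mk (fun h => f (h * g)) (f.contMDiff.comp (contMDiff_mulRight g))

@[simp] lemma leftTrans_apply (g : G) (f : SmoothFn (𝓡 n) G) (h : G) :
    leftTrans g f h = f (g * h) := rfl

lemma leftInvField_leftTrans (ξ : LieAlg n G) (f : SmoothFn (𝓡 n) G) (g : G) :
    leftInvField ξ (leftTrans g f) = leftTrans g (leftInvField ξ f) := by
  ext h
  simp only [leftInvField_apply, leftTrans_apply, mul_assoc]

lemma leftInvField_one (ξ : LieAlg n G) (f : SmoothFn (𝓡 n) G) :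
    leftInvField ξ f 1 = dAt n f 1 ξ := by
  simp only [leftInvField_apply, one_mul]

lemma rightInvField_one (ξ : LieAlg n G) (f : SmoothFn (𝓡 n) G) :
    rightInvField ξ f 1 = dAt n f 1 ξ := by
  simp only [rightInvField_apply, mul_one]

lemma SmoothFn.mdifferentiableAt (f : SmoothFn (𝓡 n) G) (g : G) :
    MDifferentiableAt (𝓡 n) 𝓘(ℝ, ℂ) f g := f.contMDiff.mdifferentiable (by simp) g

lemma leftInvField_eq_dAt (ξ : LieAlg n G) (f : SmoothFn (𝓡 n) G) (g : G) :
    leftInvField ξ f g = dAt n f g (mulInvariantVectorField ξ g) := by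
  have h1 := dAt_comp (f := f) (φ := fun h : G => g * h) (t := 1) (f.mdifferentiableAt _)
    ((contMDiff_mulLeft g).mdifferentiable (by simp) 1)
  rw [leftInvField_apply, h1, mul_one]
  rfl

lemma leftInvField_add (ξ η : LieAlg n G) :
    leftInvField (ξ + η) = leftInvField ξ + leftInvField η := by
  ext f g
  exact map_add (dAt n (leftTrans g f) 1) ξ η

lemma leftInvField_smul (c : ℝ) (ξ : LieAlg n G) :
    leftInvField (c • ξ) = (c : ℂ) • leftInvField ξ := by
  ext f g
  refine (map_smul (dAt n (leftTrans g f) 1) c ξ).trans ?_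
  exact Complex.real_smul

lemma rightInvField_add (ξ η : LieAlg n G) :
    rightInvField (ξ + η) = rightInvField ξ + rightInvField η := by
  ext f g
  exact map_add (dAt n (rightTrans g f) 1) ξ η

lemma rightInvField_smul (c : ℝ) (ξ : LieAlg n G) :
    rightInvField (c • ξ) = (c : ℂ) • rightInvField ξ := by
  ext f g
  refine (map_smul (dAt n (rightTrans g f) 1) c ξ).trans ?_
  exact Complex.real_smul

/-- The commutator of left invariant vector fields. -/
theorem leftInvField_lie (ξ η : LieAlg n G) :
    leftInvField ⁅ξ, η⁆ = ⁅leftInvField ξ, leftInvField η⁆ := by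
  have h1 : ∀ f : SmoothFn (𝓡 n) G, leftInvField ⁅ξ, η⁆ f 1 =
      leftInvField ξ (leftInvField η f) 1 - leftInvField η (leftInvField ξ f) 1 := by
    intro f
    rw [leftInvField_one, GroupLieAlgebra.bracket_def,
      dAt_mlieBracket _ _ _ (mdifferentiableAt_mulInvariantVectorField _)
        (mdifferentiableAt_mulInvariantVectorField _) f (leftInvField ξ f) (leftInvField η f)
        (leftInvField_eq_dAt ξ f) (leftInvField_eq_dAt η f), ← leftInvField_eq_dAt,
        ← leftInvField_eq_dAt]
  ext f g
  -- Left invariant fields commute with left translation, so the identity at `1` for the translated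
  -- function is the identity at `g` for `f`.
  have h2 := h1 (leftTrans g f)
  simp only [leftInvField_leftTrans, leftTrans_apply, mul_one] at h2
  rw [h2, Derivation.commutator_apply]
  rfl

/-- The differential at the diagonal is the sum of the partial differentials. -/
lemma dAt_diag (F : G → G → ℂ)
    (hF : ContMDiff ((𝓡 n).prod (𝓡 n)) 𝓘(ℝ, ℂ) ∞ (fun p : G × G => F p.1 p.2)) (g : G) :
    dAt n (fun h => F h h) g = dAt n (fun h => F h g) g + dAt n (fun h => F g h) g := by
  ext v
  have h1 := mfderiv_prod_eq_add_apply (p := (g, g)) (v := (v, v))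
    (f := fun p : G × G => F p.1 p.2) (I := 𝓡 n) (I' := 𝓡 n) (I'' := 𝓘(ℝ, ℂ))
    (hF.mdifferentiable (by simp) (g, g))
  refine Eq.trans ?_ h1
  have h0 : HasMFDerivAt (𝓡 n) ((𝓡 n).prod (𝓡 n)) (fun h : G => (h, h)) g _ :=
    (hasMFDerivAt_id g).prodMk (hasMFDerivAt_id g)
  have h2 := (HasMFDerivAt.comp (g := fun p : G × G => F p.1 p.2) (f := fun h : G => (h, h)) g
    (hF.mdifferentiable (by simp) (g, g)).hasMFDerivAt h0).mfderiv
  exact congrArg (fun L : EuclideanSpace ℝ (Fin n) →L[ℝ] ℂ => L v) h2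

/-- Composition with the inversion. -/
def invFn (f : SmoothFn (𝓡 n) G) : SmoothFn (𝓡 n) G :=
  SmoothFn.mk (fun g => f g⁻¹) (f.contMDiff.comp (contMDiff_inv (𝓡 n) ∞))

/-- Inversion exchanges left and right invariant fields up to sign: the function `h ↦ f (h h⁻¹ g)`
is constant, and its derivative is the sum of the two partial derivatives. -/
lemma rightInvField_eq_invFn (ξ : LieAlg n G) (f : SmoothFn (𝓡 n) G) :
    rightInvField ξ f = -invFn (leftInvField ξ (invFn f)) := by
  ext g
  change rightInvField ξ f g = -(leftInvField ξ (invFn f) g⁻¹)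
  rw [rightInvField_apply, leftInvField_apply]
  have h1 := dAt_diag (n := n) (fun h k : G => f (h * k⁻¹ * g))
    (f.contMDiff.comp (((contMDiff_mul (𝓡 n) ∞).comp
      (contMDiff_fst.prodMk ((contMDiff_inv (𝓡 n) ∞).comp contMDiff_snd))).mul contMDiff_const)) 1
  simp only [mul_inv_cancel, one_mul, inv_one, mul_one] at h1
  have h2 : dAt n (fun _ : G => f g) 1 = 0 := dAt_eq (hasMFDerivAt_const _ _)
  rw [h2] at h1
  have h3 : (0 : ℂ) = dAt n (fun h => f (h * g)) 1 ξ + dAt n (fun h => f (h⁻¹ * g)) 1 ξ :=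
    congrArg (fun L : EuclideanSpace ℝ (Fin n) →L[ℝ] ℂ => L ξ) h1
  have h4 : (fun h => invFn f (g⁻¹ * h)) = fun h => f (h⁻¹ * g) := by
    ext h
    change f _ = _
    simp
  rw [h4]
  exact eq_neg_of_add_eq_zero_left h3.symm

lemma invFn_invFn (f : SmoothFn (𝓡 n) G) : invFn (invFn f) = f := by
  ext g
  change f _ = _
  rw [inv_inv]

lemma invFn_neg (f : SmoothFn (𝓡 n) G) : invFn (-f) = -invFn f := rfl

/-- Conjugation with the inversion reduces this to left invariant fields. Each right invariant field
carries a sign: two of them cancel in the commutator and one remains on the bracket, which reverses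
it. -/
theorem rightInvField_lie (ξ η : LieAlg n G) :
    ⁅rightInvField ξ, rightInvField η⁆ = -rightInvField ⁅ξ, η⁆ := by
  ext1 f
  have h : ∀ (ξ : LieAlg n G) f, leftInvField ξ (-f) = -leftInvField ξ f := fun ξ f => map_neg _ f
  rw [Derivation.commutator_apply]
  simp only [rightInvField_eq_invFn, invFn_neg, invFn_invFn, h, Derivation.neg_apply,
    leftInvField_lie, Derivation.commutator_apply, neg_neg]
  ext g
  rfl

/-- Left and right translations commute: both sides are mixed partial derivatives of `(h, k) ↦ f (k
g h)`. -/
theorem leftInvField_rightInvField_comm (ξ η : LieAlg n G) (f : SmoothFn (𝓡 n) G) :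
    leftInvField ξ (rightInvField η f) = rightInvField η (leftInvField ξ f) := by
  ext g
  have hF : ContMDiff ((𝓡 n).prod (𝓡 n)) 𝓘(ℝ, ℂ) ∞ (fun p : G × G => f (p.2 * (g * p.1))) :=
    f.contMDiff.comp ((contMDiff_mul (𝓡 n) ∞).comp (contMDiff_snd.prodMk
      ((contMDiff_mulLeft g).comp contMDiff_fst)))
  have h1 := dAt_dAt_comm (fun h k : G => f (k * (g * h))) hF 1 1
    (fun η => (leftTrans g (rightInvField η f)).contMDiff)
    (fun ξ => by
      have := (rightTrans g (leftInvField ξ f)).contMDiff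
      convert this using 2 with k
      change _ = dAt n (fun h => f (k * g * h)) 1 ξ
      simp only [mul_assoc]) ξ η
  rw [leftInvField_apply, rightInvField_apply]
  refine h1.trans ?_
  congr 2
  ext k
  change _ = dAt n (fun h => f (k * g * h)) 1 ξ
  simp only [mul_assoc]

lemma dAt_eq_zero_of_leftInvField (e : Module.Basis (Fin n) ℝ (LieAlg n G)) (f : SmoothFn (𝓡 n) G)
    (g : G) (h : ∀ b, leftInvField (e b) f g = 0) : dAt n f g = 0 := by
  have h1 : dAt n (leftTrans g f) 1 = 0 := by
    refine ContinuousLinearMap.coe_injective (e.ext fun b => ?_)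
    exact h b
  have h2 : f = leftTrans g⁻¹ (leftTrans g f) := by
    ext k
    simp
  have h3 := dAt_comp (f := leftTrans g f) (φ := fun h : G => g⁻¹ * h) (t := g)
    ((leftTrans g f).mdifferentiableAt _) ((contMDiff_mulLeft g⁻¹).mdifferentiable (by simp) g)
  rw [inv_mul_cancel, h1, ContinuousLinearMap.zero_comp] at h3
  rw [h2]
  exact h3

variable [T2Space G] (e : Module.Basis (Fin n) ℝ (LieAlg n G))

/-- Functions with prescribed differentials at the identity. -/
lemma exists_dual_fn : ∃ y : Fin n → SmoothFn (𝓡 n) G, ∀ a b,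
    leftInvField (e b) (y a) 1 = if a = b then 1 else 0 := by
  have h : ∀ a, ∃ y : SmoothFn (𝓡 n) G, ∀ b, leftInvField (e b) y 1 = if a = b then 1 else 0 := by
    intro a
    let L : EuclideanSpace ℝ (Fin n) →L[ℝ] ℂ :=
      Complex.ofRealCLM.comp (LinearMap.toContinuousLinearMap (e.coord a))
    obtain ⟨y, hy⟩ := exists_dAt_eq (1 : G) L
    refine ⟨y, fun b => ?_⟩
    rw [leftInvField_one, hy]
    change ((e.coord a (e b) : ℝ) : ℂ) = _
    rw [Module.Basis.coord_apply, e.repr_self, Finsupp.single_apply]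
    by_cases hab : a = b
    · simp [hab]
    · simp [hab, Ne.symm hab]
  choose y hy using h
  exact ⟨y, hy⟩

/-- Subtracting from `f` the right multiples of the translated dual functions makes all left
invariant derivatives at `g` vanish. The difference then has zero differential at `g`, and a
derivation sees only the differential. -/
lemma der_leftInv_expand {y : Fin n → SmoothFn (𝓡 n) G}
    (hy : ∀ a b, leftInvField (e b) (y a) 1 = if a = b then 1 else 0) (V : VField (𝓡 n) G)
    (f : SmoothFn (𝓡 n) G) (g : G) :
    V f g = ∑ b, V (leftTrans g⁻¹ (y b)) g * leftInvField (e b) f g := by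
  have h1 : V (f - ∑ b, leftInvField (e b) f g • leftTrans g⁻¹ (y b)) g = 0 := by
    refine der_eq_zero_of_dAt_eq_zero V _ g (dAt_eq_zero_of_leftInvField e _ g fun b => ?_)
    simp only [map_sub, map_sum, Derivation.map_smul, leftInvField_leftTrans, SmoothFn.sub_apply,
      SmoothFn.sum_apply, SmoothFn.smul_apply, leftTrans_apply, inv_mul_cancel, hy]
    simp
  rw [map_sub, SmoothFn.sub_apply, sub_eq_zero] at h1
  rw [h1, map_sum, SmoothFn.sum_apply]
  refine Finset.sum_congr rfl fun b _ => ?_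
  rw [Derivation.map_smul, SmoothFn.smul_apply, mul_comm]

/-- Every vector field is a combination of left invariant ones with smooth coefficients. -/
theorem exists_eq_sum_leftInvField (V : VField (𝓡 n) G) :
    ∃ c : Fin n → SmoothFn (𝓡 n) G, V = ∑ b, c b • leftInvField (e b) := by
  obtain ⟨y, hy⟩ := exists_dual_fn e
  have hsm : ∀ b, ContMDiff (𝓡 n) 𝓘(ℝ, ℂ) ∞ fun g => V (leftTrans g⁻¹ (y b)) g := by
    intro b g₀
    -- The coefficient `V (leftTrans g⁻¹ (y b)) g` depends on `g` also through the function, so its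
    -- smoothness is not evident. With the translation frozen at `g₀` the coefficients solve a
    -- linear system with smooth matrix `A`, equal to the identity at `g₀`, and Cramer's rule gives
    -- smoothness near `g₀`.
    let A : Matrix (Fin n) (Fin n) (SmoothFn (𝓡 n) G) :=
      Matrix.of fun b a => leftInvField (e b) (leftTrans g₀⁻¹ (y a))
    let ev (g : G) : SmoothFn (𝓡 n) G →+* ℂ :=
      { toFun := fun f => f g, map_one' := rfl, map_mul' := fun _ _ => rfl, map_zero' := rfl,
        map_add' := fun _ _ => rfl }
    have h1 : ∀ g a, V (leftTrans g₀⁻¹ (y a)) g = ∑ b, V (leftTrans g⁻¹ (y b)) g * A b a g :=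
      fun g a => der_leftInv_expand e hy V _ g
    let N : SmoothFn (𝓡 n) G := ∑ a, V (leftTrans g₀⁻¹ (y a)) * A.adjugate a b
    have h2 : ∀ g, V (leftTrans g⁻¹ (y b)) g * A.det g = N g := by
      intro g
      have h3 : ∀ c, ∑ a, A c a g * A.adjugate a b g = if c = b then A.det g else 0 := by
        intro c
        have h4 := congrArg (fun f => ev g f) (congrFun₂ (A.mul_adjugate) c b)
        simp only [Matrix.mul_apply, map_sum, map_mul] at h4
        refine h4.trans ?_
        simp only [Matrix.smul_apply, Matrix.one_apply, smul_eq_mul, mul_ite, mul_one, mul_zero]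
        split_ifs <;> rfl
      rw [SmoothFn.sum_apply]
      simp only [SmoothFn.mul_apply, h1 g, Finset.sum_mul]
      rw [Finset.sum_comm]
      simp only [mul_assoc, ← Finset.mul_sum, h3]
      simp
    have h0 : A.det g₀ = 1 := by
      have h5 : (ev g₀).mapMatrix A = 1 := by
        ext b a
        change leftInvField (e b) (leftTrans g₀⁻¹ (y a)) g₀ = _
        rw [leftInvField_leftTrans, leftTrans_apply, inv_mul_cancel, hy, Matrix.one_apply]
        simp [eq_comm]
      have h6 := (ev g₀).map_det A
      rw [h5, Matrix.det_one] at h6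
      exact h6
    have h7 : ContMDiffAt (𝓡 n) 𝓘(ℝ, ℂ) ∞ (fun g => N g / A.det g) g₀ :=
by
      have h9 : ContMDiffAt (𝓡 n) 𝓘(ℝ, ℂ) ∞ (fun g => (A.det g)⁻¹) g₀ :=
        ContMDiffAt.comp (g := fun z : ℂ => z⁻¹) g₀
          (contDiffAt_inv ℝ (by rw [h0]; exact one_ne_zero)).contMDiffAt A.det.contMDiff.contMDiffAt
      exact contDiff_mul.contMDiff.contMDiffAt.comp g₀ (N.contMDiff.contMDiffAt.prodMk_space h9)
    refine h7.congr_of_eventuallyEq ?_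
    have h8 : ∀ᶠ g in 𝓝 g₀, A.det g ≠ 0 :=
      A.det.contMDiff.continuous.continuousAt.eventually_ne (by rw [h0]; exact one_ne_zero)
    filter_upwards [h8] with g hg
    rw [← h2, mul_div_cancel_right₀ _ hg]
  refine ⟨fun b => SmoothFn.mk _ (hsm b), ?_⟩
  ext f g
  rw [der_leftInv_expand e hy V f g, der_sum_apply, SmoothFn.sum_apply]
  rfl

lemma leftInvField_independent (c : Fin n → SmoothFn (𝓡 n) G)
    (h : ∑ b, c b • leftInvField (e b) = 0) : c = 0 := by
  obtain ⟨y, hy⟩ := exists_dual_fn e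
  ext1 a
  ext g
  have h1 := congrArg (fun f : SmoothFn (𝓡 n) G => f g)
    (congrArg (fun V : VField (𝓡 n) G => V (leftTrans g⁻¹ (y a))) h)
  simp only [der_sum_apply, SmoothFn.sum_apply, Derivation.smul_apply, smul_eq_mul,
    SmoothFn.mul_apply, leftInvField_leftTrans, leftTrans_apply, inv_mul_cancel, hy] at h1
  simpa using h1

end LieGroupFields

/-! ### Functions with vanishing differential -/

section LocallyConstant

variable {m : ℕ} {M : Type*} [TopologicalSpace M] [ChartedSpace (EuclideanSpace ℝ (Fin m)) M]
  [IsManifold (𝓡 m) ∞ M] [T2Space M]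

/-- A smooth function with vanishing differential on a connected manifold is constant. -/
theorem apply_eq_of_dAt_eq_zero [PreconnectedSpace M] (f : SmoothFn (𝓡 m) M)
    (h : ∀ x, dAt m f x = 0) (x y : M) : f x = f y := by
  have hl : IsLocallyConstant f := by
    rw [IsLocallyConstant.iff_eventually_eq]
    intro x₀
    obtain ⟨R, hR, hRt, hRd⟩ := exists_coord_ball (m := m) x₀
    set φ := extChartAt (𝓡 m) x₀ with hφ
    have h1 : ∀ z ∈ Metric.ball (φ x₀) R, HasFDerivAt (f ∘ φ.symm)
        (0 : EuclideanSpace ℝ (Fin m) →L[ℝ] ℂ) z := by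
      intro z hz
      have h2 := hRd z hz f
      have h3 : ∀ i, coordField x₀ i f (φ.symm z) = 0 := fun i =>
        der_eq_zero_of_dAt_eq_zero _ _ _ (h _)
      exact h2.congr_fderiv (Finset.sum_eq_zero fun i _ =>
        (congrArg (· • dzForm i) (h3 i)).trans (zero_smul ℂ (dzForm i)))
    have h4 : ∀ᶠ z in 𝓝 x₀, φ z ∈ Metric.ball (φ x₀) R ∧ z ∈ φ.source :=
      ((continuousAt_extChartAt (I := 𝓡 m) x₀).eventually (Metric.ball_mem_nhds _ hR)).and
        (extChartAt_source_mem_nhds (I := 𝓡 m) x₀)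
    filter_upwards [h4] with z hz
    have h5 := (convex_ball (φ x₀) R).is_const_of_fderivWithin_eq_zero (𝕜 := ℝ)
      (f := f ∘ φ.symm) (fun w hw => (h1 w hw).differentiableAt.differentiableWithinAt)
      (fun w hw => by
        rw [(h1 w hw).hasFDerivWithinAt.fderivWithin (Metric.isOpen_ball.uniqueDiffWithinAt hw)])
      hz.1 (Metric.mem_ball_self hR)
    simp only [Function.comp_apply] at h5
    rwa [φ.left_inv hz.2, φ.left_inv (mem_extChartAt_source x₀)] at h5
  exact hl.apply_eq_of_preconnectedSpace x y

end LocallyConstant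

/-! ### Left invariant frames and the Casimir operator -/

section

variable {n : ℕ} {G : Type*} [TopologicalSpace G] [ChartedSpace (EuclideanSpace ℝ (Fin n)) G]
  [Group G] [LieGroup (𝓡 n) ∞ G] [T2Space G]

lemma apply_eq_of_leftInvField_eq_zero [PreconnectedSpace G]
    (e : Module.Basis (Fin n) ℝ (LieAlg n G)) (f : SmoothFn (𝓡 n) G)
    (h : ∀ b, leftInvField (e b) f = 0) (x y : G) : f x = f y :=
  apply_eq_of_dAt_eq_zero f (fun g => dAt_eq_zero_of_leftInvField e f g fun b => by
    rw [h b]; rfl) x y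

lemma leftInvField_sum {ι : Type*} (s : Finset ι) (ξ : ι → LieAlg n G) :
    leftInvField (∑ i ∈ s, ξ i) = ∑ i ∈ s, leftInvField (ξ i) :=
  map_sum (AddMonoidHom.mk' (leftInvField (n := n) (G := G)) leftInvField_add) ξ s

/-- Any iterated derivative is a combination of iterated derivatives along left invariant fields. -/
theorem exists_iterDer_eq_sum (e : Module.Basis (Fin n) ℝ (LieAlg n G)) (w : List (VField (𝓡 n) G)) :
    ∃ c : List (Fin n) →₀ SmoothFn (𝓡 n) G, ∀ f, iterDer w f =
      ∑ v ∈ c.support, c v * iterDer (v.map fun b => leftInvField (e b)) f := by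
  let D (v : List (Fin n)) : SmoothFn (𝓡 n) G → SmoothFn (𝓡 n) G :=
    fun f => iterDer (v.map fun b => leftInvField (e b)) f
  -- The `C^∞(G)`-span of the left invariant iterated derivatives is stable under composition with
  -- any field, by the Leibniz rule and the expansion of the field in the left invariant frame.
  suffices h : (fun f => iterDer w f) ∈ Submodule.span (SmoothFn (𝓡 n) G) (Set.range D) by
    obtain ⟨c, hc⟩ := Finsupp.mem_span_range_iff_exists_finsupp.1 h
    refine ⟨c, fun f => ?_⟩
    rw [← congrFun hc f, Finsupp.sum, Finset.sum_apply]
    rfl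
  induction w with
  | nil => exact Submodule.subset_span ⟨[], rfl⟩
  | cons V w ih =>
    obtain ⟨k, hk⟩ := exists_eq_sum_leftInvField e V
    have h1 : ∀ u ∈ Submodule.span (SmoothFn (𝓡 n) G) (Set.range D),
        (fun f => V (u f)) ∈ Submodule.span (SmoothFn (𝓡 n) G) (Set.range D) := by
      intro u hu
      induction hu using Submodule.span_induction with
      | mem u hu =>
        obtain ⟨v, rfl⟩ := hu
        have h2 : (fun f => V (D v f)) = ∑ b, k b • D (b :: v) := by
          ext1 f
          rw [hk, der_sum_apply, Finset.sum_apply]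
          rfl
        rw [h2]
        exact Submodule.sum_mem _ fun b _ =>
          Submodule.smul_mem _ _ (Submodule.subset_span ⟨_, rfl⟩)
      | zero =>
        convert Submodule.zero_mem _ using 1
        ext1 f
        exact map_zero V
      | add u u' _ _ h h' =>
        convert Submodule.add_mem _ h h' using 1
        ext1 f
        exact map_add V _ _
      | smul a u hu' h =>
        convert Submodule.add_mem _ (Submodule.smul_mem _ a h) (Submodule.smul_mem _ (V a) hu')
          using 1
        ext1 f
        change V (a * u f) = a * V (u f) + V a * u f
        rw [Derivation.leibniz, smul_eq_mul, smul_eq_mul, mul_comm (V a)]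
    exact h1 _ ih

lemma norm_toCont_mul_le [CompactSpace G] (f g : SmoothFn (𝓡 n) G) :
    ‖toCont (𝓡 n) G (f * g)‖ ≤ ‖toCont (𝓡 n) G f‖ * ‖toCont (𝓡 n) G g‖ :=
  norm_mul_le (toCont (𝓡 n) G f) (toCont (𝓡 n) G g)

/-- Absolute convergence in `C^∞(G)` can be tested on left invariant derivatives. -/
theorem summable_iterDer_of_leftInvField [CompactSpace G] {ι : Type*}
    (e : Module.Basis (Fin n) ℝ (LieAlg n G)) (f : ι → SmoothFn (𝓡 n) G)
    (h : ∀ v : List (Fin n), Summable fun i =>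
      ‖toCont (𝓡 n) G (iterDer (v.map fun b => leftInvField (e b)) (f i))‖)
    (w : List (VField (𝓡 n) G)) : Summable fun i => ‖toCont (𝓡 n) G (iterDer w (f i))‖ := by
  obtain ⟨c, hc⟩ := exists_iterDer_eq_sum e w
  refine Summable.of_nonneg_of_le (fun _ => norm_nonneg _) (fun i => ?_)
    (summable_sum fun v (_ : v ∈ c.support) => (h v).mul_left ‖toCont (𝓡 n) G (c v)‖)
  rw [hc, map_sum]
  exact (norm_sum_le _ _).trans (Finset.sum_le_sum fun v _ => norm_toCont_mul_le _ _)

namespace InvariantInner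

variable (β : InvariantInner n G) (e : Module.Basis (Fin n) ℝ (LieAlg n G))
  (he : ∀ a b, β.form (e a) (e b) = if a = b then 1 else 0)

include he in
lemma sum_form_smul (ξ : LieAlg n G) : ∑ b, β.form ξ (e b) • e b = ξ := by
  have h : ∀ b, β.form ξ (e b) = e.repr ξ b := by
    intro b
    conv_lhs => rw [← e.sum_repr ξ]
    rw [map_sum, LinearMap.sum_apply, Finset.sum_eq_single b]
    · rw [map_smul, LinearMap.smul_apply, he, if_pos rfl, smul_eq_mul, mul_one]
    · intro a _ hab
      rw [map_smul, LinearMap.smul_apply, he, if_neg hab, smul_zero]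
    · simp
  simp only [h]
  exact e.sum_repr ξ

/-- The structure constants `f_{abc}`. -/
def str (a b c : Fin n) : ℝ := β.form ⁅e a, e b⁆ (e c)

lemma str_swap (a b c : Fin n) : β.str e b a c = -β.str e a b c := by
  unfold str
  rw [← lie_skew, map_neg, LinearMap.neg_apply]

lemma str_cycle (a b c : Fin n) : β.str e b c a = β.str e a b c := by
  unfold str
  rw [β.symm, ← β.invariant]

lemma str_swap_right (a b c : Fin n) : β.str e a c b = -β.str e a b c := by
  rw [← β.str_cycle e a c b, ← β.str_cycle e c b a, β.str_swap]

lemma str_self_left (a c : Fin n) : β.str e a a c = 0 := by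
  unfold str
  rw [lie_self, map_zero, LinearMap.zero_apply]

include he in
/-- The adjoint representation: right invariant fields in terms of left invariant ones. -/
lemma exists_adCoord (η : LieAlg n G) : ∃ m : Fin n → SmoothFn (𝓡 n) G,
    (∀ f, rightInvField η f = ∑ b, m b * leftInvField (e b) f) ∧
    (∀ ξ d, leftInvField ξ (m d) = ∑ b, (β.form ⁅ξ, e d⁆ (e b) : ℂ) • m b) ∧
    ∀ b, m b 1 = β.form η (e b) := by
  obtain ⟨m, hm⟩ := exists_eq_sum_leftInvField e (rightInvField η)
  have hm' : ∀ f, rightInvField η f = ∑ b, m b * leftInvField (e b) f := fun f => by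
    rw [hm, der_sum_apply]; rfl
  have hsum : ∀ (ξ : LieAlg n G) f,
      leftInvField ξ f = ∑ b, (β.form ξ (e b) : ℂ) • leftInvField (e b) f := by
    intro ξ f
    conv_lhs => rw [← β.sum_form_smul e he ξ, leftInvField_sum, der_sum_apply]
    simp only [leftInvField_smul, Derivation.smul_apply]
  have hL : ∀ ξ b (f : SmoothFn (𝓡 n) G), leftInvField ξ (leftInvField (e b) f) =
      leftInvField (e b) (leftInvField ξ f) +
        ∑ c, (β.form ⁅ξ, e b⁆ (e c) : ℂ) • leftInvField (e c) f := by
    intro ξ b f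
    rw [← hsum, leftInvField_lie, Derivation.commutator_apply]
    abel
  refine ⟨m, hm', fun ξ d => ?_, fun b => ?_⟩
  -- Expand both sides of the commutation of left and right invariant fields in the left invariant
  -- frame. Independence of the frame over `C^∞(G)` then gives the differential equation for the
  -- coefficients.
  · have h1 : ∑ d, (leftInvField ξ (m d) - ∑ b, (β.form ⁅ξ, e d⁆ (e b) : ℂ) • m b) •
        leftInvField (e d) = 0 := by
      ext1 f
      have h2 := leftInvField_rightInvField_comm ξ η f
      have h3 : ∀ b, leftInvField ξ (m b * leftInvField (e b) f) =
          m b * leftInvField (e b) (leftInvField ξ f) +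
          (∑ d, (β.form ⁅ξ, e b⁆ (e d) : ℂ) • (m b * leftInvField (e d) f) +
          leftInvField (e b) f * leftInvField ξ (m b)) := by
        intro b
        rw [Derivation.leibniz, smul_eq_mul, smul_eq_mul, hL, mul_add, Finset.mul_sum, add_assoc]
        simp only [mul_smul_comm]
      rw [hm', hm', map_sum, Finset.sum_congr rfl fun b _ => h3 b, Finset.sum_add_distrib,
        add_eq_left, Finset.sum_add_distrib] at h2
      rw [der_sum_apply, Derivation.zero_apply, ← h2, Finset.sum_comm, ← Finset.sum_add_distrib]
      refine Finset.sum_congr rfl fun d _ => ?_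
      rw [Derivation.smul_apply, smul_eq_mul, sub_mul, Finset.sum_mul, mul_comm, sub_eq_add_neg,
        add_comm, ← Finset.sum_neg_distrib]
      congr 1
      refine Finset.sum_congr rfl fun b _ => ?_
      have h4 : β.form ⁅ξ, e b⁆ (e d) = -β.form ⁅ξ, e d⁆ (e b) := by
        rw [← lie_skew, map_neg, LinearMap.neg_apply, β.invariant, β.symm]
      rw [h4, smul_mul_assoc, Complex.ofReal_neg, neg_smul]
    have h2 := congrFun (leftInvField_independent e _ h1) d
    simpa [sub_eq_zero] using h2
  · obtain ⟨y, hy⟩ := exists_dual_fn e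
    have h3 := congrArg (fun f : SmoothFn (𝓡 n) G => f 1) (hm' (y b))
    simp only [SmoothFn.sum_apply, SmoothFn.mul_apply, hy] at h3
    rw [rightInvField_one, ← leftInvField_one, hsum] at h3
    simp only [SmoothFn.sum_apply, SmoothFn.smul_apply, hy] at h3
    simpa [eq_comm] using h3

include he in
/-- The left and the right Casimir operators agree. -/
theorem casimir_comm [PreconnectedSpace G] (f : SmoothFn (𝓡 n) G) :
    ∑ a, rightInvField (e a) (rightInvField (e a) f) =
      ∑ a, leftInvField (e a) (leftInvField (e a) f) := by
  choose m hm' hd h2 using fun a => β.exists_adCoord e he (e a)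
  replace h2 : ∀ a b, m a b 1 = if a = b then 1 else 0 := fun a b => by
    rw [h2, he]; split_ifs <;> simp
  replace hd : ∀ a c d, leftInvField (e c) (m a d) = ∑ b, (β.str e c d b : ℂ) • m a b :=
    fun a c d => hd a (e c) d
  -- The coefficient matrix is orthogonal: by skew symmetry of the structure constants the inner
  -- products of its rows have zero left invariant derivatives, so they are constant on the
  -- connected group and can be read off at `1`.
  have hc : ∀ a a', ∑ d, m a d * m a' d = if a = a' then 1 else 0 := by
    intro a a'
    have h1 : ∀ c, leftInvField (e c) (∑ d, m a d * m a' d) = 0 := by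
      intro c
      simp only [map_sum, Derivation.leibniz, hd, smul_eq_mul, Finset.mul_sum,
        Finset.sum_add_distrib]
      rw [Finset.sum_comm, ← Finset.sum_add_distrib]
      refine Finset.sum_eq_zero fun b _ => ?_
      rw [← Finset.sum_add_distrib]
      refine Finset.sum_eq_zero fun d _ => ?_
      rw [β.str_swap_right e c b d]
      rw [Complex.ofReal_neg, neg_smul, mul_neg, mul_smul_comm, mul_smul_comm, mul_comm (m a' b),
        neg_add_cancel]
    ext g
    rw [apply_eq_of_leftInvField_eq_zero e _ h1 g 1]
    simp only [SmoothFn.sum_apply, SmoothFn.mul_apply, h2]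
    split_ifs with h <;> simp [h]
  have hc' : ∀ b b', ∑ a, m a b * m a b' = if b = b' then 1 else 0 := by
    let A : Matrix (Fin n) (Fin n) (SmoothFn (𝓡 n) G) := Matrix.of m
    have h1 : A * A.transpose = 1 := by
      ext1 a a'
      simp [Matrix.mul_apply, A, hc, Matrix.one_apply]
    have h2 := mul_eq_one_comm.1 h1
    intro b b'
    have h3 := congrFun₂ h2 b b'
    simpa [Matrix.mul_apply, A, Matrix.one_apply] using h3
  have h4 : ∀ a, rightInvField (e a) (rightInvField (e a) f) =
      ∑ b, ∑ c, (m a b * m a c * leftInvField (e b) (leftInvField (e c) f) +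
        ∑ d, (β.str e b c d : ℂ) • (m a b * m a d * leftInvField (e c) f)) := by
    intro a
    rw [hm']
    refine Finset.sum_congr rfl fun b _ => ?_
    rw [hm', map_sum, Finset.mul_sum]
    refine Finset.sum_congr rfl fun c _ => ?_
    rw [Derivation.leibniz, smul_eq_mul, smul_eq_mul, hd, mul_add, Finset.mul_sum, Finset.mul_sum,
      mul_assoc]
    congr 1
    refine Finset.sum_congr rfl fun d _ => ?_
    rw [mul_smul_comm, mul_smul_comm]
    congr 1
    ring
  rw [Finset.sum_congr rfl fun a _ => h4 a, Finset.sum_comm]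
  refine Finset.sum_congr rfl fun b _ => ?_
  rw [Finset.sum_comm]
  simp only [Finset.sum_add_distrib, ← Finset.sum_mul, hc', ite_mul, one_mul, zero_mul,
    Finset.sum_ite_eq, Finset.mem_univ, if_true]
  rw [add_eq_left]
  -- The first order terms: orthogonality of the columns sets two indices of the structure constant
  -- equal, and such constants vanish.
  refine Finset.sum_eq_zero fun c _ => ?_
  rw [Finset.sum_comm]
  simp only [← Finset.smul_sum, ← Finset.sum_mul, hc', ite_mul, one_mul, zero_mul, smul_ite,
    smul_zero, Finset.sum_ite_eq, Finset.mem_univ, if_true]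
  rw [β.str_swap_right, β.str_self_left, neg_zero, Complex.ofReal_zero, zero_smul]

end InvariantInner

end

/-! ### One-parameter subgroups -/

section MapsFromVectorSpaces

variable {m : ℕ} {M : Type*} [TopologicalSpace M] [ChartedSpace (EuclideanSpace ℝ (Fin m)) M]
  [IsManifold (𝓡 m) ∞ M] [T2Space M] {X : Type*} [NormedAddCommGroup X] [NormedSpace ℝ X]

lemma chart_eq_coordFn (x₀ : M) : ∀ᶠ x in 𝓝 x₀, ∀ i, (extChartAt (𝓡 m) x₀ x i : ℂ) =
    coordFn x₀ i x + extChartAt (𝓡 m) x₀ x₀ i := by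
  rw [eventually_all]
  intro i
  have h := chartExt_eventuallyEq x₀ (fun x => ((x i - extChartAt (𝓡 m) x₀ x₀ i : ℝ) : ℂ))
    (Complex.ofRealCLM.contDiff.comp
      ((EuclideanSpace.proj (𝕜 := ℝ) i).contDiff.sub contDiff_const))
  filter_upwards [h] with x hx
  unfold coordFn
  rw [hx]
  push_cast
  ring

/-- A continuous map is smooth if its compositions with smooth functions are smooth. -/
theorem contMDiff_of_comp {F : X → M} (hF : Continuous F)
    (h : ∀ f : SmoothFn (𝓡 m) M, ContDiff ℝ ∞ fun x => f (F x)) :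
    ContMDiff 𝓘(ℝ, X) (𝓡 m) ∞ F := by
  intro x₀
  rw [contMDiffAt_iff_target]
  refine ⟨hF.continuousAt, ContDiffAt.contMDiffAt ?_⟩
  rw [contDiffAt_euclidean]
  intro i
  have h1 : ContDiffAt ℝ ∞ (fun x => (coordFn (F x₀) i (F x) + extChartAt (𝓡 m) (F x₀) (F x₀) i).re)
      x₀ := Complex.reCLM.contDiff.contDiffAt.comp x₀ ((h _).add contDiff_const).contDiffAt
  refine h1.congr_of_eventuallyEq ?_
  filter_upwards [hF.continuousAt.eventually (chart_eq_coordFn (m := m) (F x₀))] with x hx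
  rw [← hx i]
  rfl

end MapsFromVectorSpaces

section OneParam

variable {n : ℕ} {G : Type*} [TopologicalSpace G] [ChartedSpace (EuclideanSpace ℝ (Fin n)) G]
  [Group G] [LieGroup (𝓡 n) ∞ G] [T2Space G]

lemma mfderiv_mulLeft_mulInvariantVectorField (ξ : LieAlg n G) (g h : G) :
    mfderiv (𝓡 n) (𝓡 n) (fun k : G => g * k) h (mulInvariantVectorField ξ h) =
      mulInvariantVectorField ξ (g * h) := by
  have h1 : (fun k : G => g * h * k) = (fun k => g * k) ∘ (fun k => h * k) := by
    ext k
    simp [mul_assoc]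
  have h2 := mfderiv_comp (I := 𝓡 n) (I' := 𝓡 n) (I'' := 𝓡 n) (1 : G)
    (g := fun k : G => g * k) (f := fun k : G => h * k)
    ((contMDiff_mulLeft g).mdifferentiable (by simp) _)
    ((contMDiff_mulLeft h).mdifferentiable (by simp) _)
  rw [← h1] at h2
  have h3 := congrArg (fun L : EuclideanSpace ℝ (Fin n) →L[ℝ] EuclideanSpace ℝ (Fin n) => L ξ) h2
  unfold mulInvariantVectorField
  refine Eq.trans ?_ h3.symm
  change dMap (fun k : G => g * k) h _ = dMap (fun k : G => g * k) (h * 1) _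
  rw [mul_one]
  rfl

lemma isMIntegralCurve_mulLeft {γ : ℝ → G} {ξ : LieAlg n G} {t : ℝ}
    (h : HasMFDerivAt 𝓘(ℝ, ℝ) (𝓡 n) γ t
      ((1 : ℝ →L[ℝ] ℝ).smulRight (mulInvariantVectorField ξ (γ t)))) (g : G) :
    HasMFDerivAt 𝓘(ℝ, ℝ) (𝓡 n) (fun t => g * γ t) t
      ((1 : ℝ →L[ℝ] ℝ).smulRight (mulInvariantVectorField ξ (g * γ t))) := by
  have h1 := HasMFDerivAt.comp (g := fun k : G => g * k) t
    ((contMDiff_mulLeft g).mdifferentiable (by simp) _).hasMFDerivAt h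
  rw [← mfderiv_mulLeft_mulInvariantVectorField]
  have h2 : (1 : ℝ →L[ℝ] ℝ).smulRight (dMap (r := n) (n := n) (fun k : G => g * k) (γ t)
      (mulInvariantVectorField ξ (γ t))) = (dMap (r := n) (n := n) (fun k : G => g * k) (γ t)).comp
      ((1 : ℝ →L[ℝ] ℝ).smulRight (mulInvariantVectorField ξ (γ t) : EuclideanSpace ℝ (Fin n))) :=
    ContinuousLinearMap.ext fun v => ((dMap (r := n) (n := n) (fun k : G => g * k) (γ t)).map_smul v _).symm
  exact Eq.mpr (congrArg (HasMFDerivAt 𝓘(ℝ, ℝ) (𝓡 n) (fun t => g * γ t) t) h2) h1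

lemma contMDiff_one_mulInvariantVectorField (ξ : LieAlg n G) :
    ContMDiff (𝓡 n) (𝓡 n).tangent 1
      (fun g => (⟨g, mulInvariantVectorField ξ g⟩ : TangentBundle (𝓡 n) G)) :=
  (contMDiff_mulInvariantVectorField ξ).of_le (by
    rw [minSmoothness_of_isRCLikeNormedField]; norm_num)

/-- Left translation carries a local integral curve through `1` to one through any point, defined on
the same time interval. Integral curves of uniform length extend to all times. -/
lemma exists_oneParam (ξ : LieAlg n G) :
    ∃ γ : ℝ → G, γ 0 = 1 ∧ IsMIntegralCurve (I := 𝓡 n) γ (fun g => mulInvariantVectorField ξ g) := by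
  obtain ⟨γ, h0, hγ⟩ := exists_isMIntegralCurveAt_of_contMDiffAt_boundaryless (I := 𝓡 n) 0
    (contMDiff_one_mulInvariantVectorField ξ (1 : G))
  obtain ⟨ε, hε, hγ⟩ := isMIntegralCurveAt_iff'.1 hγ
  refine exists_isMIntegralCurve_of_isMIntegralCurveOn (I := 𝓡 n)
    (contMDiff_one_mulInvariantVectorField ξ) hε (fun g => ⟨fun t => g * γ t, by simp [h0], ?_⟩) 1
  have h1 : Ioo (-ε) ε = Metric.ball (0 : ℝ) ε := by rw [Real.ball_eq_Ioo]; simp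
  intro t ht
  rw [h1] at ht
  exact (isMIntegralCurve_mulLeft ((hγ t ht).hasMFDerivAt (Metric.isOpen_ball.mem_nhds ht))
    g).hasMFDerivWithinAt

/-- The one-parameter subgroup `t ↦ exp(tξ)`. -/
def oneParam (ξ : LieAlg n G) : ℝ → G := (exists_oneParam ξ).choose

@[simp] lemma oneParam_zero (ξ : LieAlg n G) : oneParam ξ 0 = 1 := (exists_oneParam ξ).choose_spec.1

lemma isMIntegralCurve_oneParam (ξ : LieAlg n G) :
    IsMIntegralCurve (I := 𝓡 n) (oneParam ξ) (fun g => mulInvariantVectorField ξ g) :=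
  (exists_oneParam ξ).choose_spec.2

lemma eq_oneParam {ξ : LieAlg n G} {γ : ℝ → G}
    (h : IsMIntegralCurve (I := 𝓡 n) γ (fun g => mulInvariantVectorField ξ g)) (h0 : γ 0 = 1) :
    γ = oneParam ξ :=
  isMIntegralCurve_Ioo_eq_of_contMDiff_boundaryless (t₀ := 0)
    (contMDiff_one_mulInvariantVectorField ξ) h (isMIntegralCurve_oneParam ξ) (by simp [h0])

/-- Uniqueness of integral curves: both sides, as functions of `t`, are integral curves of the same
left invariant field with the same value at `t = 0`. -/
lemma oneParam_add (ξ : LieAlg n G) (s t : ℝ) :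
    oneParam ξ (s + t) = oneParam ξ s * oneParam ξ t := by
  have h := isMIntegralCurve_Ioo_eq_of_contMDiff_boundaryless (t₀ := 0)
    (contMDiff_one_mulInvariantVectorField ξ) ((isMIntegralCurve_oneParam ξ).comp_add s)
    (γ' := fun t => oneParam ξ s * oneParam ξ t)
    (fun t => isMIntegralCurve_mulLeft (isMIntegralCurve_oneParam ξ t) _) (by simp)
  rw [add_comm]
  exact congrFun h t

lemma continuous_oneParam (ξ : LieAlg n G) : Continuous (oneParam ξ) :=
  (isMIntegralCurve_oneParam ξ).continuous

lemma hasDerivAt_oneParam (ξ : LieAlg n G) (f : SmoothFn (𝓡 n) G) (t : ℝ) :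
    HasDerivAt (fun t => f (oneParam ξ t)) (leftInvField ξ f (oneParam ξ t)) t := by
  have h := HasMFDerivAt.comp (g := f) t (f.mdifferentiableAt _).hasMFDerivAt
    (isMIntegralCurve_oneParam ξ t)
  have h1 : HasFDerivAt (fun t => f (oneParam ξ t)) ((dAt n f (oneParam ξ t)).comp
      ((1 : ℝ →L[ℝ] ℝ).smulRight
        (mulInvariantVectorField ξ (oneParam ξ t) : EuclideanSpace ℝ (Fin n)))) t := h.hasFDerivAt
  have h2 := h1.hasDerivAt
  rw [leftInvField_eq_dAt]
  refine h2.congr_deriv ?_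
  change dAt n f (oneParam ξ t) ((1 : ℝ) • (mulInvariantVectorField ξ (oneParam ξ t))) = _
  exact congrArg (dAt n f (oneParam ξ t)) (one_smul ℝ _)

lemma contDiff_comp_oneParam (ξ : LieAlg n G) (f : SmoothFn (𝓡 n) G) :
    ContDiff ℝ ∞ fun t => f (oneParam ξ t) := by
  rw [contDiff_infty]
  intro k
  induction k generalizing f with
  | zero => exact contDiff_zero.2 (f.contMDiff.continuous.comp (continuous_oneParam ξ))
  | succ k ih =>
    rw [Nat.cast_succ]
    refine contDiff_succ_iff_deriv.2
      ⟨fun t => (hasDerivAt_oneParam ξ f t).differentiableAt, by simp, ?_⟩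
    rw [funext fun t => (hasDerivAt_oneParam ξ f t).deriv]
    exact ih _

lemma contMDiff_oneParam (ξ : LieAlg n G) : ContMDiff 𝓘(ℝ, ℝ) (𝓡 n) ∞ (oneParam ξ) :=
  contMDiff_of_comp (continuous_oneParam ξ) (contDiff_comp_oneParam ξ)

end OneParam

lemma eq_of_dAt_eq {m : ℕ} {M : Type*} [TopologicalSpace M]
    [ChartedSpace (EuclideanSpace ℝ (Fin m)) M] [IsManifold (𝓡 m) ∞ M] [T2Space M] (x : M)
    {v w : EuclideanSpace ℝ (Fin m)} (h : ∀ f : SmoothFn (𝓡 m) M, dAt m f x v = dAt m f x w) :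
    v = w := by
  ext i
  obtain ⟨f, hf⟩ := exists_dAt_eq x (dzForm i)
  have h1 := h f
  rw [hf] at h1
  exact Complex.ofReal_injective h1

section

variable {n : ℕ} {G : Type*} [TopologicalSpace G] [ChartedSpace (EuclideanSpace ℝ (Fin n)) G]
  [Group G] [LieGroup (𝓡 n) ∞ G] [T2Space G]

lemma hasDerivAt_comp_of_hom {γ : ℝ → G} (hom : ∀ s t, γ (s + t) = γ s * γ t) (ξ : LieAlg n G)
    (h : ∀ f : SmoothFn (𝓡 n) G, HasDerivAt (fun t => f (γ t)) (dAt n f 1 ξ) 0)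
    (f : SmoothFn (𝓡 n) G) (t : ℝ) :
    HasDerivAt (fun t => f (γ t)) (leftInvField ξ f (γ t)) t := by
  have h0 := h (leftTrans (γ t) f)
  rw [← sub_self t] at h0
  have h1 := h0.comp_sub_const t t
  refine (h1.congr_deriv rfl).congr_of_eventuallyEq (Eventually.of_forall fun s => ?_)
  change f (γ s) = f (γ t * γ (s - t))
  rw [← hom, add_sub_cancel]

/-- The homomorphism property moves the velocity from time `0` to time `t` by left translation, so
`γ` is an integral curve of the left invariant field. Velocities are compared through smooth
functions, which separate tangent vectors. -/
lemma eq_oneParam_of_hom {γ : ℝ → G} (hγ : MDifferentiable 𝓘(ℝ, ℝ) (𝓡 n) γ)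
    (hom : ∀ s t, γ (s + t) = γ s * γ t) (ξ : LieAlg n G)
    (h : ∀ f : SmoothFn (𝓡 n) G, HasDerivAt (fun t => f (γ t)) (dAt n f 1 ξ) 0) :
    γ = oneParam ξ := by
  refine eq_oneParam (fun t => ?_) ?_
  · have h1 := (hγ t).hasMFDerivAt
    set D : ℝ →L[ℝ] EuclideanSpace ℝ (Fin n) := mfderiv 𝓘(ℝ, ℝ) (𝓡 n) γ t
    have h2 : D = (1 : ℝ →L[ℝ] ℝ).smulRight
        (mulInvariantVectorField ξ (γ t) : EuclideanSpace ℝ (Fin n)) := by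
      refine ContinuousLinearMap.ext_ring ?_
      refine Eq.trans ?_ (one_smul ℝ (mulInvariantVectorField ξ (γ t) :
        EuclideanSpace ℝ (Fin n))).symm
      refine eq_of_dAt_eq (γ t) fun f => ?_
      have h3 : HasFDerivAt (fun t => f (γ t)) ((dAt n f (γ t)).comp D) t :=
        (HasMFDerivAt.comp (g := f) t (f.mdifferentiableAt _).hasMFDerivAt h1).hasFDerivAt
      have h4 := h3.hasDerivAt.unique (hasDerivAt_comp_of_hom hom ξ h f t)
      rw [leftInvField_eq_dAt] at h4
      exact h4
    rw [h2] at h1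
    exact h1
  · have := hom 0 0
    rwa [add_zero, left_eq_mul] at this

end

/-! ### The exponential map of a torus and its kernel -/

section TorusExp

variable {r : ℕ} {T : Type*} [TopologicalSpace T] [ChartedSpace (EuclideanSpace ℝ (Fin r)) T]
  [CommGroup T] [LieGroup (𝓡 r) ∞ T] [T2Space T]

/-- The exponential map of an abelian Lie group in the coordinates given by `ξ`. -/
def torusExp (ξ : Fin r → LieAlg r T) (x : Fin r → ℝ) : T := ∏ i, oneParam (ξ i) (x i)

lemma torusExp_add (ξ : Fin r → LieAlg r T) (x y : Fin r → ℝ) :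
    torusExp ξ (x + y) = torusExp ξ x * torusExp ξ y := by
  simp only [torusExp, Pi.add_apply, oneParam_add, Finset.prod_mul_distrib]

@[simp] lemma torusExp_zero (ξ : Fin r → LieAlg r T) : torusExp ξ 0 = 1 := by
  simp [torusExp]

lemma torusExp_neg (ξ : Fin r → LieAlg r T) (x : Fin r → ℝ) :
    torusExp ξ (-x) = (torusExp ξ x)⁻¹ := by
  rw [eq_inv_iff_mul_eq_one, ← torusExp_add, neg_add_cancel, torusExp_zero]

lemma torusExp_sum {ι : Type*} (s : Finset ι) (ξ : Fin r → LieAlg r T) (x : ι → Fin r → ℝ) :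
    torusExp ξ (∑ i ∈ s, x i) = ∏ i ∈ s, torusExp ξ (x i) :=
  map_prod (M := Multiplicative (Fin r → ℝ))
    { toFun := fun x => torusExp ξ (Multiplicative.toAdd x), map_one' := torusExp_zero ξ,
      map_mul' := fun _ _ => torusExp_add ξ _ _ : Multiplicative (Fin r → ℝ) →* T }
    (fun i => Multiplicative.ofAdd (x i)) s

lemma torusExp_single (ξ : Fin r → LieAlg r T) (i : Fin r) (t : ℝ) :
    torusExp ξ (Pi.single i t) = oneParam (ξ i) t := by
  rw [torusExp, Finset.prod_eq_single i (fun j _ h => by simp [Pi.single_eq_of_ne h]) (by simp),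
    Pi.single_eq_same]

lemma contMDiff_torusExp (ξ : Fin r → LieAlg r T) :
    ContMDiff 𝓘(ℝ, Fin r → ℝ) (𝓡 r) ∞ (torusExp ξ) := by
  unfold torusExp
  refine contMDiff_finsetProd fun i _ => (contMDiff_oneParam (ξ i)).comp ?_
  exact (contDiff_apply ℝ ℝ i).contMDiff

/-- The linear isomorphism given by a basis of the Lie algebra. -/
def basisEquiv (ξ : Module.Basis (Fin r) ℝ (LieAlg r T)) :
    (Fin r → ℝ) ≃L[ℝ] EuclideanSpace ℝ (Fin r) :=
  LinearEquiv.toContinuousLinearEquiv (F := EuclideanSpace ℝ (Fin r)) ξ.equivFun.symm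

lemma hasFDerivAt_comp_torusExp (ξ : Module.Basis (Fin r) ℝ (LieAlg r T)) :
    HasMFDerivAt 𝓘(ℝ, Fin r → ℝ) (𝓡 r) (torusExp ξ) 0
      (basisEquiv ξ : (Fin r → ℝ) →L[ℝ] EuclideanSpace ℝ (Fin r)) := by
  have h := ((contMDiff_torusExp ξ).mdifferentiable (by simp) 0).hasMFDerivAt
  set D : (Fin r → ℝ) →L[ℝ] EuclideanSpace ℝ (Fin r) :=
    mfderiv 𝓘(ℝ, Fin r → ℝ) (𝓡 r) (torusExp ξ) 0 with hD
  have h1 : D = (basisEquiv ξ : (Fin r → ℝ) →L[ℝ] EuclideanSpace ℝ (Fin r)) := by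
    refine ContinuousLinearMap.coe_injective ((Pi.basisFun ℝ (Fin r)).ext fun i => ?_)
    have h2 : (ξ.equivFun.symm (Pi.basisFun ℝ (Fin r) i) : LieAlg r T) = ξ i := by
      simp [Module.Basis.equivFun_symm_apply, Pi.single_apply]
    refine Eq.trans ?_ h2.symm
    refine eq_of_dAt_eq (1 : T) fun f => ?_
    have h3 : HasFDerivAt (fun x => f (torusExp ξ x)) ((dAt r f (torusExp ξ 0)).comp D) 0 :=
      (HasMFDerivAt.comp (g := f) 0 (f.mdifferentiableAt _).hasMFDerivAt h).hasFDerivAt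
    have h4 : HasDerivAt (fun t : ℝ => Pi.single (M := fun _ => ℝ) i t) (Pi.single i 1) 0 :=
      ((ContinuousLinearMap.single ℝ (fun _ : Fin r => ℝ) i).hasDerivAt (x := 0))
    have h5 := h3.comp_hasDerivAt_of_eq (0 : ℝ) h4 (by simp)
    have h6 := hasDerivAt_oneParam (ξ i) f 0
    rw [oneParam_zero, leftInvField_one] at h6
    rw [torusExp_zero] at h5
    have h7 : (fun x => f (torusExp ξ x)) ∘ (fun t : ℝ => Pi.single (M := fun _ => ℝ) i t) =
        fun t => f (oneParam (ξ i) t) := by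
      ext t
      exact congrArg f (torusExp_single _ i t)
    rw [h7] at h5
    have h8 := h5.unique h6
    rw [Pi.basisFun_apply]
    exact h8
  rw [← h1]
  exact h

lemma oneParam_basisEquiv (e : Module.Basis (Fin r) ℝ (LieAlg r T)) (x : Fin r → ℝ) (t : ℝ) :
    oneParam (basisEquiv e x : LieAlg r T) t = torusExp e (t • x) := by
  have h3 : ContMDiff 𝓘(ℝ, ℝ) (𝓡 r) ∞ fun t : ℝ => torusExp e (t • x) :=
    (contMDiff_torusExp e).comp (contDiff_id.smul (contDiff_const (c := x))).contMDiff
  refine (congrFun (eq_oneParam_of_hom (h3.mdifferentiable (by simp)) (fun s t => ?_) _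
    fun f => ?_) t).symm
  · rw [add_smul, torusExp_add]
  · have h4 : HasFDerivAt (fun x => f (torusExp e x)) ((dAt r f (torusExp e 0)).comp
        (basisEquiv e : (Fin r → ℝ) →L[ℝ] EuclideanSpace ℝ (Fin r))) 0 :=
      (HasMFDerivAt.comp (g := f) 0 (f.mdifferentiableAt _).hasMFDerivAt
        (hasFDerivAt_comp_torusExp e)).hasFDerivAt
    have h5 : HasDerivAt (fun t : ℝ => t • x) x 0 := by
      simpa using (hasDerivAt_id (0 : ℝ)).smul_const x
    have h6 := h4.comp_hasDerivAt_of_eq (0 : ℝ) h5 (by simp)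
    rw [torusExp_zero] at h6
    exact h6

/-- The inverse function theorem for the exponential map read in a chart at `1`. The points must lie
in the chart domain so that equality of chart values gives equality in `T`. -/
lemma exists_torusLog (ξ : Module.Basis (Fin r) ℝ (LieAlg r T)) : ∃ σ : T → (Fin r → ℝ),
    ContMDiffAt (𝓡 r) 𝓘(ℝ, Fin r → ℝ) ∞ σ 1 ∧ σ 1 = 0 ∧ (∀ᶠ t in 𝓝 1, torusExp ξ (σ t) = t) ∧
    ∀ᶠ x in 𝓝 0, σ (torusExp ξ x) = x := by
  set φ := extChartAt (𝓡 r) (torusExp ξ 0) with hφ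
  have h1 := (hasFDerivAt_comp_torusExp ξ).2
  have h2 : ContDiffAt ℝ ∞ (φ ∘ torusExp ξ) 0 :=
    (contMDiffAt_iff_target.1 ((contMDiff_torusExp ξ) 0)).2.contDiffAt
  have h1' : HasFDerivAt (φ ∘ torusExp ξ) (basisEquiv ξ : (Fin r → ℝ) →L[ℝ] EuclideanSpace ℝ (Fin r)) 0 :=
    HasFDerivWithinAt.hasFDerivAt (s := range 𝓘(ℝ, Fin r → ℝ)) h1
      (by rw [ModelWithCorners.range_eq_univ]; exact univ_mem)
  let g := h2.localInverse h1' (by simp)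
  have hg := h2.to_localInverse h1' (by simp)
  have hs := h2.hasStrictFDerivAt' h1' (by simp)
  have hg0 : g (φ 1) = 0 := by
    have := h2.localInverse_apply_image h1' (by simp)
    simpa using this
  have hr : ∀ᶠ y in 𝓝 (φ 1), φ (torusExp ξ (g y)) = y := by
    have := hs.eventually_right_inverse
    rw [Function.comp_apply, torusExp_zero] at this
    exact this
  have hl : ∀ᶠ x in 𝓝 0, g (φ (torusExp ξ x)) = x := hs.eventually_left_inverse
  have hφ1 : φ = extChartAt (𝓡 r) 1 := by rw [hφ, torusExp_zero]
  have hsm : ContMDiffAt (𝓡 r) 𝓘(ℝ, Fin r → ℝ) ∞ (fun t => g (φ t)) 1 := by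
    have h3 : ContDiffAt ℝ ∞ g (φ 1) := by simpa using hg
    refine h3.contMDiffAt.comp 1 ?_
    rw [hφ1]
    exact contMDiffAt_extChartAt
  refine ⟨fun t => g (φ t), hsm, hg0, ?_, hl⟩
  have hφc : ContinuousAt φ 1 := by rw [hφ1]; exact continuousAt_extChartAt 1
  have h5 : ContinuousAt (fun t => torusExp ξ (g (φ t))) 1 :=
    (contMDiff_torusExp ξ).continuous.continuousAt.comp hsm.continuousAt
  have h6 : φ.source ∈ 𝓝 (1 : T) := by
    rw [hφ1]; exact extChartAt_source_mem_nhds (I := 𝓡 r) 1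
  have h7 : ∀ᶠ t in 𝓝 (1 : T), torusExp ξ (g (φ t)) ∈ φ.source :=
    h5.eventually_mem (by rw [hg0, torusExp_zero]; exact h6)
  filter_upwards [hφc.eventually hr, h6, h7] with t h8 h9 h10
  exact φ.injOn h10 h9 h8

/-- The image is a subgroup that contains a neighbourhood of `1`. It is open, hence also closed,
hence everything. -/
lemma surjective_torusExp [ConnectedSpace T] (ξ : Module.Basis (Fin r) ℝ (LieAlg r T)) :
    Function.Surjective (torusExp ξ) := by
  let S : Subgroup T :=
    { carrier := Set.range (torusExp ξ)
      mul_mem' := by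
        rintro _ _ ⟨x, rfl⟩ ⟨y, rfl⟩
        exact ⟨x + y, torusExp_add _ _ _⟩
      one_mem' := ⟨0, torusExp_zero _⟩
      inv_mem' := by
        rintro _ ⟨x, rfl⟩
        exact ⟨-x, torusExp_neg _ _⟩ }
  obtain ⟨σ, -, -, h, -⟩ := exists_torusLog ξ
  have : IsTopologicalGroup T := topologicalGroup_of_lieGroup (𝓡 r) ∞
  have hS : IsOpen (S : Set T) := S.isOpen_of_mem_nhds (g := 1) (by
    filter_upwards [h] with t ht
    exact ⟨_, ht⟩)
  have h2 := IsClopen.eq_univ ⟨S.isClosed_of_isOpen hS, hS⟩ ⟨1, S.one_mem⟩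
  exact fun t => (h2 ▸ Set.mem_univ t : t ∈ (S : Set T))

lemma exists_oneParam_eq [ConnectedSpace T] (t : T) : ∃ η : LieAlg r T, oneParam η 1 = t := by
  let e : Module.Basis (Fin r) ℝ (LieAlg r T) := (EuclideanSpace.basisFun (Fin r) ℝ).toBasis
  obtain ⟨x, rfl⟩ := surjective_torusExp e t
  refine ⟨basisEquiv e x, ?_⟩
  rw [oneParam_basisEquiv, one_smul]

/-- The kernel of the exponential map. -/
def torusKer (ξ : Fin r → LieAlg r T) : Submodule ℤ (Fin r → ℝ) :=
  AddSubgroup.toIntSubmodule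
  { carrier := {x | torusExp ξ x = 1}
    add_mem' := by
      intro x y (hx : _ = _) (hy : _ = _)
      change torusExp ξ (x + y) = 1
      rw [torusExp_add, hx, hy, one_mul]
    zero_mem' := torusExp_zero ξ
    neg_mem' := by
      intro x (hx : _ = _)
      change torusExp ξ (-x) = 1
      rw [torusExp_neg, hx, inv_one] }

lemma mem_torusKer {ξ : Fin r → LieAlg r T} {x : Fin r → ℝ} :
    x ∈ torusKer ξ ↔ torusExp ξ x = 1 := Iff.rfl

/-- The local logarithm makes the exponential map injective near `0`, so `0` is isolated in the
kernel. -/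
lemma discreteTopology_torusKer (ξ : Module.Basis (Fin r) ℝ (LieAlg r T)) :
    DiscreteTopology (torusKer ξ) := by
  obtain ⟨σ, -, h0, -, h⟩ := exists_torusLog ξ
  change DiscreteTopology (torusKer ξ).toAddSubgroup
  rw [discreteTopology_iff_isOpen_singleton_zero]
  obtain ⟨U, hU, hUo, hU0⟩ := mem_nhds_iff.1 h
  have h1 : ({0} : Set (torusKer ξ).toAddSubgroup) = Subtype.val ⁻¹' U := by
    ext x
    constructor
    · rintro rfl
      exact hU0
    · intro hx
      have h2 : σ (torusExp ξ x.1) = x.1 := hU hx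
      have h3 : torusExp ξ x.1 = 1 := x.2
      rw [h3, h0] at h2
      exact Subtype.ext h2.symm
  rw [h1]
  exact hUo.preimage continuous_subtype_val

/-- Finitely many translates of a neighbourhood of `1` on which the logarithm has norm less than one
cover `T`. -/
lemma exists_torusExp_ball [CompactSpace T] [ConnectedSpace T]
    (ξ : Module.Basis (Fin r) ℝ (LieAlg r T)) :
    ∃ R, ∀ t, ∃ x : Fin r → ℝ, ‖x‖ ≤ R ∧ torusExp ξ x = t := by
  obtain ⟨σ, hσ, h0, h1, h⟩ := exists_torusLog ξ
  have : IsTopologicalGroup T := topologicalGroup_of_lieGroup (𝓡 r) ∞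
  have h2 : ∀ᶠ t in 𝓝 (1 : T), torusExp ξ (σ t) = t ∧ ‖σ t‖ < 1 :=
    h1.and (hσ.continuousAt.norm.eventually_lt_const (by simp [h0]))
  have h3 : ∀ s : T, ∀ᶠ t in 𝓝 s, torusExp ξ (σ (s⁻¹ * t)) = s⁻¹ * t ∧ ‖σ (s⁻¹ * t)‖ < 1 := by
    intro s
    have : Tendsto (fun t => s⁻¹ * t) (𝓝 s) (𝓝 1) := by
      have := (continuous_const_mul s⁻¹).tendsto s
      rwa [inv_mul_cancel] at this
    exact this.eventually h2
  obtain ⟨F, hF⟩ := CompactSpace.elim_nhds_subcover _ h3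
  choose ψ hψ using surjective_torusExp ξ
  refine ⟨∑ s ∈ F, ‖ψ s‖ + 1, fun t => ?_⟩
  obtain ⟨s, hs, hst⟩ := Set.mem_iUnion₂.1 (hF.ge (Set.mem_univ t))
  refine ⟨ψ s + σ (s⁻¹ * t), (norm_add_le _ _).trans (add_le_add ?_ hst.2.le), ?_⟩
  · exact Finset.single_le_sum (f := fun s => ‖ψ s‖) (fun _ _ => norm_nonneg _) hs
  · rw [torusExp_add, hψ, hst.1, mul_inv_cancel_left]

/-- If the kernel did not span, a nonzero linear form would vanish on it and so depend only on the
image under the exponential map. A bounded set already surjects onto `T`, so the form would be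
bounded, which is impossible. -/
lemma isZLattice_torusKer [CompactSpace T] [ConnectedSpace T]
    (ξ : Module.Basis (Fin r) ℝ (LieAlg r T)) [DiscreteTopology (torusKer ξ)] :
    IsZLattice ℝ (torusKer ξ) := by
  refine ⟨?_⟩
  by_contra hS
  obtain ⟨f, hf, hle⟩ := Submodule.exists_le_ker_of_lt_top _ (lt_top_iff_ne_top.2 hS)
  obtain ⟨R, hR⟩ := exists_torusExp_ball ξ
  refine hf ?_
  obtain ⟨C, hC⟩ : ∃ C, ∀ x, |f x| ≤ C := by
    let g := LinearMap.toContinuousLinearMap f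
    refine ⟨‖g‖ * R, fun x => ?_⟩
    obtain ⟨y, hy, hxy⟩ := hR (torusExp ξ x)
    have h1 : x - y ∈ torusKer ξ := by
      rw [mem_torusKer, sub_eq_add_neg, torusExp_add, torusExp_neg, hxy, mul_inv_cancel]
    have h2 : f (x - y) = 0 := hle (Submodule.subset_span h1)
    rw [map_sub, sub_eq_zero] at h2
    rw [h2]
    exact (g.le_opNorm y).trans (mul_le_mul_of_nonneg_left hy (norm_nonneg _))
  refine LinearMap.ext fun x => ?_
  by_contra hx
  have hx : f x ≠ 0 := hx
  have h1 := hC (((C + 1) / f x) • x)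
  rw [map_smul, smul_eq_mul, div_mul_cancel₀ _ hx] at h1
  linarith [le_abs_self (C + 1)]

/-- A basis of the Lie algebra of a torus which generates the kernel of the exponential map. -/
theorem exists_torusBasis [CompactSpace T] [ConnectedSpace T] :
    ∃ ξ : Module.Basis (Fin r) ℝ (LieAlg r T),
      ∀ x, torusExp ξ x = 1 ↔ ∀ i, ∃ k : ℤ, x i = k := by
  let e : Module.Basis (Fin r) ℝ (LieAlg r T) :=
    (EuclideanSpace.basisFun (Fin r) ℝ).toBasis
  have := discreteTopology_torusKer e
  have := isZLattice_torusKer e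
  -- A `ℤ`-basis of the lattice is also an `ℝ`-basis of the ambient space, so it may replace the
  -- original coordinates; in the new ones the kernel is `ℤ^r`.
  let b := Module.Free.chooseBasis ℤ (torusKer e)
  let B := b.ofZLatticeBasis ℝ (torusKer e)
  have hc : Fintype.card (Module.Free.ChooseBasisIndex ℤ (torusKer e)) = Fintype.card (Fin r) := by
    rw [← Module.finrank_eq_card_basis B, Module.finrank_fintype_fun_eq_card]
  let ε := Fintype.equivOfCardEq hc
  let B' := B.reindex ε
  refine ⟨B'.map e.equivFun.symm, fun x => ?_⟩
  have h1 : ∀ i t, oneParam ((B'.map e.equivFun.symm) i) t = torusExp e (t • B' i) :=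
    fun i t => oneParam_basisEquiv e (B' i) t
  have h2 : torusExp (B'.map e.equivFun.symm) x = torusExp e (∑ i, x i • B' i) := by
    unfold torusExp
    simp only [h1]
    rw [← torusExp_sum]
    rfl
  rw [h2, ← mem_torusKer, ← Module.Basis.ofZLatticeBasis_span ℝ (torusKer e) b]
  have h3 : Set.range (b.ofZLatticeBasis ℝ (torusKer e)) = Set.range B' := by
    rw [Module.Basis.range_reindex]
  rw [h3, Module.Basis.mem_span_iff_repr_mem]
  refine forall_congr' fun i => ?_
  rw [← Module.Basis.equivFun_symm_apply, ← Module.Basis.equivFun_apply, LinearEquiv.apply_symm_apply]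
  simp [eq_comm]

end TorusExp

/-! ### Weights and Fourier series on a torus -/

section

open MeasureTheory

section Weights

variable {r : ℕ} {T : Type*} [TopologicalSpace T] [ChartedSpace (EuclideanSpace ℝ (Fin r)) T]
  [Group T] [LieGroup (𝓡 r) ∞ T] [T2Space T]

@[simp] lemma Weight.fn_apply (ν : Weight r T) (t : T) : ν.fn t = (ν.char t : ℂ) := rfl

lemma Weight.fn_mul (ν : Weight r T) (s t : T) : ν.fn (s * t) = ν.fn s * ν.fn t := by
  simp

lemma Weight.leftInvField_apply (ν : Weight r T) (ξ : LieAlg r T) (t : T) :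
    leftInvField ξ ν.fn t = dAt r ν.fn 1 ξ * ν.fn t := by
  have h : leftTrans t ν.fn = ν.fn t • ν.fn := by
    ext s
    exact ν.fn_mul t s
  have h1 := congrArg (fun f => leftInvField ξ f 1) h
  simp only [leftInvField_leftTrans, leftTrans_apply, mul_one, Derivation.map_smul,
    SmoothFn.smul_apply] at h1
  rw [h1, leftInvField_one, mul_comm]

lemma Weight.fn_oneParam' (ν : Weight r T) (ξ : LieAlg r T) (t : ℝ) :
    ν.fn (oneParam ξ t) = Complex.exp (t * dAt r ν.fn 1 ξ) := by
  set a := dAt r ν.fn 1 ξ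
  have h1 : ∀ t, HasDerivAt (fun t : ℝ => ν.fn (oneParam ξ t) * Complex.exp (-(t * a))) 0 t := by
    intro t
    have h2 := hasDerivAt_oneParam ξ ν.fn t
    rw [ν.leftInvField_apply] at h2
    have h3 : HasDerivAt (fun t : ℝ => -((t : ℂ) * a)) (-(1 * a)) t :=
      ((hasDerivAt_id t).ofReal_comp.mul_const a).neg
    have h4 := h2.mul h3.cexp
    refine h4.congr_deriv ?_
    ring
  have h5 := is_const_of_deriv_eq_zero (fun t => (h1 t).differentiableAt)
    (fun t => (h1 t).deriv) t 0
  simp only [oneParam_zero, Weight.fn_apply, map_one, Circle.coe_one, Complex.ofReal_zero, zero_mul,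
    neg_zero, Complex.exp_zero, mul_one, Complex.exp_neg] at h5
  rw [mul_inv_eq_one₀ (Complex.exp_ne_zero _)] at h5
  exact h5

/-- Characters are unimodular, so the derivative at the identity is purely imaginary and is
recovered from its imaginary part, which is what `lin` records. -/
lemma Weight.dAt_fn (ν : Weight r T) (ξ : LieAlg r T) :
    dAt r ν.fn 1 ξ = 2 * Real.pi * Complex.I * ν.lin ξ := by
  have h1 : (dAt r ν.fn 1 ξ).re = 0 := by
    have h2 := congrArg norm (ν.fn_oneParam' ξ 1)
    rw [Weight.fn_apply, Circle.norm_coe, Complex.norm_exp] at h2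
    simpa using h2.symm
  have h3 : ν.lin ξ = (2 * Real.pi)⁻¹ * (dAt r ν.fn 1 ξ).im := rfl
  rw [h3]
  apply Complex.ext
  · simp [h1]
  · have := Real.pi_ne_zero
    simp
    field_simp

lemma Weight.fn_oneParam (ν : Weight r T) (ξ : LieAlg r T) (t : ℝ) :
    ν.fn (oneParam ξ t) = Complex.exp (2 * Real.pi * Complex.I * (ν.lin ξ * t)) := by
  rw [ν.fn_oneParam', ν.dAt_fn]
  congr 1
  ring

lemma Weight.leftInvField_fn (ν : Weight r T) (ξ : LieAlg r T) :
    leftInvField ξ ν.fn = (2 * Real.pi * Complex.I * ν.lin ξ : ℂ) • ν.fn := by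
  ext t
  rw [ν.leftInvField_apply, ν.dAt_fn]
  rfl

lemma Weight.rightInvField_fn (ν : Weight r T) (ξ : LieAlg r T) :
    rightInvField ξ ν.fn = (2 * Real.pi * Complex.I * ν.lin ξ : ℂ) • ν.fn := by
  rw [← ν.leftInvField_fn]
  ext t
  refine congrArg (fun f : T → ℂ => dAt r f 1 ξ) (funext fun h => ?_)
  rw [ν.fn_mul, ν.fn_mul, mul_comm]

end Weights

section TorusWeights

variable {r : ℕ} {T : Type*} [TopologicalSpace T] [ChartedSpace (EuclideanSpace ℝ (Fin r)) T]
  [CommGroup T] [LieGroup (𝓡 r) ∞ T] [T2Space T] [CompactSpace T] [ConnectedSpace T]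
  (ξ : Module.Basis (Fin r) ℝ (LieAlg r T))

lemma contMDiff_of_comp_torusExp {F : T → ℂ} (h : ContDiff ℝ ∞ fun x => F (torusExp ξ x)) :
    ContMDiff (𝓡 r) 𝓘(ℝ, ℂ) ∞ F := by
  intro t₀
  obtain ⟨σ, hσ, h0, h1, -⟩ := exists_torusLog ξ
  obtain ⟨x₀, rfl⟩ := surjective_torusExp ξ t₀
  have h2 : ContMDiffAt (𝓡 r) 𝓘(ℝ, Fin r → ℝ) ∞ (fun t => σ ((torusExp ξ x₀)⁻¹ * t))
      (torusExp ξ x₀) := by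
    refine ContMDiffAt.comp (g := σ) _ ?_ (contMDiff_mulLeft _ _)
    rwa [inv_mul_cancel]
  have h3 : ContMDiffAt (𝓡 r) 𝓘(ℝ, ℂ) ∞
      (fun t => F (torusExp ξ (x₀ + σ ((torusExp ξ x₀)⁻¹ * t)))) (torusExp ξ x₀) :=
    ContMDiffAt.comp (g := fun x => F (torusExp ξ (x₀ + x))) _
      (h.comp (contDiff_const.add contDiff_id)).contMDiff.contMDiffAt h2
  refine h3.congr_of_eventuallyEq ?_
  have : IsTopologicalGroup T := topologicalGroup_of_lieGroup (𝓡 r) ∞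
  have h4 : Tendsto (fun t => (torusExp ξ x₀)⁻¹ * t) (𝓝 (torusExp ξ x₀)) (𝓝 1) := by
    have := (continuous_const_mul (torusExp ξ x₀)⁻¹).tendsto (torusExp ξ x₀)
    rwa [inv_mul_cancel] at this
  filter_upwards [h4.eventually h1] with t ht
  rw [torusExp_add, ht, mul_inv_cancel_left]

variable (hξ : ∀ x, torusExp ξ x = 1 ↔ ∀ i, ∃ k : ℤ, x i = k)

lemma Weight.fn_torusExp (ν : Weight r T) (x : Fin r → ℝ) :
    ν.fn (torusExp ξ x) = Complex.exp (2 * Real.pi * Complex.I * ∑ i, ν.lin (ξ i) * x i) := by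
  rw [Complex.ofReal_sum, Finset.mul_sum, Complex.exp_sum]
  simp only [Complex.ofReal_mul, ← Weight.fn_oneParam, Weight.fn_apply, torusExp, map_prod]
  exact map_prod Circle.coeHom _ _

include ξ in
lemma Weight.eq_of_lin_eq {ν ν' : Weight r T} (h : ν.lin = ν'.lin) : ν = ν' := by
  have h1 : ν.fn = ν'.fn := by
    ext t
    obtain ⟨x, rfl⟩ := surjective_torusExp ξ t
    rw [ν.fn_torusExp, ν'.fn_torusExp, h]
  have h2 : ν.char = ν'.char := by
    ext t
    exact congrArg (fun f : SmoothFn (𝓡 r) T => f t) h1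
  cases ν
  cases ν'
  cases h2
  rfl

-- The function `x ↦ exp(2πi Σ k_i x_i)` takes equal values at points whose difference lies in
-- `ℤ^r`, which is the kernel of the exponential map, so it descends to a character. Smoothness is
-- tested on the exponential map.
include hξ in
lemma exists_weight_of_int (k : Fin r → ℤ) : ∃ ν : Weight r T, ∀ i, ν.lin (ξ i) = k i := by
  let L : (Fin r → ℝ) → ℝ := fun x => ∑ i, k i * x i
  have hL : ∀ x y, torusExp ξ x = torusExp ξ y →
      Circle.exp (2 * Real.pi * L x) = Circle.exp (2 * Real.pi * L y) := by
    intro x y hxy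
    have h1 : torusExp ξ (x - y) = 1 := by
      rw [sub_eq_add_neg, torusExp_add, torusExp_neg, hxy, mul_inv_cancel]
    choose m hm using (hξ _).1 h1
    refine Circle.exp_eq_exp.2 ⟨∑ i, k i * m i, ?_⟩
    have h2 : L x = L y + ∑ i, k i * m i := by
      push_cast
      rw [← Finset.sum_add_distrib]
      refine Finset.sum_congr rfl fun i _ => ?_
      rw [← hm, Pi.sub_apply]
      ring
    rw [h2]
    push_cast
    ring
  choose ψ hψ using surjective_torusExp ξ
  have hv : ∀ x, Circle.exp (2 * Real.pi * L (ψ (torusExp ξ x))) = Circle.exp (2 * Real.pi * L x) :=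
    fun x => hL _ _ (hψ _)
  have hadd : ∀ x y, L (x + y) = L x + L y := by
    intro x y
    simp only [L, Pi.add_apply, mul_add, Finset.sum_add_distrib]
  let χ : T →* Circle :=
    { toFun := fun t => Circle.exp (2 * Real.pi * L (ψ t))
      map_one' := by
        rw [← torusExp_zero ξ, hv]
        simp [L]
      map_mul' := by
        intro s t
        rw [← hψ s, ← hψ t, ← torusExp_add]
        simp only [hv]
        rw [hadd, mul_add, Circle.exp_add] }
  have hsm : ContMDiff (𝓡 r) 𝓘(ℝ, ℂ) ∞ (fun t => (χ t : ℂ)) := by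
    refine contMDiff_of_comp_torusExp ξ ?_
    change ContDiff ℝ ∞ fun x => (Circle.exp (2 * Real.pi * L (ψ (torusExp ξ x))) : ℂ)
    simp only [hv, Circle.coe_exp]
    refine ((Complex.ofRealCLM.contDiff.comp (contDiff_const.mul ?_)).mul contDiff_const).cexp
    exact ContDiff.sum fun i _ => contDiff_const.mul (contDiff_apply ℝ ℝ i)
  let ν : Weight r T := ⟨χ, hsm⟩
  refine ⟨ν, fun i => ?_⟩
  have h1 := hasDerivAt_oneParam (ξ i) ν.fn 0
  rw [oneParam_zero, leftInvField_one, ν.dAt_fn] at h1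
  have h2 : (fun t : ℝ => ν.fn (oneParam (ξ i) t)) = fun t : ℝ => Complex.exp ((2 * Real.pi * Complex.I * k i) * t) := by
    ext t
    rw [← torusExp_single]
    change (Circle.exp (2 * Real.pi * L (ψ (torusExp ξ (Pi.single i t)))) : ℂ) = _
    rw [hv, Circle.coe_exp]
    congr 1
    have : L (Pi.single i t) = k i * t := by
      simp only [L]
      rw [Finset.sum_eq_single i (fun j _ h => by simp [Pi.single_eq_of_ne h]) (by simp),
        Pi.single_eq_same]
    rw [this]
    push_cast
    ring
  rw [h2] at h1
  have h3 := (((hasDerivAt_id (0 : ℝ)).ofReal_comp.const_mul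
    (2 * Real.pi * Complex.I * k i : ℂ)).cexp).unique h1
  simp only [id, Complex.ofReal_zero, mul_zero, Complex.exp_zero, one_mul, Complex.ofReal_one,
    mul_one] at h3
  have h4 := mul_left_cancel₀ Complex.two_pi_I_ne_zero h3
  exact_mod_cast h4.symm

include hξ in
lemma Weight.exists_int (ν : Weight r T) (i : Fin r) : ∃ k : ℤ, ν.lin (ξ i) = k := by
  have h1 : oneParam (ξ i) 1 = 1 := by
    rw [← torusExp_single, hξ]
    intro j
    rcases eq_or_ne j i with rfl | h
    · exact ⟨1, by simp⟩
    · exact ⟨0, by simp [Pi.single_eq_of_ne h]⟩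
  have h2 := ν.fn_oneParam (ξ i) 1
  rw [h1, Weight.fn_apply, map_one, Circle.coe_one, eq_comm, Complex.exp_eq_one_iff] at h2
  obtain ⟨k, hk⟩ := h2
  refine ⟨k, ?_⟩
  rw [Complex.ofReal_one, mul_one, mul_comm] at hk
  have := mul_right_cancel₀ Complex.two_pi_I_ne_zero hk
  exact_mod_cast this

end TorusWeights

end

section

open MeasureTheory

section Sums

/-- A weight function on `ℤ^r`. -/
def intSize {r : ℕ} (k : Fin r → ℤ) : ℝ := 1 + ∑ i, |(k i : ℝ)|

lemma one_le_intSize {r : ℕ} (k : Fin r → ℤ) : 1 ≤ intSize k :=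
  le_add_of_nonneg_right (Finset.sum_nonneg fun _ _ => abs_nonneg _)

lemma abs_le_intSize {r : ℕ} (k : Fin r → ℤ) (i : Fin r) : 1 + |(k i : ℝ)| ≤ intSize k :=
  add_le_add_right (Finset.single_le_sum (f := fun i => |(k i : ℝ)|) (fun _ _ => abs_nonneg _)
    (Finset.mem_univ i)) 1

lemma summable_prod_int (g : ℤ → ℝ) (hg : Summable g) (h0 : ∀ k, 0 ≤ g k) (r : ℕ) :
    Summable fun k : Fin r → ℤ => ∏ i, g (k i) := by
  induction r with
  | zero => exact Summable.of_finite
  | succ r ih =>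
    have h1 := hg.mul_of_nonneg ih h0 (fun k => Finset.prod_nonneg fun i _ => h0 _)
    rw [← (Fin.consEquiv fun _ : Fin (r + 1) => ℤ).summable_iff]
    refine h1.congr fun p => ?_
    simp [Fin.prod_univ_succ, Fin.consEquiv]

/-- Comparison with `∏ (1 + |k_i|)⁻²`: each of the `r` factors `(1 + |k_i|)²` is at most `intSize k
^ 2`, which explains the exponent `2 * r`. -/
lemma summable_intSize (r : ℕ) : Summable fun k : Fin r → ℤ => (intSize k ^ (2 * r))⁻¹ := by
  have h1 : Summable fun k : ℤ => ((1 + |(k : ℝ)|) ^ 2)⁻¹ := by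
    have h2 : Summable fun k : ℕ => ((1 + (k : ℝ)) ^ 2)⁻¹ := by
      have := (summable_nat_add_iff 1).2 (Real.summable_nat_pow_inv.2 (one_lt_two))
      refine this.congr fun k => ?_
      rw [Nat.cast_add, Nat.cast_one, add_comm]
    refine Summable.of_nat_of_neg (by simpa using h2) (by simpa using h2)
  refine Summable.of_nonneg_of_le (fun k => ?_) (fun k => ?_)
    (summable_prod_int _ h1 (fun k => by positivity) r)
  · have := one_le_intSize k
    positivity
  · rw [Finset.prod_inv_distrib]
    refine inv_anti₀ (Finset.prod_pos fun i _ => by positivity) ?_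
    calc ∏ i, (1 + |(k i : ℝ)|) ^ 2 ≤ ∏ _i : Fin r, intSize k ^ 2 :=
          Finset.prod_le_prod (fun i _ => by positivity) fun i _ =>
            pow_le_pow_left₀ (by positivity) (abs_le_intSize k i) 2
      _ = _ := by simp [pow_mul]

end Sums

-- The normalization of total mass one, for which the functions `mFourier` are orthonormal.
local instance : MeasureSpace UnitAddCircle := ⟨AddCircle.haarAddCircle⟩

local instance : Measure.IsAddHaarMeasure (volume : Measure UnitAddCircle) :=
  inferInstanceAs (Measure.IsAddHaarMeasure AddCircle.haarAddCircle)

local instance : IsProbabilityMeasure (volume : Measure UnitAddCircle) :=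
  inferInstanceAs (IsProbabilityMeasure AddCircle.haarAddCircle)

open UnitAddTorus

section Fourier

variable {r : ℕ} {T : Type*} [TopologicalSpace T] [ChartedSpace (EuclideanSpace ℝ (Fin r)) T]
  [CommGroup T] [LieGroup (𝓡 r) ∞ T] [T2Space T] [CompactSpace T] [ConnectedSpace T]
  (ξ : Module.Basis (Fin r) ℝ (LieAlg r T))
  (hξ : ∀ x, torusExp ξ x = 1 ↔ ∀ i, ∃ k : ℤ, x i = k)

include hξ in
lemma periodic_oneParam (i : Fin r) : Function.Periodic (oneParam (ξ i)) 1 := by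
  have h1 : oneParam (ξ i) 1 = 1 := by
    rw [← torusExp_single, hξ]
    intro j
    rcases eq_or_ne j i with rfl | h
    · exact ⟨1, by simp⟩
    · exact ⟨0, by simp [Pi.single_eq_of_ne h]⟩
  intro t
  rw [oneParam_add, h1, mul_one]

/-- The parametrization of the torus by `(ℝ / ℤ)^r`. -/
def torusParam (θ : UnitAddTorus (Fin r)) : T :=
  ∏ i, (periodic_oneParam ξ hξ i).lift (θ i)

lemma torusParam_coe (x : Fin r → ℝ) :
    torusParam ξ hξ (fun i => (x i : UnitAddCircle)) = torusExp ξ x := rfl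

lemma exists_eq_coe (θ : UnitAddTorus (Fin r)) :
    ∃ x : Fin r → ℝ, θ = fun i => (x i : UnitAddCircle) := by
  choose x hx using fun i => QuotientAddGroup.mk_surjective (θ i)
  exact ⟨x, funext fun i => (hx i).symm⟩

lemma continuous_torusParam : Continuous (torusParam ξ hξ) := by
  have : IsTopologicalGroup T := topologicalGroup_of_lieGroup (𝓡 r) ∞
  refine continuous_finsetProd _ fun i _ => ?_
  have h : Continuous (periodic_oneParam ξ hξ i).lift :=
    (continuous_oneParam (ξ i)).quotient_lift _
  exact h.comp (continuous_apply i)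

lemma surjective_torusParam : Function.Surjective (torusParam ξ hξ) := fun t => by
  obtain ⟨x, hx⟩ := surjective_torusExp ξ t
  exact ⟨_, (torusParam_coe ξ hξ x).trans hx⟩

lemma torusParam_add_coe (θ : UnitAddTorus (Fin r)) (x : Fin r → ℝ) :
    torusParam ξ hξ (θ + fun i => (x i : UnitAddCircle)) = torusParam ξ hξ θ * torusExp ξ x := by
  obtain ⟨y, rfl⟩ := exists_eq_coe θ
  rw [torusParam_coe, ← torusExp_add, ← torusParam_coe ξ hξ (y + x)]
  rfl

/-- The weight with integral coordinates `k`. -/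
def intWeight (k : Fin r → ℤ) : Weight r T := (exists_weight_of_int ξ hξ k).choose

lemma intWeight_lin (k : Fin r → ℤ) (i : Fin r) : (intWeight ξ hξ k).lin (ξ i) = k i :=
  (exists_weight_of_int ξ hξ k).choose_spec i

lemma intWeight_bijective : Function.Bijective (intWeight ξ hξ) := by
  constructor
  · intro k l h
    ext i
    have := congrArg (fun ν : Weight r T => ν.lin (ξ i)) h
    simp only [intWeight_lin] at this
    exact_mod_cast this
  · intro ν
    choose k hk using ν.exists_int ξ hξ
    refine ⟨k, Weight.eq_of_lin_eq ξ (ξ.ext fun i => ?_)⟩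
    rw [intWeight_lin, hk]

lemma intWeight_torusParam (k : Fin r → ℤ) (θ : UnitAddTorus (Fin r)) :
    (intWeight ξ hξ k).fn (torusParam ξ hξ θ) = mFourier k θ := by
  obtain ⟨x, rfl⟩ := exists_eq_coe θ
  rw [torusParam_coe, Weight.fn_torusExp]
  simp only [intWeight_lin, mFourier, ContinuousMap.coe_mk, fourier_coe_apply, ← Complex.exp_sum]
  congr 1
  push_cast
  rw [Finset.mul_sum]
  refine Finset.sum_congr rfl fun i _ => ?_
  ring

/-- The pull-back of a function to `(ℝ / ℤ)^r`. -/
def torusPull (f : SmoothFn (𝓡 r) T) : C(UnitAddTorus (Fin r), ℂ) :=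
  (toCont (𝓡 r) T f).comp ⟨_, continuous_torusParam ξ hξ⟩

/-- The Fourier coefficients of a function on a torus. -/
def fourierCoef (k : Fin r → ℤ) : SmoothFn (𝓡 r) T →ₗ[ℂ] ℂ where
  toFun f := mFourierCoeff (torusPull ξ hξ f) k
  map_add' f g := by
    have hi : ∀ f : SmoothFn (𝓡 r) T, Integrable fun t : UnitAddTorus (Fin r) => mFourier (-k) t • torusPull ξ hξ f t :=
      fun f => (Continuous.integrable_of_hasCompactSupport (by fun_prop)
        (HasCompactSupport.of_compactSpace _))
    unfold mFourierCoeff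
    rw [← integral_add (hi f) (hi g)]
    refine integral_congr_ae (Eventually.of_forall fun t => ?_)
    exact smul_add _ _ _
  map_smul' c f := by
    unfold mFourierCoeff
    rw [RingHom.id_apply, smul_eq_mul, ← integral_const_mul]
    refine integral_congr_ae (Eventually.of_forall fun t => ?_)
    exact mul_left_comm _ _ _

lemma fourierCoef_weight (k l : Fin r → ℤ) :
    fourierCoef ξ hξ k (intWeight ξ hξ l).fn = if k = l then 1 else 0 := by
  have h1 : torusPull ξ hξ (intWeight ξ hξ l).fn = mFourier l := by
    ext θ
    exact intWeight_torusParam ξ hξ l θ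
  change mFourierCoeff (torusPull ξ hξ (intWeight ξ hξ l).fn) k = _
  rw [h1, ← mFourierCoeff_toLp, ← mFourierBasis_repr]
  have h2 : ContinuousMap.toLp 2 volume ℂ (mFourier l) = mFourierBasis (d := Fin r) l := by
    rw [coe_mFourierBasis]
  rw [h2, HilbertBasis.repr_self, lp.single_apply, Pi.single_apply]

lemma norm_fourierCoef_le (k : Fin r → ℤ) (f : SmoothFn (𝓡 r) T) :
    ‖fourierCoef ξ hξ k f‖ ≤ ‖toCont (𝓡 r) T f‖ := by
  refine (norm_integral_le_of_norm_le_const (C := ‖toCont (𝓡 r) T f‖)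
    (Eventually.of_forall fun t => ?_)).trans (by simp)
  rw [norm_smul]
  have h1 : ‖mFourier (-k) t‖ ≤ 1 := (ContinuousMap.norm_coe_le_norm _ _).trans mFourier_norm.le
  exact (mul_le_of_le_one_left (norm_nonneg _) h1).trans (norm_apply_le_toCont f _)

/-- Translation of `f` along the one-parameter subgroup of `ξ i` multiplies the coefficient by
`exp(2πi k_i s)`, by invariance of the measure. Differentiate at `s = 0` under the integral. -/
lemma fourierCoef_leftInvField (k : Fin r → ℤ) (f : SmoothFn (𝓡 r) T) (i : Fin r) :
    fourierCoef ξ hξ k (leftInvField (ξ i) f) =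
      2 * Real.pi * Complex.I * k i * fourierCoef ξ hξ k f := by
  set W := (intWeight ξ hξ (-k)).fn
  set Ψ := torusParam ξ hξ
  set φ := oneParam (ξ i)
  have hΨ : Continuous Ψ := continuous_torusParam ξ hξ
  have : IsTopologicalGroup T := topologicalGroup_of_lieGroup (𝓡 r) ∞
  have hc : ∀ f : SmoothFn (𝓡 r) T, Continuous f := fun f => f.contMDiff.continuous
  have h1 : ∀ f, fourierCoef ξ hξ k f = ∫ θ, W (Ψ θ) * f (Ψ θ) := by
    intro f
    refine integral_congr_ae (Eventually.of_forall fun t => ?_)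
    exact congrArg (· * f (Ψ t)) (intWeight_torusParam ξ hξ (-k) t).symm
  have h2 : ∀ s : ℝ, ∫ θ, W (Ψ θ) * f (Ψ θ * φ s) =
      Complex.exp (2 * Real.pi * Complex.I * (k i * s)) * fourierCoef ξ hξ k f := by
    intro s
    have h3 : ∀ θ, W (Ψ θ) * f (Ψ θ * φ s) = Complex.exp (2 * Real.pi * Complex.I * (k i * s)) *
        (fun θ => W (Ψ θ) * f (Ψ θ))
          (θ + fun j => (((Pi.single i s : Fin r → ℝ) j : ℝ) : UnitAddCircle)) := by
      intro θ
      have h4 := torusParam_add_coe ξ hξ θ (Pi.single i s)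
      rw [torusExp_single] at h4
      simp only [Ψ, h4, W, φ, Weight.fn_mul, Weight.fn_oneParam, intWeight_lin]
      rw [mul_left_comm (Complex.exp _)]
      have h5 : Complex.exp (2 * Real.pi * Complex.I * ((((-k) i : ℤ) : ℝ) * s)) *
          Complex.exp (2 * Real.pi * Complex.I * (k i * s)) = 1 := by
        rw [← Complex.exp_add]
        simp
      rw [mul_assoc (W (torusParam ξ hξ θ)), ← mul_assoc (Complex.exp _) (Complex.exp _), h5,
        one_mul]
    rw [integral_congr_ae (Eventually.of_forall h3), integral_const_mul, h1,
      integral_add_right_eq_self (fun θ => W (Ψ θ) * f (Ψ θ))]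
  have h3 : HasDerivAt (fun s : ℝ => ∫ θ, W (Ψ θ) * f (Ψ θ * φ s))
      (∫ θ, W (Ψ θ) * leftInvField (ξ i) f (Ψ θ * φ 0)) 0 := by
    refine (hasDerivAt_integral_of_dominated_loc_of_deriv_le (s := univ)
      (bound := fun _ => ‖toCont (𝓡 r) T (leftInvField (ξ i) f)‖)
      (F' := fun s θ => W (Ψ θ) * leftInvField (ξ i) f (Ψ θ * φ s)) univ_mem
      ?_ ?_ ?_ ?_ ?_ ?_).2
    · refine Eventually.of_forall fun s => Continuous.aestronglyMeasurable ?_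
      exact ((hc W).comp hΨ).mul ((hc f).comp (hΨ.mul continuous_const))
    · refine Continuous.integrable_of_hasCompactSupport ?_ (HasCompactSupport.of_compactSpace _)
      exact ((hc W).comp hΨ).mul ((hc f).comp (hΨ.mul continuous_const))
    · refine Continuous.aestronglyMeasurable ?_
      exact ((hc W).comp hΨ).mul ((hc _).comp (hΨ.mul continuous_const))
    · refine Eventually.of_forall fun θ s _ => ?_
      rw [norm_mul, Weight.fn_apply, Circle.norm_coe, one_mul]
      exact norm_apply_le_toCont _ _
    · exact integrable_const _
    · refine Eventually.of_forall fun θ s _ => ?_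
      have h4 := hasDerivAt_oneParam (ξ i) (leftTrans (Ψ θ) f) s
      rw [leftInvField_leftTrans] at h4
      exact h4.const_mul _
  rw [funext h2] at h3
  have h4 : HasDerivAt (fun s : ℝ => Complex.exp (2 * Real.pi * Complex.I * (k i * s)) *
      fourierCoef ξ hξ k f) (2 * Real.pi * Complex.I * k i * fourierCoef ξ hξ k f) 0 := by
    have h5 := ((((hasDerivAt_id (0 : ℝ)).ofReal_comp.const_mul (k i : ℂ)).const_mul
      (2 * Real.pi * Complex.I : ℂ)).cexp).mul_const (fourierCoef ξ hξ k f)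
    refine h5.congr_deriv ?_
    simp
  rw [h1, ← h3.unique h4]
  simp [φ]

/-- Rapid decay of the Fourier coefficients. -/
theorem exists_fourierCoef_bound (N : ℕ) : ∃ q : SmoothFn (𝓡 r) T → ℝ, Continuous q ∧ q 0 = 0 ∧
    ∀ k f, intSize k ^ N * ‖fourierCoef ξ hξ k f‖ ≤ q f := by
  induction N with
  | zero =>
    refine ⟨fun f => ‖toCont (𝓡 r) T f‖, (continuous_toCont_iterDer []).norm, by simp,
      fun k f => ?_⟩
    rw [pow_zero, one_mul]
    exact norm_fourierCoef_le ξ hξ k f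
  | succ N ih =>
    obtain ⟨q, hq, hq0, h⟩ := ih
    -- Since `intSize k = 1 + Σ |k_i|` and `2π ≥ 1`, one more power of `intSize k` costs the
    -- coefficients of `f` and of its first derivatives. Continuity of `q` and `q 0 = 0` are
    -- recorded in order to prove continuity of Fourier multipliers later.
    refine ⟨fun f => q f + ∑ i, q (leftInvField (ξ i) f), hq.add (continuous_finsetSum _ fun i _ =>
      hq.comp (continuous_der _)), by simp [hq0], fun k f => ?_⟩
    have h0 := one_le_intSize k
    have h1 : intSize k ^ (N + 1) * ‖fourierCoef ξ hξ k f‖ = intSize k ^ N * ‖fourierCoef ξ hξ k f‖ +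
        ∑ i, intSize k ^ N * (|(k i : ℝ)| * ‖fourierCoef ξ hξ k f‖) := by
      rw [← Finset.mul_sum, ← Finset.sum_mul, pow_succ]
      conv_lhs => rw [show intSize k ^ N * intSize k = intSize k ^ N * (1 + ∑ i, |(k i : ℝ)|) from rfl]
      ring
    rw [h1]
    refine add_le_add (h k f) (Finset.sum_le_sum fun i _ => le_trans ?_ (h k _))
    rw [fourierCoef_leftInvField]
    refine mul_le_mul_of_nonneg_left ?_ (by positivity)
    rw [norm_mul]
    refine mul_le_mul_of_nonneg_right ?_ (norm_nonneg _)
    rw [norm_mul, norm_mul, norm_mul, Complex.norm_I, Complex.norm_real, Complex.norm_intCast]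
    have := Real.pi_gt_three
    rw [Real.norm_of_nonneg Real.pi_pos.le, mul_one]
    refine le_mul_of_one_le_left (abs_nonneg _) ?_
    norm_num
    linarith

lemma iterDer_intWeight (k : Fin r → ℤ) (v : List (Fin r)) : ∃ c : ℂ,
    iterDer (v.map fun b => leftInvField (ξ b)) (intWeight ξ hξ k).fn = c • (intWeight ξ hξ k).fn ∧
    ‖c‖ ≤ (2 * Real.pi * intSize k) ^ v.length := by
  induction v with
  | nil => exact ⟨1, by simp [iterDer], by simp⟩
  | cons b v ih =>
    obtain ⟨c, h1, h2⟩ := ih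
    refine ⟨c * (2 * Real.pi * Complex.I * k b), ?_, ?_⟩
    · rw [List.map_cons, iterDer_cons, h1, Derivation.map_smul, Weight.leftInvField_fn,
        intWeight_lin, smul_smul]
      simp
    · rw [norm_mul, List.length_cons, pow_succ]
      refine mul_le_mul h2 ?_ (norm_nonneg _) (by have := one_le_intSize k; positivity)
      rw [norm_mul, norm_mul, norm_mul, Complex.norm_I, Complex.norm_real, Complex.norm_intCast,
        Real.norm_of_nonneg Real.pi_pos.le, mul_one]
      have := abs_le_intSize k b
      norm_num
      exact mul_le_mul_of_nonneg_left (by linarith) (by positivity)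

lemma summable_intSize_mul (N : ℕ) (f : SmoothFn (𝓡 r) T) :
    Summable fun k => intSize k ^ N * ‖fourierCoef ξ hξ k f‖ := by
  obtain ⟨q, -, -, hq⟩ := exists_fourierCoef_bound ξ hξ (N + 2 * r)
  refine Summable.of_nonneg_of_le (fun k => ?_) (fun k => ?_)
    ((summable_intSize r).mul_right (q f))
  · have := one_le_intSize k
    positivity
  · have h0 := one_le_intSize k
    rw [inv_mul_eq_div, le_div_iff₀ (by positivity)]
    refine le_trans (le_of_eq ?_) (hq k f)
    ring

/-- The Fourier series of a smooth function on a torus converges in `C^∞`. -/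
theorem hasSum_fourier (f : SmoothFn (𝓡 r) T) :
    HasSum (fun k => fourierCoef ξ hξ k f • (intWeight ξ hξ k).fn) f := by
  have h1 := summable_iterDer_of_leftInvField ξ
    (fun k => fourierCoef ξ hξ k f • (intWeight ξ hξ k).fn) (fun v => by
      refine Summable.of_nonneg_of_le (fun _ => norm_nonneg _) (fun k => ?_)
        ((summable_intSize_mul ξ hξ v.length f).mul_left ((2 * Real.pi) ^ v.length))
      obtain ⟨c, h1, h2⟩ := iterDer_intWeight ξ hξ k v
      rw [map_smul, h1, map_smul, map_smul, norm_smul, norm_smul]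
      have h3 : ‖toCont (𝓡 r) T (intWeight ξ hξ k).fn‖ ≤ 1 := by
        refine (ContinuousMap.norm_le _ zero_le_one).2 fun t => ?_
        exact (Circle.norm_coe _).le
      calc ‖fourierCoef ξ hξ k f‖ * (‖c‖ * ‖toCont (𝓡 r) T (intWeight ξ hξ k).fn‖)
          ≤ ‖fourierCoef ξ hξ k f‖ * ((2 * Real.pi * intSize k) ^ v.length * 1) := by
            have := one_le_intSize k
            gcongr
        _ = _ := by ring)
  obtain ⟨F, hF⟩ := exists_hasSum_smoothFn _ h1
  -- The series converges in `C^∞` to some `F`. It is identified with `f` pointwise, where an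
  -- absolutely summable Fourier series converges to the function.
  convert hF
  ext t
  obtain ⟨θ, rfl⟩ := surjective_torusParam ξ hξ t
  have h2 : HasSum (fun k => fourierCoef ξ hξ k f * mFourier k θ) (F (torusParam ξ hξ θ)) := by
    have := hF.map (SmoothFn.eval (torusParam ξ hξ θ)) (continuous_smoothFn_eval _)
    refine this.congr_fun fun k => ?_
    rw [← intWeight_torusParam ξ hξ k θ]
    rfl
  have h3 : Summable (mFourierCoeff (torusPull ξ hξ f)) := by
    refine Summable.of_norm ((summable_intSize_mul ξ hξ 0 f).congr fun k => ?_)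
    rw [pow_zero, one_mul]
    rfl
  have h4 := hasSum_mFourier_series_apply_of_summable h3 θ
  exact h4.unique h2

end Fourier

end

/-! ### A maximal torus is its own centralizer -/

/-- A group with commuting elements. -/
abbrev commGroupOf {T : Type*} [Group T] (h : ∀ s t : T, s * t = t * s) : CommGroup T :=
  { ‹Group T› with mul_comm := h }

/-- The curve `x` is only assumed continuous at `0`, as for a lift to a subgroup. Injectivity of `D`
gives `x = O(D x)`, so `h s - h 0 = D (x s) + o(D (x s))` and hence `D (x s) = O(s)`. Then `D (x s /
s)` tends to `v`, and the range of `D` is closed. -/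
lemma mem_range_of_hasFDerivAt {E F : Type*} [NormedAddCommGroup E] [NormedSpace ℝ E]
    [FiniteDimensional ℝ E] [NormedAddCommGroup F] [NormedSpace ℝ F] {g : E → F} {D : E →L[ℝ] F}
    (hg : HasFDerivAt g D 0) (hD : Function.Injective D) {h : ℝ → F} {v : F}
    (hh : HasDerivAt h v 0) {x : ℝ → E} (hx : Tendsto x (𝓝 0) (𝓝 0))
    (hgh : ∀ᶠ s in 𝓝 0, g (x s) = h s) (h0 : g 0 = h 0) : v ∈ LinearMap.range D.toLinearMap := by
  obtain ⟨K, -, hK⟩ := D.toLinearMap.exists_antilipschitzWith (LinearMap.ker_eq_bot.2 hD)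
  have h1 : (fun s => x s) =O[𝓝 0] fun s => D (x s) :=
    Asymptotics.IsBigO.of_bound K (Eventually.of_forall fun s => by
      have := hK.le_mul_dist (x s) 0
      simpa [dist_eq_norm] using this)
  have h2 : (fun s => g (x s) - g 0 - D (x s)) =o[𝓝 0] x := by
    have := (hasFDerivAt_iff_isLittleO.1 hg).comp_tendsto hx
    simpa [Function.comp_def] using this
  have h3 : (fun s => (h s - h 0) - D (x s)) =o[𝓝 0] fun s => D (x s) :=
    (h2.trans_isBigO h1).congr' (by
      filter_upwards [hgh] with s hs
      rw [hs, h0]) EventuallyEq.rfl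
  have h4 : (fun s => h s - h 0) =O[𝓝 0] fun s : ℝ => s := by
    have := hh.hasFDerivAt.isBigO_sub
    simpa using this
  have h5 : (fun s => D (x s)) =O[𝓝 0] fun s : ℝ => s :=
    (h3.right_isBigO_add.congr_right fun s => sub_add_cancel _ _).trans h4
  have h6 := h3.trans_isBigO h5
  have h7 : Tendsto (fun s : ℝ => s⁻¹ • D (x s)) (𝓝[≠] 0) (𝓝 v) := by
    have h8 := hasDerivAt_iff_tendsto_slope.1 hh
    have h9 : Tendsto (fun s : ℝ => s⁻¹ • ((h s - h 0) - D (x s))) (𝓝[≠] 0) (𝓝 0) := by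
      exact h6.tendsto_inv_smul_nhds_zero.mono_left nhdsWithin_le_nhds
    have := h8.sub h9
    rw [sub_zero] at this
    refine this.congr fun s => ?_
    rw [slope_def_module, sub_zero, ← smul_sub, sub_sub_cancel]
  have hc : IsClosed (LinearMap.range D.toLinearMap : Set F) :=
    Submodule.closed_of_finiteDimensional _
  refine hc.mem_of_tendsto h7 (Eventually.of_forall fun s => ?_)
  exact ⟨s⁻¹ • x s, by simp⟩

section

variable {n r : ℕ} {G : Type*} [TopologicalSpace G] [ChartedSpace (EuclideanSpace ℝ (Fin n)) G]
  [Group G] [LieGroup (𝓡 n) ∞ G] [T2Space G]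

/-- A homomorphism of Lie groups maps one-parameter subgroups to one-parameter subgroups. -/
lemma map_oneParam {T : Type*} [TopologicalSpace T] [ChartedSpace (EuclideanSpace ℝ (Fin r)) T]
    [Group T] [LieGroup (𝓡 r) ∞ T] [T2Space T] (φ : T →* G) (hφ : ContMDiff (𝓡 r) (𝓡 n) ∞ φ)
    (η : LieAlg r T) (ξ : LieAlg n G) (h : (dMap φ 1 η : EuclideanSpace ℝ (Fin n)) = ξ) (t : ℝ) :
    φ (oneParam η t) = oneParam ξ t := by
  refine congrFun (eq_oneParam_of_hom (γ := fun t => φ (oneParam η t))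
    ((hφ.comp (contMDiff_oneParam η)).mdifferentiable (by simp))
    (fun s t => by rw [oneParam_add, map_mul]) ξ fun f => ?_) t
  have h1 := hasDerivAt_oneParam η (SmoothFn.mk _ (f.contMDiff.comp hφ)) 0
  rw [oneParam_zero, leftInvField_one] at h1
  refine h1.congr_deriv ?_
  have h2 := dAt_comp (f := f) (φ := φ) (t := 1) (f.mdifferentiableAt _)
    (hφ.mdifferentiable (by simp) 1)
  rw [map_one] at h2
  rw [← h]
  exact congrArg (fun L : EuclideanSpace ℝ (Fin r) →L[ℝ] ℂ => L η) h2

variable (β : InvariantInner n G) (e : Module.Basis (Fin n) ℝ (LieAlg n G))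
  (he : ∀ a b, β.form (e a) (e b) = if a = b then 1 else 0)

include he in
lemma InvariantInner.sum_form_mul_form (ξ η : LieAlg n G) :
    ∑ b, β.form ξ (e b) * β.form η (e b) = β.form ξ η := by
  conv_rhs => rw [← β.sum_form_smul e he η, map_sum]
  refine Finset.sum_congr rfl fun b _ => ?_
  rw [map_smul, smul_eq_mul, mul_comm]

include he in
/-- If `[ξ, η] = 0`, then the left and right invariant fields of `η` agree along `exp(tξ)`. -/
lemma rightInvField_eq_leftInvField_of_lie_eq_zero {ξ η : LieAlg n G} (h : ⁅ξ, η⁆ = 0) (t : ℝ)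
    (f : SmoothFn (𝓡 n) G) :
    rightInvField η f (oneParam ξ t) = leftInvField η f (oneParam ξ t) := by
  obtain ⟨y, hη, hy, h1⟩ := β.exists_adCoord e he η
  -- Along `exp(tξ)` the coefficients of the right invariant field solve the linear equation with
  -- matrix `A`. The constant vector of coordinates of `η` solves the same equation because `[ξ, η]
  -- = 0`, and the two agree at `t = 0`.
  let A : (Fin n → ℂ) →L[ℂ] (Fin n → ℂ) := LinearMap.toContinuousLinearMap
    (Matrix.mulVecLin (Matrix.of fun d b => (β.form ⁅ξ, e d⁆ (e b) : ℂ)))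
  have hA : ∀ z d, A z d = ∑ b, (β.form ⁅ξ, e d⁆ (e b) : ℂ) * z b := fun z d => rfl
  have h2 : ∀ t, HasDerivAt (fun t d => y d (oneParam ξ t)) (A fun d => y d (oneParam ξ t)) t := by
    intro t
    rw [hasDerivAt_pi]
    intro d
    refine (hasDerivAt_oneParam ξ (y d) t).congr_deriv ?_
    rw [hy, SmoothFn.sum_apply, hA]
    rfl
  have h3 : ∀ t, HasDerivAt (fun (_ : ℝ) d => (β.form η (e d) : ℂ))
      (A fun d => (β.form η (e d) : ℂ)) t := by
    intro t
    refine (hasDerivAt_const t _).congr_deriv ?_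
    ext1 d
    rw [hA]
    have h4 : ∑ b, β.form ⁅ξ, e d⁆ (e b) * β.form η (e b) = 0 := by
      rw [β.sum_form_mul_form e he, ← lie_skew, map_neg, LinearMap.neg_apply, β.invariant, h,
        map_zero, neg_zero]
    change (0 : ℂ) = _
    exact_mod_cast h4.symm
  have hconst := ODE_solution_unique_univ (v := fun _ => A) (s := fun _ => univ) (t₀ := 0)
    (fun _ => A.lipschitz.lipschitzOnWith) (fun t => ⟨h2 t, mem_univ _⟩)
    (fun t => ⟨h3 t, mem_univ _⟩) (by ext d; rw [oneParam_zero, h1])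
  rw [hη, SmoothFn.sum_apply]
  conv_rhs => rw [← β.sum_form_smul e he η, leftInvField_sum, der_sum_apply]
  simp only [leftInvField_smul, Derivation.smul_apply, SmoothFn.sum_apply, SmoothFn.smul_apply,
    SmoothFn.mul_apply]
  refine Finset.sum_congr rfl fun d _ => ?_
  rw [congrFun (congrFun hconst t) d]

-- Conjugation of `exp(tη)` by `g = exp(sξ)` is again a one-parameter subgroup. Its velocity
-- involves the right invariant derivative at `g`, which equals the left invariant one since `[ξ, η]
-- = 0`, so the velocity is `η` and the subgroup is unchanged.
include β e he in
lemma oneParam_comm {ξ η : LieAlg n G} (h : ⁅ξ, η⁆ = 0) (s t : ℝ) :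
    oneParam ξ s * oneParam η t = oneParam η t * oneParam ξ s := by
  set g := oneParam ξ s with hg
  have h1 : (fun t => g⁻¹ * (oneParam η t * g)) = oneParam η := by
    refine eq_oneParam_of_hom ?_ (fun s t => ?_) η fun f => ?_
    · exact (((contMDiff_mulLeft g⁻¹).comp (contMDiff_mulRight g)).comp
        (contMDiff_oneParam η)).mdifferentiable (by simp)
    · rw [oneParam_add]
      group
    · have h2 := hasDerivAt_oneParam η (rightTrans g (leftTrans g⁻¹ f)) 0
      refine h2.congr_deriv ?_
      rw [oneParam_zero, leftInvField_one]
      change rightInvField η (leftTrans g⁻¹ f) g = _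
      rw [rightInvField_eq_leftInvField_of_lie_eq_zero β e he h, ← hg, leftInvField_leftTrans,
        leftTrans_apply, inv_mul_cancel, leftInvField_one]
  have h2 : g⁻¹ * (oneParam η t * g) = oneParam η t := congrFun h1 t
  rw [inv_mul_eq_iff_eq_mul] at h2
  exact h2.symm

end

section MaximalTorus

variable {n r : ℕ} {G : Type*} [TopologicalSpace G] [ChartedSpace (EuclideanSpace ℝ (Fin n)) G]
  [Group G] [LieGroup (𝓡 n) ∞ G] [T2Space G]
  {T : Type*} [TopologicalSpace T] [ChartedSpace (EuclideanSpace ℝ (Fin r)) T] [Group T]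
  [LieGroup (𝓡 r) ∞ T] [T2Space T] [CompactSpace T]

namespace MaxTorus

variable (τ : MaxTorus n r G T)

include τ in
lemma mul_comm (s t : T) : s * t = t * s := by
  refine τ.injective ?_
  rw [map_mul, map_mul]
  exact τ.maximal.prop.2.2 _ ⟨s, rfl⟩ _ ⟨t, rfl⟩

lemma isClosedEmbedding : IsClosedEmbedding τ.incl :=
  τ.smooth.continuous.isClosedEmbedding τ.injective

include τ in
lemma connectedSpace : ConnectedSpace T := by
  have h1 : IsConnected (Set.range τ.incl) := by
    have := τ.maximal.prop.2.1
    rwa [MonoidHom.coe_range] at this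
  have := isConnected_iff_connectedSpace.1 h1
  exact τ.isClosedEmbedding.isEmbedding.toHomeomorph.symm.surjective.connectedSpace
    τ.isClosedEmbedding.isEmbedding.toHomeomorph.symm.continuous

lemma incl_oneParam (η : LieAlg r T) (t : ℝ) :
    τ.incl (oneParam η t) = oneParam (τ.lieIncl η) t :=
  map_oneParam τ.incl τ.smooth η _ rfl t

lemma lieIncl_injective : Function.Injective τ.lieIncl := τ.immersion 1

/-- The torus is its own centralizer. -/
lemma mem_range_of_comm {γ : ℝ → G} (hγ : Continuous γ) (hom : ∀ s t, γ (s + t) = γ s * γ t)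
    (hc : ∀ s t, γ s * τ.incl t = τ.incl t * γ s) (s : ℝ) : γ s ∈ τ.incl.range := by
  have : IsTopologicalGroup G := topologicalGroup_of_lieGroup (𝓡 n) ∞
  have h0 : γ 0 = 1 := by
    have := hom 0 0
    rwa [add_zero, left_eq_mul] at this
  have hcomm : ∀ s t, γ s * γ t = γ t * γ s := fun s t => by rw [← hom, ← hom, add_comm]
  -- The products of torus elements with the curve form a connected abelian subgroup. Its closure is
  -- closed, connected and abelian and contains the torus, so maximality puts it inside the torus.
  let P : Subgroup G :=
    { carrier := Set.range fun p : T × ℝ => τ.incl p.1 * γ p.2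
      one_mem' := ⟨(1, 0), by simp [h0]⟩
      mul_mem' := by
        rintro _ _ ⟨⟨t, s⟩, rfl⟩ ⟨⟨t', s'⟩, rfl⟩
        refine ⟨(t * t', s + s'), ?_⟩
        simp only [map_mul, hom]
        rw [mul_assoc, ← mul_assoc (τ.incl t'), ← hc, mul_assoc, mul_assoc]
      inv_mem' := by
        rintro _ ⟨⟨t, s⟩, rfl⟩
        refine ⟨(t⁻¹, -s), ?_⟩
        have h1 : γ (-s) = (γ s)⁻¹ := by
          rw [eq_inv_iff_mul_eq_one, ← hom, neg_add_cancel, h0]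
        simp only [map_inv, h1]
        rw [← mul_inv_rev, hc] }
  have hP : ∀ x y : P, x * y = y * x := by
    rintro ⟨_, ⟨t, s⟩, rfl⟩ ⟨_, ⟨t', s'⟩, rfl⟩
    refine Subtype.ext ?_
    change τ.incl t * γ s * (τ.incl t' * γ s') = τ.incl t' * γ s' * (τ.incl t * γ s)
    rw [mul_assoc, ← mul_assoc (γ s), hc, mul_assoc, mul_assoc, ← mul_assoc (γ s'), hc s' t,
      mul_assoc, hcomm s s', ← mul_assoc, ← mul_assoc (τ.incl t'), ← map_mul, ← map_mul,
      τ.mul_comm]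
  have h1 : IsConnected (P : Set G) := by
    have := τ.connectedSpace
    exact isConnected_range ((τ.smooth.continuous.comp continuous_fst).mul
      (hγ.comp continuous_snd))
  have h2 := τ.maximal.le_of_ge (y := P.topologicalClosure)
    ⟨P.isClosed_topologicalClosure, h1.closure, fun x hx y hy => congrArg Subtype.val
      ((P.commGroupTopologicalClosure hP).mul_comm ⟨x, hx⟩ ⟨y, hy⟩)⟩ (by
      rintro _ ⟨t, rfl⟩
      exact P.le_topologicalClosure ⟨(t, 0), by simp [h0]⟩)
  exact h2 (P.le_topologicalClosure ⟨(1, s), by simp⟩)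

include τ in
lemma exists_local_param : ∃ (j : (Fin r → ℝ) → T) (L : (Fin r → ℝ) ≃L[ℝ] EuclideanSpace ℝ (Fin r))
    (σ : T → Fin r → ℝ), j 0 = 1 ∧ HasMFDerivAt 𝓘(ℝ, Fin r → ℝ) (𝓡 r) j 0
      (L : (Fin r → ℝ) →L[ℝ] EuclideanSpace ℝ (Fin r)) ∧ σ 1 = 0 ∧ ContinuousAt σ 1 ∧
      ∀ᶠ t in 𝓝 1, j (σ t) = t := by
  let _ : CommGroup T := commGroupOf τ.mul_comm
  let e : Module.Basis (Fin r) ℝ (LieAlg r T) := (EuclideanSpace.basisFun (Fin r) ℝ).toBasis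
  obtain ⟨σ, h1, h2, h3, -⟩ := exists_torusLog e
  exact ⟨torusExp e, basisEquiv e, σ, torusExp_zero e, hasFDerivAt_comp_torusExp e, h2,
    h1.continuousAt, h3⟩

/-- The one-parameter subgroup lifts to `T`, continuously because `T → G` is an embedding. In the
coordinates dual to `e` the preceding differentiability argument, with `T` parametrized near `1`,
shows that the velocity is tangent to `T`. -/
lemma mem_range_lieIncl_of_oneParam (e : Module.Basis (Fin n) ℝ (LieAlg n G)) (ξ : LieAlg n G)
    (h : ∀ s, oneParam ξ s ∈ τ.incl.range) :
    ξ ∈ LinearMap.range τ.lieIncl := by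
  obtain ⟨j, L, σ, hj0, hj, hσ0, hσ, hσj⟩ := τ.exists_local_param
  choose u hu using h
  obtain ⟨y, hy⟩ := exists_dual_fn e
  let D₀ : (Fin r → ℝ) →L[ℝ] EuclideanSpace ℝ (Fin n) := (dMap τ.incl 1).comp
    (L : (Fin r → ℝ) →L[ℝ] EuclideanSpace ℝ (Fin r))
  let D₁ : EuclideanSpace ℝ (Fin n) →L[ℝ] (Fin n → ℂ) :=
    ContinuousLinearMap.pi fun i => dAt n (y i) 1
  have hD₁ : ∀ (η : LieAlg n G) i, D₁ η i = e.repr η i := by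
    intro η i
    change dAt n (y i) 1 η = _
    rw [← leftInvField_one]
    conv_lhs => rw [← e.sum_repr η, leftInvField_sum, der_sum_apply]
    simp only [leftInvField_smul, Derivation.smul_apply, SmoothFn.sum_apply, SmoothFn.smul_apply,
      hy]
    simp
  have hD₁i : Function.Injective D₁ := by
    intro η ζ hηζ
    refine e.repr.injective (Finsupp.ext fun i => ?_)
    have := congrFun hηζ i
    exact Complex.ofReal_injective (((hD₁ η i).symm.trans this).trans (hD₁ ζ i))
  have hu1 : Tendsto u (𝓝 0) (𝓝 1) := by
    have h0 : u 0 = 1 := τ.injective (by rw [hu, oneParam_zero, map_one])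
    have h1 : Continuous u := by
      rw [τ.isClosedEmbedding.isEmbedding.isInducing.continuous_iff]
      refine (continuous_oneParam ξ).congr fun s => ?_
      exact (hu s).symm
    have h2 := h1.tendsto 0
    rwa [h0] at h2
  obtain ⟨z, hz⟩ := mem_range_of_hasFDerivAt (g := fun z i => y i (τ.incl (j z)))
    (D := D₁.comp D₀) (h := fun s i => y i (oneParam ξ s)) (v := D₁ ξ) (x := fun s => σ (u s))
    (by
      rw [hasFDerivAt_pi']
      intro i
      have h1 := HasMFDerivAt.comp (g := τ.incl) 0
        ((τ.smooth.mdifferentiable (by simp) (j 0)).hasMFDerivAt) hj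
      have h2 := HasMFDerivAt.comp (g := y i) 0 ((y i).mdifferentiableAt _).hasMFDerivAt h1
      refine h2.hasFDerivAt.congr_fderiv ?_
      have h3 : (τ.incl ∘ j) 0 = 1 := by rw [Function.comp_apply, hj0, map_one]
      change ((dAt n (y i) ((τ.incl ∘ j) 0)).comp ((dMap τ.incl (j 0)).comp
        (L : (Fin r → ℝ) →L[ℝ] EuclideanSpace ℝ (Fin r))) : (Fin r → ℝ) →L[ℝ] ℂ) = _
      rw [h3, hj0]
      rfl)
    (hD₁i.comp (τ.lieIncl_injective.comp L.injective))
    (by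
      rw [hasDerivAt_pi]
      intro i
      refine (hasDerivAt_oneParam ξ (y i) 0).congr_deriv ?_
      rw [oneParam_zero, leftInvField_one]
      rfl) ((hσ0 ▸ hσ.tendsto).comp hu1) (by
      filter_upwards [hu1.eventually hσj] with s hs
      rw [hs, hu]) (by rw [hj0, map_one, oneParam_zero])
  exact ⟨L z, hD₁i hz⟩

/-- If `ξ` commutes with `𝔱`, then `exp(sξ)` commutes with every `exp(η)`, that is, with all of the
connected group `T`. By maximality it stays in `T`, so `ξ` is tangent to `T`. -/
theorem mem_range_lieIncl (β : InvariantInner n G) (e : Module.Basis (Fin n) ℝ (LieAlg n G))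
    (he : ∀ a b, β.form (e a) (e b) = if a = b then 1 else 0) (ξ : LieAlg n G)
    (h : ∀ η, ⁅τ.lieIncl η, ξ⁆ = 0) : ξ ∈ LinearMap.range τ.lieIncl := by
  refine τ.mem_range_lieIncl_of_oneParam e ξ
    (τ.mem_range_of_comm (continuous_oneParam ξ) (oneParam_add ξ) fun s t => ?_)
  obtain ⟨η, rfl⟩ : ∃ η : LieAlg r T, oneParam η 1 = t := by
    let _ : CommGroup T := commGroupOf τ.mul_comm
    have := τ.connectedSpace
    exact exists_oneParam_eq t
  rw [τ.incl_oneParam]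
  exact (oneParam_comm β e he (h η) 1 s).symm

end MaxTorus

end MaximalTorus

/-- Commuting operators on a nonzero complex vector space have a joint eigenvector. -/
lemma exists_joint_eigenvector {k : ℕ} {V : Type*} [AddCommGroup V] [Module ℂ V]
    [FiniteDimensional ℂ V] [Nontrivial V] (f : Fin k → Module.End ℂ V)
    (hf : ∀ a b, Commute (f a) (f b)) : ∃ v ≠ 0, ∀ a, ∃ μ : ℂ, f a v = μ • v := by
  induction k generalizing V with
  | zero =>
    obtain ⟨v, hv⟩ := exists_ne (0 : V)
    exact ⟨v, hv, fun a => a.elim0⟩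
  | succ k ih =>
    obtain ⟨μ, hμ⟩ := Module.End.exists_eigenvalue (f 0)
    have hm : ∀ a, ∀ v ∈ (f 0).eigenspace μ, f a v ∈ (f 0).eigenspace μ := fun a v hv =>
      Module.End.mapsTo_genEigenspace_of_comm (hf 0 a) μ 1 hv
    have : Nontrivial ((f 0).eigenspace μ) := Submodule.nontrivial_iff_ne_bot.2 hμ
    obtain ⟨v, hv, h⟩ := ih (V := (f 0).eigenspace μ) (fun a => (f a.succ).restrict (hm a.succ))
      fun a b => by
        ext v
        exact congrArg (fun g : Module.End ℂ V => g v) (hf a.succ b.succ).eq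
    refine ⟨v, fun h0 => hv (Subtype.ext h0), fun a => ?_⟩
    refine Fin.cases ⟨μ, Module.End.mem_eigenspace_iff.1 v.2⟩ (fun a => ?_) a
    obtain ⟨ν, hν⟩ := h a
    exact ⟨ν, congrArg Subtype.val hν⟩

/-! ### Complexified Lie algebra and root decomposition -/

section Roots

variable {L A : Type*} [LieRing L] [LieAlgebra ℝ L] [AddCommGroup A] [Module ℝ A]

section

variable (x y z : ℂ ⊗[ℝ] L) (a : ℂ)

lemma lieC_add : ⁅x, y + z⁆ = ⁅x, y⁆ + ⁅x, z⁆ := lie_add x y z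

lemma add_lieC : ⁅x + y, z⁆ = ⁅x, z⁆ + ⁅y, z⁆ := add_lie x y z

@[simp] lemma lieC_zero : ⁅x, (0 : ℂ ⊗[ℝ] L)⁆ = 0 := lie_zero x

@[simp] lemma zero_lieC : ⁅(0 : ℂ ⊗[ℝ] L), x⁆ = 0 := zero_lie x

lemma lieC_smul : ⁅x, a • y⁆ = a • ⁅x, y⁆ := lie_smul a x y

lemma smul_lieC : ⁅a • x, y⁆ = a • ⁅x, y⁆ := smul_lie a x y

lemma lieC_skew : -⁅y, x⁆ = ⁅x, y⁆ := lie_skew x y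

lemma lieC_lieC : ⁅⁅x, y⁆, z⁆ = ⁅x, ⁅y, z⁆⁆ - ⁅y, ⁅x, z⁆⁆ := lie_lie x y z

lemma sum_lieC {ι : Type*} (s : Finset ι) (f : ι → ℂ ⊗[ℝ] L) :
    ⁅∑ j ∈ s, f j, y⁆ = ∑ j ∈ s, ⁅f j, y⁆ := sum_lie s f y

end

/-- Complex conjugation on the complexification of a real Lie algebra. -/
def conjC : ℂ ⊗[ℝ] L →ₗ[ℝ] ℂ ⊗[ℝ] L := Complex.conjAe.toLinearMap.rTensor _

@[simp] lemma conjC_tmul (z : ℂ) (x : L) : conjC (z ⊗ₜ[ℝ] x) = (starRingEnd ℂ z) ⊗ₜ[ℝ] x := rfl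

lemma conjC_smul (z : ℂ) (x : ℂ ⊗[ℝ] L) : conjC (z • x) = (starRingEnd ℂ z) • conjC x := by
  induction x with
  | zero => simp
  | tmul w x => simp [TensorProduct.smul_tmul']
  | add x y hx hy => rw [smul_add, map_add, hx, hy, map_add, smul_add]

@[simp] lemma conjC_conjC (x : ℂ ⊗[ℝ] L) : conjC (conjC x) = x := by
  induction x with
  | zero => simp
  | tmul w x => simp
  | add x y hx hy => rw [map_add, map_add, hx, hy]

lemma conjC_lie (x y : ℂ ⊗[ℝ] L) : conjC ⁅x, y⁆ = ⁅conjC x, conjC y⁆ := by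
  induction x with
  | zero => simp
  | tmul w x =>
    induction y with
    | zero => simp
    | tmul z y => simp [LieAlgebra.ExtendScalars.bracket_tmul]
    | add x y hx hy => rw [lieC_add, map_add, hx, hy, map_add, lieC_add]
  | add x y hx hy => rw [add_lieC, map_add, hx, hy, map_add, add_lie]

lemma exists_eq_tmul_add (x : ℂ ⊗[ℝ] L) : ∃ y z : L, x = 1 ⊗ₜ[ℝ] y + Complex.I ⊗ₜ[ℝ] z := by
  induction x with
  | zero => exact ⟨0, 0, by simp⟩
  | tmul w x =>
    refine ⟨w.re • x, w.im • x, ?_⟩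
    rw [← TensorProduct.smul_tmul, ← TensorProduct.smul_tmul, ← TensorProduct.add_tmul]
    congr 1
    apply Complex.ext <;> simp
  | add x y hx hy =>
    obtain ⟨a, b, rfl⟩ := hx
    obtain ⟨c, d, rfl⟩ := hy
    exact ⟨a + c, b + d, by rw [TensorProduct.tmul_add, TensorProduct.tmul_add]; abel⟩

/-- The complex bilinear extension of a form. -/
abbrev formC (β : LinearMap.BilinForm ℝ L) : LinearMap.BilinForm ℂ (ℂ ⊗[ℝ] L) :=
  LinearMap.BilinForm.baseChange ℂ β

/-- The elements `e ∈ 𝔤_ℂ` with `[ξ, e] = 2πi α(ξ) e`. -/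
def weightSpace (i : A →ₗ[ℝ] L) (α : Module.Dual ℝ A) : Set (ℂ ⊗[ℝ] L) :=
  {e | ∀ ξ, ⁅(1 : ℂ) ⊗ₜ[ℝ] i ξ, e⁆ = (2 * Real.pi * Complex.I * α ξ : ℂ) • e}

/-- A Lie algebra with an invariant inner product, orthonormal bases, and a subalgebra (the image
of `i`) which is its own centralizer. -/
structure IsCartan {n r : ℕ} (i : A →ₗ[ℝ] L) (β : LinearMap.BilinForm ℝ L)
    (e : Module.Basis (Fin n) ℝ L) (t : Module.Basis (Fin r) ℝ A) : Prop where
  symm : ∀ x y, β x y = β y x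
  inv : ∀ x y z, β ⁅x, y⁆ z = β x ⁅y, z⁆
  orth : ∀ a b, β (e a) (e b) = if a = b then 1 else 0
  orthT : ∀ k l, β (i (t k)) (i (t l)) = if k = l then 1 else 0
  comm : ∀ ξ η, ⁅i ξ, i η⁆ = 0
  max : ∀ x, (∀ ξ, ⁅i ξ, x⁆ = 0) → x ∈ LinearMap.range i

namespace IsCartan

variable {n r : ℕ} {i : A →ₗ[ℝ] L} {β : LinearMap.BilinForm ℝ L}
  {e : Module.Basis (Fin n) ℝ L} {t : Module.Basis (Fin r) ℝ A} (h : IsCartan i β e t)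

include h

lemma sum_form_smul (x : L) : ∑ a, β (e a) x • e a = x := by
  conv_rhs => rw [← e.sum_repr x]
  refine Finset.sum_congr rfl fun a _ => ?_
  congr 1
  conv_lhs => rw [← e.sum_repr x, map_sum]
  simp [h.orth]

lemma sum_formT_smul (ξ : A) : ∑ k, β (i (t k)) (i ξ) • t k = ξ := by
  conv_rhs => rw [← t.sum_repr ξ]
  refine Finset.sum_congr rfl fun a _ => ?_
  congr 1
  conv_lhs => rw [← t.sum_repr ξ, map_sum, map_sum]
  simp [h.orthT]

lemma symmC (x y : ℂ ⊗[ℝ] L) : formC β x y = formC β y x := by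
  induction x with
  | zero => simp
  | tmul w x =>
    induction y with
    | zero => simp
    | tmul z y => simp [h.symm x y, mul_comm]
    | add x y hx hy => rw [map_add, hx, hy, map_add, LinearMap.add_apply]
  | add x y hx hy => rw [map_add, LinearMap.add_apply, hx, hy, map_add]

lemma invC (x y z : ℂ ⊗[ℝ] L) : formC β ⁅x, y⁆ z = formC β x ⁅y, z⁆ := by
  induction x with
  | zero => simp
  | add x y hx hy => simp only [add_lieC, map_add, LinearMap.add_apply, hx, hy]
  | tmul a x =>
    induction y with
    | zero => simp
    | add x y hx hy => simp only [add_lieC, lieC_add, map_add, LinearMap.add_apply, hx, hy]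
    | tmul b y =>
      induction z with
      | zero => simp
      | add x y hx hy => simp only [lieC_add, map_add, hx, hy]
      | tmul c z => simp [LieAlgebra.ExtendScalars.bracket_tmul, h.inv, mul_assoc]

omit h in
lemma formC_conj (x y : ℂ ⊗[ℝ] L) :
    formC β (conjC x) (conjC y) = starRingEnd ℂ (formC β x y) := by
  induction x with
  | zero => simp
  | tmul w x =>
    induction y with
    | zero => simp
    | tmul z y => simp
    | add x y hx hy => simp only [map_add, hx, hy]
  | add x y hx hy => simp only [map_add, LinearMap.add_apply, hx, hy]

lemma sum_formC_smul (x : ℂ ⊗[ℝ] L) :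
    ∑ a, formC β (1 ⊗ₜ[ℝ] e a) x • ((1 : ℂ) ⊗ₜ[ℝ] e a) = x := by
  induction x with
  | zero => simp
  | add x y hx hy => simp only [map_add, add_smul, Finset.sum_add_distrib, hx, hy]
  | tmul z x =>
    conv_rhs => rw [← h.sum_form_smul x, TensorProduct.tmul_sum]
    refine Finset.sum_congr rfl fun a _ => ?_
    rw [TensorProduct.tmul_smul, TensorProduct.smul_tmul', TensorProduct.smul_tmul']
    simp

lemma formC_conj_self (x : ℂ ⊗[ℝ] L) :
    formC β (conjC x) x = ((∑ a, ‖formC β (1 ⊗ₜ[ℝ] e a) x‖ ^ 2 : ℝ) : ℂ) := by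
  conv_lhs => rw [← h.sum_formC_smul x]
  rw [map_sum, Complex.ofReal_sum]
  refine Finset.sum_congr rfl fun a _ => ?_
  have h1 : formC β (conjC x) (1 ⊗ₜ[ℝ] e a) = starRingEnd ℂ (formC β (1 ⊗ₜ[ℝ] e a) x) := by
    rw [h.symmC, ← formC_conj, conjC_tmul, map_one]
  rw [h.sum_formC_smul x, map_smul, h1, smul_eq_mul, Complex.mul_conj']
  norm_cast

/-- Positive definiteness of the Hermitian form attached to the inner product, in a shape that
allows comparison of real numbers. -/
lemma exists_formC_conj_self (x : ℂ ⊗[ℝ] L) : ∃ N : ℝ, 0 ≤ N ∧ formC β (conjC x) x = N ∧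
    (N = 0 → x = 0) := by
  refine ⟨_, Finset.sum_nonneg fun a _ => sq_nonneg _, h.formC_conj_self x, fun h0 => ?_⟩
  rw [Finset.sum_eq_zero_iff_of_nonneg fun a _ => sq_nonneg _] at h0
  rw [← h.sum_formC_smul x]
  refine Finset.sum_eq_zero fun a ha => ?_
  have := h0 a ha
  rw [sq_eq_zero_iff, norm_eq_zero] at this
  rw [this, zero_smul]

omit h in
lemma conjC_mem {α : Module.Dual ℝ A} {x : ℂ ⊗[ℝ] L} (hx : x ∈ weightSpace i α) :
    conjC x ∈ weightSpace i (-α) := by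
  intro ξ
  have := congrArg conjC (hx ξ)
  rw [conjC_lie, conjC_smul, conjC_tmul, map_one] at this
  rw [this]
  congr 1
  simp only [map_mul, Complex.conj_ofReal, Complex.conj_I, map_ofNat, LinearMap.neg_apply,
    Complex.ofReal_neg]
  ring

omit h in
lemma lie_mem {α γ : Module.Dual ℝ A} {x y : ℂ ⊗[ℝ] L} (hx : x ∈ weightSpace i α)
    (hy : y ∈ weightSpace i γ) : ⁅x, y⁆ ∈ weightSpace i (α + γ) := by
  intro ξ
  rw [← sub_add_cancel ⁅(1 : ℂ) ⊗ₜ[ℝ] i ξ, ⁅x, y⁆⁆ ⁅x, ⁅(1 : ℂ) ⊗ₜ[ℝ] i ξ, y⁆⁆, ← lieC_lieC, hx, hy, smul_lieC,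
      lieC_smul, ← add_smul]
  congr 1
  push_cast [LinearMap.add_apply]
  ring

lemma one_tmul_mem (ξ : A) : (1 : ℂ) ⊗ₜ[ℝ] i ξ ∈ weightSpace i (0 : Module.Dual ℝ A) := by
  intro η
  simp [LieAlgebra.ExtendScalars.bracket_tmul, h.comm]

/-- Invariance of the form under some `ξ ∈ 𝔱` with `(α + γ)(ξ) ≠ 0` multiplies the value by a
nonzero scalar and gives zero. -/
lemma formC_eq_zero {α γ : Module.Dual ℝ A} {x y : ℂ ⊗[ℝ] L} (hx : x ∈ weightSpace i α)
    (hy : y ∈ weightSpace i γ) (hne : α + γ ≠ 0) : formC β x y = 0 := by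
  obtain ⟨ξ, hξ⟩ : ∃ ξ, (α + γ) ξ ≠ 0 := by
    by_contra! h0
    exact hne (LinearMap.ext h0)
  have h1 : formC β ⁅x, (1 : ℂ) ⊗ₜ[ℝ] i ξ⁆ y = formC β x ⁅(1 : ℂ) ⊗ₜ[ℝ] i ξ, y⁆ := h.invC _ _ _
  rw [← lieC_skew, hx, hy, map_neg, map_smul, map_smul, LinearMap.neg_apply, LinearMap.smul_apply,
    smul_eq_mul, smul_eq_mul] at h1
  have h2 : (2 * Real.pi * Complex.I * ((α + γ) ξ : ℝ) : ℂ) * formC β x y = 0 := by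
    rw [LinearMap.add_apply]
    push_cast
    linear_combination -h1
  refine (mul_eq_zero.1 h2).resolve_left ?_
  simp [Real.pi_ne_zero]
  exact_mod_cast hξ

/-- An element of weight zero lies in `𝔱_ℂ`. -/
lemma eq_sum_of_mem_zero {x : ℂ ⊗[ℝ] L} (hx : x ∈ weightSpace i (0 : Module.Dual ℝ A)) :
    x = ∑ k, formC β (1 ⊗ₜ[ℝ] i (t k)) x • ((1 : ℂ) ⊗ₜ[ℝ] i (t k)) := by
  have key : ∀ y : L, (∀ ξ, ⁅i ξ, y⁆ = 0) → ∀ z : ℂ, z ⊗ₜ[ℝ] y =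
      ∑ k, formC β (1 ⊗ₜ[ℝ] i (t k)) (z ⊗ₜ[ℝ] y) • ((1 : ℂ) ⊗ₜ[ℝ] i (t k)) := by
    intro y hy z
    obtain ⟨η, rfl⟩ := h.max y hy
    conv_lhs => rw [← h.sum_formT_smul η, map_sum, TensorProduct.tmul_sum]
    refine Finset.sum_congr rfl fun a _ => ?_
    rw [map_smul, TensorProduct.tmul_smul, TensorProduct.smul_tmul', TensorProduct.smul_tmul']
    simp
  obtain ⟨y, z, rfl⟩ := exists_eq_tmul_add x
  -- Maximality of `𝔱` concerns real elements, so the real and imaginary parts are shown separately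
  -- to centralize `𝔱`.
  have h1 : ∀ ξ, ⁅i ξ, y⁆ = 0 ∧ ⁅i ξ, z⁆ = 0 := by
    intro ξ
    have h2 := hx ξ
    simp only [lieC_add, LieAlgebra.ExtendScalars.bracket_tmul, one_mul, mul_one,
      LinearMap.zero_apply, Complex.ofReal_zero, mul_zero, zero_smul] at h2
    have h3 : ∀ a, β (e a) ⁅i ξ, y⁆ = 0 ∧ β (e a) ⁅i ξ, z⁆ = 0 := by
      intro a
      have h4 := congrArg (formC β (1 ⊗ₜ[ℝ] e a)) h2
      rw [map_add, LinearMap.BilinForm.baseChange_tmul, LinearMap.BilinForm.baseChange_tmul,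
        map_zero] at h4
      have h5 := congrArg Complex.re h4
      have h6 := congrArg Complex.im h4
      simp at h5 h6
      exact ⟨h5, h6⟩
    constructor
    · rw [← h.sum_form_smul ⁅i ξ, y⁆]
      exact Finset.sum_eq_zero fun a _ => by rw [(h3 a).1, zero_smul]
    · rw [← h.sum_form_smul ⁅i ξ, z⁆]
      exact Finset.sum_eq_zero fun a _ => by rw [(h3 a).2, zero_smul]
  conv_lhs => rw [key y (fun ξ => (h1 ξ).1) 1, key z (fun ξ => (h1 ξ).2) Complex.I]
  simp only [map_add, add_smul, Finset.sum_add_distrib]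

/-- `[e, ē] = 2πi (e · ē) α` for a root vector `e`, where `𝔱^*` is identified with `𝔱`. -/
lemma lie_conj_eq {α : Module.Dual ℝ A} {x y : ℂ ⊗[ℝ] L} (hx : x ∈ weightSpace i α)
    (hy : y ∈ weightSpace i (-α)) :
    ⁅x, y⁆ = (2 * Real.pi * Complex.I * formC β x y) •
      ∑ k, (α (t k) : ℂ) • ((1 : ℂ) ⊗ₜ[ℝ] i (t k)) := by
  have h1 := lie_mem hx hy
  rw [add_neg_cancel] at h1
  rw [h.eq_sum_of_mem_zero h1, Finset.smul_sum]
  refine Finset.sum_congr rfl fun k _ => ?_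
  rw [← h.invC, hx, map_smul, LinearMap.smul_apply, smul_smul, smul_eq_mul]
  congr 1
  ring

/-- Root spaces are one-dimensional. -/
lemma eq_zero_of_formC_conj_eq_zero {α : Module.Dual ℝ A} (hα : α ≠ 0) {x y : ℂ ⊗[ℝ] L}
    (hx : x ∈ weightSpace i α) (hy : y ∈ weightSpace i α) (hx0 : x ≠ 0)
    (hxy : formC β y (conjC x) = 0) : y = 0 := by
  obtain ⟨N, hN, hN1, hN2⟩ := h.exists_formC_conj_self x
  obtain ⟨N', hN', hN1', hN2'⟩ := h.exists_formC_conj_self y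
  obtain ⟨K, hK, hK1, -⟩ := h.exists_formC_conj_self ⁅x, y⁆
  have hNpos : 0 < N := lt_of_le_of_ne hN fun h0 => hx0 (hN2 h0.symm)
  have h1 : ⁅y, conjC x⁆ = 0 := by
    rw [h.lie_conj_eq hy (conjC_mem hx), hxy, mul_zero, zero_smul]
  -- Pair `[[x, x̄], y]` with `ȳ` in two ways. The Jacobi identity, with `[y, x̄] = 0`, gives the
  -- squared norm `K ≥ 0` of `[x, y]`; the weight of `y` gives `-4π² |α|² N N'` with `N > 0`. Hence
  -- the squared norm `N'` of `y` is zero.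
  have h2 : ⁅⁅x, conjC x⁆, y⁆ = -⁅conjC x, ⁅x, y⁆⁆ := by
    have h3 := lieC_lieC x (conjC x) y
    rw [h3, ← lieC_skew (conjC x) y, h1, neg_zero, lieC_zero, zero_sub]
  have h3 : ⁅⁅x, conjC x⁆, y⁆ =
      (-(4 * Real.pi ^ 2 * N * ∑ k, α (t k) ^ 2 : ℝ) : ℂ) • y := by
    rw [h.lie_conj_eq hx (conjC_mem hx), h.symmC, hN1, smul_lieC, sum_lieC]
    simp only [smul_lieC, hy _, smul_smul, ← Finset.sum_smul, Finset.mul_sum]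
    congr 1
    push_cast
    rw [← Finset.sum_neg_distrib]
    refine Finset.sum_congr rfl fun k _ => ?_
    linear_combination (4 * (Real.pi : ℂ) ^ 2 * N * (α (t k) : ℂ) ^ 2) * Complex.I_sq
  have h4 : formC β ⁅⁅x, conjC x⁆, y⁆ (conjC y) = K := by
    rw [h2, lieC_skew, h.invC, ← conjC_lie, h.symmC, hK1]
  rw [h3, map_smul, LinearMap.smul_apply, h.symmC, hN1', smul_eq_mul] at h4
  have h5 : -(4 * Real.pi ^ 2 * N * ∑ k, α (t k) ^ 2) * N' = K := by exact_mod_cast h4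
  have h6 : 0 < ∑ k, α (t k) ^ 2 := by
    refine lt_of_le_of_ne (Finset.sum_nonneg fun k _ => sq_nonneg _) fun h0 => hα ?_
    refine t.ext fun k => ?_
    have := (Finset.sum_eq_zero_iff_of_nonneg fun k _ => sq_nonneg (α (t k))).1 h0.symm k
      (Finset.mem_univ _)
    simpa using this
  have h7 : 0 < 4 * Real.pi ^ 2 * N * ∑ k, α (t k) ^ 2 := by positivity
  refine hN2' (le_antisymm ?_ hN')
  nlinarith

-- Real elements act by skew-Hermitian operators, so the joint eigenvalues are imaginary and are
-- `2πi` times a real linear form.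
omit h in
lemma exists_weight_of_joint_eigenvector (h : IsCartan i β e t) {y : ℂ ⊗[ℝ] L} (hy0 : y ≠ 0)
    (hy : ∀ k, ∃ μ : ℂ, ⁅(1 : ℂ) ⊗ₜ[ℝ] i (t k), y⁆ = μ • y) :
    ∃ α : Module.Dual ℝ A, y ∈ weightSpace i α := by
  choose μ hμ using hy
  obtain ⟨N, hN, hN1, hN2⟩ := h.exists_formC_conj_self y
  have h1 : ∀ k, (starRingEnd ℂ) (μ k) = -μ k := by
    intro k
    have h2 := h.invC (conjC y) (1 ⊗ₜ[ℝ] i (t k)) y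
    have h3 : ⁅conjC y, (1 : ℂ) ⊗ₜ[ℝ] i (t k)⁆ = -((starRingEnd ℂ) (μ k) • conjC y) := by
      rw [← lieC_skew, ← conjC_smul, ← hμ, conjC_lie, conjC_tmul, map_one]
    rw [h3, hμ, map_neg, map_smul, map_smul, LinearMap.neg_apply, LinearMap.smul_apply, hN1,
      smul_eq_mul, smul_eq_mul, ← neg_mul] at h2
    have h4 := mul_right_cancel₀ (Complex.ofReal_ne_zero.2 fun h0 => hy0 (hN2 h0)) h2
    rw [← neg_eq_iff_eq_neg, h4]
  have h5 : ∀ k, μ k = 2 * Real.pi * Complex.I * ((μ k).im / (2 * Real.pi) : ℝ) := by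
    intro k
    have h6 : (μ k).re = 0 := by
      have := congrArg Complex.re (h1 k)
      rw [Complex.conj_re, Complex.neg_re] at this
      linarith
    have h7 := Complex.re_add_im (μ k)
    rw [h6, Complex.ofReal_zero, zero_add] at h7
    conv_lhs => rw [← h7]
    push_cast
    have := Complex.ofReal_ne_zero.2 Real.pi_ne_zero
    field_simp
  refine ⟨t.constr ℝ fun k => (μ k).im / (2 * Real.pi), fun ξ => ?_⟩
  conv_lhs => rw [← t.sum_repr ξ, map_sum, TensorProduct.tmul_sum, sum_lieC]
  rw [Module.Basis.constr_apply_fintype, Complex.ofReal_sum, Finset.mul_sum, Finset.sum_smul]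
  refine Finset.sum_congr rfl fun k _ => ?_
  have h8 : (1 : ℂ) ⊗ₜ[ℝ] i (t.repr ξ k • t k) = (t.repr ξ k : ℂ) • ((1 : ℂ) ⊗ₜ[ℝ] i (t k)) := by
    rw [map_smul, TensorProduct.tmul_smul, TensorProduct.smul_tmul', TensorProduct.smul_tmul']
    simp
  rw [h8, smul_lieC, hμ, smul_smul]
  congr 1
  conv_lhs => rw [h5 k]
  simp
  ring

end IsCartan

/-- The positive roots with respect to a regular element. -/
def posSet (i : A →ₗ[ℝ] L) (reg : A) : Set (Module.Dual ℝ A) :=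
  {α | (α ≠ 0 ∧ ∃ x ∈ weightSpace i α, x ≠ 0) ∧ 0 < α reg}

/-- A Cartan subalgebra with a regular element and normalized root vectors. -/
structure IsRootData {n r : ℕ} (i : A →ₗ[ℝ] L) (β : LinearMap.BilinForm ℝ L)
    (e : Module.Basis (Fin n) ℝ L) (t : Module.Basis (Fin r) ℝ A) (reg : A)
    (E : Module.Dual ℝ A → ℂ ⊗[ℝ] L) : Prop extends IsCartan i β e t where
  reg_ne : ∀ α : Module.Dual ℝ A, α ≠ 0 → (∃ x ∈ weightSpace i α, x ≠ 0) → α reg ≠ 0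
  mem : ∀ α ∈ posSet i reg, E α ∈ weightSpace i α
  norm : ∀ α ∈ posSet i reg, formC β (E α) (conjC (E α)) = 1

namespace IsRootData

variable {n r : ℕ} {i : A →ₗ[ℝ] L} {β : LinearMap.BilinForm ℝ L}
  {e : Module.Basis (Fin n) ℝ L} {t : Module.Basis (Fin r) ℝ A} {reg : A}
  {E : Module.Dual ℝ A → ℂ ⊗[ℝ] L} (h : IsRootData i β e t reg E)

include h

open Classical in
lemma formC_conj_pos {α γ : Module.Dual ℝ A} (hα : α ∈ posSet i reg) (hγ : γ ∈ posSet i reg) :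
    formC β (conjC (E α)) (E γ) = if α = γ then 1 else 0 := by
  split_ifs with h0
  · rw [h0, h.symmC, h.norm γ hγ]
  · exact h.formC_eq_zero (IsCartan.conjC_mem (h.mem α hα)) (h.mem γ hγ) fun h1 =>
      h0 (neg_add_eq_zero.1 h1)

lemma formC_pos_pos {α γ : Module.Dual ℝ A} (hα : α ∈ posSet i reg) (hγ : γ ∈ posSet i reg) :
    formC β (E α) (E γ) = 0 := by
  refine h.formC_eq_zero (h.mem α hα) (h.mem γ hγ) fun h1 => ?_
  have := congrArg (fun f => f reg) h1
  have h2 := hα.2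
  have h3 := hγ.2
  simp at this
  linarith

lemma formC_conj_conj {α γ : Module.Dual ℝ A} (hα : α ∈ posSet i reg) (hγ : γ ∈ posSet i reg) :
    formC β (conjC (E α)) (conjC (E γ)) = 0 := by
  rw [IsCartan.formC_conj, h.formC_pos_pos hα hγ, map_zero]

lemma formC_tmul_pos (ξ : A) {α : Module.Dual ℝ A} (hα : α ∈ posSet i reg) :
    formC β (1 ⊗ₜ[ℝ] i ξ) (E α) = 0 :=
  h.formC_eq_zero (h.one_tmul_mem ξ) (h.mem α hα) (by rw [zero_add]; exact hα.1.1)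

lemma formC_tmul_conj (ξ : A) {α : Module.Dual ℝ A} (hα : α ∈ posSet i reg) :
    formC β (1 ⊗ₜ[ℝ] i ξ) (conjC (E α)) = 0 :=
  h.formC_eq_zero (h.one_tmul_mem ξ) (IsCartan.conjC_mem (h.mem α hα))
    (by rw [zero_add]; exact neg_ne_zero.2 hα.1.1)

omit h in
lemma formC_tmul_tmul (h : IsCartan i β e t) (k l : Fin r) :
    formC β (1 ⊗ₜ[ℝ] i (t k)) (1 ⊗ₜ[ℝ] i (t l)) = if k = l then 1 else 0 := by
  simp [h.orthT]

/-- The conjugates of the root vectors, paired by the form, are a dual family, so the root vectors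
are linearly independent in a finite-dimensional space. -/
lemma finite_posSet : (posSet i reg).Finite := by
  have : Module.Finite ℝ L := Module.Finite.of_basis e
  have h1 : LinearIndependent ℂ fun α : posSet i reg => E α := by
    refine LinearIndependent.of_pairwise_dual_eq_zero_one (v := fun α : posSet i reg => E α)
      (fun α => formC β (conjC (E α))) ?_ ?_
    · intro α γ hαγ
      rw [h.formC_conj_pos α.2 γ.2, if_neg fun h0 => hαγ (Subtype.ext h0)]
    · intro α
      rw [h.formC_conj_pos α.2 α.2, if_pos rfl]
  have := h1.finite
  exact Set.toFinite _

/-- The finite set of positive roots. -/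
def pos (h : IsRootData i β e t reg E) : Finset (Module.Dual ℝ A) := h.finite_posSet.toFinset

lemma mem_pos {α : Module.Dual ℝ A} : α ∈ h.pos ↔ α ∈ posSet i reg := h.finite_posSet.mem_toFinset

/-- A vector orthogonal to `𝔱` and all root vectors vanishes. -/
lemma eq_zero_of_orthogonal {y : ℂ ⊗[ℝ] L} (h1 : ∀ k, formC β (1 ⊗ₜ[ℝ] i (t k)) y = 0)
    (h2 : ∀ α ∈ posSet i reg, formC β (E α) y = 0)
    (h3 : ∀ α ∈ posSet i reg, formC β (conjC (E α)) y = 0) : y = 0 := by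
  have : Module.Finite ℝ L := Module.Finite.of_basis e
  -- The orthogonal complement is stable under `𝔱`, so if nonzero it contains a joint eigenvector.
  -- Weight zero would put it in `𝔱_ℂ`; a positive or negative weight would make it or its conjugate
  -- orthogonal to, yet in the same one-dimensional root space as, a chosen root vector.
  let Y : Submodule ℂ (ℂ ⊗[ℝ] L) :=
    (⨅ k, LinearMap.ker (formC β (1 ⊗ₜ[ℝ] i (t k)))) ⊓
    ((⨅ α : posSet i reg, LinearMap.ker (formC β (E α))) ⊓
      (⨅ α : posSet i reg, LinearMap.ker (formC β (conjC (E α)))))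
  have hY : ∀ y, y ∈ Y ↔ (∀ k, formC β (1 ⊗ₜ[ℝ] i (t k)) y = 0) ∧
      (∀ α ∈ posSet i reg, formC β (E α) y = 0) ∧
      (∀ α ∈ posSet i reg, formC β (conjC (E α)) y = 0) := by
    intro y
    simp [Y]
  suffices hbot : Y = ⊥ by
    have h4 := (hY y).2 ⟨h1, h2, h3⟩
    rwa [hbot, Submodule.mem_bot] at h4
  by_contra hbot
  let D : Fin r → Module.End ℂ (ℂ ⊗[ℝ] L) := fun k => LieAlgebra.ad ℂ (ℂ ⊗[ℝ] L) (1 ⊗ₜ[ℝ] i (t k))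
  have hD : ∀ k y, D k y = ⁅(1 : ℂ) ⊗ₜ[ℝ] i (t k), y⁆ := fun _ _ => rfl
  have hw : ∀ {α : Module.Dual ℝ A} {x : ℂ ⊗[ℝ] L}, x ∈ weightSpace i α → ∀ k y,
      formC β x y = 0 → formC β x (D k y) = 0 := by
    intro α x hx k y h0
    rw [hD, ← h.invC, ← lieC_skew, hx, map_neg, map_smul, LinearMap.neg_apply,
      LinearMap.smul_apply, h0, smul_zero, neg_zero]
  have hDY : ∀ k, ∀ y ∈ Y, D k y ∈ Y := by
    intro k y hy
    rw [hY] at hy ⊢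
    exact ⟨fun l => hw (h.one_tmul_mem _) k y (hy.1 l),
      fun α hα => hw (h.mem α hα) k y (hy.2.1 α hα),
      fun α hα => hw (IsCartan.conjC_mem (h.mem α hα)) k y (hy.2.2 α hα)⟩
  have : Nontrivial Y := Submodule.nontrivial_iff_ne_bot.2 hbot
  obtain ⟨y, hy0, hy⟩ := exists_joint_eigenvector (fun k => (D k).restrict (hDY k)) fun a b => by
    ext y
    change D a (D b y) = D b (D a y)
    have h4 := lieC_lieC ((1 : ℂ) ⊗ₜ[ℝ] i (t a)) ((1 : ℂ) ⊗ₜ[ℝ] i (t b)) (y : ℂ ⊗[ℝ] L)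
    rw [LieAlgebra.ExtendScalars.bracket_tmul, h.comm, TensorProduct.tmul_zero, zero_lieC] at h4
    exact sub_eq_zero.1 h4.symm
  have hy0 : (y : ℂ ⊗[ℝ] L) ≠ 0 := fun h0 => hy0 (Subtype.ext h0)
  obtain ⟨α, hα⟩ := h.exists_weight_of_joint_eigenvector hy0 fun k => by
    obtain ⟨μ, hμ⟩ := hy k
    exact ⟨μ, congrArg Subtype.val hμ⟩
  obtain ⟨hy1, hy2, hy3⟩ := (hY y).1 y.2
  by_cases hα0 : α = 0
  · subst hα0
    have h5 := h.eq_sum_of_mem_zero hα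
    simp only [hy1, zero_smul, Finset.sum_const_zero] at h5
    exact hy0 h5
  rcases lt_or_gt_of_ne (h.reg_ne α hα0 ⟨y, hα, hy0⟩) with h5 | h5
  · have h6 : conjC (y : ℂ ⊗[ℝ] L) ≠ 0 := fun h0 => hy0 (by rw [← conjC_conjC y.1, h0, map_zero])
    have h7 : -α ∈ posSet i reg :=
      ⟨⟨neg_ne_zero.2 hα0, _, IsCartan.conjC_mem hα, h6⟩, by simpa using h5⟩
    refine h6 (h.eq_zero_of_formC_conj_eq_zero (neg_ne_zero.2 hα0) (h.mem _ h7)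
      (IsCartan.conjC_mem hα) (fun h0 => ?_) ?_)
    · have := h.norm _ h7
      rw [h0] at this
      simp at this
    · rw [IsCartan.formC_conj, h.symmC, hy2 _ h7, map_zero]
  · have h7 : α ∈ posSet i reg := ⟨⟨hα0, y, hα, hy0⟩, h5⟩
    refine hy0 (h.eq_zero_of_formC_conj_eq_zero hα0 (h.mem _ h7) hα (fun h0 => ?_) ?_)
    · have := h.norm _ h7
      rw [h0] at this
      simp at this
    · rw [h.symmC, hy3 _ h7]

lemma eq_sum (x : ℂ ⊗[ℝ] L) : x = ∑ k, formC β (1 ⊗ₜ[ℝ] i (t k)) x • ((1 : ℂ) ⊗ₜ[ℝ] i (t k)) +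
    ∑ α ∈ h.pos, (formC β (conjC (E α)) x • E α + formC β (E α) x • conjC (E α)) := by
  classical
  rw [← sub_eq_zero]
  refine h.eq_zero_of_orthogonal (fun l => ?_) (fun γ hγ => ?_) fun γ hγ => ?_
  · rw [map_sub, map_add, map_sum, map_sum, Finset.sum_eq_zero (s := h.pos), add_zero]
    · simp only [map_smul, formC_tmul_tmul h.toIsCartan]
      simp
    · intro α hα
      rw [map_add, map_smul, map_smul, h.formC_tmul_pos _ (h.mem_pos.1 hα),
        h.formC_tmul_conj _ (h.mem_pos.1 hα), smul_zero, smul_zero, add_zero]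
  · rw [map_sub, map_add, map_sum, map_sum, Finset.sum_eq_zero (s := Finset.univ), zero_add,
      Finset.sum_eq_single_of_mem γ (h.mem_pos.2 hγ)]
    · rw [map_add, map_smul, map_smul, h.formC_pos_pos hγ hγ, h.norm γ hγ]
      simp
    · intro α hα hαγ
      rw [map_add, map_smul, map_smul, h.formC_pos_pos hγ (h.mem_pos.1 hα),
        h.symmC (E γ), h.formC_conj_pos (h.mem_pos.1 hα) hγ, if_neg hαγ]
      simp
    · intro k _
      rw [map_smul, h.symmC (E γ), h.formC_tmul_pos _ hγ, smul_zero]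
  · rw [map_sub, map_add, map_sum, map_sum, Finset.sum_eq_zero (s := Finset.univ), zero_add,
      Finset.sum_eq_single_of_mem γ (h.mem_pos.2 hγ)]
    · rw [map_add, map_smul, map_smul, h.formC_conj_conj hγ hγ, h.symmC _ (E γ), h.norm γ hγ]
      simp
    · intro α hα hαγ
      rw [map_add, map_smul, map_smul, h.formC_conj_conj hγ (h.mem_pos.1 hα),
        h.formC_conj_pos hγ (h.mem_pos.1 hα), if_neg (Ne.symm hαγ)]
      simp
    · intro k _
      rw [map_smul, h.symmC (conjC (E γ)), h.formC_tmul_conj _ hγ, smul_zero]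

/-- The canonical element of `𝔤_ℂ ⊗ 𝔤_ℂ` in terms of the root decomposition. -/
lemma sum_tmul_eq : ∑ a, ((1 : ℂ) ⊗ₜ[ℝ] e a) ⊗ₜ[ℂ] ((1 : ℂ) ⊗ₜ[ℝ] e a) =
    ∑ k, ((1 : ℂ) ⊗ₜ[ℝ] i (t k)) ⊗ₜ[ℂ] ((1 : ℂ) ⊗ₜ[ℝ] i (t k)) +
      ∑ α ∈ h.pos, (E α ⊗ₜ[ℂ] conjC (E α) + conjC (E α) ⊗ₜ[ℂ] E α) := by
  have key : ∀ x y : ℂ ⊗[ℝ] L, ∑ a, ((1 : ℂ) ⊗ₜ[ℝ] e a) ⊗ₜ[ℂ] (formC β x (1 ⊗ₜ[ℝ] e a) • y) =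
      x ⊗ₜ[ℂ] y := by
    intro x y
    conv_rhs => rw [← h.sum_formC_smul x, TensorProduct.sum_tmul]
    refine Finset.sum_congr rfl fun a _ => ?_
    rw [TensorProduct.tmul_smul, TensorProduct.smul_tmul', h.symmC]
  have h1 : ∀ a, ((1 : ℂ) ⊗ₜ[ℝ] e a) ⊗ₜ[ℂ] ((1 : ℂ) ⊗ₜ[ℝ] e a) = _ := fun a =>
    congrArg (((1 : ℂ) ⊗ₜ[ℝ] e a) ⊗ₜ[ℂ] ·) (h.eq_sum ((1 : ℂ) ⊗ₜ[ℝ] e a))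
  rw [Finset.sum_congr rfl fun a _ => h1 a]
  simp only [TensorProduct.tmul_add, TensorProduct.tmul_sum, Finset.sum_add_distrib]
  rw [Finset.sum_comm, Finset.sum_comm (t := h.pos), Finset.sum_comm (t := h.pos)]
  simp only [key]
  rw [add_comm (∑ α ∈ h.pos, _ ⊗ₜ[ℂ] _)]

end IsRootData

end Roots

/-! ### Spin elements and the cubic element of the Clifford algebra -/

section Clifford

variable {L A : Type*} [LieRing L] [LieAlgebra ℝ L] [AddCommGroup A] [Module ℝ A]
  {n r : ℕ} {i : A →ₗ[ℝ] L} {β : LinearMap.BilinForm ℝ L}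
  {e : Module.Basis (Fin n) ℝ L} {t : Module.Basis (Fin r) ℝ A} (h : IsCartan i β e t)

/-- The generator of the Clifford algebra for a complex vector. -/
abbrev clι (β : LinearMap.BilinForm ℝ L) : ℂ ⊗[ℝ] L →ₗ[ℂ] Cliff β :=
  CliffordAlgebra.ι (halfForm β)

/-- The bracket of the complexification as a bilinear map. -/
def lieBil : ℂ ⊗[ℝ] L →ₗ[ℂ] ℂ ⊗[ℝ] L →ₗ[ℂ] ℂ ⊗[ℝ] L :=
  LinearMap.mk₂ ℂ (fun x y => ⁅x, y⁆) add_lieC (fun a x y => smul_lieC x y a) lieC_add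
    (fun a x y => lieC_smul x y a)

lemma lieBil_apply (x y : ℂ ⊗[ℝ] L) : lieBil x y = ⁅x, y⁆ := rfl

/-- The complex linear extension of `clSpin`. -/
def spinC (β : LinearMap.BilinForm ℝ L) (e : Module.Basis (Fin n) ℝ L) :
    ℂ ⊗[ℝ] L →ₗ[ℂ] Cliff β :=
  (-(1 / 2) : ℂ) • ∑ b, LinearMap.mulLeft ℂ (clx β (e b)) ∘ₗ clι β ∘ₗ
    (lieBil.flip ((1 : ℂ) ⊗ₜ[ℝ] e b))

lemma spinC_apply (w : ℂ ⊗[ℝ] L) : spinC β e w = (-(1 / 2) : ℂ) • ∑ b, clι β (1 ⊗ₜ[ℝ] e b) *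
    clι β ⁅w, (1 : ℂ) ⊗ₜ[ℝ] e b⁆ := by
  simp only [spinC, LinearMap.smul_apply, LinearMap.sum_apply]
  rfl

namespace IsCartan

include h

lemma clι_swap (v w : ℂ ⊗[ℝ] L) :
    clι β v * clι β w = algebraMap ℂ _ (formC β v w) - clι β w * clι β v := by
  rw [eq_sub_iff_add_eq, CliffordAlgebra.ι_mul_ι_add_swap]
  congr 1
  have h1 : QuadraticMap.polar (halfForm β) v w = (1 / 2 : ℂ) * (formC β v w + formC β w v) := by
    simp only [QuadraticMap.polar, halfForm, smul_apply,
      LinearMap.BilinMap.toQuadraticMap_apply, map_add, LinearMap.add_apply, smul_eq_mul]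
    ring
  rw [h1, h.symmC w v]
  ring

/-- `∑ [w, e_a] ⊗ e_a = -∑ e_a ⊗ [w, e_a]`. -/
lemma sum_lie_tmul (w : ℂ ⊗[ℝ] L) :
    ∑ a, ⁅w, (1 : ℂ) ⊗ₜ[ℝ] e a⁆ ⊗ₜ[ℂ] ((1 : ℂ) ⊗ₜ[ℝ] e a) =
      -∑ a, ((1 : ℂ) ⊗ₜ[ℝ] e a) ⊗ₜ[ℂ] ⁅w, (1 : ℂ) ⊗ₜ[ℝ] e a⁆ := by
  have h1 : ∀ a, ⁅w, (1 : ℂ) ⊗ₜ[ℝ] e a⁆ = _ := fun a => (h.sum_formC_smul _).symm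
  have h2 : ∀ a b, formC β (1 ⊗ₜ[ℝ] e b) ⁅w, (1 : ℂ) ⊗ₜ[ℝ] e a⁆ =
      -formC β (1 ⊗ₜ[ℝ] e a) ⁅w, (1 : ℂ) ⊗ₜ[ℝ] e b⁆ := by
    intro a b
    rw [← h.invC, ← lieC_skew, map_neg, LinearMap.neg_apply, h.symmC]
  rw [Finset.sum_congr rfl fun a _ => congrArg (· ⊗ₜ[ℂ] ((1 : ℂ) ⊗ₜ[ℝ] e a)) (h1 a),
    Finset.sum_congr rfl fun a _ => congrArg (((1 : ℂ) ⊗ₜ[ℝ] e a) ⊗ₜ[ℂ] ·) (h1 a)]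
  simp only [TensorProduct.sum_tmul, TensorProduct.tmul_sum, TensorProduct.tmul_smul,
    ← TensorProduct.smul_tmul']
  rw [Finset.sum_comm, ← Finset.sum_neg_distrib]
  refine Finset.sum_congr rfl fun b _ => ?_
  rw [← Finset.sum_neg_distrib]
  refine Finset.sum_congr rfl fun a _ => ?_
  rw [h2]
  have h3 : ∀ (c : ℂ) (z : (ℂ ⊗[ℝ] L) ⊗[ℂ] (ℂ ⊗[ℝ] L)), -c • z = -(c • z) := fun c z => neg_smul c z
  exact h3 _ _

lemma sum_bilin_lie {X : Type*} [AddCommGroup X] [Module ℂ X]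
    (Φ : ℂ ⊗[ℝ] L →ₗ[ℂ] ℂ ⊗[ℝ] L →ₗ[ℂ] X) (w : ℂ ⊗[ℝ] L) :
    ∑ a, Φ ⁅w, (1 : ℂ) ⊗ₜ[ℝ] e a⁆ (1 ⊗ₜ[ℝ] e a) = -∑ a, Φ (1 ⊗ₜ[ℝ] e a) ⁅w, (1 : ℂ) ⊗ₜ[ℝ] e a⁆ := by
  have := congrArg (TensorProduct.lift Φ) (h.sum_lie_tmul w)
  simpa using this

lemma sum_formC_smul_map {X : Type*} [AddCommGroup X] [Module ℂ X] (f : ℂ ⊗[ℝ] L →ₗ[ℂ] X)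
    (w : ℂ ⊗[ℝ] L) : ∑ a, formC β w (1 ⊗ₜ[ℝ] e a) • f (1 ⊗ₜ[ℝ] e a) = f w := by
  conv_rhs => rw [← h.sum_formC_smul w, map_sum]
  refine Finset.sum_congr rfl fun a _ => ?_
  rw [map_smul, h.symmC]

/-- Moving a generator through a product of two generators leaves two contractions. Skew symmetry of
`ad w` makes them contribute equally after summation, and the factor `-1/2` normalizes the result to
the bracket. -/
lemma spinC_clι (w v : ℂ ⊗[ℝ] L) :
    spinC β e w * clι β v - clι β v * spinC β e w = clι β ⁅w, v⁆ := by
  rw [spinC_apply, smul_mul_assoc, mul_smul_comm, ← smul_sub, Finset.sum_mul, Finset.mul_sum,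
    ← Finset.sum_sub_distrib]
  have h1 : ∀ x y : ℂ ⊗[ℝ] L, clι β x * clι β y * clι β v - clι β v * (clι β x * clι β y) =
      formC β y v • clι β x - formC β v x • clι β y := by
    intro x y
    rw [mul_assoc, h.clι_swap y v, ← mul_assoc (clι β v), h.clι_swap v x, mul_sub, sub_mul,
      ← Algebra.commutes, ← Algebra.smul_def, ← Algebra.smul_def, mul_assoc]
    abel
  simp only [h1]
  have h2 : ∀ a, formC β ⁅w, (1 : ℂ) ⊗ₜ[ℝ] e a⁆ v = -formC β ⁅w, v⁆ (1 ⊗ₜ[ℝ] e a) := by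
    intro a
    rw [← lieC_skew, map_neg, LinearMap.neg_apply, h.invC, h.symmC]
  have h3 := h.sum_formC_smul_map (clι β ∘ₗ lieBil w) v
  have h4 := h.sum_formC_smul_map (clι β) ⁅w, v⁆
  simp only [LinearMap.comp_apply, lieBil_apply] at h3
  rw [Finset.sum_sub_distrib, h3]
  simp only [h2, neg_smul, Finset.sum_neg_distrib, h4]
  module

/-- The commutator with `spinC w` is a derivation acting by `ad w` on generators; apply it to the
quadratic expression for `spinC v`, use skew symmetry, and conclude with the Jacobi identity. -/
lemma spinC_spinC (w v : ℂ ⊗[ℝ] L) :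
    spinC β e w * spinC β e v - spinC β e v * spinC β e w = spinC β e ⁅w, v⁆ := by
  have h1 : ∀ x y : ℂ ⊗[ℝ] L, spinC β e w * (clι β x * clι β y) -
      (clι β x * clι β y) * spinC β e w = clι β ⁅w, x⁆ * clι β y + clι β x * clι β ⁅w, y⁆ := by
    intro x y
    rw [← h.spinC_clι, ← h.spinC_clι]
    noncomm_ring
  have h5 : spinC β e w * spinC β e v - spinC β e v * spinC β e w = (-(1 / 2) : ℂ) • ∑ b,
      (clι β ⁅w, (1 : ℂ) ⊗ₜ[ℝ] e b⁆ * clι β ⁅v, (1 : ℂ) ⊗ₜ[ℝ] e b⁆ +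
        clι β (1 ⊗ₜ[ℝ] e b) * clι β ⁅w, ⁅v, (1 : ℂ) ⊗ₜ[ℝ] e b⁆⁆) := by
    conv_lhs => rw [spinC_apply v, smul_mul_assoc, mul_smul_comm, ← smul_sub, Finset.sum_mul,
      Finset.mul_sum, ← Finset.sum_sub_distrib]
    simp only [h1]
  have h2 := h.sum_bilin_lie ((LinearMap.mul ℂ (Cliff β)).compl₁₂ (clι β)
    (clι β ∘ₗ lieBil v)) w
  have h3 : ∑ b, clι β ⁅w, (1 : ℂ) ⊗ₜ[ℝ] e b⁆ * clι β ⁅v, (1 : ℂ) ⊗ₜ[ℝ] e b⁆ =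
      -∑ b, clι β (1 ⊗ₜ[ℝ] e b) * clι β ⁅v, ⁅w, (1 : ℂ) ⊗ₜ[ℝ] e b⁆⁆ := h2
  rw [h5, Finset.sum_add_distrib, h3, spinC_apply, neg_add_eq_sub, ← Finset.sum_sub_distrib]
  simp only [lieC_lieC w v, map_sub, mul_sub]

/-- This form reduces all computations with the cubic element to commutators with generators and
spin elements. -/
lemma clGamma_eq : clGamma β e = (1 / 3 : ℂ) • ∑ a, clι β (1 ⊗ₜ[ℝ] e a) *
    spinC β e (1 ⊗ₜ[ℝ] e a) := by
  have h1 : ∀ a b, ∑ c, (β ⁅e a, e b⁆ (e c) : ℂ) • (clx β (e a) * clx β (e b) * clx β (e c)) =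
      clι β (1 ⊗ₜ[ℝ] e a) * (clι β (1 ⊗ₜ[ℝ] e b) * clι β ⁅(1 : ℂ) ⊗ₜ[ℝ] e a, (1 : ℂ) ⊗ₜ[ℝ] e b⁆) := by
    intro a b
    rw [← h.sum_formC_smul_map (clι β) ⁅(1 : ℂ) ⊗ₜ[ℝ] e a, (1 : ℂ) ⊗ₜ[ℝ] e b⁆, Finset.mul_sum,
      Finset.mul_sum]
    refine Finset.sum_congr rfl fun c _ => ?_
    rw [mul_smul_comm, mul_smul_comm, mul_assoc, LieAlgebra.ExtendScalars.bracket_tmul,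
      LinearMap.BilinForm.baseChange_tmul]
    simp [clx]
  simp only [clGamma, h1, spinC_apply, mul_smul_comm, ← Finset.smul_sum, Finset.mul_sum, smul_smul]
  norm_num

lemma clSpin_eq (ξ : L) : clSpin β e ξ = spinC β e (1 ⊗ₜ[ℝ] ξ) := by
  rw [clSpin, spinC_apply]
  congr 1
  refine Finset.sum_congr rfl fun b _ => ?_
  rw [← h.sum_formC_smul_map (clι β) ⁅(1 : ℂ) ⊗ₜ[ℝ] ξ, (1 : ℂ) ⊗ₜ[ℝ] e b⁆, Finset.mul_sum]
  refine Finset.sum_congr rfl fun c _ => ?_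
  rw [mul_smul_comm, LieAlgebra.ExtendScalars.bracket_tmul, LinearMap.BilinForm.baseChange_tmul]
  simp [clx]

/-- `{x_w, γ} = s_w`. -/
lemma clι_clGamma (w : ℂ ⊗[ℝ] L) :
    clι β w * clGamma β e + clGamma β e * clι β w = spinC β e w := by
  rw [h.clGamma_eq, mul_smul_comm, smul_mul_assoc, ← smul_add, Finset.mul_sum, Finset.sum_mul,
    ← Finset.sum_add_distrib]
  have h1 : ∀ v : ℂ ⊗[ℝ] L, clι β w * (clι β v * spinC β e v) + clι β v * spinC β e v * clι β w =
      formC β w v • spinC β e v - clι β v * clι β ⁅w, v⁆ := by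
    intro v
    have h2 : spinC β e v * clι β w = clι β ⁅v, w⁆ + clι β w * spinC β e v :=
      sub_eq_iff_eq_add.1 (h.spinC_clι v w)
    rw [mul_assoc (clι β v), h2, ← mul_assoc, h.clι_swap w v, ← lieC_skew v w, map_neg,
      Algebra.smul_def]
    noncomm_ring
  simp only [h1]
  rw [Finset.sum_sub_distrib, h.sum_formC_smul_map]
  have h3 : ∑ b, clι β (1 ⊗ₜ[ℝ] e b) * clι β ⁅w, (1 : ℂ) ⊗ₜ[ℝ] e b⁆ = (-2 : ℂ) • spinC β e w := by
    rw [spinC_apply, smul_smul]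
    norm_num
  rw [h3]
  module

/-- `[s_w, γ] = 0`. -/
lemma spinC_clGamma (w : ℂ ⊗[ℝ] L) : spinC β e w * clGamma β e = clGamma β e * spinC β e w := by
  rw [← sub_eq_zero, h.clGamma_eq, mul_smul_comm, smul_mul_assoc, ← smul_sub, Finset.mul_sum,
    Finset.sum_mul, ← Finset.sum_sub_distrib]
  have h1 : ∀ x y : ℂ ⊗[ℝ] L, spinC β e w * (clι β x * spinC β e y) -
      (clι β x * spinC β e y) * spinC β e w =
        clι β ⁅w, x⁆ * spinC β e y + clι β x * spinC β e ⁅w, y⁆ := by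
    intro x y
    rw [← h.spinC_clι, ← h.spinC_spinC]
    noncomm_ring
  simp only [h1]
  have h2 : ∑ b, clι β ⁅w, (1 : ℂ) ⊗ₜ[ℝ] e b⁆ * spinC β e (1 ⊗ₜ[ℝ] e b) =
      -∑ b, clι β (1 ⊗ₜ[ℝ] e b) * spinC β e ⁅w, (1 : ℂ) ⊗ₜ[ℝ] e b⁆ :=
    h.sum_bilin_lie ((LinearMap.mul ℂ (Cliff β)).compl₁₂ (clι β) (spinC β e)) w
  rw [Finset.sum_add_distrib, h2, neg_add_cancel, smul_zero]

/-- `γ²` is central. -/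
lemma clGamma_sq_central (y : Cliff β) :
    clGamma β e * clGamma β e * y = y * (clGamma β e * clGamma β e) := by
  induction y using CliffordAlgebra.left_induction with
  | algebraMap r => exact (Algebra.commutes _ _).symm
  | add x y hx hy => rw [mul_add, add_mul, hx, hy]
  | ι_mul x m hx =>
    -- From `γ x = s - x γ` one gets `γ² x = γ s - s γ + x γ²`, and `s` commutes with `γ`.
    have h1 : clGamma β e * clι β m = spinC β e m - clι β m * clGamma β e :=
      eq_sub_of_add_eq' (h.clι_clGamma m)
    have h2 : clGamma β e * clGamma β e * clι β m = clι β m * (clGamma β e * clGamma β e) := by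
      rw [mul_assoc, h1, mul_sub, ← mul_assoc, h1, ← h.spinC_clGamma]
      noncomm_ring
    rw [← mul_assoc, h2, mul_assoc, hx, mul_assoc]

lemma involute_spinC (w : ℂ ⊗[ℝ] L) : CliffordAlgebra.involute (spinC β e w) = spinC β e w := by
  simp [spinC_apply]

lemma involute_clGamma : CliffordAlgebra.involute (clGamma β e) = -clGamma β e := by
  rw [h.clGamma_eq]
  simp [h.involute_spinC]

/-- `∑ [e_a, e_b] · e_c x_a x_b = -2 s_c`. -/
lemma sum_str_clι (c : Fin n) : ∑ a, ∑ b, (β ⁅e a, e b⁆ (e c) : ℂ) •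
    (clι β (1 ⊗ₜ[ℝ] e a) * clι β (1 ⊗ₜ[ℝ] e b)) = (-2 : ℂ) • spinC β e (1 ⊗ₜ[ℝ] e c) := by
  have h1 : ∀ a, ∑ b, (β ⁅e a, e b⁆ (e c) : ℂ) •
      (clι β (1 ⊗ₜ[ℝ] e a) * clι β (1 ⊗ₜ[ℝ] e b)) =
      clι β (1 ⊗ₜ[ℝ] e a) * clι β ⁅(1 : ℂ) ⊗ₜ[ℝ] e c, (1 : ℂ) ⊗ₜ[ℝ] e a⁆ := by
    intro a
    rw [← h.sum_formC_smul_map (clι β) ⁅(1 : ℂ) ⊗ₜ[ℝ] e c, (1 : ℂ) ⊗ₜ[ℝ] e a⁆, Finset.mul_sum]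
    refine Finset.sum_congr rfl fun b _ => ?_
    rw [mul_smul_comm, LieAlgebra.ExtendScalars.bracket_tmul, LinearMap.BilinForm.baseChange_tmul,
      h.symm ⁅e a, e b⁆, h.inv]
    simp
  rw [Finset.sum_congr rfl fun a _ => h1 a, spinC_apply, smul_smul]
  norm_num

end IsCartan

end Clifford

/-! ### The Lie algebra of a maximal torus as Cartan data -/

section

variable {n r : ℕ} {G : Type*} [TopologicalSpace G] [ChartedSpace (EuclideanSpace ℝ (Fin n)) G]
  [Group G] [LieGroup (𝓡 n) ∞ G] [T2Space G]
  {T : Type*} [TopologicalSpace T] [ChartedSpace (EuclideanSpace ℝ (Fin r)) T] [Group T]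
  [LieGroup (𝓡 r) ∞ T] [T2Space T] [CompactSpace T]

lemma leftInvField_leftInvField_comm_of_comm (hT : ∀ s t : T, s * t = t * s) (ξ η : LieAlg r T)
    (f : SmoothFn (𝓡 r) T) :
    leftInvField ξ (leftInvField η f) = leftInvField η (leftInvField ξ f) := by
  have h1 : ∀ f, rightInvField ξ f = leftInvField ξ f := by
    intro f
    ext t
    rw [rightInvField_apply, leftInvField_apply]
    simp only [hT _ t]
  rw [← h1, ← h1, leftInvField_rightInvField_comm]

lemma lie_eq_zero_of_comm (hT : ∀ s t : T, s * t = t * s) (ξ η : LieAlg r T) : ⁅ξ, η⁆ = 0 := by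
  refine eq_of_dAt_eq (1 : T) fun f => ?_
  rw [← leftInvField_one, leftInvField_lie, Derivation.commutator_apply,
    leftInvField_leftInvField_comm_of_comm hT, sub_self]
  exact (map_zero (dAt r f 1)).symm

namespace MaxTorus

variable (τ : MaxTorus n r G T)

/-- Restriction of functions to the torus. -/
def resFn (f : SmoothFn (𝓡 n) G) : SmoothFn (𝓡 r) T := SmoothFn.mk _ (f.contMDiff.comp τ.smooth)

lemma resFn_apply (f : SmoothFn (𝓡 n) G) (t : T) : τ.resFn f t = f (τ.incl t) := rfl

lemma leftInvField_resFn (ξ : LieAlg r T) (f : SmoothFn (𝓡 n) G) :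
    leftInvField ξ (τ.resFn f) = τ.resFn (leftInvField (τ.lieIncl ξ) f) := by
  ext t
  have h1 := hasDerivAt_oneParam ξ (leftTrans t (τ.resFn f)) 0
  have h2 := hasDerivAt_oneParam (τ.lieIncl ξ) (leftTrans (τ.incl t) f) 0
  have h3 : (fun s => leftTrans t (τ.resFn f) (oneParam ξ s)) =
      fun s => leftTrans (τ.incl t) f (oneParam (τ.lieIncl ξ) s) := by
    ext s
    rw [leftTrans_apply, leftTrans_apply, resFn_apply, map_mul, τ.incl_oneParam]
  rw [h3] at h1
  have h4 := h1.unique h2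
  rw [leftInvField_leftTrans, leftInvField_leftTrans, leftTrans_apply, leftTrans_apply,
    oneParam_zero, oneParam_zero, mul_one, mul_one] at h4
  exact h4

lemma lieIncl_comm (ξ η : LieAlg r T) : ⁅τ.lieIncl ξ, τ.lieIncl η⁆ = 0 := by
  refine eq_of_dAt_eq (1 : G) fun f => ?_
  have h1 : ∀ ξ η, (leftInvField (τ.lieIncl ξ) (leftInvField (τ.lieIncl η) f)) 1 =
      leftInvField ξ (leftInvField η (τ.resFn f)) 1 := by
    intro ξ η
    rw [leftInvField_resFn, leftInvField_resFn, resFn_apply, map_one τ.incl]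
  rw [← leftInvField_one, leftInvField_lie, Derivation.commutator_apply]
  change leftInvField _ _ 1 - leftInvField _ _ 1 = _
  rw [h1, h1, leftInvField_leftInvField_comm_of_comm τ.mul_comm, sub_self]
  exact (map_zero (dAt n f 1)).symm

end MaxTorus

/-- The passage to linear algebra: the root and Clifford computations use only the bracket, the
form, the root vectors and the self-centralizing property recorded here. -/
lemma CartanWeyl.isRootData {τ : MaxTorus n r G T} {β : InvariantInner n G} (c : CartanWeyl τ β) :
    IsRootData τ.lieIncl β.form c.basis c.basisT c.regular c.rootVec where
  symm := β.symm
  inv := β.invariant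
  orth := c.basis_orthonormal
  orthT := c.basisT_orthonormal
  comm := τ.lieIncl_comm
  max := fun ξ h => τ.mem_range_lieIncl β c.basis c.basis_orthonormal ξ h
  reg_ne := fun α h0 h1 => c.regular_ne α ⟨h0, h1⟩
  mem := fun α hα => c.rootVec_mem α hα.1 hα.2
  norm := fun α hα => c.rootVec_norm α hα.1 hα.2

end

/-! ### The square of the cubic Dirac operator -/

section SquareLemma

variable {R : Type*} [Ring R] [Algebra ℂ R]

/-- The square of the cubic Dirac operator. -/
lemma sum_mul_add_sq {n : ℕ} (f : Fin n → Fin n → Fin n → ℂ) (l X S : Fin n → R) (g : R)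
    (h1 : ∀ a b, l a * X b = X b * l a) (h2 : ∀ a, l a * g = g * l a)
    (h3 : ∀ a b, l a * l b - l b * l a = ∑ c, f a b c • l c)
    (h4 : ∀ a b, X a * X b + X b * X a = if a = b then 1 else 0)
    (h5 : ∀ c, ∑ a, ∑ b, f a b c • (X a * X b) = (-2 : ℂ) • S c)
    (h6 : ∀ a, X a * g + g * X a = S a) :
    (∑ a, l a * X a + g) * (∑ a, l a * X a + g) = (1 / 2 : ℂ) • ∑ a, l a * l a + g * g := by
  set Q := (∑ a, l a * X a) * ∑ a, l a * X a with hQ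
  have e1 : Q = ∑ a, ∑ b, l a * l b * (X a * X b) := by
    rw [hQ, Finset.sum_mul_sum]
    refine Finset.sum_congr rfl fun a _ => Finset.sum_congr rfl fun b _ => ?_
    rw [mul_assoc, ← mul_assoc (X a), ← h1 b a]
    noncomm_ring
  have e2 : Q = ∑ a, ∑ b, (l a * l b - ∑ c, f a b c • l c) * ((if a = b then 1 else 0) - X a * X b) := by
    rw [e1, Finset.sum_comm]
    refine Finset.sum_congr rfl fun a _ => Finset.sum_congr rfl fun b _ => ?_
    rw [← h3, ← h4]
    congr 1 <;> abel
  have e3 : ∀ a, ∑ c, f a a c • l c = 0 := fun a => by rw [← h3, sub_self]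
  have e4 : ∑ a, ∑ b, (∑ c, f a b c • l c) * (X a * X b) = (-2 : ℂ) • ∑ c, l c * S c := by
    simp only [Finset.sum_mul]
    have : ∀ a, ∑ b, ∑ c, f a b c • l c * (X a * X b) = ∑ c, ∑ b, f a b c • l c * (X a * X b) :=
      fun a => Finset.sum_comm
    rw [Finset.sum_congr rfl fun a _ => this a, Finset.sum_comm, Finset.smul_sum]
    refine Finset.sum_congr rfl fun c _ => ?_
    rw [← mul_smul_comm, ← h5, Finset.mul_sum]
    refine Finset.sum_congr rfl fun a _ => ?_
    rw [Finset.mul_sum]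
    refine Finset.sum_congr rfl fun b _ => ?_
    rw [smul_mul_assoc, mul_smul_comm]
  -- Exchange both the `l` and the `X` in every term of `Q`: the anticommutator gives `Σ l_a²`, the
  -- bracket of the `l` gives the spin term, and `Q` returns with a minus sign. One solves for `Q`.
  have e5 : Q = ∑ a, l a * l a - Q + (-2 : ℂ) • ∑ c, l c * S c := by
    conv_lhs => rw [e2]
    simp only [mul_sub, sub_mul, Finset.sum_sub_distrib, mul_ite, mul_one, mul_zero,
      Finset.sum_ite_eq, Finset.mem_univ, if_true, e3, e4, Finset.sum_const_zero]
    rw [← e1]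
    abel
  have e6 : Q = (1 / 2 : ℂ) • ∑ a, l a * l a - ∑ c, l c * S c := by
    have : (2 : ℂ) • Q = ∑ a, l a * l a + (-2 : ℂ) • ∑ c, l c * S c := by
      rw [two_smul]
      nth_rewrite 1 [e5]
      abel
    rw [← inv_smul_smul₀ (two_ne_zero' ℂ) Q, this, smul_add, smul_smul]
    norm_num
    abel
  have e7 : (∑ a, l a * X a) * g + g * ∑ a, l a * X a = ∑ c, l c * S c := by
    rw [Finset.sum_mul, Finset.mul_sum, ← Finset.sum_add_distrib]
    refine Finset.sum_congr rfl fun a _ => ?_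
    rw [← h6, mul_add, ← mul_assoc g, ← h2]
    noncomm_ring
  calc _ = Q + ((∑ a, l a * X a) * g + g * ∑ a, l a * X a) + g * g := by rw [hQ]; noncomm_ring
    _ = _ := by rw [e7, e6]; abel

/-- The version for graded right multiplication, where all relations have opposite signs. It follows
from `sum_mul_add_sq` for `-l`, `i X`, `-S` and `-i g`. -/
lemma sum_mul_add_sq_neg {n : ℕ} (f : Fin n → Fin n → Fin n → ℂ) (l X S : Fin n → R) (g : R)
    (h1 : ∀ a b, l a * X b = X b * l a) (h2 : ∀ a, l a * g = g * l a)
    (h3 : ∀ a b, l a * l b - l b * l a = -∑ c, f a b c • l c)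
    (h4 : ∀ a b, X a * X b + X b * X a = if a = b then -1 else 0)
    (h5 : ∀ c, ∑ a, ∑ b, f a b c • (X a * X b) = (-2 : ℂ) • S c)
    (h6 : ∀ a, X a * g + g * X a = -S a) :
    (∑ a, l a * X a + g) * (∑ a, l a * X a + g) = -((1 / 2 : ℂ) • ∑ a, l a * l a) + g * g := by
  have hI : ∀ x y : R, (Complex.I • x) * (Complex.I • y) = -(x * y) := by
    intro x y
    rw [smul_mul_assoc, mul_smul_comm, smul_smul, Complex.I_mul_I, neg_smul, one_smul]
  have key := sum_mul_add_sq f (fun a => -l a) (fun a => Complex.I • X a) (fun a => -S a)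
    (-(Complex.I • g))
    (fun a b => by rw [neg_mul, mul_neg, mul_smul_comm, smul_mul_assoc, h1])
    (fun a => by rw [neg_mul_neg, neg_mul_neg, mul_smul_comm, smul_mul_assoc, h2])
    (fun a b => by
      rw [neg_mul_neg, neg_mul_neg, h3, ← Finset.sum_neg_distrib]
      simp only [smul_neg])
    (fun a b => by
      rw [hI, hI, ← neg_add, h4]
      split_ifs <;> simp)
    (fun c => by
      simp only [hI, smul_neg, Finset.sum_neg_distrib, h5])
    (fun a => by
      rw [mul_neg, neg_mul, hI, hI, neg_neg, neg_neg, h6])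
  have h7 : ∑ a, -l a * Complex.I • X a + -(Complex.I • g) =
      -(Complex.I • (∑ a, l a * X a + g)) := by
    simp only [neg_mul, mul_smul_comm, Finset.sum_neg_distrib, smul_add, Finset.smul_sum, neg_add,
      smul_neg]
  rw [h7, neg_mul_neg, hI, neg_mul_neg, hI] at key
  simp only [neg_mul_neg] at key
  rw [neg_eq_iff_eq_neg] at key
  rw [key]
  abel

lemma anticomm_sum_add {n : ℕ} (P Q : Fin n → R) (g k : R)
    (h1 : ∀ a b, P a * Q b + Q b * P a = 0) (h2 : ∀ a, P a * k + k * P a = 0)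
    (h3 : ∀ b, g * Q b + Q b * g = 0) (h4 : g * k + k * g = 0) :
    (∑ a, P a + g) * (∑ a, Q a + k) + (∑ a, Q a + k) * (∑ a, P a + g) = 0 := by
  have e1 : (∑ a, P a) * (∑ a, Q a) + (∑ a, Q a) * ∑ a, P a = 0 := by
    rw [Finset.sum_mul_sum, Finset.sum_mul_sum, Finset.sum_comm (s := Finset.univ) (t := Finset.univ)
      (f := fun a b => Q a * P b), ← Finset.sum_add_distrib]
    refine Finset.sum_eq_zero fun a _ => ?_
    rw [← Finset.sum_add_distrib]
    exact Finset.sum_eq_zero fun b _ => h1 a b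
  have e2 : (∑ a, P a) * k + k * ∑ a, P a = 0 := by
    rw [Finset.sum_mul, Finset.mul_sum, ← Finset.sum_add_distrib]
    exact Finset.sum_eq_zero fun a _ => h2 a
  have e3 : g * (∑ a, Q a) + (∑ a, Q a) * g = 0 := by
    rw [Finset.sum_mul, Finset.mul_sum, ← Finset.sum_add_distrib]
    exact Finset.sum_eq_zero fun a _ => h3 a
  calc _ = ((∑ a, P a) * (∑ a, Q a) + (∑ a, Q a) * ∑ a, P a) + ((∑ a, P a) * k + k * ∑ a, P a) +
      (g * (∑ a, Q a) + (∑ a, Q a) * g) + (g * k + k * g) := by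
        simp only [add_mul, mul_add]; abel
    _ = 0 := by rw [e1, e2, e3, h4]; simp

lemma sub_mul_self_of_anticomm (x y : R) (h : x * y + y * x = 0) :
    (x - y) * (x - y) = x * x + y * y := by
  have : (x - y) * (x - y) = x * x + y * y - (x * y + y * x) := by noncomm_ring
  rw [this, h, sub_zero]

lemma sub_mul_of_anticomm {x y p : R} (hx : p * x + x * p = 0) (hy : p * y + y * p = 0) :
    (x - y) * p = -(p * (x - y)) := by
  rw [← eq_neg_iff_add_eq_zero] at hx hy
  rw [sub_mul, mul_sub, hx, hy]
  abel

lemma anticomm_sub {x y p a b u v : R} (hx : p * x + x * p = a + u) (hy : p * y + y * p = b + v) :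
    p * (x - y) + (x - y) * p = (a - b) + (u - v) := by
  rw [mul_sub, sub_mul, sub_add_sub_comm, hx, hy]
  abel

end SquareLemma

section CliffordOps

variable {L : Type*} [LieRing L] [LieAlgebra ℝ L] (β : LinearMap.BilinForm ℝ L)

lemma clRight_apply (y c : Cliff β) : clRight β y c = CliffordAlgebra.involute c * y := rfl

end CliffordOps

section TensorOps

variable (S C : Type*) [AddCommGroup S] [Module ℂ S] [AddCommGroup C] [Module ℂ C]

/-- Operators on the first factor. -/
abbrev opL : Module.End ℂ S →ₐ[ℂ] Module.End ℂ (S ⊗[ℂ] C) := Module.End.rTensorAlgHom ℂ S C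

/-- Operators on the second factor. -/
abbrev opR : Module.End ℂ C →ₐ[ℂ] Module.End ℂ (S ⊗[ℂ] C) := Module.End.lTensorAlgHom ℂ C S

variable {S C}

lemma map_eq_opL_mul_opR (D : Module.End ℂ S) (F : Module.End ℂ C) :
    TensorProduct.map D F = opL S C D * opR S C F := by
  ext s c
  rfl

lemma opL_mul_opR (D : Module.End ℂ S) (F : Module.End ℂ C) :
    opL S C D * opR S C F = opR S C F * opL S C D := by
  ext s c
  rfl

lemma op_sum_mul_add_sq {n : ℕ} (f : Fin n → Fin n → Fin n → ℂ) (l : Fin n → Module.End ℂ S)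
    (X Y : Fin n → Module.End ℂ C) (g : Module.End ℂ C)
    (h3 : ∀ a b, l a * l b - l b * l a = ∑ c, f a b c • l c)
    (h4 : ∀ a b, X a * X b + X b * X a = if a = b then 1 else 0)
    (h5 : ∀ c, ∑ a, ∑ b, f a b c • (X a * X b) = (-2 : ℂ) • Y c)
    (h6 : ∀ a, X a * g + g * X a = Y a) :
    (∑ a, opL S C (l a) * opR S C (X a) + opR S C g) *
      (∑ a, opL S C (l a) * opR S C (X a) + opR S C g) =
        (1 / 2 : ℂ) • opL S C (∑ a, l a * l a) + opR S C (g * g) := by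
  rw [sum_mul_add_sq f (fun a => opL S C (l a)) (fun a => opR S C (X a)) (fun a => opR S C (Y a))
    (opR S C g) (fun a b => opL_mul_opR _ _) (fun a => opL_mul_opR _ _)
    (fun a b => by
      rw [← map_mul, ← map_mul, ← map_sub, h3, map_sum]
      simp only [map_smul])
    (fun a b => by
      rw [← map_mul, ← map_mul, ← map_add, h4]
      split_ifs
      · rw [map_one]
      · rw [map_zero])
    (fun c => by
      rw [← map_smul, ← h5, map_sum]
      refine Finset.sum_congr rfl fun a _ => ?_
      rw [map_sum]
      refine Finset.sum_congr rfl fun b _ => ?_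
      rw [map_smul, map_mul])
    (fun a => by rw [← map_mul, ← map_mul, ← map_add, h6]), map_sum]
  simp only [map_mul]

lemma op_sum_mul_add_sq_neg {n : ℕ} (f : Fin n → Fin n → Fin n → ℂ) (l : Fin n → Module.End ℂ S)
    (X Y : Fin n → Module.End ℂ C) (g : Module.End ℂ C)
    (h3 : ∀ a b, l a * l b - l b * l a = -∑ c, f a b c • l c)
    (h4 : ∀ a b, X a * X b + X b * X a = if a = b then -1 else 0)
    (h5 : ∀ c, ∑ a, ∑ b, f a b c • (X a * X b) = (-2 : ℂ) • Y c)
    (h6 : ∀ a, X a * g + g * X a = -Y a) :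
    (∑ a, opL S C (l a) * opR S C (X a) + opR S C g) *
      (∑ a, opL S C (l a) * opR S C (X a) + opR S C g) =
        -((1 / 2 : ℂ) • opL S C (∑ a, l a * l a)) + opR S C (g * g) := by
  rw [sum_mul_add_sq_neg f (fun a => opL S C (l a)) (fun a => opR S C (X a))
    (fun a => opR S C (Y a)) (opR S C g) (fun a b => opL_mul_opR _ _) (fun a => opL_mul_opR _ _)
    (fun a b => by
      rw [← map_mul, ← map_mul, ← map_sub, h3, map_neg, map_sum]
      simp only [map_smul])
    (fun a b => by
      rw [← map_mul, ← map_mul, ← map_add, h4]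
      split_ifs
      · rw [map_neg, map_one]
      · rw [map_zero])
    (fun c => by
      rw [← map_smul, ← h5, map_sum]
      refine Finset.sum_congr rfl fun a _ => ?_
      rw [map_sum]
      refine Finset.sum_congr rfl fun b _ => ?_
      rw [map_smul, map_mul])
    (fun a => by rw [← map_mul, ← map_mul, ← map_add, h6, map_neg]), map_sum]
  simp only [map_mul]

lemma op_anticomm {D D' : Module.End ℂ S} {F F' : Module.End ℂ C} (hD : D * D' = D' * D)
    (hF : F * F' + F' * F = 0) :
    (opL S C D * opR S C F) * (opL S C D' * opR S C F') +
      (opL S C D' * opR S C F') * (opL S C D * opR S C F) = 0 := by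
  have h1 : ∀ (D D' : Module.End ℂ S) (F F' : Module.End ℂ C),
      (opL S C D * opR S C F) * (opL S C D' * opR S C F') = opL S C (D * D') * opR S C (F * F') := by
    intro D D' F F'
    rw [map_mul, map_mul, mul_assoc, ← mul_assoc (opR S C F), ← opL_mul_opR]
    simp only [mul_assoc]
  rw [h1, h1, hD, ← mul_add, ← map_add, hF, map_zero, mul_zero]

lemma op_anticomm_sum {n : ℕ} (F : Module.End ℂ C) (l : Fin n → Module.End ℂ S)
    (X f : Fin n → Module.End ℂ C) (g k : Module.End ℂ C) (hf : ∀ a, F * X a + X a * F = f a)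
    (hk : F * g + g * F = k) :
    opR S C F * (∑ a, opL S C (l a) * opR S C (X a) + opR S C g) +
      (∑ a, opL S C (l a) * opR S C (X a) + opR S C g) * opR S C F =
        ∑ a, opL S C (l a) * opR S C (f a) + opR S C k := by
  have h1 : ∀ a, opR S C F * (opL S C (l a) * opR S C (X a)) +
      opL S C (l a) * opR S C (X a) * opR S C F = opL S C (l a) * opR S C (f a) := by
    intro a
    rw [← mul_assoc, ← opL_mul_opR, mul_assoc, mul_assoc, ← map_mul, ← map_mul, ← mul_add,
      ← map_add, hf]
  rw [← hk, Finset.sum_congr rfl fun a _ => (h1 a).symm, Finset.sum_add_distrib, mul_add, add_mul,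
    Finset.mul_sum, Finset.sum_mul, map_add, map_mul, map_mul]
  abel

lemma op_add_commutator (D D' : Module.End ℂ S) (F F' : Module.End ℂ C) :
    (opL S C D + opR S C F) * (opL S C D' + opR S C F') -
      (opL S C D' + opR S C F') * (opL S C D + opR S C F) =
        opL S C (D * D' - D' * D) + opR S C (F * F' - F' * F) := by
  simp only [add_mul, mul_add, map_sub, map_mul, opL_mul_opR]
  abel

lemma opR_anticomm {F F' : Module.End ℂ C} (h : F * F' + F' * F = 0) :
    opR S C F * opR S C F' = -(opR S C F' * opR S C F) := by
  rw [eq_neg_iff_add_eq_zero, ← map_mul, ← map_mul, ← map_add, h, map_zero]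

lemma op_add_mul_opR (D : Module.End ℂ S) {F P : Module.End ℂ C} (h : F * P = P * F) :
    (opL S C D + opR S C F) * opR S C P = opR S C P * (opL S C D + opR S C F) := by
  rw [add_mul, mul_add, opL_mul_opR, ← map_mul, ← map_mul, h]

lemma op_add_commutator_opR (D : Module.End ℂ S) (F F' : Module.End ℂ C) :
    (opL S C D + opR S C F) * opR S C F' - opR S C F' * (opL S C D + opR S C F) =
      opR S C (F * F' - F' * F) := by
  rw [add_mul, mul_add, opL_mul_opR, add_sub_add_left_eq_sub, ← map_mul, ← map_mul, ← map_sub]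

lemma op_add_add (D D' : Module.End ℂ S) (F F' : Module.End ℂ C) :
    opL S C (D + D') + opR S C (F + F') = (opL S C D + opR S C F) + (opL S C D' + opR S C F') := by
  rw [map_add, map_add, add_add_add_comm]

lemma op_add_smul (a : ℂ) (D : Module.End ℂ S) (F : Module.End ℂ C) :
    opL S C (a • D) + opR S C (a • F) = a • (opL S C D + opR S C F) := by
  rw [map_smul, map_smul, smul_add]

lemma commute_of_anticomm {R : Type*} [Ring R] {i d l : R} (hd : d * d = 0)
    (h : i * d + d * i = l) : l * d = d * l := by
  rw [← h, add_mul, mul_add, mul_assoc, hd, mul_zero, zero_add, ← mul_assoc, ← mul_assoc, hd,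
    zero_mul, add_zero]

lemma sub_commutator {R : Type*} [Ring R] {a b a' b' : R} (h : a * b' = b' * a)
    (h' : a' * b = b * a') :
    (a - b) * (a' - b') - (a' - b') * (a - b) = (a * a' - a' * a) + (b * b' - b' * b) := by
  simp only [sub_mul, mul_sub, h, h']
  abel

end TensorOps

/-! ### The non-commutative Weil algebra as a differential space -/

section Weil

variable {n r : ℕ} {G : Type*} [TopologicalSpace G] [ChartedSpace (EuclideanSpace ℝ (Fin n)) G]
  [Group G] [LieGroup (𝓡 n) ∞ G] [T2Space G] [CompactSpace G] [ConnectedSpace G]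
  {T : Type*} [TopologicalSpace T] [ChartedSpace (EuclideanSpace ℝ (Fin r)) T] [Group T]
  [LieGroup (𝓡 r) ∞ T] [T2Space T] [CompactSpace T]
  {τ : MaxTorus n r G T} {β : InvariantInner n G} (c : CartanWeyl τ β)
  {B : Type*} [AddCommGroup B] [Module ℂ B] [TopologicalSpace B] [IsTopologicalAddGroup B]
  [ContinuousConstSMul ℂ B]

lemma convLeft_apply (ξ : LieAlg n G) (u : Dist n G B) (f : SmoothFn (𝓡 n) G) :
    convLeft ξ u f = u (rightInvField ξ f) := rfl

lemma convRight_apply (ξ : LieAlg n G) (u : Dist n G B) (f : SmoothFn (𝓡 n) G) :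
    convRight ξ u f = u (leftInvField ξ f) := rfl

lemma Dist.ext {u v : Dist n G B} (h : ∀ f, u f = v f) : u = v := DFunLike.ext _ _ h

/-- Two reversals cancel: transposition to distributions reverses products, and right invariant
fields have reversed brackets. -/
lemma convLeft_lie (ξ η : LieAlg n G) : convLeft (B := B) ξ * convLeft η - convLeft η * convLeft ξ =
    convLeft ⁅ξ, η⁆ := by
  ext u
  refine Dist.ext fun f => ?_
  change u (rightInvField η (rightInvField ξ f)) - u (rightInvField ξ (rightInvField η f)) =
    u (rightInvField ⁅ξ, η⁆ f)
  have h1 : rightInvField ξ (rightInvField η f) - rightInvField η (rightInvField ξ f) =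
      -rightInvField ⁅ξ, η⁆ f := by
    rw [← Derivation.commutator_apply, rightInvField_lie]
    rfl
  rw [← map_sub, ← neg_sub, h1, neg_neg]

lemma convRight_lie (ξ η : LieAlg n G) :
    convRight (B := B) ξ * convRight η - convRight η * convRight ξ = -convRight ⁅ξ, η⁆ := by
  ext u
  refine Dist.ext fun f => ?_
  change u (leftInvField η (leftInvField ξ f)) - u (leftInvField ξ (leftInvField η f)) =
    -u (leftInvField ⁅ξ, η⁆ f)
  rw [← map_sub, leftInvField_lie, ← map_neg]
  simp [Derivation.commutator_apply]

lemma convLeft_convRight (ξ η : LieAlg n G) :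
    convLeft (B := B) ξ * convRight η = convRight η * convLeft ξ := by
  ext u
  refine Dist.ext fun f => ?_
  change u (leftInvField η (rightInvField ξ f)) = u (rightInvField ξ (leftInvField η f))
  rw [leftInvField_rightInvField_comm]

lemma convLeft_add (ξ η : LieAlg n G) : convLeft (B := B) (ξ + η) = convLeft ξ + convLeft η := by
  ext u
  refine Dist.ext fun f => ?_
  change u (rightInvField (ξ + η) f) = u (rightInvField ξ f) + u (rightInvField η f)
  rw [rightInvField_add, ← map_add]
  rfl

lemma convRight_add (ξ η : LieAlg n G) :
    convRight (B := B) (ξ + η) = convRight ξ + convRight η := by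
  ext u
  refine Dist.ext fun f => ?_
  change u (leftInvField (ξ + η) f) = u (leftInvField ξ f) + u (leftInvField η f)
  rw [leftInvField_add, ← map_add]
  rfl

lemma convLeft_smul (a : ℝ) (ξ : LieAlg n G) :
    convLeft (B := B) (a • ξ) = (a : ℂ) • convLeft ξ := by
  ext u
  refine Dist.ext fun f => ?_
  change u (rightInvField (a • ξ) f) = (a : ℂ) • u (rightInvField ξ f)
  rw [rightInvField_smul, ← map_smul]
  rfl

lemma convRight_smul (a : ℝ) (ξ : LieAlg n G) :
    convRight (B := B) (a • ξ) = (a : ℂ) • convRight ξ := by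
  ext u
  refine Dist.ext fun f => ?_
  change u (leftInvField (a • ξ) f) = (a : ℂ) • u (leftInvField ξ f)
  rw [leftInvField_smul, ← map_smul]
  rfl

variable (B) in
/-- Convolution from the left as a linear map in `ξ`. -/
def convLeftHom : LieAlg n G →ₗ[ℝ] Module.End ℂ (Dist n G B) where
  toFun := convLeft
  map_add' := convLeft_add
  map_smul' a ξ := by rw [convLeft_smul]; rfl

variable (B) in
/-- Convolution from the right as a linear map in `ξ`. -/
def convRightHom : LieAlg n G →ₗ[ℝ] Module.End ℂ (Dist n G B) where
  toFun := convRight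
  map_add' := convRight_add
  map_smul' a ξ := by rw [convRight_smul]; rfl

include c in
lemma convLeft_lie_basis (a b : Fin n) :
    convLeft (B := B) ⁅c.basis a, c.basis b⁆ =
      ∑ d, (β.form ⁅c.basis a, c.basis b⁆ (c.basis d) : ℂ) • convLeft (c.basis d) := by
  have h1 := congrArg (convLeftHom B) (c.isRootData.sum_form_smul ⁅c.basis a, c.basis b⁆)
  rw [map_sum] at h1
  refine h1.symm.trans (Finset.sum_congr rfl fun d _ => ?_)
  rw [β.symm]
  exact convLeft_smul _ _

include c in
lemma convRight_lie_basis (a b : Fin n) :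
    convRight (B := B) ⁅c.basis a, c.basis b⁆ =
      ∑ d, (β.form ⁅c.basis a, c.basis b⁆ (c.basis d) : ℂ) • convRight (c.basis d) := by
  have h1 := congrArg (convRightHom B) (c.isRootData.sum_form_smul ⁅c.basis a, c.basis b⁆)
  rw [map_sum] at h1
  refine h1.symm.trans (Finset.sum_congr rfl fun d _ => ?_)
  rw [β.symm]
  exact convRight_smul _ _

lemma sum_convLeft_sq : ∑ a, convLeft (B := B) (c.basis a) * convLeft (c.basis a) =
    ∑ a, convRight (c.basis a) * convRight (c.basis a) := by
  ext u
  refine Dist.ext fun f => ?_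
  have h1 := congrArg u (β.casimir_comm c.basis c.basis_orthonormal f)
  rw [map_sum, map_sum] at h1
  have h2 : ∀ (s : Fin n → Dist n G B), (∑ a, s a) f = ∑ a, s a f := fun s =>
    map_sum ({ toFun := fun u => u f, map_zero' := rfl, map_add' := fun _ _ => rfl } :
      Dist n G B →+ B) s _
  rw [LinearMap.sum_apply, LinearMap.sum_apply, h2, h2]
  exact h1

variable (B) in
/-- The left half of the Weil differential. -/
def weilLeft : Module.End ℂ (Dist n G B ⊗[ℂ] Cliff β.form) :=
  ∑ a, opL _ _ (convLeft (c.basis a)) * opR _ _ (clLeft β.form (clx β.form (c.basis a))) +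
    opR _ _ (clLeft β.form (clGamma β.form c.basis))

variable (B) in
/-- The right half of the Weil differential. -/
def weilRight : Module.End ℂ (Dist n G B ⊗[ℂ] Cliff β.form) :=
  ∑ a, opL _ _ (convRight (c.basis a)) * opR _ _ (clRight β.form (clx β.form (c.basis a))) +
    opR _ _ (clRight β.form (clGamma β.form c.basis))

/-- The super commutator with the Dirac element is left multiplication minus graded right
multiplication, and the two halves can be squared separately. -/
lemma weilOps_d_eq : (weilOps B β.form c.basis).d = weilLeft c B - weilRight c B := by
  have h1 : TensorProduct.map (LinearMap.id : Dist n G B →ₗ[ℂ] Dist n G B)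
      (oddAd β.form (clGamma β.form c.basis)) =
      opR _ _ (clLeft β.form (clGamma β.form c.basis)) -
        opR _ _ (clRight β.form (clGamma β.form c.basis)) := by
    rw [← map_sub]
    rfl
  change ∑ a, _ + _ = _
  rw [h1, Finset.sum_sub_distrib, weilLeft, weilRight]
  simp only [map_eq_opL_mul_opR]
  abel

lemma CartanWeyl.clx_swap (a b : Fin n) :
    clx β.form (c.basis a) * clx β.form (c.basis b) + clx β.form (c.basis b) *
      clx β.form (c.basis a) = if a = b then 1 else 0 := by
  have h1 := c.isRootData.clι_swap ((1 : ℂ) ⊗ₜ[ℝ] c.basis a) (1 ⊗ₜ[ℝ] c.basis b)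
  rw [eq_sub_iff_add_eq] at h1
  refine h1.trans ?_
  rw [LinearMap.BilinForm.baseChange_tmul, c.basis_orthonormal]
  split_ifs <;> simp

lemma involute_clx (ξ : LieAlg n G) :
    CliffordAlgebra.involute (clx β.form ξ) = -clx β.form ξ := CliffordAlgebra.involute_ι _

variable (β) in
/-- Right multiplication as an element of the algebra of endomorphisms. -/
def clFlip : Cliff β.form →ₗ[ℂ] Module.End ℂ (Cliff β.form) := (LinearMap.mul ℂ (Cliff β.form)).flip

lemma clLeft_mul (x y : Cliff β.form) :
    (clLeft β.form x * clLeft β.form y : Module.End ℂ (Cliff β.form)) = clLeft β.form (x * y) :=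
  LinearMap.ext fun z => (mul_assoc x y z).symm

/-- Besides reversing the order, graded right multiplication by `x` applies the parity involution to
the factor `y` already present; this is the source of the sign, and of the opposite square of the
right half. -/
lemma clRight_mul (x y : Cliff β.form) (hy : CliffordAlgebra.involute y = -y) :
    (clRight β.form x * clRight β.form y : Module.End ℂ (Cliff β.form)) =
      -clFlip β (y * x) := by
  refine LinearMap.ext fun z => ?_
  change clRight β.form x (clRight β.form y z) = -(z * (y * x))
  rw [clRight_apply, clRight_apply, map_mul, CliffordAlgebra.involute_involute, hy, mul_neg,
    neg_mul, mul_assoc]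

lemma weilLeft_sq : weilLeft c B * weilLeft c B =
    (1 / 2 : ℂ) • opL _ _ (∑ a, convLeft (c.basis a) * convLeft (c.basis a)) +
      opR _ _ (clLeft β.form (clGamma β.form c.basis * clGamma β.form c.basis)) := by
  have h := c.isRootData.toIsCartan
  rw [← clLeft_mul]
  refine op_sum_mul_add_sq (fun a b d => (β.form ⁅c.basis a, c.basis b⁆ (c.basis d) : ℂ)) _ _
    (fun a => clLeft β.form (spinC β.form c.basis (1 ⊗ₜ[ℝ] c.basis a))) _ (fun a b => ?_)
    (fun a b => ?_) (fun d => ?_) fun a => ?_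
  · rw [convLeft_lie, convLeft_lie_basis c]
  · rw [clLeft_mul, clLeft_mul, ← map_add, c.clx_swap]
    split_ifs
    · exact LinearMap.ext fun z => one_mul z
    · exact map_zero _
  · simp only [clLeft_mul]
    have h1 := congrArg (clLeft β.form) (h.sum_str_clι d)
    simp only [map_sum, map_smul] at h1
    exact h1
  · rw [clLeft_mul, clLeft_mul, ← map_add]
    exact congrArg (clLeft β.form) (h.clι_clGamma _)

lemma weilRight_sq : weilRight c B * weilRight c B =
    -((1 / 2 : ℂ) • opL _ _ (∑ a, convRight (c.basis a) * convRight (c.basis a))) -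
      opR _ _ (clFlip β (clGamma β.form c.basis * clGamma β.form c.basis)) := by
  have h := c.isRootData.toIsCartan
  have hγ := h.involute_clGamma
  rw [sub_eq_add_neg, ← map_neg, ← clRight_mul _ _ hγ]
  refine op_sum_mul_add_sq_neg (fun a b d => (β.form ⁅c.basis a, c.basis b⁆ (c.basis d) : ℂ)) _ _
    (fun a => clFlip β (spinC β.form c.basis (1 ⊗ₜ[ℝ] c.basis a))) _ (fun a b => ?_)
    (fun a b => ?_) (fun d => ?_) fun a => ?_
  · rw [convRight_lie, convRight_lie_basis c]
  · rw [clRight_mul _ _ (involute_clx _), clRight_mul _ _ (involute_clx _), ← neg_add, ← map_add,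
      c.clx_swap b a]
    by_cases hab : a = b
    · rw [if_pos hab, if_pos hab.symm]
      exact congrArg Neg.neg (LinearMap.ext fun z => mul_one z)
    · rw [if_neg hab, if_neg (Ne.symm hab), map_zero, neg_zero]
  · have h1 := congrArg (clFlip β) (h.sum_str_clι d)
    simp only [map_sum, map_smul] at h1
    rw [Finset.sum_comm] at h1
    refine Eq.trans ?_ h1
    refine Finset.sum_congr rfl fun a _ => Finset.sum_congr rfl fun b _ => ?_
    rw [clRight_mul _ _ (involute_clx _), ← lie_skew, map_neg, LinearMap.neg_apply,
      Complex.ofReal_neg, neg_smul_neg]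
    rfl
  · rw [clRight_mul _ _ hγ, clRight_mul _ _ (involute_clx _), ← neg_add, ← map_add, add_comm]
    exact congrArg (fun x => -clFlip β x) (h.clι_clGamma _)

lemma clLeft_clRight (x y : Cliff β.form) (hx : CliffordAlgebra.involute x = -x) :
    (clLeft β.form x * clRight β.form y + clRight β.form y * clLeft β.form x :
      Module.End ℂ (Cliff β.form)) = 0 := by
  refine LinearMap.ext fun z => ?_
  change x * (CliffordAlgebra.involute z * y) + CliffordAlgebra.involute (x * z) * y = 0
  rw [map_mul, hx, neg_mul, neg_mul, mul_assoc, add_neg_cancel]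

lemma weilLeft_weilRight : weilLeft c B * weilRight c B + weilRight c B * weilLeft c B = 0 := by
  have hγ := c.isRootData.toIsCartan.involute_clGamma
  refine anticomm_sum_add _ _ _ _ (fun a b => ?_) (fun a => ?_) (fun b => ?_) ?_
  · exact op_anticomm (convLeft_convRight _ _) (clLeft_clRight _ _ (involute_clx _))
  · have := op_anticomm (S := Dist n G B) (D := convLeft (c.basis a)) (D' := 1) rfl
      (clLeft_clRight (clx β.form (c.basis a)) (clGamma β.form c.basis) (involute_clx _))
    rwa [map_one, one_mul] at this
  · have := op_anticomm (S := Dist n G B) (D := 1) (D' := convRight (c.basis b)) rfl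
      (clLeft_clRight (clGamma β.form c.basis) (clx β.form (c.basis b)) hγ)
    rwa [map_one, one_mul] at this
  · rw [← map_mul, ← map_mul, ← map_add, clLeft_clRight _ _ hγ, map_zero]

/-- The halves anticommute, and their squares are `½` the left Casimir plus `γ²`, and minus `½` the
right Casimir minus `γ²`. They cancel since the Casimirs agree and `γ²` is central. -/
lemma weilOps_d_d : (weilOps B β.form c.basis).d ∘ₗ (weilOps B β.form c.basis).d = 0 := by
  change (weilOps B β.form c.basis).d * (weilOps B β.form c.basis).d = 0
  have h2 : clFlip β (clGamma β.form c.basis * clGamma β.form c.basis) =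
      clLeft β.form (clGamma β.form c.basis * clGamma β.form c.basis) :=
    LinearMap.ext fun z => (c.isRootData.toIsCartan.clGamma_sq_central z).symm
  rw [weilOps_d_eq, sub_mul_self_of_anticomm _ _ (weilLeft_weilRight c), weilLeft_sq, weilRight_sq, sum_convLeft_sq, h2]
  abel

lemma oddAd_mul_clLeft (x y : Cliff β.form) (hx : CliffordAlgebra.involute x = -x) :
    (oddAd β.form y * clLeft β.form x + clLeft β.form x * oddAd β.form y :
      Module.End ℂ (Cliff β.form)) = clLeft β.form (y * x + x * y) := by
  refine LinearMap.ext fun z => ?_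
  change y * (x * z) - CliffordAlgebra.involute (x * z) * y +
    x * (y * z - CliffordAlgebra.involute z * y) = (y * x + x * y) * z
  rw [map_mul, hx]
  noncomm_ring

lemma oddAd_mul_clRight (x y : Cliff β.form) (hx : CliffordAlgebra.involute x = -x)
    (hy : CliffordAlgebra.involute y = -y) :
    (oddAd β.form y * clRight β.form x + clRight β.form x * oddAd β.form y :
      Module.End ℂ (Cliff β.form)) = clFlip β (y * x + x * y) := by
  refine LinearMap.ext fun z => ?_
  change y * (CliffordAlgebra.involute z * x) -
    CliffordAlgebra.involute (CliffordAlgebra.involute z * x) * y +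
    CliffordAlgebra.involute (y * z - CliffordAlgebra.involute z * y) * x = z * (y * x + x * y)
  simp only [map_mul, map_sub, hx, hy, CliffordAlgebra.involute_involute]
  noncomm_ring

lemma oddAd_parity (y : Cliff β.form) (hy : CliffordAlgebra.involute y = -y) :
    (oddAd β.form y * clParity β.form + clParity β.form * oddAd β.form y :
      Module.End ℂ (Cliff β.form)) = 0 := by
  refine LinearMap.ext fun z => ?_
  change y * CliffordAlgebra.involute z -
    CliffordAlgebra.involute (CliffordAlgebra.involute z) * y +
    CliffordAlgebra.involute (y * z - CliffordAlgebra.involute z * y) = 0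
  simp only [map_mul, map_sub, hy, CliffordAlgebra.involute_involute]
  noncomm_ring

lemma clLeft_parity (y : Cliff β.form) (hy : CliffordAlgebra.involute y = -y) :
    (clLeft β.form y * clParity β.form + clParity β.form * clLeft β.form y :
      Module.End ℂ (Cliff β.form)) = 0 := by
  refine LinearMap.ext fun z => ?_
  change y * CliffordAlgebra.involute z + CliffordAlgebra.involute (y * z) = 0
  rw [map_mul, hy, neg_mul, add_neg_cancel]

lemma clRight_parity (y : Cliff β.form) (hy : CliffordAlgebra.involute y = -y) :
    (clRight β.form y * clParity β.form + clParity β.form * clRight β.form y :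
      Module.End ℂ (Cliff β.form)) = 0 := by
  refine LinearMap.ext fun z => ?_
  change CliffordAlgebra.involute (CliffordAlgebra.involute z) * y +
    CliffordAlgebra.involute (CliffordAlgebra.involute z * y) = 0
  rw [map_mul, hy, mul_neg, add_neg_cancel]

lemma evenAd_parity (y : Cliff β.form) (hy : CliffordAlgebra.involute y = y) :
    (evenAd β.form y * clParity β.form : Module.End ℂ (Cliff β.form)) =
      clParity β.form * evenAd β.form y := by
  refine LinearMap.ext fun z => ?_
  change y * CliffordAlgebra.involute z - CliffordAlgebra.involute z * y =
    CliffordAlgebra.involute (y * z - z * y)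
  rw [map_sub, map_mul, map_mul, hy]

lemma evenAd_oddAd (x y : Cliff β.form) (hx : CliffordAlgebra.involute x = x) :
    (evenAd β.form x * oddAd β.form y - oddAd β.form y * evenAd β.form x :
      Module.End ℂ (Cliff β.form)) = oddAd β.form (x * y - y * x) := by
  refine LinearMap.ext fun z => ?_
  change x * (y * z - CliffordAlgebra.involute z * y) - (y * z - CliffordAlgebra.involute z * y) * x -
    (y * (x * z - z * x) - CliffordAlgebra.involute (x * z - z * x) * y) =
    (x * y - y * x) * z - CliffordAlgebra.involute z * (x * y - y * x)
  simp only [map_mul, map_sub, hx]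
  noncomm_ring

lemma evenAd_evenAd (x y : Cliff β.form) :
    (evenAd β.form x * evenAd β.form y - evenAd β.form y * evenAd β.form x :
      Module.End ℂ (Cliff β.form)) = evenAd β.form (x * y - y * x) := by
  refine LinearMap.ext fun z => ?_
  change x * (y * z - z * y) - (y * z - z * y) * x - (y * (x * z - z * x) - (x * z - z * x) * y) =
    (x * y - y * x) * z - z * (x * y - y * x)
  noncomm_ring

lemma oddAd_oddAd (x y : Cliff β.form) (hx : CliffordAlgebra.involute x = -x)
    (hy : CliffordAlgebra.involute y = -y) (r : ℂ) (hxy : x * y + y * x = algebraMap ℂ _ r) :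
    (oddAd β.form x * oddAd β.form y + oddAd β.form y * oddAd β.form x :
      Module.End ℂ (Cliff β.form)) = 0 := by
  refine LinearMap.ext fun z => ?_
  change x * (y * z - CliffordAlgebra.involute z * y) -
    CliffordAlgebra.involute (y * z - CliffordAlgebra.involute z * y) * x +
    (y * (x * z - CliffordAlgebra.involute z * x) -
    CliffordAlgebra.involute (x * z - CliffordAlgebra.involute z * x) * y) = 0
  have h1 : x * (y * z - CliffordAlgebra.involute z * y) -
    CliffordAlgebra.involute (y * z - CliffordAlgebra.involute z * y) * x +
    (y * (x * z - CliffordAlgebra.involute z * x) -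
    CliffordAlgebra.involute (x * z - CliffordAlgebra.involute z * x) * y) =
      (x * y + y * x) * z - z * (x * y + y * x) := by
    simp only [map_mul, map_sub, hx, hy, CliffordAlgebra.involute_involute]
    noncomm_ring
  rw [h1, hxy, Algebra.commutes, sub_self]

lemma clx_add (ξ η : LieAlg n G) : clx β.form (ξ + η) = clx β.form ξ + clx β.form η := by
  rw [clx, TensorProduct.tmul_add, map_add]; rfl

lemma clx_smul (a : ℝ) (ξ : LieAlg n G) : clx β.form (a • ξ) = (a : ℂ) • clx β.form ξ := by
  rw [clx, clx, ← map_smul, TensorProduct.tmul_smul, TensorProduct.smul_tmul',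
    TensorProduct.smul_tmul']
  simp

variable (B) in
lemma weilOps_contr_eq (ξ : LieAlg n G) : (weilOps B β.form c.basis).contr ξ =
    opR _ _ (oddAd β.form (clx β.form ξ)) := rfl

variable (B) in
lemma weilOps_lie_eq (ξ : LieAlg n G) : (weilOps B β.form c.basis).lie ξ =
    opL _ _ (convLeft ξ - convRight ξ) +
      opR _ _ (evenAd β.form (spinC β.form c.basis (1 ⊗ₜ[ℝ] ξ))) := by
  rw [← c.isRootData.toIsCartan.clSpin_eq]
  rfl

variable (B) in
lemma weilOps_parity_eq : (weilOps B β.form c.basis).parity = opR _ _ (clParity β.form) := rfl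

lemma weilLeft_anticomm (F : Module.End ℂ (Cliff β.form)) (f : Fin n → Module.End ℂ (Cliff β.form))
    (k : Module.End ℂ (Cliff β.form))
    (hf : ∀ a, F * clLeft β.form (clx β.form (c.basis a)) +
      clLeft β.form (clx β.form (c.basis a)) * F = f a)
    (hk : F * clLeft β.form (clGamma β.form c.basis) +
      clLeft β.form (clGamma β.form c.basis) * F = k) :
    opR _ _ F * weilLeft c B + weilLeft c B * opR _ _ F =
      ∑ a, opL _ _ (convLeft (c.basis a)) * opR _ _ (f a) + opR _ _ k :=
  op_anticomm_sum _ _ _ _ _ _ hf hk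

lemma weilRight_anticomm (F : Module.End ℂ (Cliff β.form)) (f : Fin n → Module.End ℂ (Cliff β.form))
    (k : Module.End ℂ (Cliff β.form))
    (hf : ∀ a, F * clRight β.form (clx β.form (c.basis a)) +
      clRight β.form (clx β.form (c.basis a)) * F = f a)
    (hk : F * clRight β.form (clGamma β.form c.basis) +
      clRight β.form (clGamma β.form c.basis) * F = k) :
    opR _ _ F * weilRight c B + weilRight c B * opR _ _ F =
      ∑ a, opL _ _ (convRight (c.basis a)) * opR _ _ (f a) + opR _ _ k :=
  op_anticomm_sum _ _ _ _ _ _ hf hk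

include c in
lemma sum_convLeft (ξ : LieAlg n G) : ∑ a, (β.form ξ (c.basis a) : ℂ) • convLeft (c.basis a) =
    convLeft (B := B) ξ := by
  have h1 := congrArg (convLeftHom B) (c.isRootData.sum_form_smul ξ)
  rw [map_sum] at h1
  refine Eq.trans (Finset.sum_congr rfl fun d _ => ?_) h1
  rw [β.symm]
  exact (convLeft_smul _ _).symm

include c in
lemma sum_convRight (ξ : LieAlg n G) : ∑ a, (β.form ξ (c.basis a) : ℂ) • convRight (c.basis a) =
    convRight (B := B) ξ := by
  have h1 := congrArg (convRightHom B) (c.isRootData.sum_form_smul ξ)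
  rw [map_sum] at h1
  refine Eq.trans (Finset.sum_congr rfl fun d _ => ?_) h1
  rw [β.symm]
  exact (convRight_smul _ _).symm

include c in
lemma CartanWeyl.clx_swap' (ξ η : LieAlg n G) : clx β.form ξ * clx β.form η + clx β.form η * clx β.form ξ =
    algebraMap ℂ _ (β.form ξ η) := by
  have h1 := c.isRootData.clι_swap ((1 : ℂ) ⊗ₜ[ℝ] ξ) (1 ⊗ₜ[ℝ] η)
  rw [eq_sub_iff_add_eq] at h1
  refine h1.trans ?_
  rw [LinearMap.BilinForm.baseChange_tmul]
  simp

/-- Both halves of the Dirac operator have anticommutator with `ad(x_ξ)` equal to multiplication, on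
the respective side, by `u_ξ` plus the spin element of `ξ`. The difference of the two is the Lie
derivative. -/
lemma weilOps_contr_d (ξ : LieAlg n G) :
    (weilOps B β.form c.basis).contr ξ * (weilOps B β.form c.basis).d +
      (weilOps B β.form c.basis).d * (weilOps B β.form c.basis).contr ξ =
        (weilOps B β.form c.basis).lie ξ := by
  have h := c.isRootData.toIsCartan
  have hγ := h.involute_clGamma
  have h1 := weilLeft_anticomm c (B := B) (oddAd β.form (clx β.form ξ))
    (fun a => (β.form ξ (c.basis a) : ℂ) • 1) (clLeft β.form (spinC β.form c.basis (1 ⊗ₜ[ℝ] ξ)))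
    (fun a => by
      rw [oddAd_mul_clLeft _ _ (involute_clx _), c.clx_swap']
      exact LinearMap.ext fun z => (Algebra.smul_def _ _).symm)
    (by
      rw [oddAd_mul_clLeft _ _ hγ]
      exact congrArg (clLeft β.form) (h.clι_clGamma _))
  have h2 := weilRight_anticomm c (B := B) (oddAd β.form (clx β.form ξ))
    (fun a => (β.form ξ (c.basis a) : ℂ) • 1) (clFlip β (spinC β.form c.basis (1 ⊗ₜ[ℝ] ξ)))
    (fun a => by
      rw [oddAd_mul_clRight _ _ (involute_clx _) (involute_clx _), c.clx_swap']
      exact LinearMap.ext fun z => ((Algebra.smul_def _ _).trans (Algebra.commutes _ _)).symm)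
    (by
      rw [oddAd_mul_clRight _ _ hγ (involute_clx _)]
      exact congrArg (clFlip β) (h.clι_clGamma _))
  simp only [map_smul, map_one, mul_smul_comm, mul_one] at h1 h2
  simp only [← map_smul, ← map_sum, sum_convLeft c, sum_convRight c] at h1 h2
  rw [weilOps_d_eq, weilOps_contr_eq, weilOps_lie_eq, map_sub]
  exact (anticomm_sub h1 h2).trans (congrArg (_ + ·) (map_sub (opR _ _) _ _).symm)

lemma weilOps_d_parity : (weilOps B β.form c.basis).d ∘ₗ (weilOps B β.form c.basis).parity =
    -((weilOps B β.form c.basis).parity ∘ₗ (weilOps B β.form c.basis).d) := by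
  have hγ := c.isRootData.toIsCartan.involute_clGamma
  have h1 := weilLeft_anticomm c (B := B) (clParity β.form) 0 0
    (fun a => by rw [add_comm]; exact clLeft_parity _ (involute_clx _))
    (by rw [add_comm]; exact clLeft_parity _ hγ)
  have h2 := weilRight_anticomm c (B := B) (clParity β.form) 0 0
    (fun a => by rw [add_comm]; exact clRight_parity _ (involute_clx _))
    (by rw [add_comm]; exact clRight_parity _ hγ)
  simp only [Pi.zero_apply, map_zero, mul_zero, Finset.sum_const_zero, add_zero] at h1 h2
  rw [weilOps_d_eq, weilOps_parity_eq]
  exact sub_mul_of_anticomm h1 h2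

lemma weilOps_lie_lie (ξ η : LieAlg n G) :
    (weilOps B β.form c.basis).lie ξ ∘ₗ (weilOps B β.form c.basis).lie η -
      (weilOps B β.form c.basis).lie η ∘ₗ (weilOps B β.form c.basis).lie ξ =
        (weilOps B β.form c.basis).lie ⁅ξ, η⁆ := by
  have h := c.isRootData.toIsCartan
  rw [weilOps_lie_eq, weilOps_lie_eq, weilOps_lie_eq]
  refine (op_add_commutator _ _ _ _).trans (congrArg₂ (fun x y => opL _ _ x + opR _ _ y) ?_ ?_)
  · refine (sub_commutator (convLeft_convRight _ _) (convLeft_convRight _ _)).trans ?_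
    rw [convLeft_lie, convRight_lie, sub_eq_add_neg]
  · rw [evenAd_evenAd, h.spinC_spinC, LieAlgebra.ExtendScalars.bracket_tmul, one_mul]

lemma weilOps_parity_parity : (weilOps B β.form c.basis).parity ∘ₗ
    (weilOps B β.form c.basis).parity = LinearMap.id := by
  rw [weilOps_parity_eq, ← Module.End.mul_eq_comp, ← map_mul]
  refine (congrArg (opR _ _) (LinearMap.ext fun z => ?_)).trans (map_one _)
  exact CliffordAlgebra.involute_involute z

lemma weilOps_contr_parity (ξ : LieAlg n G) : (weilOps B β.form c.basis).contr ξ ∘ₗ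
    (weilOps B β.form c.basis).parity =
      -((weilOps B β.form c.basis).parity ∘ₗ (weilOps B β.form c.basis).contr ξ) := by
  rw [weilOps_contr_eq, weilOps_parity_eq]
  exact opR_anticomm (oddAd_parity _ (involute_clx _))

lemma weilOps_lie_parity (ξ : LieAlg n G) : (weilOps B β.form c.basis).lie ξ ∘ₗ
    (weilOps B β.form c.basis).parity =
      (weilOps B β.form c.basis).parity ∘ₗ (weilOps B β.form c.basis).lie ξ := by
  rw [weilOps_lie_eq, weilOps_parity_eq]
  exact op_add_mul_opR _ (evenAd_parity _ (c.isRootData.toIsCartan.involute_spinC _))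

lemma weilOps_lie_add (ξ η : LieAlg n G) : (weilOps B β.form c.basis).lie (ξ + η) =
    (weilOps B β.form c.basis).lie ξ + (weilOps B β.form c.basis).lie η := by
  have h1 : (1 : ℂ) ⊗ₜ[ℝ] (ξ + η) = (1 : ℂ) ⊗ₜ[ℝ] ξ + 1 ⊗ₜ[ℝ] η := TensorProduct.tmul_add _ _ _
  have h2 : evenAd β.form (spinC β.form c.basis (1 ⊗ₜ[ℝ] (ξ + η))) =
      evenAd β.form (spinC β.form c.basis (1 ⊗ₜ[ℝ] ξ)) +
        evenAd β.form (spinC β.form c.basis (1 ⊗ₜ[ℝ] η)) := by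
    rw [h1, map_add, map_add]
  have h3 : convLeft (ξ + η) - convRight (ξ + η) =
      (convLeft ξ - convRight ξ : Module.End ℂ (Dist n G B)) + (convLeft η - convRight η) := by
    rw [convLeft_add, convRight_add, add_sub_add_comm]
  rw [weilOps_lie_eq, weilOps_lie_eq, weilOps_lie_eq, h2, h3]
  exact op_add_add _ _ _ _

lemma weilOps_lie_smul (a : ℝ) (ξ : LieAlg n G) : (weilOps B β.form c.basis).lie (a • ξ) =
    (a : ℂ) • (weilOps B β.form c.basis).lie ξ := by
  have h1 : (1 : ℂ) ⊗ₜ[ℝ] (a • ξ) = (a : ℂ) • ((1 : ℂ) ⊗ₜ[ℝ] ξ) := by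
    rw [TensorProduct.tmul_smul, TensorProduct.smul_tmul', TensorProduct.smul_tmul']
    simp
  have h2 : evenAd β.form (spinC β.form c.basis (1 ⊗ₜ[ℝ] (a • ξ))) =
      (a : ℂ) • evenAd β.form (spinC β.form c.basis (1 ⊗ₜ[ℝ] ξ)) := by
    rw [h1, map_smul, map_smul]
  rw [weilOps_lie_eq, weilOps_lie_eq, h2, convLeft_smul, convRight_smul, ← smul_sub]
  exact op_add_smul _ _ _

lemma weilOps_contr_contr (ξ η : LieAlg n G) :
    (weilOps B β.form c.basis).contr ξ ∘ₗ (weilOps B β.form c.basis).contr η +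
      (weilOps B β.form c.basis).contr η ∘ₗ (weilOps B β.form c.basis).contr ξ = 0 := by
  have h1 := oddAd_oddAd _ _ (involute_clx ξ) (involute_clx η) _ (c.clx_swap' ξ η)
  exact eq_neg_iff_add_eq_zero.1 (opR_anticomm h1)

lemma weilOps_lie_d (ξ : LieAlg n G) :
    (weilOps B β.form c.basis).lie ξ ∘ₗ (weilOps B β.form c.basis).d =
      (weilOps B β.form c.basis).d ∘ₗ (weilOps B β.form c.basis).lie ξ :=
  commute_of_anticomm (weilOps_d_d c) (weilOps_contr_d c ξ)

lemma weilOps_lie_contr (ξ η : LieAlg n G) :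
    (weilOps B β.form c.basis).lie ξ ∘ₗ (weilOps B β.form c.basis).contr η -
      (weilOps B β.form c.basis).contr η ∘ₗ (weilOps B β.form c.basis).lie ξ =
        (weilOps B β.form c.basis).contr ⁅ξ, η⁆ := by
  have h := c.isRootData.toIsCartan
  rw [weilOps_contr_eq, weilOps_contr_eq, weilOps_lie_eq]
  refine (op_add_commutator_opR _ _ _).trans (congrArg (opR _ _) ?_)
  rw [evenAd_oddAd _ _ (h.involute_spinC _)]
  exact congrArg (fun x => oddAd β.form x) ((h.spinC_clι _ _).trans (by
    rw [LieAlgebra.ExtendScalars.bracket_tmul, one_mul]; rfl))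

theorem isDifferentialSpace_weilOps : (weilOps B β.form c.basis).IsDifferentialSpace := by
  refine ⟨weilOps_parity_parity c, weilOps_d_parity c, weilOps_contr_parity c,
    weilOps_lie_parity c, fun ξ η => ?_, fun a ξ => ?_, weilOps_lie_add c, weilOps_lie_smul c,
    weilOps_d_d c, weilOps_contr_contr c, weilOps_contr_d c, weilOps_lie_d c, weilOps_lie_contr c,
    weilOps_lie_lie c⟩
  · rw [weilOps_contr_eq, weilOps_contr_eq, weilOps_contr_eq, ← map_add, clx_add, map_add]
  · rw [weilOps_contr_eq, weilOps_contr_eq, ← map_smul, clx_smul, map_smul]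

theorem isDifferentialSpace_restrict_weilOps :
    ((weilOps B β.form c.basis).restrict τ.lieIncl).IsDifferentialSpace := by
  have h := isDifferentialSpace_weilOps (B := B) c
  refine ⟨h.parity_parity, h.d_parity, fun ξ => h.contr_parity _, fun ξ => h.lie_parity _,
    fun ξ η => ?_, fun a ξ => ?_, fun ξ η => ?_, fun a ξ => ?_, h.d_d, fun ξ η => h.contr_contr _ _,
    fun ξ => h.contr_d _, fun ξ => h.lie_d _, fun ξ η => ?_, fun ξ η => ?_⟩
  · simp only [DiffOps.restrict, map_add, h.contr_add]
  · simp only [DiffOps.restrict, map_smul, h.contr_smul]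
  · simp only [DiffOps.restrict, map_add, h.lie_add]
  · simp only [DiffOps.restrict, map_smul, h.lie_smul]
  · simp only [DiffOps.restrict, h.lie_contr, τ.lieIncl_comm, lie_eq_zero_of_comm τ.mul_comm,
      map_zero]
  · simp only [DiffOps.restrict, h.lie_lie, τ.lieIncl_comm, lie_eq_zero_of_comm τ.mul_comm,
      map_zero]

end Weil

/-! ### Symbol map, exterior multiplication and contraction -/

section Symbol

lemma involute_contractLeft {R M : Type*} [CommRing R] [AddCommGroup M] [Module R M]
    {Q : QuadraticForm R M} (d : Module.Dual R M) (x : CliffordAlgebra Q) :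
    CliffordAlgebra.involute (CliffordAlgebra.contractLeft d x) =
      -CliffordAlgebra.contractLeft d (CliffordAlgebra.involute x) := by
  induction x using CliffordAlgebra.left_induction with
  | algebraMap r => simp
  | add x y hx hy => simp only [map_add, hx, hy, neg_add]
  | ι_mul x m hx =>
    simp only [CliffordAlgebra.contractLeft_ι_mul, map_sub, map_mul, map_smul,
      CliffordAlgebra.involute_ι, hx, neg_mul, map_neg]
    simp

lemma contractLeft_map {R M N : Type*} [CommRing R] [AddCommGroup M] [Module R M]
    [AddCommGroup N] [Module R N] (f : M →ₗ[R] N) (d : Module.Dual R N)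
    (x : ExteriorAlgebra R M) :
    CliffordAlgebra.contractLeft d (ExteriorAlgebra.map f x) =
      ExteriorAlgebra.map f (CliffordAlgebra.contractLeft (d ∘ₗ f) x) := by
  induction x using CliffordAlgebra.left_induction with
  | algebraMap r => 
    rw [CliffordAlgebra.contractLeft_algebraMap, map_zero]
    exact (congrArg _ (AlgHom.commutes _ _)).trans (CliffordAlgebra.contractLeft_algebraMap _ _ _)
  | add x y hx hy => simp only [map_add, hx, hy]
  | ι_mul x m hx =>
    have h1 : ∀ y, ExteriorAlgebra.map f (CliffordAlgebra.ι 0 m * y) =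
        CliffordAlgebra.ι 0 (f m) * ExteriorAlgebra.map f y := by
      intro y
      rw [map_mul]
      exact congrArg (· * _) (ExteriorAlgebra.map_apply_ι f m)
    rw [h1, CliffordAlgebra.contractLeft_ι_mul, CliffordAlgebra.contractLeft_ι_mul, hx, map_sub,
      h1, map_smul]
    rfl

variable {V W : Type*} [AddCommGroup V] [Module ℝ V] [AddCommGroup W] [Module ℝ W]
  {β : LinearMap.BilinForm ℝ V} {β' : LinearMap.BilinForm ℝ W}

lemma baseChange_symm (hβ : ∀ x y, β x y = β y x) (x y : ℂ ⊗[ℝ] V) :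
    LinearMap.BilinForm.baseChange ℂ β x y = LinearMap.BilinForm.baseChange ℂ β y x := by
  induction x with
  | zero => simp
  | tmul w x =>
    induction y with
    | zero => simp
    | tmul z y => simp [hβ x y, mul_comm]
    | add x y hx hy => rw [map_add, hx, hy, map_add, LinearMap.add_apply]
  | add x y hx hy => rw [map_add, LinearMap.add_apply, hx, hy, map_add]

lemma clifford_ι_swap (hβ : ∀ x y, β x y = β y x) (v w : ℂ ⊗[ℝ] V) :
    CliffordAlgebra.ι (halfForm β) v * CliffordAlgebra.ι (halfForm β) w =
      algebraMap ℂ _ (LinearMap.BilinForm.baseChange ℂ β v w) -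
        CliffordAlgebra.ι (halfForm β) w * CliffordAlgebra.ι (halfForm β) v := by
  rw [eq_sub_iff_add_eq, CliffordAlgebra.ι_mul_ι_add_swap]
  congr 1
  have h1 : QuadraticMap.polar (halfForm β) v w = (1 / 2 : ℂ) *
      (LinearMap.BilinForm.baseChange ℂ β v w + LinearMap.BilinForm.baseChange ℂ β w v) := by
    simp only [QuadraticMap.polar, halfForm, smul_apply,
      LinearMap.BilinMap.toQuadraticMap_apply, map_add, LinearMap.add_apply, smul_eq_mul]
    ring
  rw [h1, baseChange_symm hβ w v]
  ring

/-- Both sides are odd derivations that vanish on scalars and agree on generators. No factor appears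
because the relations are normalized to `v w + w v = v · w`. -/
lemma clContr_eq_contractLeft (hβ : ∀ x y, β x y = β y x) (v : ℂ ⊗[ℝ] V) (x : Cliff β) :
    clContr β v x =
      CliffordAlgebra.contractLeft (LinearMap.BilinForm.baseChange ℂ β v) x := by
  change CliffordAlgebra.ι (halfForm β) v * x - CliffordAlgebra.involute x *
    CliffordAlgebra.ι (halfForm β) v = _
  induction x using CliffordAlgebra.left_induction with
  | algebraMap r =>
    rw [AlgHom.commutes, Algebra.commutes, sub_self, CliffordAlgebra.contractLeft_algebraMap]
  | add x y hx hy => rw [map_add, map_add, mul_add, add_mul, add_sub_add_comm, hx, hy]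
  | ι_mul x m hx =>
    rw [CliffordAlgebra.contractLeft_ι_mul, ← hx, ← mul_assoc, clifford_ι_swap hβ v m, map_mul,
      CliffordAlgebra.involute_ι, Algebra.smul_def, sub_mul, mul_sub, neg_mul, neg_mul]
    simp only [mul_assoc]
    abel

/-- The symbol map. -/
def clSymbol (β : LinearMap.BilinForm ℝ V) : Cliff β ≃ₗ[ℂ] ExteriorAlgebra ℂ (ℂ ⊗[ℝ] V) :=
  letI : Invertible (2 : ℂ) := invertibleOfNonzero two_ne_zero
  CliffordAlgebra.equivExterior (halfForm β)

lemma clSymbol_clProj (P : V →ₗ[ℝ] W) (x : Cliff β) :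
    clSymbol β' (clProj β β' P x) = ExteriorAlgebra.map (P.baseChange ℂ) (clSymbol β x) :=
  (clSymbol β').apply_symm_apply _

lemma clSymbol_algebraMap (a : ℂ) : clSymbol β (algebraMap ℂ _ a) = algebraMap ℂ _ a :=
  letI : Invertible (2 : ℂ) := invertibleOfNonzero two_ne_zero
  CliffordAlgebra.changeForm_algebraMap CliffordAlgebra.changeForm.associated_neg_proof a

lemma clSymbol_contractLeft (d : Module.Dual ℂ (ℂ ⊗[ℝ] V)) (x : Cliff β) :
    clSymbol β (CliffordAlgebra.contractLeft d x) =
      CliffordAlgebra.contractLeft d (clSymbol β x) :=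
  letI : Invertible (2 : ℂ) := invertibleOfNonzero two_ne_zero
  CliffordAlgebra.changeForm_contractLeft CliffordAlgebra.changeForm.associated_neg_proof _ _

/-- Clifford multiplication differs from exterior multiplication by half a contraction, the half
again reflecting the normalization of the relations. This half is what the twist removes or doubles.
-/
lemma clSymbol_ι_mul (hβ : ∀ x y, β x y = β y x) (v : ℂ ⊗[ℝ] V) (x : Cliff β) :
    clSymbol β (CliffordAlgebra.ι (halfForm β) v * x) =
      ExteriorAlgebra.ι ℂ v * clSymbol β x +
        (1 / 2 : ℂ) • CliffordAlgebra.contractLeft (LinearMap.BilinForm.baseChange ℂ β v)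
          (clSymbol β x) := by
  let _ : Invertible (2 : ℂ) := invertibleOfNonzero two_ne_zero
  have h1 : QuadraticMap.associated (R := ℂ) (-halfForm β) v =
      -((1 / 2 : ℂ) • LinearMap.BilinForm.baseChange ℂ β v) := by
    refine LinearMap.ext fun w => ?_
    have h2 := congrArg (fun f => f v w) (QuadraticMap.two_nsmul_associated ℂ (-halfForm β))
    simp only [halfForm, neg_apply, smul_apply, two_nsmul,
      LinearMap.BilinMap.toQuadraticMap_apply, map_add, LinearMap.add_apply, smul_eq_mul,
      QuadraticMap.polarBilin_apply_apply, QuadraticMap.polar, baseChange_symm hβ w v] at h2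
    change QuadraticMap.associated (R := ℂ) (-((1 / 2 : ℂ) •
      (LinearMap.BilinForm.baseChange ℂ β).toQuadraticMap)) v w =
        -((1 / 2 : ℂ) * LinearMap.BilinForm.baseChange ℂ β v w)
    linear_combination (1 / 2 : ℂ) * h2
  have h2 : ∀ y : ExteriorAlgebra ℂ (ℂ ⊗[ℝ] V),
      -CliffordAlgebra.contractLeft (QuadraticMap.associated (R := ℂ) (-halfForm β) v) y =
        (1 / 2 : ℂ) • CliffordAlgebra.contractLeft (LinearMap.BilinForm.baseChange ℂ β v) y := by
    intro y
    rw [h1, map_neg, LinearMap.neg_apply, neg_neg, map_smul, LinearMap.smul_apply]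
  refine (CliffordAlgebra.changeForm_ι_mul
    CliffordAlgebra.changeForm.associated_neg_proof v x).trans ?_
  rw [sub_eq_add_neg]
  exact congrArg (_ + ·) (h2 _)

lemma clSymbol_involute (hβ : ∀ x y, β x y = β y x) (x : Cliff β) :
    clSymbol β (CliffordAlgebra.involute x) =
      CliffordAlgebra.involute (Q := (0 : QuadraticForm ℂ (ℂ ⊗[ℝ] V))) (clSymbol β x) := by
  induction x using CliffordAlgebra.left_induction with
  | algebraMap r =>
    rw [AlgHom.commutes, clSymbol_algebraMap]
    exact (AlgHom.commutes _ _).symm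
  | add x y hx hy => simp only [map_add, hx, hy]
  | ι_mul x m hx =>
    rw [map_mul, CliffordAlgebra.involute_ι, neg_mul, map_neg, clSymbol_ι_mul hβ,
      clSymbol_ι_mul hβ, hx, map_add, map_smul, involute_contractLeft, smul_neg, neg_add]
    congr 1
    rw [map_mul, ← neg_mul]
    exact congrArg (· * _) (CliffordAlgebra.involute_ι m).symm

/-- The operator on the Clifford algebra which corresponds to the exterior product with `v`. -/
def clWedge (β : LinearMap.BilinForm ℝ V) (v : ℂ ⊗[ℝ] V) : Cliff β →ₗ[ℂ] Cliff β :=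
  clLeft β (CliffordAlgebra.ι (halfForm β) v) - (1 / 2 : ℂ) • clContr β v

lemma clSymbol_clWedge (hβ : ∀ x y, β x y = β y x) (v : ℂ ⊗[ℝ] V) (x : Cliff β) :
    clSymbol β (clWedge β v x) = ExteriorAlgebra.ι ℂ v * clSymbol β x := by
  change clSymbol β (CliffordAlgebra.ι (halfForm β) v * x - (1 / 2 : ℂ) • clContr β v x) = _
  rw [map_sub, clSymbol_ι_mul hβ, map_smul, clContr_eq_contractLeft hβ, clSymbol_contractLeft,
    add_sub_cancel_right]

lemma clLeft_eq_clWedge (v : ℂ ⊗[ℝ] V) : clLeft β (CliffordAlgebra.ι (halfForm β) v) =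
    clWedge β v + (1 / 2 : ℂ) • clContr β v := (sub_add_cancel _ _).symm

lemma clRight_eq_clWedge (v : ℂ ⊗[ℝ] V) : clRight β (CliffordAlgebra.ι (halfForm β) v) =
    clWedge β v - (1 / 2 : ℂ) • clContr β v := by
  have h1 : clContr β v = clLeft β (CliffordAlgebra.ι (halfForm β) v) -
    clRight β (CliffordAlgebra.ι (halfForm β) v) := rfl
  rw [clWedge, sub_sub, ← add_smul, h1]
  norm_num

lemma clProj_clWedge (hβ : ∀ x y, β x y = β y x) (hβ' : ∀ x y, β' x y = β' y x)
    (P : V →ₗ[ℝ] W) (v : ℂ ⊗[ℝ] V) (x : Cliff β) :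
    clProj β β' P (clWedge β v x) = clWedge β' (P.baseChange ℂ v) (clProj β β' P x) := by
  apply (clSymbol β').injective
  rw [clSymbol_clProj, clSymbol_clWedge hβ, clSymbol_clWedge hβ', clSymbol_clProj, map_mul,
    ExteriorAlgebra.map_apply_ι]

/-- A contraction descends along the projection exactly when its linear form factors through `P`,
which is the hypothesis `h`. -/
lemma clProj_clContr (hβ : ∀ x y, β x y = β y x) (hβ' : ∀ x y, β' x y = β' y x)
    (P : V →ₗ[ℝ] W) (v : ℂ ⊗[ℝ] V) (w : ℂ ⊗[ℝ] W)
    (h : ∀ u : V, LinearMap.BilinForm.baseChange ℂ β v (1 ⊗ₜ[ℝ] u) =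
      LinearMap.BilinForm.baseChange ℂ β' w (1 ⊗ₜ[ℝ] P u)) (x : Cliff β) :
    clProj β β' P (clContr β v x) = clContr β' w (clProj β β' P x) := by
  apply (clSymbol β').injective
  have h1 : LinearMap.BilinForm.baseChange ℂ β v =
      LinearMap.BilinForm.baseChange ℂ β' w ∘ₗ P.baseChange ℂ := by
    ext u
    exact h u
  rw [clSymbol_clProj, clContr_eq_contractLeft hβ, clContr_eq_contractLeft hβ',
    clSymbol_contractLeft, clSymbol_contractLeft, clSymbol_clProj, contractLeft_map, h1]

lemma clProj_involute (hβ : ∀ x y, β x y = β y x) (hβ' : ∀ x y, β' x y = β' y x)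
    (P : V →ₗ[ℝ] W) (x : Cliff β) :
    clProj β β' P (CliffordAlgebra.involute x) = CliffordAlgebra.involute (clProj β β' P x) := by
  apply (clSymbol β').injective
  rw [clSymbol_clProj, clSymbol_involute hβ, clSymbol_involute hβ', clSymbol_clProj]
  generalize clSymbol β x = y
  have h1 : (ExteriorAlgebra.map (P.baseChange ℂ)).comp
      (CliffordAlgebra.involute (Q := (0 : QuadraticForm ℂ (ℂ ⊗[ℝ] V)))) =
      AlgHom.comp (CliffordAlgebra.involute (Q := (0 : QuadraticForm ℂ (ℂ ⊗[ℝ] W))))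
        (ExteriorAlgebra.map (P.baseChange ℂ)) := by
    refine ExteriorAlgebra.hom_ext (LinearMap.ext fun m => ?_)
    change ExteriorAlgebra.map (P.baseChange ℂ) (CliffordAlgebra.involute
        (CliffordAlgebra.ι 0 m)) = CliffordAlgebra.involute
        (ExteriorAlgebra.map (P.baseChange ℂ) (ExteriorAlgebra.ι ℂ m))
    rw [CliffordAlgebra.involute_ι, ExteriorAlgebra.map_apply_ι, map_neg]
    exact (congrArg Neg.neg (ExteriorAlgebra.map_apply_ι _ m)).trans
      (CliffordAlgebra.involute_ι _).symm
  exact DFunLike.congr_fun h1 y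

end Symbol

/-! ### The truncated exponential of the contractions -/

section TruncatedExp

variable {R : Type*} [Ring R] [Algebra ℂ R]

/-- The exponential series up to order `n`. -/
def truncExp (n : ℕ) (S : R) : R := ∑ k ∈ Finset.range (n + 1), ((k.factorial : ℂ)⁻¹) • S ^ k

lemma commute_truncExp {n : ℕ} {S x : R} (h : S * x = x * S) :
    truncExp n S * x = x * truncExp n S := by
  rw [truncExp, Finset.sum_mul, Finset.mul_sum]
  refine Finset.sum_congr rfl fun k _ => ?_
  rw [smul_mul_assoc, mul_smul_comm]
  exact congrArg _ ((show Commute S x from h).pow_left k)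

/-- If `[S, x] = D` commutes with `S`, then `[S^k, x] = k D S^(k-1)`. Hence `e^S x = (x + D) e^S`.
For the series cut off at order `n` the only discrepancy is a multiple of `D S^n`, which `h0`
removes. -/
lemma truncExp_mul {n : ℕ} {S x D : R} (h : S * x = x * S + D) (hD : S * D = D * S)
    (h0 : D * S ^ n = 0) : truncExp n S * x = (x + D) * truncExp n S := by
  have h1 : ∀ k : ℕ, S ^ (k + 1) * x = x * S ^ (k + 1) + ((k + 1 : ℕ) : ℂ) • (D * S ^ k) := by
    intro k
    induction k with
    | zero => simpa using h
    | succ k ih =>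
      rw [pow_succ', mul_assoc, ih, mul_add, ← mul_assoc, h, mul_smul_comm, ← mul_assoc S D, hD,
        mul_assoc D S, ← pow_succ' S k, add_mul, mul_assoc x S, ← pow_succ', add_assoc]
      congr 1
      push_cast
      module
  have h2 : ∀ k : ℕ, (((k + 1).factorial : ℂ)⁻¹) • (S ^ (k + 1) * x) =
      (((k + 1).factorial : ℂ)⁻¹) • (x * S ^ (k + 1)) + ((k.factorial : ℂ)⁻¹) • (D * S ^ k) := by
    intro k
    rw [h1, smul_add, smul_smul, Nat.factorial_succ]
    congr 2
    have := Nat.factorial_ne_zero k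
    push_cast
    have h3 : ((k : ℂ) + 1) ≠ 0 := by exact_mod_cast Nat.succ_ne_zero k
    field_simp
  have h3 : D * truncExp n S = ∑ k ∈ Finset.range n, ((k.factorial : ℂ)⁻¹) • (D * S ^ k) := by
    rw [truncExp, Finset.sum_range_succ, mul_add, mul_smul_comm, h0, smul_zero, add_zero,
      Finset.mul_sum]
    simp only [mul_smul_comm]
  have h4 : ∀ f : ℕ → R, ∑ k ∈ Finset.range (n + 1), f k = f 0 + ∑ k ∈ Finset.range n, f (k + 1) := by
    intro f
    rw [Finset.sum_range_succ', add_comm]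
  rw [add_mul, h3, truncExp, Finset.sum_mul, Finset.mul_sum, h4, h4]
  simp only [smul_mul_assoc, mul_smul_comm, h2, Finset.sum_add_distrib]
  simp [add_assoc]

end TruncatedExp

section Contractions

variable {V : Type*} [AddCommGroup V] [Module ℝ V] {β : LinearMap.BilinForm ℝ V}
  (hβ : ∀ x y, β x y = β y x)

include hβ

lemma clContr_clContr (u v : ℂ ⊗[ℝ] V) :
    (clContr β u * clContr β v : Module.End ℂ (Cliff β)) = -(clContr β v * clContr β u) := by
  refine LinearMap.ext fun x => ?_
  change clContr β u (clContr β v x) = -clContr β v (clContr β u x)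
  simp only [clContr_eq_contractLeft hβ]
  exact CliffordAlgebra.contractLeft_comm _ _ _

lemma clContr_clContr_self (u : ℂ ⊗[ℝ] V) :
    (clContr β u * clContr β u : Module.End ℂ (Cliff β)) = 0 := by
  refine LinearMap.ext fun x => ?_
  change clContr β u (clContr β u x) = 0
  simp only [clContr_eq_contractLeft hβ]
  exact CliffordAlgebra.contractLeft_contractLeft _ _

lemma clContr_clLeft (u v : ℂ ⊗[ℝ] V) :
    (clContr β u * clLeft β (CliffordAlgebra.ι (halfForm β) v) : Module.End ℂ (Cliff β)) =
      LinearMap.BilinForm.baseChange ℂ β u v • 1 -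
        clLeft β (CliffordAlgebra.ι (halfForm β) v) * clContr β u := by
  refine LinearMap.ext fun x => ?_
  change clContr β u (CliffordAlgebra.ι (halfForm β) v * x) =
    LinearMap.BilinForm.baseChange ℂ β u v • x -
      CliffordAlgebra.ι (halfForm β) v * (clContr β u x)
  simp only [clContr_eq_contractLeft hβ]
  exact CliffordAlgebra.contractLeft_ι_mul _ _ _

lemma clContr_clRight (u v : ℂ ⊗[ℝ] V) :
    (clContr β u * clRight β (CliffordAlgebra.ι (halfForm β) v) : Module.End ℂ (Cliff β)) =
      LinearMap.BilinForm.baseChange ℂ β u v • 1 -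
        clRight β (CliffordAlgebra.ι (halfForm β) v) * clContr β u := by
  have h1 : (clRight β (CliffordAlgebra.ι (halfForm β) v) : Module.End ℂ (Cliff β)) =
      clLeft β (CliffordAlgebra.ι (halfForm β) v) - clContr β v := by
    change _ = clLeft β (CliffordAlgebra.ι (halfForm β) v) -
      (clLeft β (CliffordAlgebra.ι (halfForm β) v) - clRight β (CliffordAlgebra.ι (halfForm β) v))
    abel
  rw [h1, mul_sub, sub_mul, clContr_clLeft hβ, clContr_clContr hβ u v]
  abel

lemma clContr_involute (u : ℂ ⊗[ℝ] V) :
    (clContr β u * clParity β : Module.End ℂ (Cliff β)) = -(clParity β * clContr β u) := by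
  refine LinearMap.ext fun x => ?_
  change clContr β u (CliffordAlgebra.involute x) = -CliffordAlgebra.involute (clContr β u x)
  simp only [clContr_eq_contractLeft hβ, involute_contractLeft, neg_neg]

/-- The algebra generated by the contractions, as a quotient of the exterior algebra. -/
def clContrHom : ExteriorAlgebra ℂ (ℂ ⊗[ℝ] V) →ₐ[ℂ] Module.End ℂ (Cliff β) :=
  ExteriorAlgebra.lift ℂ ⟨clContr β, fun u => clContr_clContr_self hβ u⟩

lemma clContrHom_ι (u : ℂ ⊗[ℝ] V) : clContrHom hβ (ExteriorAlgebra.ι ℂ u) = clContr β u :=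
  ExteriorAlgebra.lift_ι_apply _ _ _ _

/-- A product of more than `dim V` contractions vanishes. -/
lemma clContr_mul_pow_eq_zero [Module.Finite ℝ V] {ι : Type*} (s : Finset ι)
    (f g : ι → ℂ ⊗[ℝ] V) (a : ℂ) (u : ℂ ⊗[ℝ] V) {N : ℕ} (hN : Module.finrank ℝ V ≤ N) :
    clContr β u * (a • ∑ j ∈ s, clContr β (f j) * clContr β (g j) :
      Module.End ℂ (Cliff β)) ^ N = 0 := by
  let y : ExteriorAlgebra ℂ (ℂ ⊗[ℝ] V) :=
    a • ∑ j ∈ s, ExteriorAlgebra.ι ℂ (f j) * ExteriorAlgebra.ι ℂ (g j)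
  have hy : y ∈ LinearMap.range (ExteriorAlgebra.ι ℂ (M := ℂ ⊗[ℝ] V)) ^ 2 := by
    refine Submodule.smul_mem _ _ (Submodule.sum_mem _ fun j _ => ?_)
    rw [pow_two]
    exact Submodule.mul_mem_mul (LinearMap.mem_range_self _ _) (LinearMap.mem_range_self _ _)
  have h1 : ExteriorAlgebra.ι ℂ u * y ^ N ∈
      LinearMap.range (ExteriorAlgebra.ι ℂ (M := ℂ ⊗[ℝ] V)) ^ (1 + 2 * N) := by
    rw [pow_add, pow_one, pow_mul]
    exact Submodule.mul_mem_mul (LinearMap.mem_range_self _ _) (Submodule.pow_mem_pow _ hy N)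
  -- The degree `1 + 2 * N` exceeds the dimension, so this exterior power is zero.
  have h2 : Module.finrank ℂ (⋀[ℂ]^(1 + 2 * N) (ℂ ⊗[ℝ] V)) = 0 := by
    rw [exteriorPower.finrank_eq, Module.finrank_baseChange]
    exact Nat.choose_eq_zero_of_lt (by omega)
  have h3 : (⋀[ℂ]^(1 + 2 * N) (ℂ ⊗[ℝ] V)) = ⊥ := Submodule.finrank_eq_zero.1 h2
  have h4 : ExteriorAlgebra.ι ℂ u * y ^ N = 0 := by
    have : ExteriorAlgebra.ι ℂ u * y ^ N ∈ (⋀[ℂ]^(1 + 2 * N) (ℂ ⊗[ℝ] V)) := h1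
    rwa [h3, Submodule.mem_bot] at this
  have h5 := congrArg (clContrHom hβ) h4
  rw [map_mul, map_pow, map_smul, map_sum, map_zero] at h5
  simpa only [map_mul, clContrHom_ι] using h5

end Contractions

/-! ### The twisted projection from `Cl(𝔤)` to `Cl(𝔱)` -/

section Theta

lemma mul_mul_eq_of_anticomm {R : Type*} [Ring R] {a b u : R} (ha : a * u = -(u * a))
    (hb : b * u = -(u * b)) : a * b * u = u * (a * b) := by
  rw [mul_assoc, hb, mul_neg, ← mul_assoc, ha, neg_mul, neg_neg, mul_assoc]

lemma clRight_involute {V : Type*} [AddCommGroup V] [Module ℝ V] {β : LinearMap.BilinForm ℝ V}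
    (y x : Cliff β) : clRight β y (CliffordAlgebra.involute x) = x * y :=
  congrArg (· * y) (CliffordAlgebra.involute_involute x)

variable {L A : Type*} [LieRing L] [LieAlgebra ℝ L] [AddCommGroup A] [Module ℝ A]

/-- The orthogonal projection onto a subspace with orthonormal basis `i ∘ t`. -/
def projT {r : ℕ} (i : A →ₗ[ℝ] L) (β : LinearMap.BilinForm ℝ L) (t : Module.Basis (Fin r) ℝ A) :
    L →ₗ[ℝ] A := ∑ k, (β.flip (i (t k))).smulRight (t k)

variable {n r : ℕ} {i : A →ₗ[ℝ] L} {β : LinearMap.BilinForm ℝ L}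
  {e : Module.Basis (Fin n) ℝ L} {t : Module.Basis (Fin r) ℝ A} {reg : A}
  {E : Module.Dual ℝ A → ℂ ⊗[ℝ] L} (h : IsRootData i β e t reg E)

namespace IsRootData

/-- The quadratic element in the contractions given by the classical `r`-matrix. -/
def rOp (h : IsRootData i β e t reg E) : Module.End ℂ (Cliff β) :=
  (1 / 2 : ℂ) • ∑ α ∈ h.pos, clContr β (E α) * clContr β (conjC (E α))

/-- The twisted projection `Cl(𝔤) → Cl(𝔱)`. -/
def theta (h : IsRootData i β e t reg E) : Cliff β →ₗ[ℂ] Cliff (β.compl₁₂ i i) :=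
  clProj β (β.compl₁₂ i i) (projT i β t) ∘ₗ truncExp n h.rOp

include h

lemma projT_baseChange (w : ℂ ⊗[ℝ] L) : (projT i β t).baseChange ℂ w =
    ∑ k, formC β (1 ⊗ₜ[ℝ] i (t k)) w • ((1 : ℂ) ⊗ₜ[ℝ] t k) := by
  induction w with
  | zero => simp
  | add x y hx hy => simp only [map_add, add_smul, Finset.sum_add_distrib, hx, hy]
  | tmul z y =>
    rw [LinearMap.baseChange_tmul, projT, LinearMap.sum_apply, TensorProduct.tmul_sum]
    refine Finset.sum_congr rfl fun k _ => ?_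
    change z ⊗ₜ[ℝ] (β y (i (t k)) • t k) = _
    rw [LinearMap.BilinForm.baseChange_tmul, h.symm y, TensorProduct.smul_tmul',
      TensorProduct.tmul_smul, TensorProduct.smul_tmul']
    simp

lemma projT_one_tmul (ξ : A) : (projT i β t).baseChange ℂ (1 ⊗ₜ[ℝ] i ξ) = 1 ⊗ₜ[ℝ] ξ := by
  rw [LinearMap.baseChange_tmul]
  congr 1
  conv_rhs => rw [← h.sum_formT_smul ξ]
  rw [projT, LinearMap.sum_apply]
  refine Finset.sum_congr rfl fun k _ => ?_
  change β (i ξ) (i (t k)) • t k = _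
  rw [h.symm]

lemma symm_compl (x y : A) : β.compl₁₂ i i x y = β.compl₁₂ i i y x := h.symm _ _

lemma form_projT (ξ : A) (x : L) : β (i ξ) (i (projT i β t x)) = β (i ξ) x := by
  have h1 : i (projT i β t x) = ∑ k, β (i (t k)) x • i (t k) := by
    rw [projT, LinearMap.sum_apply, map_sum]
    refine Finset.sum_congr rfl fun k _ => ?_
    change i (β x (i (t k)) • t k) = _
    rw [map_smul, h.symm]
  have h2 := congrArg (fun η => β (i η) x) (h.sum_formT_smul ξ)
  simp only [map_sum, map_smul, LinearMap.sum_apply, LinearMap.smul_apply, smul_eq_mul] at h2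
  rw [h1, map_sum, ← h2]
  refine Finset.sum_congr rfl fun k _ => ?_
  rw [map_smul, smul_eq_mul, h.symm (i ξ)]
  ring

lemma rOp_clContr (u : ℂ ⊗[ℝ] L) : h.rOp * clContr β u = clContr β u * h.rOp := by
  have hs := h.symm
  rw [rOp, smul_mul_assoc, mul_smul_comm, Finset.sum_mul, Finset.mul_sum]
  congr 1
  refine Finset.sum_congr rfl fun α _ => ?_
  exact mul_mul_eq_of_anticomm (clContr_clContr hs _ _) (clContr_clContr hs _ _)

/-- The commutator of `rOp` with multiplication operators. -/
def rVec (h : IsRootData i β e t reg E) (w : ℂ ⊗[ℝ] L) : ℂ ⊗[ℝ] L :=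
  (1 / 2 : ℂ) • ∑ α ∈ h.pos, (formC β (conjC (E α)) w • E α - formC β (E α) w • conjC (E α))

lemma rOp_mul_of_anticomm {F : Module.End ℂ (Cliff β)} {w : ℂ ⊗[ℝ] L}
    (hF : ∀ u, (clContr β u * F : Module.End ℂ (Cliff β)) = formC β u w • 1 - F * clContr β u) :
    h.rOp * F = F * h.rOp + clContr β (h.rVec w) := by
  have h1 : ∀ α, (clContr β (E α) * clContr β (conjC (E α)) * F : Module.End ℂ (Cliff β)) =
      F * (clContr β (E α) * clContr β (conjC (E α))) +
        clContr β (formC β (conjC (E α)) w • E α - formC β (E α) w • conjC (E α)) := by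
    intro α
    rw [mul_assoc, hF, mul_sub, ← mul_assoc (clContr β (E α)) F, hF, sub_mul, map_sub, map_smul,
      map_smul, mul_smul_comm, mul_one, smul_mul_assoc, one_mul, mul_assoc F]
    abel
  rw [rOp, rVec, smul_mul_assoc, mul_smul_comm, Finset.sum_mul, Finset.mul_sum, map_smul, map_sum,
    ← smul_add, ← Finset.sum_add_distrib]
  congr 1
  exact Finset.sum_congr rfl fun α _ => h1 α

/-- Conjugation by the exponential adds the contraction with `rVec w`. The hypothesis on `F` holds
both for left and for graded right multiplication by `w`. Truncation at `n = dim 𝔤` is exact because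
the extra contraction times the `n`-th power vanishes. -/
lemma truncExp_rOp_mul {F : Module.End ℂ (Cliff β)} {w : ℂ ⊗[ℝ] L}
    (hF : ∀ u, (clContr β u * F : Module.End ℂ (Cliff β)) = formC β u w • 1 - F * clContr β u) :
    truncExp n h.rOp * F = (F + clContr β (h.rVec w)) * truncExp n h.rOp := by
  have : Module.Finite ℝ L := Module.Finite.of_basis e
  refine truncExp_mul (h.rOp_mul_of_anticomm hF) (h.rOp_clContr _) ?_
  refine clContr_mul_pow_eq_zero h.symm _ _ _ _ _ ?_
  rw [Module.finrank_eq_card_basis e, Fintype.card_fin]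

lemma rVec_pos {γ : Module.Dual ℝ A} (hγ : γ ∈ posSet i reg) :
    h.rVec (E γ) = (1 / 2 : ℂ) • E γ := by
  classical
  rw [rVec]
  congr 1
  rw [Finset.sum_congr rfl fun α hα => by
    rw [h.formC_conj_pos (h.mem_pos.1 hα) hγ, h.formC_pos_pos (h.mem_pos.1 hα) hγ, zero_smul,
      sub_zero, ite_smul, one_smul, zero_smul], Finset.sum_ite_eq' , if_pos (h.mem_pos.2 hγ)]

lemma rVec_conj {γ : Module.Dual ℝ A} (hγ : γ ∈ posSet i reg) :
    h.rVec (conjC (E γ)) = -((1 / 2 : ℂ) • conjC (E γ)) := by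
  classical
  rw [rVec, ← smul_neg]
  congr 1
  rw [Finset.sum_congr rfl fun α hα => by
    rw [h.formC_conj_conj (h.mem_pos.1 hα) hγ, h.symmC, h.formC_conj_pos hγ (h.mem_pos.1 hα),
      zero_smul, zero_sub, ite_smul, one_smul, zero_smul], Finset.sum_neg_distrib,
    Finset.sum_ite_eq, if_pos (h.mem_pos.2 hγ)]

lemma rVec_tmul (ξ : A) : h.rVec (1 ⊗ₜ[ℝ] i ξ) = 0 := by
  rw [rVec, Finset.sum_eq_zero, smul_zero]
  intro α hα
  rw [h.symmC, h.formC_tmul_conj ξ (h.mem_pos.1 hα), h.symmC, h.formC_tmul_pos ξ (h.mem_pos.1 hα),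
    zero_smul, zero_smul, sub_zero]

lemma clProj_clWedge_eq_zero {w : ℂ ⊗[ℝ] L} (hw : ∀ k, formC β (1 ⊗ₜ[ℝ] i (t k)) w = 0)
    (x : Cliff β) : clProj β (β.compl₁₂ i i) (projT i β t) (clWedge β w x) = 0 := by
  rw [clProj_clWedge h.symm h.symm_compl, h.projT_baseChange,
    Finset.sum_eq_zero fun k _ => by rw [hw, zero_smul]]
  simp [clWedge]

/-- Left multiplication is exterior multiplication plus half a contraction, and the twist
contributes minus half a contraction for a negative root vector. What remains is exterior
multiplication by a vector orthogonal to `𝔱`, which the projection kills. -/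
lemma theta_conj_mul {γ : Module.Dual ℝ A} (hγ : γ ∈ posSet i reg) (x : Cliff β) :
    h.theta (clι β (conjC (E γ)) * x) = 0 := by
  have h1 := LinearMap.congr_fun (h.truncExp_rOp_mul fun u => clContr_clLeft h.symm u (conjC (E γ))) x
  refine (congrArg (clProj β (β.compl₁₂ i i) (projT i β t)) h1).trans ?_
  rw [h.rVec_conj hγ, clLeft_eq_clWedge, map_neg, map_smul, add_neg_cancel_right]
  exact h.clProj_clWedge_eq_zero (fun k => h.formC_tmul_conj _ hγ) _

/-- Mirror image: graded right multiplication is exterior multiplication minus half a contraction,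
and the twist adds half a contraction for a positive root vector. -/
lemma theta_clRight_pos {γ : Module.Dual ℝ A} (hγ : γ ∈ posSet i reg) (x : Cliff β) :
    h.theta (clRight β (clι β (E γ)) x) = 0 := by
  have h1 := LinearMap.congr_fun (h.truncExp_rOp_mul fun u => clContr_clRight h.symm u (E γ)) x
  refine (congrArg (clProj β (β.compl₁₂ i i) (projT i β t)) h1).trans ?_
  rw [h.rVec_pos hγ, clRight_eq_clWedge, map_smul, sub_add_cancel]
  exact h.clProj_clWedge_eq_zero (fun k => h.formC_tmul_pos _ hγ) _

lemma clProj_clWedge_tmul (ξ : A) (x : Cliff β) :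
    clProj β (β.compl₁₂ i i) (projT i β t) (clWedge β (1 ⊗ₜ[ℝ] i ξ) x) =
      clWedge _ (1 ⊗ₜ[ℝ] ξ) (clProj β (β.compl₁₂ i i) (projT i β t) x) := by
  rw [clProj_clWedge h.symm h.symm_compl, h.projT_one_tmul]

lemma clProj_clContr_tmul (ξ : A) (x : Cliff β) :
    clProj β (β.compl₁₂ i i) (projT i β t) (clContr β (1 ⊗ₜ[ℝ] i ξ) x) =
      clContr _ (1 ⊗ₜ[ℝ] ξ) (clProj β (β.compl₁₂ i i) (projT i β t) x) := by
  refine clProj_clContr h.symm h.symm_compl _ _ _ (fun u => ?_) _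
  rw [LinearMap.BilinForm.baseChange_tmul, LinearMap.BilinForm.baseChange_tmul]
  exact congrArg (· • (1 * 1 : ℂ)) (h.form_projT ξ u).symm

/-- The `r`-matrix has no component along `𝔱`, so the twist does not affect multiplication by
elements of `𝔱`. The projection respects both their exterior multiplication and their contraction.
-/
lemma theta_clLeft_tmul (ξ : A) (x : Cliff β) :
    h.theta (clLeft β (clx β (i ξ)) x) = clLeft _ (clx _ ξ) (h.theta x) := by
  have h1 := LinearMap.congr_fun
    (h.truncExp_rOp_mul fun u => clContr_clLeft h.symm u (1 ⊗ₜ[ℝ] i ξ)) x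
  refine (congrArg (clProj β (β.compl₁₂ i i) (projT i β t)) h1).trans ?_
  change _ = clLeft _ (CliffordAlgebra.ι _ _) _
  rw [h.rVec_tmul, map_zero, add_zero, clLeft_eq_clWedge, clLeft_eq_clWedge]
  refine (map_add _ _ _).trans ?_
  exact congrArg₂ (· + ·) (h.clProj_clWedge_tmul ξ _) ((map_smul _ _ _).trans
    (congrArg ((1 / 2 : ℂ) • ·) (h.clProj_clContr_tmul ξ _)))

lemma theta_clRight_tmul (ξ : A) (x : Cliff β) :
    h.theta (clRight β (clx β (i ξ)) x) = clRight _ (clx _ ξ) (h.theta x) := by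
  have h1 := LinearMap.congr_fun
    (h.truncExp_rOp_mul fun u => clContr_clRight h.symm u (1 ⊗ₜ[ℝ] i ξ)) x
  refine (congrArg (clProj β (β.compl₁₂ i i) (projT i β t)) h1).trans ?_
  change _ = clRight _ (CliffordAlgebra.ι _ _) _
  rw [h.rVec_tmul, map_zero, add_zero, clRight_eq_clWedge, clRight_eq_clWedge]
  refine (map_sub _ _ _).trans ?_
  exact congrArg₂ (· - ·) (h.clProj_clWedge_tmul ξ _) ((map_smul _ _ _).trans
    (congrArg ((1 / 2 : ℂ) • ·) (h.clProj_clContr_tmul ξ _)))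

lemma theta_involute (x : Cliff β) :
    h.theta (CliffordAlgebra.involute x) = CliffordAlgebra.involute (h.theta x) := by
  have h1 : h.rOp * clParity β = clParity β * h.rOp := by
    rw [rOp, smul_mul_assoc, mul_smul_comm, Finset.sum_mul, Finset.mul_sum]
    congr 1
    refine Finset.sum_congr rfl fun α _ => ?_
    exact mul_mul_eq_of_anticomm (clContr_involute h.symm _) (clContr_involute h.symm _)
  have h2 := LinearMap.congr_fun (commute_truncExp (n := n) h1) x
  refine (congrArg (clProj β (β.compl₁₂ i i) (projT i β t)) h2).trans ?_
  exact clProj_involute h.symm h.symm_compl _ _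

lemma theta_tmul_mul (ξ : A) (x : Cliff β) :
    h.theta (clx β (i ξ) * x) = clx _ ξ * h.theta x := h.theta_clLeft_tmul ξ x

lemma theta_mul_tmul (ξ : A) (x : Cliff β) :
    h.theta (x * clx β (i ξ)) = h.theta x * clx _ ξ := by
  rw [← clRight_involute, h.theta_clRight_tmul, h.theta_involute]
  exact clRight_involute _ _

/-- By orthogonality of weight spaces `w` is a combination of conjugate root vectors. That `δ` is a
root is not required, so the lemma applies directly to brackets of root vectors. -/
lemma theta_neg_mul {δ : Module.Dual ℝ A} (hδ : δ reg < 0) {w : ℂ ⊗[ℝ] L}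
    (hw : w ∈ weightSpace i δ) (x : Cliff β) : h.theta (clι β w * x) = 0 := by
  have h1 : w = ∑ α ∈ h.pos, formC β (E α) w • conjC (E α) := by
    conv_lhs => rw [h.eq_sum w]
    rw [Finset.sum_eq_zero, zero_add]
    · refine Finset.sum_congr rfl fun α hα => ?_
      have h2 := (h.mem_pos.1 hα)
      rw [h.formC_eq_zero (IsCartan.conjC_mem (h.mem α h2)) hw, zero_smul, zero_add]
      intro h3
      have h4 := congrArg (fun f => f reg) h3
      have h5 := h2.2
      simp only [LinearMap.add_apply, LinearMap.neg_apply, LinearMap.zero_apply] at h4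
      linarith
    · intro k _
      rw [h.formC_eq_zero (h.one_tmul_mem _) hw, zero_smul]
      rintro h3
      rw [zero_add] at h3
      simp [h3] at hδ
  rw [h1, map_sum, Finset.sum_mul, map_sum, Finset.sum_eq_zero]
  intro α hα
  rw [map_smul, smul_mul_assoc, map_smul, h.theta_conj_mul (h.mem_pos.1 hα), smul_zero]

lemma theta_mul_pos {δ : Module.Dual ℝ A} (hδ : 0 < δ reg) {w : ℂ ⊗[ℝ] L}
    (hw : w ∈ weightSpace i δ) (x : Cliff β) : h.theta (x * clι β w) = 0 := by
  have h1 : w = ∑ α ∈ h.pos, formC β (conjC (E α)) w • E α := by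
    conv_lhs => rw [h.eq_sum w]
    rw [Finset.sum_eq_zero, zero_add]
    · refine Finset.sum_congr rfl fun α hα => ?_
      have h2 := (h.mem_pos.1 hα)
      rw [h.formC_eq_zero (h.mem α h2) hw, zero_smul, add_zero]
      intro h3
      have h4 := congrArg (fun f => f reg) h3
      have h5 := h2.2
      simp only [LinearMap.add_apply, LinearMap.zero_apply] at h4
      linarith
    · intro k _
      rw [h.formC_eq_zero (h.one_tmul_mem _) hw, zero_smul]
      rintro h3
      rw [zero_add] at h3
      simp [h3] at hδ
  rw [h1, map_sum, Finset.mul_sum, map_sum, Finset.sum_eq_zero]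
  intro α hα
  rw [map_smul, mul_smul_comm, map_smul, ← clRight_involute, h.theta_clRight_pos (h.mem_pos.1 hα),
    smul_zero]

end IsRootData
end Theta

/-! ### The twisted projection of the cubic element -/

section ThetaGamma

variable {L A : Type*} [LieRing L] [LieAlgebra ℝ L] [AddCommGroup A] [Module ℝ A]
  {n r : ℕ} {i : A →ₗ[ℝ] L} {β : LinearMap.BilinForm ℝ L}
  {e : Module.Basis (Fin n) ℝ L} {t : Module.Basis (Fin r) ℝ A} {reg : A}
  {E : Module.Dual ℝ A → ℂ ⊗[ℝ] L} (h : IsRootData i β e t reg E)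

namespace IsRootData

/-- The half sum of the positive roots. -/
def halfSum (h : IsRootData i β e t reg E) : Module.Dual ℝ A := (1 / 2 : ℝ) • ∑ α ∈ h.pos, α

include h

/-- Sums over an orthonormal basis in terms of root vectors. -/
lemma sum_bilin {X : Type*} [AddCommGroup X] [Module ℂ X]
    (Φ : ℂ ⊗[ℝ] L →ₗ[ℂ] ℂ ⊗[ℝ] L →ₗ[ℂ] X) :
    ∑ a, Φ (1 ⊗ₜ[ℝ] e a) (1 ⊗ₜ[ℝ] e a) = ∑ k, Φ (1 ⊗ₜ[ℝ] i (t k)) (1 ⊗ₜ[ℝ] i (t k)) +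
      ∑ α ∈ h.pos, (Φ (E α) (conjC (E α)) + Φ (conjC (E α)) (E α)) := by
  have := congrArg (TensorProduct.lift Φ) h.sum_tmul_eq
  simpa using this

lemma spinC_eq (w : ℂ ⊗[ℝ] L) : spinC β e w = (-(1 / 2) : ℂ) •
    (∑ k, clι β (1 ⊗ₜ[ℝ] i (t k)) * clι β ⁅w, (1 : ℂ) ⊗ₜ[ℝ] i (t k)⁆ +
      ∑ α ∈ h.pos, (clι β (E α) * clι β ⁅w, conjC (E α)⁆ +
        clι β (conjC (E α)) * clι β ⁅w, E α⁆)) := by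
  rw [spinC_apply]
  exact congrArg _ (h.sum_bilin ((LinearMap.mul ℂ (Cliff β)).compl₁₂ (clι β) (clι β ∘ₗ lieBil w)))

lemma clGamma_eq_roots : clGamma β e = (1 / 3 : ℂ) •
    (∑ k, clι β (1 ⊗ₜ[ℝ] i (t k)) * spinC β e (1 ⊗ₜ[ℝ] i (t k)) +
      ∑ α ∈ h.pos, (clι β (E α) * spinC β e (conjC (E α)) +
        clι β (conjC (E α)) * spinC β e (E α))) := by
  rw [h.clGamma_eq]
  exact congrArg _ (h.sum_bilin ((LinearMap.mul ℂ (Cliff β)).compl₁₂ (clι β) (spinC β e)))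

lemma halfSum_apply (ξ : A) : (h.halfSum ξ : ℂ) = (1 / 2) * ∑ α ∈ h.pos, (α ξ : ℂ) := by
  rw [halfSum, LinearMap.smul_apply, LinearMap.sum_apply, smul_eq_mul]
  push_cast
  rfl

/-- Normal ordering: each term `x_{e_α} x_{ē_α}` is rewritten with the negative root vector on the
left, and the resulting constants add up to `2πi ρ(ξ)`. In this order the root terms vanish under
the twisted projection, whether one multiplies from the left or from the right. -/
lemma spinC_tmul (ξ : A) : spinC β e (1 ⊗ₜ[ℝ] i ξ) =
    algebraMap ℂ _ (2 * Real.pi * Complex.I * h.halfSum ξ) -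
      ∑ α ∈ h.pos, (2 * Real.pi * Complex.I * α ξ : ℂ) •
        (clι β (conjC (E α)) * clι β (E α)) := by
  rw [h.spinC_eq, Finset.sum_eq_zero, zero_add]
  · have h1 : ∀ α ∈ h.pos, clι β (E α) * clι β ⁅(1 : ℂ) ⊗ₜ[ℝ] i ξ, conjC (E α)⁆ +
        clι β (conjC (E α)) * clι β ⁅(1 : ℂ) ⊗ₜ[ℝ] i ξ, E α⁆ =
        (2 * Real.pi * Complex.I * α ξ : ℂ) •
          ((2 : ℂ) • (clι β (conjC (E α)) * clι β (E α)) - 1) := by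
      intro α hα
      have hα' := h.mem_pos.1 hα
      have h2 := IsCartan.conjC_mem (h.mem α hα') ξ
      rw [h2, h.mem α hα' ξ, map_smul, map_smul, mul_smul_comm, mul_smul_comm,
        h.clι_swap (E α), h.norm α hα', map_one, LinearMap.neg_apply]
      push_cast
      module
    rw [Finset.sum_congr rfl h1, h.halfSum_apply, Finset.mul_sum, Finset.mul_sum, map_sum, Finset.smul_sum,
      ← Finset.sum_sub_distrib]
    refine Finset.sum_congr rfl fun α _ => ?_
    rw [Algebra.algebraMap_eq_smul_one]
    module
  · intro k _
    rw [LieAlgebra.ExtendScalars.bracket_tmul, h.comm, TensorProduct.tmul_zero, map_zero, mul_zero]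

lemma theta_spinC_tmul_mul (ξ : A) (x : Cliff β) : h.theta (spinC β e (1 ⊗ₜ[ℝ] i ξ) * x) =
    (2 * Real.pi * Complex.I * h.halfSum ξ : ℂ) • h.theta x := by
  rw [h.spinC_tmul, sub_mul, map_sub, ← Algebra.smul_def, map_smul, Finset.sum_mul, map_sum,
    Finset.sum_eq_zero, sub_zero]
  intro α hα
  rw [smul_mul_assoc, mul_assoc (clι β _), map_smul, h.theta_conj_mul (h.mem_pos.1 hα), smul_zero]

lemma theta_mul_spinC_tmul (ξ : A) (x : Cliff β) : h.theta (x * spinC β e (1 ⊗ₜ[ℝ] i ξ)) =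
    (2 * Real.pi * Complex.I * h.halfSum ξ : ℂ) • h.theta x := by
  rw [h.spinC_tmul, mul_sub, map_sub, ← Algebra.commutes, ← Algebra.smul_def, map_smul,
    Finset.mul_sum, map_sum, Finset.sum_eq_zero, sub_zero]
  intro α hα
  have hα' := h.mem_pos.1 hα
  rw [mul_smul_comm, ← mul_assoc, map_smul, h.theta_mul_pos hα'.2 (h.mem α hα'), smul_zero]

lemma clι_anticomm {v w : ℂ ⊗[ℝ] L} (hvw : formC β v w = 0) :
    clι β v * clι β w = -(clι β w * clι β v) := by
  rw [h.clι_swap, hvw, map_zero, zero_sub]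

lemma spinC_weight {δ : Module.Dual ℝ A} (hδ : δ ≠ 0) {w : ℂ ⊗[ℝ] L} (hw : w ∈ weightSpace i δ)
    (γ : Module.Dual ℝ A) {x y : ℂ ⊗[ℝ] L} (hx : x ∈ weightSpace i γ)
    (hy : y ∈ weightSpace i (-γ)) :
    clι β x * clι β ⁅w, y⁆ = -(clι β ⁅w, y⁆ * clι β x) := by
  refine h.clι_anticomm (h.formC_eq_zero hx (IsCartan.lie_mem hw hy) ?_)
  rwa [add_comm δ, ← add_assoc, add_neg_cancel, zero_add]

lemma neg_add_apply_neg {α γ : Module.Dual ℝ A} (hα : α ∈ h.pos) (hγ : γ ∈ h.pos) :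
    (-α + -γ) reg < 0 := by
  have h1 := (h.mem_pos.1 hα).2
  have h2 := (h.mem_pos.1 hγ).2
  simp only [LinearMap.add_apply, LinearMap.neg_apply]
  linarith

/-- Every summand of the quadratic element contains a factor of negative weight. Because the total
weight `-α` is nonzero, the two factors anticommute whenever they must be exchanged, so such a
factor can be placed on the left, where it is killed. -/
lemma theta_spinC_conj_mul {α : Module.Dual ℝ A} (hα : α ∈ h.pos) (x : Cliff β) :
    h.theta (spinC β e (conjC (E α)) * x) = 0 := by
  have hα' := h.mem_pos.1 hα
  have hw := IsCartan.conjC_mem (h.mem α hα')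
  have hne : -α ≠ 0 := neg_ne_zero.2 hα'.1.1
  have hneg : (-α) reg < 0 := neg_lt_zero.2 hα'.2
  rw [h.spinC_eq, smul_mul_assoc, map_smul, add_mul, Finset.sum_mul, Finset.sum_mul, map_add,
    map_sum, map_sum, Finset.sum_eq_zero, Finset.sum_eq_zero, add_zero, smul_zero]
  · intro γ hγ
    have hγ' := h.mem_pos.1 hγ
    rw [h.spinC_weight hne hw γ (h.mem γ hγ') (IsCartan.conjC_mem (h.mem γ hγ')), add_mul, map_add,
      neg_mul, map_neg, mul_assoc, mul_assoc,
      h.theta_neg_mul (h.neg_add_apply_neg hα hγ)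
        (IsCartan.lie_mem hw (IsCartan.conjC_mem (h.mem γ hγ'))),
      h.theta_conj_mul hγ', neg_zero, add_zero]
  · intro k _
    rw [h.spinC_weight hne hw 0 (h.one_tmul_mem _) (by rw [neg_zero]; exact h.one_tmul_mem _),
      neg_mul, map_neg, mul_assoc, h.theta_neg_mul (δ := -α + 0) (by rwa [add_zero])
        (IsCartan.lie_mem hw (h.one_tmul_mem _)), neg_zero]

lemma theta_mul_spinC_pos {α : Module.Dual ℝ A} (hα : α ∈ h.pos) (x : Cliff β) :
    h.theta (x * spinC β e (E α)) = 0 := by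
  have hα' := h.mem_pos.1 hα
  have hw := h.mem α hα'
  have hne : α ≠ 0 := hα'.1.1
  rw [h.spinC_eq, mul_smul_comm, map_smul, mul_add, Finset.mul_sum, Finset.mul_sum, map_add,
    map_sum, map_sum, Finset.sum_eq_zero, Finset.sum_eq_zero, add_zero, smul_zero]
  · intro γ hγ
    have hγ' := h.mem_pos.1 hγ
    rw [h.spinC_weight hne hw γ (h.mem γ hγ') (IsCartan.conjC_mem (h.mem γ hγ')), mul_add, map_add,
      mul_neg, map_neg, ← mul_assoc, ← mul_assoc,
      h.theta_mul_pos (add_pos hα'.2 hγ'.2 : 0 < (α + γ) reg)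
        (IsCartan.lie_mem hw (h.mem γ hγ')),
      h.theta_mul_pos hγ'.2 (h.mem γ hγ'), neg_zero, add_zero]
  · intro k _
    have h0 : 0 < (α + 0) reg := by rw [add_zero]; exact hα'.2
    rw [← mul_assoc, h.theta_mul_pos h0 (IsCartan.lie_mem hw (h.one_tmul_mem _))]

lemma sum_root_smul {X : Type*} [AddCommGroup X] [Module ℂ X] (f : Fin r → X) :
    ∑ α ∈ h.pos, ((2 * Real.pi * Complex.I : ℂ) • ∑ k, (α (t k) : ℂ) • f k) =
      (2 : ℂ) • ∑ k, (2 * Real.pi * Complex.I * h.halfSum (t k) : ℂ) • f k := by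
  rw [← Finset.smul_sum, Finset.sum_comm, Finset.smul_sum, Finset.smul_sum]
  refine Finset.sum_congr rfl fun k _ => ?_
  rw [← Finset.sum_smul, h.halfSum_apply]
  module

lemma lie_conj_root {α : Module.Dual ℝ A} (hα : α ∈ h.pos) : ⁅E α, conjC (E α)⁆ =
    (2 * Real.pi * Complex.I : ℂ) • ∑ k, (α (t k) : ℂ) • ((1 : ℂ) ⊗ₜ[ℝ] i (t k)) := by
  have hα' := h.mem_pos.1 hα
  rw [h.lie_conj_eq (h.mem α hα') (IsCartan.conjC_mem (h.mem α hα')), h.norm α hα',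
    mul_one]

/-- In `γ = ⅓ Σ x_a s_a` the torus terms give `2πi ρ_k x_k` once. In the root terms, reordering
leaves only `[e_α, ē_α] = 2πi α`, and the sum over positive roots gives `2πi ρ_k x_k` twice. The
total of three cancels the factor `⅓`. -/
theorem theta_clGamma_mul (x : Cliff β) : h.theta (clGamma β e * x) =
    ∑ k, (2 * Real.pi * Complex.I * h.halfSum (t k) : ℂ) • (clx _ (t k) * h.theta x) := by
  have h1 : ∀ k, h.theta (clι β (1 ⊗ₜ[ℝ] i (t k)) * spinC β e (1 ⊗ₜ[ℝ] i (t k)) * x) =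
      (2 * Real.pi * Complex.I * h.halfSum (t k) : ℂ) • (clx _ (t k) * h.theta x) := by
    intro k
    rw [mul_assoc]
    refine (h.theta_tmul_mul _ _).trans ?_
    rw [h.theta_spinC_tmul_mul, mul_smul_comm]
  have h2 : ∀ α ∈ h.pos, h.theta ((clι β (E α) * spinC β e (conjC (E α)) +
      clι β (conjC (E α)) * spinC β e (E α)) * x) =
      (2 * Real.pi * Complex.I : ℂ) • ∑ k, (α (t k) : ℂ) • (clx _ (t k) * h.theta x) := by
    intro α hα
    have h3 : clι β (E α) * spinC β e (conjC (E α)) = spinC β e (conjC (E α)) * clι β (E α) +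
        clι β ⁅E α, conjC (E α)⁆ := by
      have := h.spinC_clι (conjC (E α)) (E α)
      rw [← lieC_skew (E α), map_neg, ← this]
      abel
    rw [h3, add_mul, add_mul, map_add, map_add, mul_assoc, mul_assoc (clι β (conjC (E α))),
      h.theta_spinC_conj_mul hα, h.theta_conj_mul (h.mem_pos.1 hα), zero_add, add_zero,
      h.lie_conj_root hα, map_smul, smul_mul_assoc, map_smul, map_sum, Finset.sum_mul, map_sum]
    congr 1
    refine Finset.sum_congr rfl fun k _ => ?_
    rw [map_smul, smul_mul_assoc, map_smul]
    exact congrArg _ (h.theta_tmul_mul _ _)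
  rw [h.clGamma_eq_roots, smul_mul_assoc, map_smul, add_mul, Finset.sum_mul, Finset.sum_mul,
    map_add, map_sum, map_sum, Finset.sum_congr rfl fun k _ => h1 k, Finset.sum_congr rfl h2,
    h.sum_root_smul]
  module

/-- The same count for right multiplication, with the same reordering: the factors that now stand on
the right end, with positive weight, are killed. -/
theorem theta_mul_clGamma (x : Cliff β) : h.theta (x * clGamma β e) =
    ∑ k, (2 * Real.pi * Complex.I * h.halfSum (t k) : ℂ) • (h.theta x * clx _ (t k)) := by
  have h1 : ∀ k, h.theta (x * (clι β (1 ⊗ₜ[ℝ] i (t k)) * spinC β e (1 ⊗ₜ[ℝ] i (t k)))) =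
      (2 * Real.pi * Complex.I * h.halfSum (t k) : ℂ) • (h.theta x * clx _ (t k)) := by
    intro k
    rw [← mul_assoc, h.theta_mul_spinC_tmul]
    exact congrArg _ (h.theta_mul_tmul _ _)
  have h2 : ∀ α ∈ h.pos, h.theta (x * (clι β (E α) * spinC β e (conjC (E α)) +
      clι β (conjC (E α)) * spinC β e (E α))) =
      (2 * Real.pi * Complex.I : ℂ) • ∑ k, (α (t k) : ℂ) • (h.theta x * clx _ (t k)) := by
    intro α hα
    have h3 : clι β (E α) * spinC β e (conjC (E α)) = spinC β e (conjC (E α)) * clι β (E α) +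
        clι β ⁅E α, conjC (E α)⁆ := by
      have := h.spinC_clι (conjC (E α)) (E α)
      rw [← lieC_skew (E α), map_neg, ← this]
      abel
    have hα' := h.mem_pos.1 hα
    rw [h3, mul_add, mul_add, map_add, map_add, ← mul_assoc, ← mul_assoc x (clι β (conjC (E α))),
      h.theta_mul_spinC_pos hα, h.theta_mul_pos hα'.2 (h.mem α hα'), zero_add, add_zero,
      h.lie_conj_root hα, map_smul, mul_smul_comm, map_smul, map_sum, Finset.mul_sum, map_sum]
    congr 1
    refine Finset.sum_congr rfl fun k _ => ?_
    rw [map_smul, mul_smul_comm, map_smul]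
    exact congrArg _ (h.theta_mul_tmul _ _)
  rw [h.clGamma_eq_roots, mul_smul_comm, map_smul, mul_add, Finset.mul_sum, Finset.mul_sum,
    map_add, map_sum, map_sum, Finset.sum_congr rfl fun k _ => h1 k, Finset.sum_congr rfl h2,
    h.sum_root_smul]
  module

end IsRootData
end ThetaGamma

/-! ### Comparison with the `r`-matrix and `ρ` -/

section RootSum

variable {n r : ℕ} {G : Type*} [TopologicalSpace G] [ChartedSpace (EuclideanSpace ℝ (Fin n)) G]
  [Group G] [LieGroup (𝓡 n) ∞ G] [T2Space G]
  {T : Type*} [TopologicalSpace T] [ChartedSpace (EuclideanSpace ℝ (Fin r)) T] [Group T]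
  [LieGroup (𝓡 r) ∞ T] [T2Space T] [CompactSpace T]
  {τ : MaxTorus n r G T} {β : InvariantInner n G} (c : CartanWeyl τ β)

namespace CartanWeyl

lemma posRoots_eq : c.posRoots = (c.isRootData.pos : Set (Module.Dual ℝ (LieAlg r T))) := by
  ext α
  exact c.isRootData.mem_pos.symm

lemma mem_pos {α : Module.Dual ℝ (LieAlg r T)} : α ∈ c.isRootData.pos ↔ α ∈ c.posRoots :=
  c.isRootData.mem_pos

lemma rho_eq : c.rho = c.isRootData.halfSum := by
  rw [rho, IsRootData.halfSum, posRoots_eq, finsum_mem_coe_finset]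

/-- Contractions anticommute, so the two halves of the antisymmetric `r`-matrix contribute equally
and `½ r_{ab} ι_a ι_b` becomes `½ Σ_α ι(e_α) ι(ē_α)`. -/
lemma theta_eq : c.clRes ∘ₗ c.twist = c.isRootData.theta := by
  have h1 : (1 / 2 : ℂ) • clContr₂ β.form c.rMatrix = c.isRootData.rOp := by
    rw [rMatrix, posRoots_eq, finsum_mem_coe_finset, map_smul, map_sum, IsRootData.rOp]
    congr 1
    rw [Finset.smul_sum]
    refine Finset.sum_congr rfl fun α _ => ?_
    rw [map_sub]
    have h2 : clContr₂ β.form (c.rootVec α ⊗ₜ[ℂ] MaxTorus.conj (c.rootVec α)) =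
      (clContr β.form (c.rootVec α) * clContr β.form (conjC (c.rootVec α)) :
        Module.End ℂ (Cliff β.form)) := TensorProduct.lift.tmul _ _
    have h3 : clContr₂ β.form (MaxTorus.conj (c.rootVec α) ⊗ₜ[ℂ] c.rootVec α) =
      (clContr β.form (conjC (c.rootVec α)) * clContr β.form (c.rootVec α) :
        Module.End ℂ (Cliff β.form)) := TensorProduct.lift.tmul _ _
    rw [h2, h3, clContr_clContr β.symm (conjC (c.rootVec α))]
    module
  rw [IsRootData.theta, truncExp, ← h1]
  rfl

end CartanWeyl
end RootSum

/-! ### Matrix coefficients of highest weight representations -/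

section MatrixCoefficients

variable {n r : ℕ} {G : Type*} [TopologicalSpace G] [ChartedSpace (EuclideanSpace ℝ (Fin n)) G]
  [Group G] [LieGroup (𝓡 n) ∞ G] [T2Space G]
  {T : Type*} [TopologicalSpace T] [ChartedSpace (EuclideanSpace ℝ (Fin r)) T] [Group T]
  [LieGroup (𝓡 r) ∞ T] [T2Space T] [CompactSpace T]
  {τ : MaxTorus n r G T} {β : InvariantInner n G} {c : CartanWeyl τ β} {χ : Weight r T}

namespace CartanWeyl.HighestWeightRep

variable (V : c.HighestWeightRep χ)

/-- The space of the representation. -/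
abbrev Space : Type := EuclideanSpace ℂ (Fin V.dim)

/-- The matrix coefficient `g ↦ (w₁, g · w₂)`. -/
def mc (w₁ w₂ : V.Space) : SmoothFn (𝓡 n) G :=
  SmoothFn.mk (fun g => inner ℂ w₁ (V.π g w₂))
    (((((innerSL ℂ w₁).comp
      (ContinuousLinearMap.apply ℂ _ w₂)).restrictScalars ℝ).contDiff).comp_contMDiff V.smooth)

lemma mc_apply (w₁ w₂ : V.Space) (g : G) : V.mc w₁ w₂ g = inner ℂ w₁ (V.π g w₂) := rfl

lemma coeff_eq_mc : V.coeff = V.mc V.v V.v := rfl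

/-- The representation of the Lie algebra. -/
def dpi : LieAlg n G →ₗ[ℝ] (V.Space →L[ℂ] V.Space) := orbitDeriv V.π

lemma orbitDeriv_clm {W : Type*} [NormedAddCommGroup W] [NormedSpace ℝ W]
    (L : (V.Space →L[ℂ] V.Space) →L[ℝ] W) (ξ : LieAlg n G) :
    orbitDeriv (fun g => L (V.π g)) ξ = L (V.dpi ξ) := by
  have h1 : HasMFDerivAt (𝓡 n) 𝓘(ℝ, V.Space →L[ℂ] V.Space) V.π 1
    (mfderiv (𝓡 n) 𝓘(ℝ, V.Space →L[ℂ] V.Space) V.π 1) :=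
      (V.smooth.mdifferentiable (by simp) 1).hasMFDerivAt
  have h2 := HasMFDerivAt.comp (1 : G) (L.hasMFDerivAt (x := V.π 1)) h1
  exact congrArg (fun D : EuclideanSpace ℝ (Fin n) →L[ℝ] W => D ξ) h2.mfderiv

lemma dAt_clm (L : (V.Space →L[ℂ] V.Space) →L[ℝ] ℂ) (ξ : LieAlg n G) :
    dAt n (fun g => L (V.π g)) 1 ξ = L (V.dpi ξ) := V.orbitDeriv_clm L ξ

lemma leftInvField_mc (ξ : LieAlg n G) (w₁ w₂ : V.Space) :
    leftInvField ξ (V.mc w₁ w₂) = V.mc w₁ (V.dpi ξ w₂) := by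
  ext g
  have h1 := V.dAt_clm (((innerSL ℂ w₁).comp ((V.π g).comp
    (ContinuousLinearMap.apply ℂ _ w₂))).restrictScalars ℝ) ξ
  refine Eq.trans ?_ h1
  refine congrArg (fun f : G → ℂ => dAt n f 1 ξ) (funext fun h => ?_)
  change inner ℂ w₁ (V.π (g * h) w₂) = inner ℂ w₁ (V.π g (V.π h w₂))
  rw [map_mul]
  rfl

lemma rightInvField_mc_apply (ξ : LieAlg n G) (w₁ w₂ : V.Space) (g : G) :
    rightInvField ξ (V.mc w₁ w₂) g = inner ℂ w₁ (V.dpi ξ (V.π g w₂)) := by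
  have h1 := V.dAt_clm (((innerSL ℂ w₁).comp
    (ContinuousLinearMap.apply ℂ _ (V.π g w₂))).restrictScalars ℝ) ξ
  refine Eq.trans ?_ h1
  refine congrArg (fun f : G → ℂ => dAt n f 1 ξ) (funext fun h => ?_)
  change inner ℂ w₁ (V.π (h * g) w₂) = inner ℂ w₁ (V.π h (V.π g w₂))
  rw [map_mul]
  rfl

lemma inner_π (g : G) (w₁ w₂ : V.Space) :
    inner ℂ (V.π g w₁) (V.π g w₂) = inner ℂ w₁ w₂ := by
  let f : V.Space →ₗᵢ[ℂ] V.Space := ⟨(V.π g).toLinearMap, V.unitary g⟩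
  exact f.inner_map_map w₁ w₂

lemma inner_dpi (ξ : LieAlg n G) (w₁ w₂ : V.Space) :
    inner ℂ w₁ (V.dpi ξ w₂) = -inner ℂ (V.dpi ξ w₁) w₂ := by
  have h1 : rightInvField ξ (V.mc w₁ w₂) 1 = inner ℂ w₁ (V.dpi ξ w₂) := by
    rw [rightInvField_mc_apply, map_one]
    rfl
  have h2 := V.dAt_clm ((Complex.conjCLE : ℂ →L[ℝ] ℂ).comp (((innerSL ℂ w₂).comp
    (ContinuousLinearMap.apply ℂ _ w₁)).restrictScalars ℝ)) ξ
  have h3 : (fun g => ((Complex.conjCLE : ℂ →L[ℝ] ℂ).comp (((innerSL ℂ w₂).comp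
    (ContinuousLinearMap.apply ℂ _ w₁)).restrictScalars ℝ)) (V.π g)) = invFn (V.mc w₁ w₂) := by
    funext g
    change starRingEnd ℂ (inner ℂ w₂ (V.π g w₁)) = inner ℂ w₁ (V.π g⁻¹ w₂)
    rw [inner_conj_symm, ← V.inner_π g w₁]
    congr 1
    change _ = (V.π g * V.π g⁻¹) w₂
    rw [← map_mul, mul_inv_cancel, map_one]
    rfl
  have h4 : rightInvField ξ (V.mc w₁ w₂) 1 = -(leftInvField ξ (invFn (V.mc w₁ w₂)) 1) := by
    rw [rightInvField_eq_invFn]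
    change -(leftInvField ξ (invFn (V.mc w₁ w₂)) 1⁻¹) = _
    rw [inv_one]
  rw [h3] at h2
  rw [← h1, h4, leftInvField_one, h2]
  congr 1
  exact inner_conj_symm (𝕜 := ℂ) (V.dpi ξ w₁) w₂

lemma dpi_lie (ξ η : LieAlg n G) : V.dpi ⁅ξ, η⁆ = V.dpi ξ * V.dpi η - V.dpi η * V.dpi ξ := by
  ext1 w
  refine ext_inner_left ℂ fun w₁ => ?_
  have h1 := congrArg (fun D => D (V.mc w₁ w) 1) (leftInvField_lie ξ η)
  simp only [Derivation.commutator_apply, leftInvField_mc] at h1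
  have h2 : ∀ w₂, V.mc w₁ w₂ 1 = inner ℂ w₁ w₂ := fun w₂ => by
    rw [mc_apply, map_one]; rfl
  rw [← h2, h1]
  change V.mc _ _ 1 - V.mc _ _ 1 = inner ℂ w₁ (V.dpi ξ (V.dpi η w) - V.dpi η (V.dpi ξ w))
  rw [h2, h2, inner_sub_right]

/-- The representation of the complexified Lie algebra. -/
def dpiC : ℂ ⊗[ℝ] LieAlg n G →ₗ[ℂ] (V.Space →L[ℂ] V.Space) := LinearMap.liftBaseChange ℂ V.dpi

lemma dpiC_tmul (z : ℂ) (ξ : LieAlg n G) : V.dpiC (z ⊗ₜ[ℝ] ξ) = z • V.dpi ξ := rfl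

lemma dpiC_lie (x y : ℂ ⊗[ℝ] LieAlg n G) :
    V.dpiC ⁅x, y⁆ = V.dpiC x * V.dpiC y - V.dpiC y * V.dpiC x := by
  induction x with
  | zero => simp
  | add x x' hx hx' => rw [add_lieC, map_add, hx, hx', map_add]; noncomm_ring
  | tmul a x =>
    induction y with
    | zero => simp
    | add y y' hy hy' => rw [lieC_add, map_add, hy, hy', map_add]; noncomm_ring
    | tmul b y =>
      rw [LieAlgebra.ExtendScalars.bracket_tmul, dpiC_tmul, dpiC_tmul, dpiC_tmul, dpi_lie,
        smul_mul_smul_comm, smul_mul_smul_comm, mul_comm b a, smul_sub]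

lemma inner_dpiC (x : ℂ ⊗[ℝ] LieAlg n G) (w₁ w₂ : V.Space) :
    inner ℂ w₁ (V.dpiC x w₂) = -inner ℂ (V.dpiC (conjC x) w₁) w₂ := by
  induction x with
  | zero => simp
  | add x y hx hy =>
    rw [map_add, map_add, map_add, add_apply, add_apply,
      inner_add_right, inner_add_left, hx, hy]
    ring
  | tmul a x =>
    rw [conjC_tmul, dpiC_tmul, dpiC_tmul, smul_apply,
      smul_apply, inner_smul_right, inner_smul_left, inner_dpi,
      Complex.conj_conj]
    ring

lemma dpiC_v {α : Module.Dual ℝ (LieAlg r T)} (hα : α ∈ c.posRoots) : V.dpiC (c.rootVec α) V.v = 0 := by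
  refine Eq.trans ?_ (V.highest α hα (c.rootVec α) (c.rootVec_mem α hα.1 hα.2))
  generalize c.rootVec α = x
  induction x with
  | zero => simp
  | add x y hx hy => rw [map_add, map_add, add_apply, hx, hy]
  | tmul a x =>
    rw [dpiC_tmul, LinearMap.liftBaseChange_tmul, smul_apply]
    congr 1
    exact (V.orbitDeriv_clm ((ContinuousLinearMap.apply ℂ _ V.v).restrictScalars ℝ) x).symm

lemma dpi_v (ξ : LieAlg r T) :
    V.dpi (τ.lieIncl ξ) V.v = (2 * Real.pi * Complex.I * χ.lin ξ : ℂ) • V.v := by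
  refine ext_inner_left ℂ fun w => ?_
  have h1 : τ.resFn (V.mc w V.v) = inner ℂ w V.v • χ.fn := by
    ext t
    change inner ℂ w (V.π (τ.incl t) V.v) = inner ℂ w V.v * (χ.char t : ℂ)
    rw [V.weight, inner_smul_right, mul_comm]
  have h2 := congrArg (fun f => leftInvField ξ f 1) h1
  simp only [MaxTorus.leftInvField_resFn, Derivation.map_smul, χ.leftInvField_fn,
    leftInvField_mc] at h2
  have h3 : τ.resFn (V.mc w (V.dpi (τ.lieIncl ξ) V.v)) 1 =
      inner ℂ w (V.dpi (τ.lieIncl ξ) V.v) := by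
    rw [MaxTorus.resFn_apply, map_one, mc_apply, map_one]
    rfl
  rw [← h3, h2, inner_smul_right]
  change inner ℂ w V.v * (_ * (χ.char 1 : ℂ)) = _
  rw [map_one, Circle.coe_one]
  ring

end CartanWeyl.HighestWeightRep
end MatrixCoefficients

/-! ### Casimir eigenvalue and growth of the derivatives of `Δ_χ` -/

section Casimir

variable {n r : ℕ} {G : Type*} [TopologicalSpace G] [ChartedSpace (EuclideanSpace ℝ (Fin n)) G]
  [Group G] [LieGroup (𝓡 n) ∞ G] [T2Space G]
  {T : Type*} [TopologicalSpace T] [ChartedSpace (EuclideanSpace ℝ (Fin r)) T] [Group T]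
  [LieGroup (𝓡 r) ∞ T] [T2Space T] [CompactSpace T]
  {τ : MaxTorus n r G T} {β : InvariantInner n G} {c : CartanWeyl τ β} {χ : Weight r T}

namespace CartanWeyl

/-- Minus the eigenvalue of the Casimir operator on the representation with highest weight `χ`. -/
def casimirValue (c : CartanWeyl τ β) (χ : Weight r T) : ℝ :=
  4 * Real.pi ^ 2 * ∑ k, (χ.lin (c.basisT k) ^ 2 + 2 * c.rho (c.basisT k) * χ.lin (c.basisT k))

namespace HighestWeightRep

variable (V : c.HighestWeightRep χ)

/-- The Casimir operator. -/
def casimir : V.Space →L[ℂ] V.Space := ∑ a, V.dpi (c.basis a) * V.dpi (c.basis a)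

/-- On matrix coefficients the right invariant Casimir acts after `π g` and the left invariant one
before it, so their equality as differential operators says that the Casimir operator commutes with
the group. -/
lemma casimir_π [ConnectedSpace G] (g : G) (w : V.Space) :
    V.casimir (V.π g w) = V.π g (V.casimir w) := by
  refine ext_inner_left ℂ fun w₁ => ?_
  have h1 := congrArg (fun f => f g) (β.casimir_comm c.basis c.basis_orthonormal (V.mc w₁ w))
  have h2 : ∀ s : Fin n → SmoothFn (𝓡 n) G, (∑ a, s a) g = ∑ a, s a g := fun s =>
    map_sum ({ toFun := fun u => u g, map_zero' := rfl, map_add' := fun _ _ => rfl } :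
      SmoothFn (𝓡 n) G →+ ℂ) s _
  have h3 : ∀ ξ, rightInvField ξ (rightInvField ξ (V.mc w₁ w)) g =
      inner ℂ w₁ (V.dpi ξ (V.dpi ξ (V.π g w))) := by
    intro ξ
    have h4 : rightInvField ξ (V.mc w₁ w) = -V.mc (V.dpi ξ w₁) w := by
      ext g
      rw [rightInvField_mc_apply, inner_dpi]
      rfl
    rw [h4, map_neg]
    change -(rightInvField ξ (V.mc (V.dpi ξ w₁) w) g) = _
    rw [rightInvField_mc_apply, inner_dpi V ξ w₁]
  simp only [h2, h3, leftInvField_mc] at h1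
  rw [casimir, sum_apply, sum_apply, inner_sum, map_sum,
    inner_sum]
  exact h1

/-- In the root basis the positive root vectors kill `v`, so `e_α ē_α` acts on `v` as `[e_α, ē_α]`,
an element of `𝔱`. The sum over positive roots produces the term with `2ρ`. -/
lemma casimir_v : V.casimir V.v = -(c.casimirValue χ : ℂ) • V.v := by
  have h := c.isRootData
  have h0 : V.casimir = ∑ k, V.dpiC (1 ⊗ₜ[ℝ] τ.lieIncl (c.basisT k)) *
      V.dpiC (1 ⊗ₜ[ℝ] τ.lieIncl (c.basisT k)) +
      ∑ α ∈ h.pos, (V.dpiC (c.rootVec α) * V.dpiC (conjC (c.rootVec α)) +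
        V.dpiC (conjC (c.rootVec α)) * V.dpiC (c.rootVec α)) := by
    rw [casimir]
    refine Eq.trans (Finset.sum_congr rfl fun a _ => ?_) (h.sum_bilin
      ((LinearMap.mul ℂ (V.Space →L[ℂ] V.Space)).compl₁₂ V.dpiC V.dpiC))
    change _ = V.dpiC _ * V.dpiC _
    rw [dpiC_tmul, one_smul]
  have h1 : ∀ k, (V.dpiC (1 ⊗ₜ[ℝ] τ.lieIncl (c.basisT k)) *
      V.dpiC (1 ⊗ₜ[ℝ] τ.lieIncl (c.basisT k))) V.v =
      (2 * Real.pi * Complex.I * χ.lin (c.basisT k) : ℂ) ^ 2 • V.v := by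
    intro k
    rw [dpiC_tmul, one_smul]
    change V.dpi (τ.lieIncl (c.basisT k)) (V.dpi (τ.lieIncl (c.basisT k)) V.v) = _
    rw [dpi_v, map_smul, dpi_v, smul_smul, sq]
  have h2 : ∀ α ∈ h.pos, (V.dpiC (c.rootVec α) * V.dpiC (conjC (c.rootVec α)) +
      V.dpiC (conjC (c.rootVec α)) * V.dpiC (c.rootVec α)) V.v =
      (2 * Real.pi * Complex.I : ℂ) • ∑ k, (α (c.basisT k) : ℂ) •
        (2 * Real.pi * Complex.I * χ.lin (c.basisT k) : ℂ) • V.v := by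
    intro α hα
    have h3 : V.dpiC (c.rootVec α) V.v = 0 := V.dpiC_v (c.mem_pos.1 hα)
    have h4 := congrArg (fun A => A V.v) (V.dpiC_lie (c.rootVec α) (conjC (c.rootVec α)))
    rw [h.lie_conj_root hα] at h4
    change _ = V.dpiC _ (V.dpiC _ V.v) - V.dpiC _ (V.dpiC _ V.v) at h4
    rw [h3, map_zero, sub_zero] at h4
    change V.dpiC _ (V.dpiC _ V.v) + V.dpiC _ (V.dpiC _ V.v) = _
    rw [h3, map_zero, add_zero, ← h4, map_smul, map_sum, smul_apply,
      sum_apply]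
    congr 1
    refine Finset.sum_congr rfl fun k _ => ?_
    rw [map_smul, smul_apply, dpiC_tmul, one_smul, dpi_v]
  rw [h0, add_apply, sum_apply,
    sum_apply, Finset.sum_congr rfl fun k _ => h1 k, Finset.sum_congr rfl h2,
    h.sum_root_smul, casimirValue, c.rho_eq, Finset.smul_sum, ← Finset.sum_add_distrib,
    Complex.ofReal_mul, Complex.ofReal_sum, Finset.mul_sum, ← Finset.sum_neg_distrib,
    Finset.sum_smul]
  refine Finset.sum_congr rfl fun k _ => ?_
  rw [smul_smul, smul_smul, ← add_smul]
  congr 1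
  push_cast
  linear_combination (4 * Real.pi ^ 2 * (χ.lin (c.basisT k) : ℂ) ^ 2 +
    8 * Real.pi ^ 2 * (h.halfSum (c.basisT k) : ℂ) * (χ.lin (c.basisT k) : ℂ)) * Complex.I_sq

/-- The eigenspace is invariant under the group and contains the nonzero vector `v`, so by
irreducibility it is the whole space. -/
lemma casimir_eq [ConnectedSpace G] (w : V.Space) :
    V.casimir w = -(c.casimirValue χ : ℂ) • w := by
  let W : Submodule ℂ V.Space :=
    LinearMap.ker (V.casimir.toLinearMap - (-(c.casimirValue χ : ℂ)) • LinearMap.id)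
  have hW : ∀ w, w ∈ W ↔ V.casimir w = -(c.casimirValue χ : ℂ) • w := fun w => by
    rw [LinearMap.mem_ker, LinearMap.sub_apply, sub_eq_zero]
    rfl
  rcases V.irreducible W fun g w hw => (hW _).2 (by rw [casimir_π, (hW w).1 hw, map_smul]) with h | h
  · have h1 : V.v ∈ W := (hW _).2 V.casimir_v
    rw [h, Submodule.mem_bot] at h1
    have := V.norm_v
    rw [h1, norm_zero] at this
    exact absurd this zero_ne_one
  · exact (hW w).1 (h ▸ Submodule.mem_top)

/-- By unitarity the Casimir operator is minus the sum of the `A* A` over a basis. Its scalar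
therefore bounds the norm of every basis element of the Lie algebra in the representation. -/
lemma sum_norm_dpi_sq [ConnectedSpace G] (w : V.Space) :
    ∑ a, ‖V.dpi (c.basis a) w‖ ^ 2 = c.casimirValue χ * ‖w‖ ^ 2 := by
  have h1 : inner ℂ w (V.casimir w) = -((∑ a, ‖V.dpi (c.basis a) w‖ ^ 2 : ℝ) : ℂ) := by
    rw [casimir, sum_apply, inner_sum, Complex.ofReal_sum,
      ← Finset.sum_neg_distrib]
    refine Finset.sum_congr rfl fun a _ => ?_
    change inner ℂ w (V.dpi _ (V.dpi _ w)) = _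
    rw [inner_dpi, inner_self_eq_norm_sq_to_K]
    push_cast
    rfl
  rw [casimir_eq, inner_smul_right, inner_self_eq_norm_sq_to_K, neg_mul, neg_inj] at h1
  refine Complex.ofReal_injective (h1.symm.trans ?_)
  push_cast
  rfl

lemma norm_dpi_le [ConnectedSpace G] {C : ℝ} (hC : 0 ≤ C) (h : c.casimirValue χ ≤ C ^ 2) (a : Fin n)
    (w : V.Space) : ‖V.dpi (c.basis a) w‖ ≤ C * ‖w‖ := by
  refine le_of_sq_le_sq ?_ (by positivity)
  calc ‖V.dpi (c.basis a) w‖ ^ 2 ≤ ∑ a, ‖V.dpi (c.basis a) w‖ ^ 2 :=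
        Finset.single_le_sum (f := fun a => ‖V.dpi (c.basis a) w‖ ^ 2) (fun _ _ => sq_nonneg _)
          (Finset.mem_univ a)
    _ = c.casimirValue χ * ‖w‖ ^ 2 := V.sum_norm_dpi_sq w
    _ ≤ (C * ‖w‖) ^ 2 := by rw [mul_pow]; gcongr

lemma exists_iterDer_mc [ConnectedSpace G] {C : ℝ} (hC : 0 ≤ C) (h : c.casimirValue χ ≤ C ^ 2)
    (v : List (Fin n)) (w₁ : V.Space) : ∃ w : V.Space,
      iterDer (v.map fun b => leftInvField (c.basis b)) (V.mc w₁ V.v) = V.mc w₁ w ∧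
        ‖w‖ ≤ C ^ v.length := by
  induction v with
  | nil => exact ⟨V.v, rfl, by simp [V.norm_v]⟩
  | cons b v ih =>
    obtain ⟨w, h1, h2⟩ := ih
    refine ⟨V.dpi (c.basis b) w, ?_, ?_⟩
    · rw [List.map_cons, iterDer_cons, h1, leftInvField_mc]
    · rw [List.length_cons, pow_succ']
      exact (V.norm_dpi_le hC h b w).trans (by gcongr)

lemma norm_mc_le [CompactSpace G] (w₁ w₂ : V.Space) : ‖toCont (𝓡 n) G (V.mc w₁ w₂)‖ ≤ ‖w₁‖ * ‖w₂‖ := by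
  refine (ContinuousMap.norm_le _ (by positivity)).2 fun g => ?_
  refine (norm_inner_le_norm (𝕜 := ℂ) w₁ (V.π g w₂)).trans ?_
  rw [V.unitary]

end HighestWeightRep

/-- Derivatives of `Δ_χ` grow at most polynomially in `χ`. -/
theorem norm_iterDer_Delta_le [ConnectedSpace G] [CompactSpace G] (χ : Weight r T) {C : ℝ}
    (hC : 0 ≤ C) (h : c.casimirValue χ ≤ C ^ 2) (v : List (Fin n)) :
    ‖toCont (𝓡 n) G (iterDer (v.map fun b => leftInvField (c.basis b)) (c.Delta χ))‖ ≤
      C ^ v.length := by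
  rw [Delta]
  split_ifs with hV
  · rw [HighestWeightRep.coeff_eq_mc]
    obtain ⟨w, h1, h2⟩ := hV.some.exists_iterDer_mc hC h v hV.some.v
    rw [h1]
    refine (hV.some.norm_mc_le _ _).trans ?_
    rwa [hV.some.norm_v, one_mul]
  -- If there is no representation with highest weight `χ`, the default value of `Delta` is zero,
  -- and the bound is trivial.
  · rw [map_zero, map_zero, norm_zero]
    positivity

end CartanWeyl
end Casimir

/-! ### Derivatives of `Δ_χ` along root vectors -/

section ComplexDerivations

variable {n r : ℕ} {G : Type*} [TopologicalSpace G] [ChartedSpace (EuclideanSpace ℝ (Fin n)) G]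
  [Group G] [LieGroup (𝓡 n) ∞ G] [T2Space G]

/-- Derivatives of `f` along right invariant fields, complex linear in the field. -/
def rightDer (f : SmoothFn (𝓡 n) G) : ℂ ⊗[ℝ] LieAlg n G →ₗ[ℂ] SmoothFn (𝓡 n) G :=
  LinearMap.liftBaseChange ℂ
    { toFun := fun ξ => rightInvField ξ f
      map_add' := fun ξ η => by rw [rightInvField_add]; rfl
      map_smul' := fun a ξ => by rw [rightInvField_smul]; rfl }

/-- Derivatives of `f` along left invariant fields, complex linear in the field. -/
def leftDer (f : SmoothFn (𝓡 n) G) : ℂ ⊗[ℝ] LieAlg n G →ₗ[ℂ] SmoothFn (𝓡 n) G :=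
  LinearMap.liftBaseChange ℂ
    { toFun := fun ξ => leftInvField ξ f
      map_add' := fun ξ η => by rw [leftInvField_add]; rfl
      map_smul' := fun a ξ => by rw [leftInvField_smul]; rfl }

lemma rightDer_tmul (f : SmoothFn (𝓡 n) G) (z : ℂ) (ξ : LieAlg n G) :
    rightDer f (z ⊗ₜ[ℝ] ξ) = z • rightInvField ξ f := rfl

lemma leftDer_tmul (f : SmoothFn (𝓡 n) G) (z : ℂ) (ξ : LieAlg n G) :
    leftDer f (z ⊗ₜ[ℝ] ξ) = z • leftInvField ξ f := rfl

lemma rightDer_zero (x : ℂ ⊗[ℝ] LieAlg n G) : rightDer (0 : SmoothFn (𝓡 n) G) x = 0 := by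
  induction x with
  | zero => simp
  | add x y hx hy => rw [map_add, hx, hy, add_zero]
  | tmul z ξ => rw [rightDer_tmul, map_zero, smul_zero]

lemma leftDer_zero (x : ℂ ⊗[ℝ] LieAlg n G) : leftDer (0 : SmoothFn (𝓡 n) G) x = 0 := by
  induction x with
  | zero => simp
  | add x y hx hy => rw [map_add, hx, hy, add_zero]
  | tmul z ξ => rw [leftDer_tmul, map_zero, smul_zero]

variable {T : Type*} [TopologicalSpace T] [ChartedSpace (EuclideanSpace ℝ (Fin r)) T] [Group T]
  [LieGroup (𝓡 r) ∞ T] [T2Space T] [CompactSpace T]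
  {τ : MaxTorus n r G T} {β : InvariantInner n G} {c : CartanWeyl τ β} {χ : Weight r T}

namespace CartanWeyl

lemma HighestWeightRep.leftDer_mc (V : c.HighestWeightRep χ) (w₁ w₂ : V.Space)
    (x : ℂ ⊗[ℝ] LieAlg n G) : leftDer (V.mc w₁ w₂) x = V.mc w₁ (V.dpiC x w₂) := by
  ext g
  induction x with
  | zero => simp [mc_apply]
  | add x y hx hy =>
    have h1 : V.dpiC (x + y) w₂ = V.dpiC x w₂ + V.dpiC y w₂ := by rw [map_add]; rfl
    rw [map_add (leftDer (V.mc w₁ w₂)), h1]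
    change leftDer (V.mc w₁ w₂) x g + leftDer (V.mc w₁ w₂) y g = _
    rw [hx, hy, mc_apply, mc_apply, mc_apply, map_add, inner_add_right]
  | tmul z ξ =>
    rw [leftDer_tmul, leftInvField_mc, dpiC_tmul, SmoothFn.smul_apply, mc_apply, mc_apply,
      smul_apply, map_smul, inner_smul_right]

lemma HighestWeightRep.rightDer_mc_apply (V : c.HighestWeightRep χ) (w₁ w₂ : V.Space)
    (x : ℂ ⊗[ℝ] LieAlg n G) (g : G) :
    rightDer (V.mc w₁ w₂) x g = -inner ℂ (V.dpiC (conjC x) w₁) (V.π g w₂) := by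
  rw [← inner_dpiC]
  induction x with
  | zero => simp
  | add x y hx hy =>
    have h1 : V.dpiC (x + y) (V.π g w₂) = V.dpiC x (V.π g w₂) + V.dpiC y (V.π g w₂) := by
      rw [map_add]; rfl
    rw [map_add (rightDer (V.mc w₁ w₂)), h1]
    change rightDer (V.mc w₁ w₂) x g + rightDer (V.mc w₁ w₂) y g = _
    rw [hx, hy, inner_add_right]
  | tmul z ξ =>
    rw [rightDer_tmul, SmoothFn.smul_apply, rightInvField_mc_apply, dpiC_tmul,
      smul_apply, inner_smul_right]

/-- Left invariant derivatives act on the vector to the right of the group element, and that vector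
is annihilated by positive root vectors. -/
lemma leftDer_Delta_pos (χ : Weight r T) {α : Module.Dual ℝ (LieAlg r T)} (hα : α ∈ c.posRoots) :
    leftDer (c.Delta χ) (c.rootVec α) = 0 := by
  rw [Delta]
  split_ifs with hV
  · rw [HighestWeightRep.coeff_eq_mc, HighestWeightRep.leftDer_mc, hV.some.dpiC_v hα]
    ext g
    rw [HighestWeightRep.mc_apply, map_zero, inner_zero_right]
    rfl
  · exact leftDer_zero _

/-- Right invariant derivatives act to the left of the group element. Unitarity moves them to the
other side of the inner product with a conjugation, so a negative root vector becomes a positive one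
acting on the highest weight vector. -/
lemma rightDer_Delta_conj (χ : Weight r T) {α : Module.Dual ℝ (LieAlg r T)} (hα : α ∈ c.posRoots) :
    rightDer (c.Delta χ) (conjC (c.rootVec α)) = 0 := by
  rw [Delta]
  split_ifs with hV
  · ext g
    rw [HighestWeightRep.coeff_eq_mc, HighestWeightRep.rightDer_mc_apply, conjC_conjC,
      hV.some.dpiC_v hα, inner_zero_left, neg_zero]
    rfl
  · exact rightDer_zero _

lemma leftInvField_Delta (χ : Weight r T) (ξ : LieAlg r T) :
    leftInvField (τ.lieIncl ξ) (c.Delta χ) = (2 * Real.pi * Complex.I * χ.lin ξ : ℂ) • c.Delta χ := by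
  rw [Delta]
  split_ifs with hV
  · ext g
    rw [HighestWeightRep.coeff_eq_mc, HighestWeightRep.leftInvField_mc, hV.some.dpi_v,
      SmoothFn.smul_apply, HighestWeightRep.mc_apply, HighestWeightRep.mc_apply, map_smul,
      inner_smul_right]
  · rw [map_zero, smul_zero]

lemma rightInvField_Delta (χ : Weight r T) (ξ : LieAlg r T) :
    rightInvField (τ.lieIncl ξ) (c.Delta χ) = (2 * Real.pi * Complex.I * χ.lin ξ : ℂ) • c.Delta χ := by
  rw [Delta]
  split_ifs with hV
  · ext g
    rw [HighestWeightRep.coeff_eq_mc, HighestWeightRep.rightInvField_mc_apply,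
      HighestWeightRep.inner_dpi, hV.some.dpi_v, SmoothFn.smul_apply, HighestWeightRep.mc_apply,
      inner_smul_left]
    simp only [map_mul, Complex.conj_ofReal, Complex.conj_I, map_ofNat]
    ring
  · rw [map_zero, smul_zero]

end CartanWeyl
end ComplexDerivations

/-! ### Operators on `C^∞(T)` prescribed on characters -/

section FourierMultiplier

variable {n r : ℕ} {G : Type*} [TopologicalSpace G] [ChartedSpace (EuclideanSpace ℝ (Fin n)) G]
  [Group G] [LieGroup (𝓡 n) ∞ G] [T2Space G] [CompactSpace G]

lemma exists_iterDer_bound (e : Module.Basis (Fin n) ℝ (LieAlg n G))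
    (F : (Fin r → ℤ) → SmoothFn (𝓡 n) G)
    (hF : ∀ v : List (Fin n), ∃ (D : ℝ) (N : ℕ), ∀ k,
      ‖toCont (𝓡 n) G (iterDer (v.map fun b => leftInvField (e b)) (F k))‖ ≤ D * intSize k ^ N)
    (w : List (VField (𝓡 n) G)) : ∃ (D : ℝ) (N : ℕ), 0 ≤ D ∧ ∀ k,
      ‖toCont (𝓡 n) G (iterDer w (F k))‖ ≤ D * intSize k ^ N := by
  obtain ⟨a, ha⟩ := exists_iterDer_eq_sum e w
  choose D N hDN using hF
  refine ⟨∑ v ∈ a.support, ‖toCont (𝓡 n) G (a v)‖ * |D v|, ∑ v ∈ a.support, N v,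
    Finset.sum_nonneg fun v _ => by positivity, fun k => ?_⟩
  have h0 := one_le_intSize k
  rw [ha, map_sum, Finset.sum_mul]
  refine (norm_sum_le _ _).trans (Finset.sum_le_sum fun v hv => ?_)
  refine (norm_toCont_mul_le _ _).trans ?_
  rw [mul_assoc]
  refine mul_le_mul_of_nonneg_left ((hDN v k).trans ?_) (norm_nonneg _)
  refine mul_le_mul (le_abs_self _) ?_ (by positivity) (abs_nonneg _)
  exact pow_le_pow_right₀ h0 (Finset.single_le_sum (f := N) (fun _ _ => Nat.zero_le _) hv)

variable {T : Type*} [TopologicalSpace T] [ChartedSpace (EuclideanSpace ℝ (Fin r)) T]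
  [CommGroup T] [LieGroup (𝓡 r) ∞ T] [T2Space T] [CompactSpace T] [ConnectedSpace T]
  (ξ : Module.Basis (Fin r) ℝ (LieAlg r T))
  (hξ : ∀ x, torusExp ξ x = 1 ↔ ∀ i, ∃ k : ℤ, x i = k)

/-- Continuous linear maps out of `C^∞(T)` with prescribed values on the characters. -/
theorem exists_clm_of_intWeight (e : Module.Basis (Fin n) ℝ (LieAlg n G))
    (F : (Fin r → ℤ) → SmoothFn (𝓡 n) G)
    (hF : ∀ v : List (Fin n), ∃ (D : ℝ) (N : ℕ), ∀ k,
      ‖toCont (𝓡 n) G (iterDer (v.map fun b => leftInvField (e b)) (F k))‖ ≤ D * intSize k ^ N) :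
    ∃ S : SmoothFn (𝓡 r) T →L[ℂ] SmoothFn (𝓡 n) G, ∀ k, S (intWeight ξ hξ k).fn = F k := by
  have hw := exists_iterDer_bound e F hF
  -- Polynomial growth of the prescribed values against rapid decay of the Fourier coefficients.
  have hs : ∀ (f : SmoothFn (𝓡 r) T) (w : List (VField (𝓡 n) G)), Summable fun k =>
      ‖toCont (𝓡 n) G (iterDer w (fourierCoef ξ hξ k f • F k))‖ := by
    intro f w
    obtain ⟨D, N, hD, h⟩ := hw w
    refine Summable.of_nonneg_of_le (fun _ => norm_nonneg _) (fun k => ?_)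
      ((summable_intSize_mul ξ hξ N f).mul_left D)
    rw [map_smul, map_smul, norm_smul]
    refine (mul_le_mul_of_nonneg_left (h k) (norm_nonneg _)).trans_eq ?_
    ring
  choose S hS using fun f => exists_hasSum_smoothFn _ (hs f)
  let S' : SmoothFn (𝓡 r) T →ₗ[ℂ] SmoothFn (𝓡 n) G :=
    { toFun := S
      map_add' := fun f g => (hS (f + g)).unique (by
        refine ((hS f).add (hS g)).congr_fun fun k => ?_
        rw [map_add, add_smul])
      map_smul' := fun a f => (hS (a • f)).unique (by
        refine ((hS f).const_smul a).congr_fun fun k => ?_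
        rw [map_smul, smul_assoc]) }
  have hS0 : S 0 = 0 := map_zero S'
  have hc : Continuous S' := by
    refine continuous_of_continuousAt_zero S' ?_
    rw [ContinuousAt, map_zero, tendsto_smoothFn_iff]
    intro w
    obtain ⟨D, N, hD, h⟩ := hw w
    -- The power `N` absorbs the growth of `F`, and `2 * r` more powers make the sum over `ℤ^r`
    -- converge. The bound is then a constant times the continuous function `q`, which vanishes at
    -- `0`.
    obtain ⟨q, hq, hq0, hqb⟩ := exists_fourierCoef_bound ξ hξ (N + 2 * r)
    rw [map_zero, map_zero]
    refine squeeze_zero_norm (a := fun f => (∑' k : Fin r → ℤ, (intSize k ^ (2 * r))⁻¹) * (D * q f))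
      (fun f => ?_) ?_
    · refine ((hS f).map ((toCont (𝓡 n) G) ∘ₗ iterDer w)
        (continuous_toCont_iterDer w)).norm_le_of_bounded
        ((summable_intSize r).hasSum.mul_right (D * q f)) fun k => ?_
      have h0 := one_le_intSize k
      change ‖toCont (𝓡 n) G (iterDer w (fourierCoef ξ hξ k f • F k))‖ ≤ _
      rw [map_smul, map_smul, norm_smul]
      calc ‖fourierCoef ξ hξ k f‖ * ‖toCont (𝓡 n) G (iterDer w (F k))‖
          ≤ ‖fourierCoef ξ hξ k f‖ * (D * intSize k ^ N) :=
            mul_le_mul_of_nonneg_left (h k) (norm_nonneg _)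
        _ = (intSize k ^ (2 * r))⁻¹ * (D * (intSize k ^ (N + 2 * r) * ‖fourierCoef ξ hξ k f‖)) := by
            rw [pow_add]
            field_simp
        _ ≤ _ := by
            have := hqb k f
            gcongr
    · have : Continuous fun f => (∑' k : Fin r → ℤ, (intSize k ^ (2 * r))⁻¹) * (D * q f) := by
        fun_prop
      have h1 := this.tendsto 0
      rwa [hq0, mul_zero, mul_zero] at h1
  refine ⟨⟨S', hc⟩, fun l => (hS _).unique ?_⟩
  have h1 := hasSum_single (f := fun k => fourierCoef ξ hξ k (intWeight ξ hξ l).fn • F k) l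
    (fun k hk => by rw [fourierCoef_weight, if_neg hk, zero_smul])
  rwa [fourierCoef_weight, if_pos rfl, one_smul] at h1

end FourierMultiplier

/-! ### The transpose of the restriction map -/

section DeltaOperator

variable {n r : ℕ} {G : Type*} [TopologicalSpace G] [ChartedSpace (EuclideanSpace ℝ (Fin n)) G]
  [Group G] [LieGroup (𝓡 n) ∞ G] [T2Space G] [CompactSpace G] [ConnectedSpace G]
  {T : Type*} [TopologicalSpace T] [ChartedSpace (EuclideanSpace ℝ (Fin r)) T] [Group T]
  [LieGroup (𝓡 r) ∞ T] [T2Space T] [CompactSpace T]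

lemma abs_lin_le {ξ : Module.Basis (Fin r) ℝ (LieAlg r T)} {f : Module.Dual ℝ (LieAlg r T)}
    {k : Fin r → ℤ} (hf : ∀ i, f (ξ i) = k i) (η : LieAlg r T) :
    |f η| ≤ (∑ i, |ξ.repr η i|) * intSize k := by
  conv_lhs => rw [← ξ.sum_repr η]
  rw [map_sum, Finset.sum_mul]
  refine (Finset.abs_sum_le_sum_abs _ _).trans (Finset.sum_le_sum fun i _ => ?_)
  rw [map_smul, smul_eq_mul, abs_mul, hf]
  have := abs_le_intSize k i
  gcongr
  linarith

namespace MaxTorus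

variable (τ : MaxTorus n r G T)

include τ in
/-- The characters span a dense subspace of `C^∞(T)`. -/
theorem ext_of_weight {B : Type*} [AddCommGroup B] [Module ℂ B] [TopologicalSpace B] [T2Space B]
    {u v : SmoothFn (𝓡 r) T →L[ℂ] B} (h : ∀ ν : Weight r T, u ν.fn = v ν.fn) : u = v := by
  let _ : CommGroup T := commGroupOf τ.mul_comm
  have := τ.connectedSpace
  obtain ⟨ξ, hξ⟩ := exists_torusBasis (r := r) (T := T)
  ext f
  have h1 := (hasSum_fourier ξ hξ f).map u u.continuous
  have h2 := (hasSum_fourier ξ hξ f).map v v.continuous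
  refine h1.unique (h2.congr_fun fun k => ?_)
  simp only [Function.comp_apply, map_smul, h]

include τ in
lemma weight_ext {ν ν' : Weight r T} (h : ν.lin = ν'.lin) : ν = ν' := by
  let _ : CommGroup T := commGroupOf τ.mul_comm
  have := τ.connectedSpace
  obtain ⟨ξ, hξ⟩ := exists_torusBasis (r := r) (T := T)
  exact Weight.eq_of_lin_eq ξ h

end MaxTorus

namespace CartanWeyl

variable {τ : MaxTorus n r G T} {β : InvariantInner n G} (c : CartanWeyl τ β)

/-- Completing the square, the value is `4π²(|χ+ρ|² - |ρ|²)`, hence at most `4π²|ν|²`. The norm of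
`ν` is controlled by its integral coordinates `k`. -/
lemma casimirValue_le {χ : Weight r T} {ν : Module.Dual ℝ (LieAlg r T)} (h : ν = χ.lin + c.rho)
    {ξ : Module.Basis (Fin r) ℝ (LieAlg r T)} {k : Fin r → ℤ} (hν : ∀ i, ν (ξ i) = k i) :
    c.casimirValue χ ≤ (2 * Real.pi * √(∑ l, (∑ i, |ξ.repr (c.basisT l) i|) ^ 2) * intSize k) ^ 2 := by
  rw [mul_pow, mul_pow, Real.sq_sqrt (Finset.sum_nonneg fun _ _ => sq_nonneg _), mul_assoc,
    Finset.sum_mul, casimirValue, mul_pow]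
  refine (mul_le_mul_of_nonneg_left (Finset.sum_le_sum fun l _ => ?_) (by positivity)).trans_eq
    (by ring)
  have h1 := abs_lin_le hν (c.basisT l)
  have h2 : ν (c.basisT l) ^ 2 ≤ ((∑ i, |ξ.repr (c.basisT l) i|) * intSize k) ^ 2 := by
    rw [← sq_abs]
    exact pow_le_pow_left₀ (abs_nonneg _) h1 2
  rw [mul_pow, h, LinearMap.add_apply] at h2
  have h3 := sq_nonneg (c.rho (c.basisT l))
  linarith

/-- The transpose of the restriction map `E'(G) → E'(T)^-`. -/
theorem exists_deltaOp : ∃ S : SmoothFn (𝓡 r) T →L[ℂ] SmoothFn (𝓡 n) G,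
    (∀ χ ν : Weight r T, c.Dominant χ → ν.lin = χ.lin + c.rho → S ν.fn = c.Delta χ) ∧
    ∀ ν : Weight r T, (¬ ∃ χ : Weight r T, c.Dominant χ ∧ ν.lin = χ.lin + c.rho) → S ν.fn = 0 := by
  classical
  let _ : CommGroup T := commGroupOf τ.mul_comm
  have := τ.connectedSpace
  obtain ⟨ξ, hξ⟩ := exists_torusBasis (r := r) (T := T)
  let P : Weight r T → Prop := fun ν => ∃ χ : Weight r T, c.Dominant χ ∧ ν.lin = χ.lin + c.rho
  -- Values are indexed by the shifted weight `ν`, and `χ` is recovered by choice; the choice is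
  -- harmless because a weight is determined by its linear form. The value zero elsewhere makes the
  -- transpose land in the Hardy space.
  let D : Weight r T → SmoothFn (𝓡 n) G := fun ν => if h : P ν then c.Delta h.choose else 0
  obtain ⟨S, hS⟩ := exists_clm_of_intWeight ξ hξ c.basis (fun k => D (intWeight ξ hξ k)) fun v => by
    set C := 2 * Real.pi * √(∑ l, (∑ i, |ξ.repr (c.basisT l) i|) ^ 2)
    have hC : 0 ≤ C := by positivity
    refine ⟨C ^ v.length, v.length, fun k => ?_⟩
    have h0 := one_le_intSize k
    rw [← mul_pow]
    by_cases h : P (intWeight ξ hξ k)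
    · simp only [D, dif_pos h]
      exact c.norm_iterDer_Delta_le _ (by positivity)
        (c.casimirValue_le h.choose_spec.2 (intWeight_lin ξ hξ k)) v
    · simp only [D, dif_neg h, map_zero, norm_zero]
      positivity
  have hS' : ∀ ν, S ν.fn = D ν := by
    intro ν
    obtain ⟨k, rfl⟩ := (intWeight_bijective ξ hξ).2 ν
    exact hS k
  refine ⟨S, fun χ ν hχ hν => ?_, fun ν hν => ?_⟩
  · have h : P ν := ⟨χ, hχ, hν⟩
    rw [hS']
    simp only [D, dif_pos h]
    have h1 : h.choose = χ := τ.weight_ext (add_right_cancel (h.choose_spec.2.symm.trans hν))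
    rw [h1]
  · rw [hS']
    exact dif_neg hν

end CartanWeyl
end DeltaOperator

/-! ### The restriction of distributions to the Hardy space -/

section Restriction

variable {n r m : ℕ} {G : Type*} [TopologicalSpace G] [ChartedSpace (EuclideanSpace ℝ (Fin n)) G]
  [Group G] [LieGroup (𝓡 n) ∞ G] [T2Space G] [CompactSpace G] [ConnectedSpace G]
  {T : Type*} [TopologicalSpace T] [ChartedSpace (EuclideanSpace ℝ (Fin r)) T] [Group T]
  [LieGroup (𝓡 r) ∞ T] [T2Space T] [CompactSpace T]
  {B : Type*} [AddCommGroup B] [Module ℂ B] [TopologicalSpace B] [IsTopologicalAddGroup B]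
  [ContinuousConstSMul ℂ B]

instance {A : Type*} [CommRing A] [Algebra ℂ A] [TopologicalSpace A] [T2Space A] (k : ℕ) :
    T2Space (Form A k) :=
  (IsEmbedding.mk ⟨rfl⟩ DFunLike.coe_injective :
    IsEmbedding (fun θ : Form A k => (θ : (Fin k → Derivation ℂ A A) → A))).t2Space

-- Uniqueness of `r_M` requires limits in `Ω(M)` to be unique.
instance {M : Type*} [TopologicalSpace M] [ChartedSpace (EuclideanSpace ℝ (Fin m)) M]
    [IsManifold (𝓡 m) ∞ M] : T2Space (Ω m M) :=
  inferInstanceAs (T2Space (∀ k, Form (SmoothFn (𝓡 m) M) k))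

/-- Convolution from the left by elements of the complexified Lie algebra. -/
def convLeftC : ℂ ⊗[ℝ] LieAlg n G →ₗ[ℂ] Module.End ℂ (Dist n G B) :=
  LinearMap.liftBaseChange ℂ (convLeftHom B)

/-- Convolution from the right by elements of the complexified Lie algebra. -/
def convRightC : ℂ ⊗[ℝ] LieAlg n G →ₗ[ℂ] Module.End ℂ (Dist n G B) :=
  LinearMap.liftBaseChange ℂ (convRightHom B)

lemma convLeftC_one_tmul (ξ : LieAlg n G) : convLeftC (B := B) (1 ⊗ₜ[ℝ] ξ) = convLeft ξ := by
  rw [convLeftC, LinearMap.liftBaseChange_tmul, one_smul]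
  rfl

lemma convRightC_one_tmul (ξ : LieAlg n G) : convRightC (B := B) (1 ⊗ₜ[ℝ] ξ) = convRight ξ := by
  rw [convRightC, LinearMap.liftBaseChange_tmul, one_smul]
  rfl

lemma convLeftC_apply (x : ℂ ⊗[ℝ] LieAlg n G) (u : Dist n G B) (f : SmoothFn (𝓡 n) G) :
    convLeftC x u f = u (rightDer f x) := by
  induction x with
  | zero => rw [map_zero, map_zero, map_zero]; rfl
  | add x y hx hy => rw [map_add, map_add, map_add, ← hx, ← hy]; rfl
  | tmul z ξ => rw [rightDer_tmul, map_smul]; rfl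

lemma convRightC_apply (x : ℂ ⊗[ℝ] LieAlg n G) (u : Dist n G B) (f : SmoothFn (𝓡 n) G) :
    convRightC x u f = u (leftDer f x) := by
  induction x with
  | zero => rw [map_zero, map_zero, map_zero]; rfl
  | add x y hx hy => rw [map_add, map_add, map_add, ← hx, ← hy]; rfl
  | tmul z ξ => rw [leftDer_tmul, map_smul]; rfl

namespace CartanWeyl

variable {τ : MaxTorus n r G T} {β : InvariantInner n G} (c : CartanWeyl τ β)

/-- Elements of the Hardy space vanish on all other characters by definition, and values on
characters determine a distribution. -/
lemma Hardy.ext [T2Space B] {u v : c.Hardy B} (h : ∀ χ ν : Weight r T, c.Dominant χ →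
    ν.lin = χ.lin + c.rho → Hardy.incl c u ν.fn = Hardy.incl c v ν.fn) : u = v := by
  refine Subtype.ext (τ.ext_of_weight fun ν => ?_)
  by_cases hν : ∃ χ : Weight r T, c.Dominant χ ∧ ν.lin = χ.lin + c.rho
  · obtain ⟨χ, hχ, hν⟩ := hν
    exact h χ ν hχ hν
  · exact (u.2 ν hν).trans (v.2 ν hν).symm

variable (B) in
theorem exists_isDistRestriction : ∃ R : Dist n G B →ₗ[ℂ] c.Hardy B, c.IsDistRestriction R := by
  obtain ⟨S, hS, hS0⟩ := c.exists_deltaOp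
  refine ⟨LinearMap.codRestrict (c.hardySpace B)
    { toFun := fun u => ContinuousLinearMap.comp u S
      map_add' := fun _ _ => rfl
      map_smul' := fun _ _ => rfl } fun u ν hν => ?_, fun u χ ν hχ hν => ?_⟩
  · change u (S ν.fn) = 0
    rw [hS0 ν hν, map_zero]
  · exact congrArg u (hS χ ν hχ hν)

lemma hardyConv_apply (ξ : LieAlg r T) (u : c.Hardy B) (ν : Weight r T) :
    Hardy.incl c (c.hardyConv ξ u) ν.fn =
      (2 * Real.pi * Complex.I * ν.lin ξ : ℂ) • Hardy.incl c u ν.fn := by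
  change Hardy.incl c u (rightInvField ξ ν.fn) = _
  rw [Weight.rightInvField_fn, map_smul]

namespace IsDistRestriction

variable {c} [T2Space B] {R : Dist n G B →ₗ[ℂ] c.Hardy B} (hR : c.IsDistRestriction R)

include hR

lemma eq {R' : Dist n G B →ₗ[ℂ] c.Hardy B} (hR' : c.IsDistRestriction R') : R' = R :=
  LinearMap.ext fun u => Hardy.ext c fun χ ν hχ hν =>
    (hR' u χ ν hχ hν).trans (hR u χ ν hχ hν).symm

/-- The shift by `ρ`: the factor on `Δ_χ` is `2πi χ(ξ)`, whereas convolution on `T` sees the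
character `χ + ρ`. -/
lemma conv_aux (ξ : LieAlg r T) {u u' : Dist n G B}
    (h : ∀ χ, u' (c.Delta χ) = (2 * Real.pi * Complex.I * χ.lin ξ : ℂ) • u (c.Delta χ)) :
    R u' = c.hardyConv ξ (R u) - (2 * Real.pi * Complex.I * c.rho ξ : ℂ) • R u := by
  refine Hardy.ext c fun χ ν hχ hν => ?_
  have h1 := c.hardyConv_apply ξ (R u) ν
  rw [hR u χ ν hχ hν] at h1
  rw [hR u' χ ν hχ hν, h]
  refine Eq.trans ?_ (congrArg₂ (fun x y => x - (2 * Real.pi * Complex.I * c.rho ξ : ℂ) • y)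
    h1 (hR u χ ν hχ hν)).symm
  rw [hν, LinearMap.add_apply, Complex.ofReal_add]
  module

lemma apply_convLeft (ξ : LieAlg r T) (u : Dist n G B) : R (convLeft (τ.lieIncl ξ) u) =
    c.hardyConv ξ (R u) - (2 * Real.pi * Complex.I * c.rho ξ : ℂ) • R u :=
  hR.conv_aux ξ fun χ => by rw [convLeft_apply, c.rightInvField_Delta, map_smul]

lemma apply_convRight (ξ : LieAlg r T) (u : Dist n G B) : R (convRight (τ.lieIncl ξ) u) =
    c.hardyConv ξ (R u) - (2 * Real.pi * Complex.I * c.rho ξ : ℂ) • R u :=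
  hR.conv_aux ξ fun χ => by rw [convRight_apply, c.leftInvField_Delta, map_smul]

lemma eq_zero {u : Dist n G B} (h : ∀ χ, u (c.Delta χ) = 0) : R u = 0 := by
  refine Hardy.ext c fun χ ν hχ hν => ?_
  rw [hR u χ ν hχ hν, h, map_zero]
  rfl

lemma convLeftC_conj {α : Module.Dual ℝ (LieAlg r T)} (hα : α ∈ c.posRoots) (u : Dist n G B) :
    R (convLeftC (conjC (c.rootVec α)) u) = 0 :=
  hR.eq_zero fun χ => by rw [convLeftC_apply, c.rightDer_Delta_conj χ hα, map_zero]

lemma convRightC_pos {α : Module.Dual ℝ (LieAlg r T)} (hα : α ∈ c.posRoots) (u : Dist n G B) :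
    R (convRightC (c.rootVec α) u) = 0 :=
  hR.eq_zero fun χ => by rw [convRightC_apply, c.leftDer_Delta_pos χ hα, map_zero]

lemma apply_post (S : B →L[ℂ] B) (u : Dist n G B) : R (Dist.post S u) = c.hardyPost S (R u) :=
  Hardy.ext c fun χ ν hχ hν => (hR _ χ ν hχ hν).trans (congrArg S (hR u χ ν hχ hν)).symm

end IsDistRestriction

/-- The right-hand side also lies in the `B`-valued Hardy space, and both sides take the same values
on the shifted dominant weights. -/
lemma incl_restriction_tmul [ContinuousSMul ℂ B] [T2Space B] {R : Dist n G ℂ →ₗ[ℂ] c.Hardy ℂ}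
    (hR : c.IsDistRestriction R) {R' : Dist n G B →ₗ[ℂ] c.Hardy B} (hR' : c.IsDistRestriction R')
    (u : Dist n G ℂ) (b : B) : Hardy.incl c (R' (u.tmul b)) = (Hardy.incl c (R u)).tmul b := by
  have hmem : (Hardy.incl c (R u)).tmul b ∈ c.hardySpace B := fun ν hν => by
    change (Hardy.incl c (R u) ν.fn) • b = 0
    rw [show Hardy.incl c (R u) ν.fn = 0 from (R u).2 ν hν, zero_smul]
  refine congrArg (Hardy.incl c) (Hardy.ext c (v := ⟨_, hmem⟩) fun χ ν hχ hν => ?_)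
  exact (hR' _ χ ν hχ hν).trans (congrArg (· • b) (hR u χ ν hχ hν)).symm

end CartanWeyl
end Restriction

/-! ### Induced maps on basic cohomology -/

namespace DiffOps

variable {𝔨 𝔥 V W : Type*} [AddCommGroup V] [Module ℂ V] [AddCommGroup W] [Module ℂ W]

/-- Homomorphisms map cocycles of the basic subcomplexes to cocycles, and induce maps on the
cohomologies of the basic subcomplexes. -/
theorem IsHom.exists_cohomology_map {X : DiffOps 𝔨 V} {Y : DiffOps 𝔥 W} {φ : 𝔥 → 𝔨}
    {R : V →ₗ[ℂ] W} (h : IsHom (X.restrict φ) Y R) : ∃ Φ : X.cohomology →ₗ[ℂ] Y.cohomology,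
      ∀ z : X.cocycles, ∃ hz : R z ∈ Y.cocycles,
        Φ (Submodule.Quotient.mk z) = Submodule.Quotient.mk ⟨R z, hz⟩ := by
  have hb : ∀ z ∈ X.basic, R z ∈ Y.basic := fun z hz => by
    simp only [basic, Submodule.mem_inf, Submodule.mem_iInf, LinearMap.mem_ker] at hz ⊢
    refine ⟨fun ξ => ?_, fun ξ => ?_⟩
    · exact (LinearMap.congr_fun (h.contr ξ) z).symm.trans
        ((congrArg R (hz.1 (φ ξ))).trans (map_zero R))
    · exact (LinearMap.congr_fun (h.lie ξ) z).symm.trans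
        ((congrArg R (hz.2 (φ ξ))).trans (map_zero R))
  have hd : ∀ z, R (X.d z) = Y.d (R z) := LinearMap.congr_fun h.d
  have hc : ∀ z ∈ X.cocycles, R z ∈ Y.cocycles := fun z hz =>
    ⟨hb z hz.1, (hd z).symm.trans ((congrArg R hz.2).trans (map_zero R))⟩
  refine ⟨Submodule.mapQ _ _ (R.restrict hc) ?_, fun z => ⟨hc z z.2, rfl⟩⟩
  rintro ⟨_, hz⟩ ⟨y, hy, rfl⟩
  exact ⟨R y, hb y hy, (hd y).symm⟩

end DiffOps

/-- The cancellation of the `ρ`-shift of the distributions against the image of the cubic element.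
-/
lemma sum_sub_smul_tmul_add {r : ℕ} {S C : Type*} [AddCommGroup S] [Module ℂ S] [AddCommGroup C]
    [Module ℂ C] (a : Fin r → ℂ) (v : Fin r → S) (w : S) (y : Fin r → C) :
    ∑ k, (v k - a k • w) ⊗ₜ[ℂ] y k + w ⊗ₜ[ℂ] ∑ k, a k • y k = ∑ k, v k ⊗ₜ[ℂ] y k := by
  rw [TensorProduct.tmul_sum, ← Finset.sum_add_distrib]
  refine Finset.sum_congr rfl fun k _ => ?_
  rw [TensorProduct.sub_tmul, TensorProduct.tmul_smul, TensorProduct.smul_tmul', sub_add_cancel]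

/-! ### The restriction map as a chain map -/

section Restriction

variable {n r m : ℕ} {G : Type*} [TopologicalSpace G] [ChartedSpace (EuclideanSpace ℝ (Fin n)) G]
  [Group G] [LieGroup (𝓡 n) ∞ G] [T2Space G] [CompactSpace G] [ConnectedSpace G]
  {T : Type*} [TopologicalSpace T] [ChartedSpace (EuclideanSpace ℝ (Fin r)) T] [Group T]
  [LieGroup (𝓡 r) ∞ T] [T2Space T] [CompactSpace T]
  {B : Type*} [AddCommGroup B] [Module ℂ B] [TopologicalSpace B] [IsTopologicalAddGroup B]
  [ContinuousConstSMul ℂ B]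
  {τ : MaxTorus n r G T} {β : InvariantInner n G} {c : CartanWeyl τ β}

namespace CartanWeyl

variable (c) in
/-- The twisted projection `Cl(𝔤) → Cl(𝔱)`. -/
def theta : Cliff β.form →ₗ[ℂ] Cliff (τ.res β.form) := c.isRootData.theta

lemma theta_involute (x : Cliff β.form) :
    c.theta (CliffordAlgebra.involute x) = CliffordAlgebra.involute (c.theta x) :=
  c.isRootData.theta_involute x

lemma theta_clLeft_tmul (ξ : LieAlg r T) (x : Cliff β.form) :
    c.theta (clLeft β.form (clx β.form (τ.lieIncl ξ)) x) =
      clLeft (τ.res β.form) (clx (τ.res β.form) ξ) (c.theta x) :=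
  c.isRootData.theta_clLeft_tmul ξ x

lemma theta_clRight_tmul (ξ : LieAlg r T) (x : Cliff β.form) :
    c.theta (clRight β.form (clx β.form (τ.lieIncl ξ)) x) =
      clRight (τ.res β.form) (clx (τ.res β.form) ξ) (c.theta x) :=
  c.isRootData.theta_clRight_tmul ξ x

lemma theta_oddAd_tmul (ξ : LieAlg r T) (x : Cliff β.form) :
    c.theta (oddAd β.form (clx β.form (τ.lieIncl ξ)) x) =
      oddAd (τ.res β.form) (clx (τ.res β.form) ξ) (c.theta x) := by
  change c.theta (clLeft β.form (clx β.form (τ.lieIncl ξ)) x -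
    clRight β.form (clx β.form (τ.lieIncl ξ)) x) = clLeft (τ.res β.form) (clx (τ.res β.form) ξ)
      (c.theta x) - clRight (τ.res β.form) (clx (τ.res β.form) ξ) (c.theta x)
  rw [map_sub, theta_clLeft_tmul, theta_clRight_tmul]

lemma theta_evenAd_spinC (ξ : LieAlg r T) (x : Cliff β.form) :
    c.theta (evenAd β.form (spinC β.form c.basis (1 ⊗ₜ[ℝ] τ.lieIncl ξ)) x) = 0 := by
  have h := c.isRootData
  change h.theta (spinC β.form c.basis (1 ⊗ₜ[ℝ] τ.lieIncl ξ) * x -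
    x * spinC β.form c.basis (1 ⊗ₜ[ℝ] τ.lieIncl ξ)) = 0
  rw [map_sub, h.theta_spinC_tmul_mul, h.theta_mul_spinC_tmul, sub_self]

lemma theta_clGamma_mul (x : Cliff β.form) : c.theta (clGamma β.form c.basis * x) =
    ∑ k, (2 * Real.pi * Complex.I * c.rho (c.basisT k) : ℂ) •
      clLeft (τ.res β.form) (clx (τ.res β.form) (c.basisT k)) (c.theta x) := by
  rw [rho_eq]
  exact c.isRootData.theta_clGamma_mul x

lemma theta_clRight_clGamma (x : Cliff β.form) :
    c.theta (clRight β.form (clGamma β.form c.basis) x) =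
      ∑ k, (2 * Real.pi * Complex.I * c.rho (c.basisT k) : ℂ) •
        clRight (τ.res β.form) (clx (τ.res β.form) (c.basisT k)) (c.theta x) := by
  rw [rho_eq]
  refine (c.isRootData.theta_mul_clGamma (CliffordAlgebra.involute x)).trans ?_
  rw [c.isRootData.theta_involute]
  rfl

lemma theta_conj_mul {α : Module.Dual ℝ (LieAlg r T)} (hα : α ∈ c.posRoots) (x : Cliff β.form) :
    c.theta (clι β.form (conjC (c.rootVec α)) * x) = 0 :=
  c.isRootData.theta_conj_mul (c.isRootData.mem_pos.1 (c.mem_pos.2 hα)) x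

lemma theta_clRight_pos {α : Module.Dual ℝ (LieAlg r T)} (hα : α ∈ c.posRoots)
    (x : Cliff β.form) : c.theta (clRight β.form (clι β.form (c.rootVec α)) x) = 0 :=
  c.isRootData.theta_clRight_pos (c.isRootData.mem_pos.1 (c.mem_pos.2 hα)) x

lemma weilRestriction_tmul (R : Dist n G B →ₗ[ℂ] c.Hardy B) (u : Dist n G B) (x : Cliff β.form) :
    c.weilRestriction R (u ⊗ₜ x) = R u ⊗ₜ c.theta x := by
  rw [weilRestriction, theta_eq]
  rfl

lemma hardyWeilOps_d_tmul (u : c.Hardy B) (y : Cliff (τ.res β.form)) :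
    (c.hardyWeilOps B).d (u ⊗ₜ y) =
      ∑ k, c.hardyConv (c.basisT k) u ⊗ₜ oddAd _ (clx _ (c.basisT k)) y := by
  change (∑ k, TensorProduct.map (c.hardyConv (c.basisT k))
    (oddAd _ (clx _ (c.basisT k))) : _ →ₗ[ℂ] _) (u ⊗ₜ y) = _
  rw [LinearMap.sum_apply]
  rfl

namespace IsDistRestriction

variable [T2Space B] {R : Dist n G B →ₗ[ℂ] c.Hardy B} (hR : c.IsDistRestriction R)

include hR

/-- In the root basis each root term has a factor that dies: `x_{ē_α}` under the twisted projection,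
or `u_{ē_α}` under the restriction of distributions. In the torus terms the `ρ`-shift cancels
against the image of `γ`. -/
lemma weilRestriction_weilLeft (u : Dist n G B) (x : Cliff β.form) :
    c.weilRestriction R (weilLeft c B (u ⊗ₜ x)) = ∑ k, c.hardyConv (c.basisT k) (R u) ⊗ₜ
      clLeft (τ.res β.form) (clx _ (c.basisT k)) (c.theta x) := by
  have h := c.isRootData
  let Φ : ℂ ⊗[ℝ] LieAlg n G →ₗ[ℂ] ℂ ⊗[ℝ] LieAlg n G →ₗ[ℂ]
      c.Hardy B ⊗[ℂ] Cliff (τ.res β.form) :=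
    (TensorProduct.mk ℂ _ _).compl₁₂ (R ∘ₗ convLeftC.flip u)
      (c.theta ∘ₗ (clLeft β.form).flip x ∘ₗ clι β.form)
  have hΦ : ∀ y z, Φ y z = R (convLeftC y u) ⊗ₜ c.theta (clι β.form z * x) := fun _ _ => rfl
  have h0 : weilLeft c B (u ⊗ₜ x) = ∑ a, convLeft (c.basis a) u ⊗ₜ (clx β.form (c.basis a) * x) +
      u ⊗ₜ (clGamma β.form c.basis * x) := by
    rw [weilLeft, LinearMap.add_apply, LinearMap.sum_apply]
    rfl
  have h1 := h.sum_bilin Φ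
  rw [Finset.sum_eq_zero (s := h.pos), add_zero] at h1
  · rw [h0, map_add, map_sum]
    simp only [weilRestriction_tmul]
    rw [c.theta_clGamma_mul]
    refine Eq.trans ?_ (sum_sub_smul_tmul_add (fun k => 2 * Real.pi * Complex.I * c.rho (c.basisT k))
      (fun k => c.hardyConv (c.basisT k) (R u)) (R u)
      fun k => clLeft (τ.res β.form) (clx _ (c.basisT k)) (c.theta x))
    refine congrArg₂ (· + ·) (Eq.trans (Finset.sum_congr rfl fun a _ => ?_)
      (h1.trans (Finset.sum_congr rfl fun k _ => ?_))) rfl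
    · rw [hΦ, convLeftC_one_tmul]
      rfl
    · rw [hΦ, convLeftC_one_tmul, hR.apply_convLeft]
      exact congrArg _ (c.theta_clLeft_tmul _ _)
  · intro α hα
    rw [hΦ, hΦ, c.theta_conj_mul (c.mem_pos.1 hα), hR.convLeftC_conj (c.mem_pos.1 hα),
      TensorProduct.tmul_zero, TensorProduct.zero_tmul, add_zero]

/-- The same argument with the positive root vectors in the role of the negative ones, since right
multiplications by these are what both factors of the map annihilate. -/
lemma weilRestriction_weilRight (u : Dist n G B) (x : Cliff β.form) :
    c.weilRestriction R (weilRight c B (u ⊗ₜ x)) = ∑ k, c.hardyConv (c.basisT k) (R u) ⊗ₜ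
      clRight (τ.res β.form) (clx _ (c.basisT k)) (c.theta x) := by
  have h := c.isRootData
  let Φ : ℂ ⊗[ℝ] LieAlg n G →ₗ[ℂ] ℂ ⊗[ℝ] LieAlg n G →ₗ[ℂ]
      c.Hardy B ⊗[ℂ] Cliff (τ.res β.form) :=
    (TensorProduct.mk ℂ _ _).compl₁₂ (R ∘ₗ convRightC.flip u)
      (c.theta ∘ₗ (clRight β.form).flip x ∘ₗ clι β.form)
  have hΦ : ∀ y z, Φ y z = R (convRightC y u) ⊗ₜ c.theta (clRight β.form (clι β.form z) x) :=
    fun _ _ => rfl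
  have h0 : weilRight c B (u ⊗ₜ x) =
      ∑ a, convRight (c.basis a) u ⊗ₜ clRight β.form (clx β.form (c.basis a)) x +
      u ⊗ₜ clRight β.form (clGamma β.form c.basis) x := by
    rw [weilRight, LinearMap.add_apply, LinearMap.sum_apply]
    rfl
  have h1 := h.sum_bilin Φ
  rw [Finset.sum_eq_zero (s := h.pos), add_zero] at h1
  · rw [h0, map_add, map_sum]
    simp only [weilRestriction_tmul]
    rw [c.theta_clRight_clGamma]
    refine Eq.trans ?_ (sum_sub_smul_tmul_add (fun k => 2 * Real.pi * Complex.I * c.rho (c.basisT k))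
      (fun k => c.hardyConv (c.basisT k) (R u)) (R u)
      fun k => clRight (τ.res β.form) (clx _ (c.basisT k)) (c.theta x))
    refine congrArg₂ (· + ·) (Eq.trans (Finset.sum_congr rfl fun a _ => ?_)
      (h1.trans (Finset.sum_congr rfl fun k _ => ?_))) rfl
    · rw [hΦ, convRightC_one_tmul]
      rfl
    · rw [hΦ, convRightC_one_tmul, hR.apply_convRight]
      exact congrArg _ (c.theta_clRight_tmul _ _)
  · intro α hα
    rw [hΦ, hΦ, c.theta_clRight_pos (c.mem_pos.1 hα), hR.convRightC_pos (c.mem_pos.1 hα),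
      TensorProduct.tmul_zero, TensorProduct.zero_tmul, add_zero]

theorem isHom_weilRestriction : DiffOps.IsHom ((weilOps B β.form c.basis).restrict τ.lieIncl)
    (c.hardyWeilOps B) (c.weilRestriction R) where
  parity := TensorProduct.ext' fun u x => by
    change c.weilRestriction R (u ⊗ₜ CliffordAlgebra.involute x) =
      (c.hardyWeilOps B).parity (c.weilRestriction R (u ⊗ₜ x))
    rw [weilRestriction_tmul, weilRestriction_tmul, c.theta_involute]
    rfl
  d := TensorProduct.ext' fun u x => by
    change c.weilRestriction R ((weilOps B β.form c.basis).d (u ⊗ₜ x)) =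
      (c.hardyWeilOps B).d (c.weilRestriction R (u ⊗ₜ x))
    rw [weilOps_d_eq, LinearMap.sub_apply, map_sub, hR.weilRestriction_weilLeft,
      hR.weilRestriction_weilRight, weilRestriction_tmul, hardyWeilOps_d_tmul,
      ← Finset.sum_sub_distrib]
    exact Finset.sum_congr rfl fun k _ => (TensorProduct.tmul_sub _ _ _).symm
  contr ξ := TensorProduct.ext' fun u x => by
    change c.weilRestriction R (u ⊗ₜ oddAd β.form (clx β.form (τ.lieIncl ξ)) x) =
      ((c.hardyWeilOps B).contr ξ) (c.weilRestriction R (u ⊗ₜ x))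
    rw [weilRestriction_tmul, weilRestriction_tmul, c.theta_oddAd_tmul]
    rfl
  lie ξ := TensorProduct.ext' fun u x => by
    change c.weilRestriction R ((weilOps B β.form c.basis).lie (τ.lieIncl ξ) (u ⊗ₜ x)) = 0
    have h1 : (weilOps B β.form c.basis).lie (τ.lieIncl ξ) (u ⊗ₜ x) =
        (convLeft (τ.lieIncl ξ) u - convRight (τ.lieIncl ξ) u) ⊗ₜ x +
          u ⊗ₜ evenAd β.form (spinC β.form c.basis (1 ⊗ₜ[ℝ] τ.lieIncl ξ)) x := by
      rw [weilOps_lie_eq]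
      rfl
    rw [h1, map_add, weilRestriction_tmul, weilRestriction_tmul, map_sub, hR.apply_convLeft,
      hR.apply_convRight, sub_self, c.theta_evenAd_spinC, TensorProduct.tmul_zero,
      TensorProduct.zero_tmul, add_zero]

/-- Operators on `B` act after the distribution and so commute with `R`. The Clifford factor enters
them only through its parity, which the twisted projection preserves. -/
theorem isHom_weilRestriction_tensor {𝔨 : Type*} {X : DiffOps 𝔨 (Dist n G B ⊗[ℂ] Cliff β.form)}
    {Y : DiffOps 𝔨 (c.Hardy B ⊗[ℂ] Cliff (τ.res β.form))}
    (h : DiffOps.IsHom X Y (c.weilRestriction R)) (Z : ContDiffOps 𝔨 B) :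
    DiffOps.IsHom (X.tensor (clParity β.form) Dist.post Z)
      (Y.tensor (clParity (τ.res β.form)) c.hardyPost Z) (c.weilRestriction R) := by
  have h1 : ∀ S : B →L[ℂ] B, c.weilRestriction R ∘ₗ
      TensorProduct.map (Dist.post S) (clParity β.form) =
      TensorProduct.map (c.hardyPost S) (clParity (τ.res β.form)) ∘ₗ c.weilRestriction R :=
    fun S => TensorProduct.ext' fun u x => by
      change c.weilRestriction R (Dist.post S u ⊗ₜ CliffordAlgebra.involute x) =
        TensorProduct.map (c.hardyPost S) (clParity (τ.res β.form)) (c.weilRestriction R (u ⊗ₜ x))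
      rw [weilRestriction_tmul, weilRestriction_tmul, c.theta_involute, hR.apply_post]
      rfl
  have h2 : ∀ S : B →L[ℂ] B, c.weilRestriction R ∘ₗ
      TensorProduct.map (Dist.post S) LinearMap.id =
      TensorProduct.map (c.hardyPost S) LinearMap.id ∘ₗ c.weilRestriction R :=
    fun S => TensorProduct.ext' fun u x => by
      change c.weilRestriction R (Dist.post S u ⊗ₜ x) =
        TensorProduct.map (c.hardyPost S) LinearMap.id (c.weilRestriction R (u ⊗ₜ x))
      rw [weilRestriction_tmul, weilRestriction_tmul, hR.apply_post]
      rfl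
  refine ⟨h1 _, ?_, fun ξ => ?_, fun ξ => ?_⟩
  · exact (LinearMap.comp_add _ _ _).trans
      ((congrArg₂ (· + ·) h.d (h1 _)).trans (LinearMap.add_comp _ _ _).symm)
  · exact (LinearMap.comp_add _ _ _).trans
      ((congrArg₂ (· + ·) (h.contr ξ) (h1 _)).trans (LinearMap.add_comp _ _ _).symm)
  · exact (LinearMap.comp_add _ _ _).trans
      ((congrArg₂ (· + ·) (h.lie ξ) (h2 _)).trans (LinearMap.add_comp _ _ _).symm)

end IsDistRestriction

end CartanWeyl
end Restriction

/-! ### The Hardy–Weil algebra as a differential space -/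

section CliffordOps

variable {V : Type*} [AddCommGroup V] [Module ℝ V] {β : LinearMap.BilinForm ℝ V}

lemma oddAd_clx_add (ξ η : V) :
    oddAd β (clx β (ξ + η)) = oddAd β (clx β ξ) + oddAd β (clx β η) := by
  rw [clx, TensorProduct.tmul_add, map_add, map_add]
  rfl

lemma oddAd_clx_smul (a : ℝ) (ξ : V) : oddAd β (clx β (a • ξ)) = (a : ℂ) • oddAd β (clx β ξ) := by
  rw [clx, clx, ← map_smul, ← map_smul, TensorProduct.tmul_smul, TensorProduct.smul_tmul',
    TensorProduct.smul_tmul']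
  simp

end CliffordOps

section TensorOps

variable {S C : Type*} [AddCommGroup S] [Module ℂ S] [AddCommGroup C] [Module ℂ C]

/-- Exchange of the two summation indices turns the square into its own negative. -/
lemma sum_op_sq_eq_zero {n : ℕ} (l : Fin n → Module.End ℂ S) (X : Fin n → Module.End ℂ C)
    (hl : ∀ a b, l a * l b = l b * l a) (hX : ∀ a b, X a * X b = -(X b * X a)) :
    (∑ a, opL S C (l a) * opR S C (X a)) * (∑ a, opL S C (l a) * opR S C (X a)) = 0 := by
  have h1 : ∀ a b, (opL S C (l a) * opR S C (X a)) * (opL S C (l b) * opR S C (X b)) =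
      -((opL S C (l b) * opR S C (X b)) * (opL S C (l a) * opR S C (X a))) := fun a b =>
    eq_neg_of_add_eq_zero_left (op_anticomm (hl a b) (eq_neg_iff_add_eq_zero.1 (hX a b)))
  have h2 : (∑ a, opL S C (l a) * opR S C (X a)) * (∑ a, opL S C (l a) * opR S C (X a)) =
      -((∑ a, opL S C (l a) * opR S C (X a)) * (∑ a, opL S C (l a) * opR S C (X a))) := by
    conv_lhs => rw [Finset.sum_mul_sum, Finset.sum_comm]
    rw [Finset.sum_mul_sum, ← Finset.sum_neg_distrib]
    refine Finset.sum_congr rfl fun a _ => ?_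
    rw [← Finset.sum_neg_distrib]
    exact Finset.sum_congr rfl fun b _ => h1 b a
  have h3 : (2 : ℂ) • ((∑ a, opL S C (l a) * opR S C (X a)) *
      (∑ a, opL S C (l a) * opR S C (X a))) = 0 := by
    rw [two_smul]
    exact eq_neg_iff_add_eq_zero.1 h2
  exact (smul_eq_zero.1 h3).resolve_left two_ne_zero

lemma sum_op_anticomm_opR {n : ℕ} (l : Fin n → Module.End ℂ S) (X : Fin n → Module.End ℂ C)
    (F : Module.End ℂ C) (hX : ∀ a, F * X a = -(X a * F)) :
    opR S C F * (∑ a, opL S C (l a) * opR S C (X a)) +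
      (∑ a, opL S C (l a) * opR S C (X a)) * opR S C F = 0 := by
  have := op_anticomm_sum F l X 0 0 0 (fun a => eq_neg_iff_add_eq_zero.1 (hX a))
    (by rw [mul_zero, zero_mul, add_zero])
  simpa using this

end TensorOps

section HardyWeil

variable {n r : ℕ} {G : Type*} [TopologicalSpace G] [ChartedSpace (EuclideanSpace ℝ (Fin n)) G]
  [Group G] [LieGroup (𝓡 n) ∞ G] [T2Space G] [CompactSpace G] [ConnectedSpace G]
  {T : Type*} [TopologicalSpace T] [ChartedSpace (EuclideanSpace ℝ (Fin r)) T] [Group T]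
  [LieGroup (𝓡 r) ∞ T] [T2Space T] [CompactSpace T]
  {B : Type*} [AddCommGroup B] [Module ℂ B] [TopologicalSpace B] [IsTopologicalAddGroup B]
  [ContinuousConstSMul ℂ B]
  {τ : MaxTorus n r G T} {β : InvariantInner n G} (c : CartanWeyl τ β)

namespace CartanWeyl

lemma res_symm (β : InvariantInner n G) (ξ η : LieAlg r T) :
    τ.res β.form ξ η = τ.res β.form η ξ := β.symm _ _

lemma oddAd_clx_oddAd_clx (ξ η : LieAlg r T) :
    (oddAd (τ.res β.form) (clx _ ξ) * oddAd (τ.res β.form) (clx _ η) : Module.End ℂ (Cliff _)) =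
      -(oddAd (τ.res β.form) (clx _ η) * oddAd (τ.res β.form) (clx _ ξ)) :=
  clContr_clContr (res_symm β) _ _

lemma oddAd_clx_parity (ξ : LieAlg r T) :
    (oddAd (τ.res β.form) (clx _ ξ) * clParity (τ.res β.form) : Module.End ℂ (Cliff _)) =
      -(clParity (τ.res β.form) * oddAd (τ.res β.form) (clx _ ξ)) :=
  clContr_involute (res_symm β) _

lemma hardyConv_comm (ξ η : LieAlg r T) :
    (c.hardyConv ξ * c.hardyConv η : Module.End ℂ (c.Hardy B)) =
      c.hardyConv η * c.hardyConv ξ := by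
  have := τ.connectedSpace
  refine LinearMap.ext fun u => Subtype.ext ?_
  have h1 := LinearMap.congr_fun (convLeft_lie (B := B) ξ η) (Hardy.incl c u)
  rw [lie_eq_zero_of_comm τ.mul_comm] at h1
  have h2 : convLeft (0 : LieAlg r T) (Hardy.incl c u) = 0 :=
    LinearMap.congr_fun (map_zero (convLeftHom B)) _
  exact sub_eq_zero.1 (h1.trans h2)

variable (B) in
lemma hardyWeilOps_d_eq : (c.hardyWeilOps B).d = ∑ k, opL _ _ (c.hardyConv (c.basisT k)) *
    opR _ _ (oddAd (τ.res β.form) (clx _ (c.basisT k))) := by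
  change ∑ k, TensorProduct.map (c.hardyConv (c.basisT k))
    (oddAd (τ.res β.form) (clx _ (c.basisT k))) = _
  exact Finset.sum_congr rfl fun _ _ => map_eq_opL_mul_opR _ _

variable (B) in
theorem isDifferentialSpace_hardyWeilOps : (c.hardyWeilOps B).IsDifferentialSpace where
  parity_parity := by
    refine TensorProduct.ext' fun u x => ?_
    change u ⊗ₜ CliffordAlgebra.involute (CliffordAlgebra.involute x) = u ⊗ₜ x
    rw [CliffordAlgebra.involute_involute]
  d_parity := by
    rw [hardyWeilOps_d_eq]
    refine eq_neg_of_add_eq_zero_right (sum_op_anticomm_opR _ _ (clParity _) fun k => ?_)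
    rw [oddAd_clx_parity, neg_neg]
  contr_parity ξ := by
    have h1 := congrArg (opR (c.Hardy B) _) (oddAd_clx_parity (τ := τ) (β := β) ξ)
    rw [map_neg, map_mul (opR _ _), map_mul (opR _ _)] at h1
    exact h1
  lie_parity ξ := (LinearMap.zero_comp _).trans (LinearMap.comp_zero _).symm
  contr_add ξ η := (congrArg (opR (c.Hardy B) _) (oddAd_clx_add ξ η)).trans (map_add (opR _ _) _ _)
  contr_smul a ξ :=
    (congrArg (opR (c.Hardy B) _) (oddAd_clx_smul a ξ)).trans (map_smul (opR _ _) _ _)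
  lie_add ξ η := (add_zero _).symm
  lie_smul a ξ := (smul_zero _).symm
  d_d := by
    rw [hardyWeilOps_d_eq]
    exact sum_op_sq_eq_zero _ _ (fun _ _ => c.hardyConv_comm _ _)
      fun _ _ => oddAd_clx_oddAd_clx _ _
  contr_contr ξ η := by
    have h1 := congrArg (opR (c.Hardy B) _)
      (eq_neg_iff_add_eq_zero.1 (oddAd_clx_oddAd_clx (τ := τ) (β := β) ξ η))
    rw [map_add, map_mul (opR _ _), map_mul (opR _ _), map_zero] at h1
    exact h1
  contr_d ξ := by
    rw [hardyWeilOps_d_eq]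
    exact sum_op_anticomm_opR _ _ _ fun _ => oddAd_clx_oddAd_clx _ _
  lie_d ξ := (LinearMap.zero_comp _).trans (LinearMap.comp_zero _).symm
  lie_contr ξ η := by
    rw [lie_eq_zero_of_comm τ.mul_comm]
    have h1 : oddAd (τ.res β.form) (clx _ (0 : LieAlg r T)) = 0 := by
      rw [clx, TensorProduct.tmul_zero, map_zero, map_zero]
    exact (congrArg₂ (· - ·) (LinearMap.zero_comp _) (LinearMap.comp_zero _)).trans
      ((sub_zero _).trans ((congrArg (opR (c.Hardy B) _) h1).trans (map_zero (opR _ _))).symm)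
  lie_lie ξ η := (congrArg₂ (· - ·) (LinearMap.zero_comp _) (LinearMap.comp_zero _)).trans
    (sub_zero _)

end CartanWeyl
end HardyWeil

end EqLoc

end

theorem mainTheorem3 (n r s : ℕ)
    {G : Type*} [TopologicalSpace G] [ChartedSpace (EuclideanSpace ℝ (Fin n)) G] [Group G]
    [LieGroup (𝓡 n) ∞ G] [T2Space G] [CompactSpace G] [ConnectedSpace G]
    {K : Type*} [TopologicalSpace K] [Group K] [IsTopologicalGroup K] [SimplyConnectedSpace K]
    (_split : G ≃ₜ* K × (Fin s → Circle))
    {T : Type*} [TopologicalSpace T] [ChartedSpace (EuclideanSpace ℝ (Fin r)) T] [Group T]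
    [LieGroup (𝓡 r) ∞ T] [T2Space T] [CompactSpace T]
    (τ : EqLoc.MaxTorus n r G T) (β : EqLoc.InvariantInner n G) (c : EqLoc.CartanWeyl τ β) :
    ((EqLoc.weilOps ℂ β.form c.basis).restrict τ.lieIncl).IsDifferentialSpace ∧
    (c.hardyWeilOps ℂ).IsDifferentialSpace ∧
    ∃ R : EqLoc.Dist n G ℂ →ₗ[ℂ] c.Hardy ℂ,
      c.IsDistRestriction R ∧ (∀ R', c.IsDistRestriction R' → R' = R) ∧
      EqLoc.DiffOps.IsHom ((EqLoc.weilOps ℂ β.form c.basis).restrict τ.lieIncl) (c.hardyWeilOps ℂ)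
        (c.weilRestriction R) ∧
      ∀ (m : ℕ) (M : Type*) [TopologicalSpace M] [ChartedSpace (EuclideanSpace ℝ (Fin m)) M]
        [IsManifold (𝓡 m) ∞ M] [T2Space M] [SecondCountableTopology M] [MulAction G M]
        [ContMDiffSMul (𝓡 n) (𝓡 m) ∞ G M],
        ∃ RM : EqLoc.Dist n G (EqLoc.Ω m M) →ₗ[ℂ] c.Hardy (EqLoc.Ω m M),
          c.IsDistRestriction RM ∧ (∀ R', c.IsDistRestriction R' → R' = RM) ∧
          (∀ (u : EqLoc.Dist n G ℂ) (b : EqLoc.Ω m M),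
            EqLoc.CartanWeyl.Hardy.incl c (RM (u.tmul b)) =
              (EqLoc.CartanWeyl.Hardy.incl c (R u)).tmul b) ∧
          EqLoc.DiffOps.IsHom ((EqLoc.weilFormOps m M β.form c.basis).restrict τ.lieIncl)
            (c.hardyWeilFormOps m M) (c.weilRestriction RM) ∧
          ∃ Φ : (EqLoc.weilFormOps m M β.form c.basis).cohomology →ₗ[ℂ]
              (c.hardyWeilFormOps m M).cohomology,
            ∀ z : (EqLoc.weilFormOps m M β.form c.basis).cocycles,
              ∃ hz : c.weilRestriction RM z ∈ (c.hardyWeilFormOps m M).cocycles,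
                Φ (Submodule.Quotient.mk z) =
                  Submodule.Quotient.mk ⟨c.weilRestriction RM z, hz⟩ := by
  obtain ⟨R, hR⟩ := c.exists_isDistRestriction ℂ
  refine ⟨EqLoc.isDifferentialSpace_restrict_weilOps c, c.isDifferentialSpace_hardyWeilOps ℂ,
    R, hR, fun _ => hR.eq, hR.isHom_weilRestriction, ?_⟩
  intro m M _ _ _ _ _ _ _
  obtain ⟨RM, hRM⟩ := c.exists_isDistRestriction (EqLoc.Ω m M)
  have h := hRM.isHom_weilRestriction_tensor hRM.isHom_weilRestriction
    { EqLoc.formOps n m G M with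
      contr := fun ξ => (EqLoc.formOps n m G M).contr (τ.lieIncl ξ)
      lie := fun ξ => (EqLoc.formOps n m G M).lie (τ.lieIncl ξ) }
  -- Restriction to `𝔱` and the tensor product with `Ω(M)` commute by definition. The inclusion of
  -- `𝔱` is kept visible here so that the `G`-basic subcomplex can be taken as the source in
  -- cohomology.
  have h' : EqLoc.DiffOps.IsHom ((EqLoc.weilFormOps m M β.form c.basis).restrict τ.lieIncl)
      (c.hardyWeilFormOps m M) (c.weilRestriction RM) := h
  exact ⟨RM, hRM, fun _ => hRM.eq, c.incl_restriction_tmul hR hRM, h', h'.exists_cohomology_map⟩
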